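/- **Setting.** Let $m,n\ge 1$, $m\ne n$, and $q,d\in\mathbb C^\times$ such that for $q_1=dq^{-1}$, $q_2=q^2$, $q_3=d^{-1}q^{-1}$ one has $q_1^{n_1}q_2^{n_2}q_3^{n_3}=1$ ($n_i\in\mathbb Z$) iff $n_1=n_2=n_3$. Fix a square root $d^{1/2}$ and logarithms of $q$ and $d$, which define $q^x,d^x$ for $x\in\mathbb C$. Put $[k]=\frac{q^k-q^{-k}}{q-q^{-1}}$. Let $\hat I=\{0,\dots,m+n-1\}$ (read modulo $m+n$), $I=\hat I\setminus\{0\}$, $\hat I^+=\{1,\dots,m-1\}$, $\hat I^-=\{m+1,\dots,m+n-1\}$, $J=\hat I^-\cup\{m\}$; $|i|=1$ for $i\in\{0,m\}$ and $|i|=0$ otherwise. The symmetric matrix $A$ has $A_{i,i}=2,-2,0$ for $i\in\hat I^+$, $i\in\hat I^-$, $i\in\{0,m\}$; $A_{i-1,i}=-1$ for $1\le i\le m$, $A_{i-1,i}=1$ for the other $i$; the skew-symmetric matrix $M$ has $M_{i-1,i}=A_{i-1,i}$; all remaining entries are $0$. **The algebra.** $\mathcal E_{m|n}$ is the unital associative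 superalgebra generated by $E_{i,k},F_{i,k}$ (parity $|i|$), $H_{i,r}$, invertible $K_i$, $C$ (even), $i\in\hat I$, $k\in\mathbb Z$, $r\in\mathbb Z\setminus 0$. With $E_i(z)=\sum_kE_{i,k}z^{-k}$, $F_i(z)=\sum_kF_{i,k}z^{-k}$, $K_i^\pm(z)=K_i^{\pm1}\exp(\pm(q-q^{-1})\sum_{r>0}H_{i,\pm r}z^{\mp r})$, $\delta(z)=\sum_{k\in\mathbb Z} z^k$, $[X,Y]_a=XY-(-1)^{|X||Y|}aYX$, $[X,Y]=[X,Y]_1$, the relations are: $C$ is central; $K_iK_j=K_jK_i$; $K_iE_j(z)K_i^{-1}=q^{A_{i,j}}E_j(z)$; $K_iF_j(z)K_i^{-1}=q^{-A_{i,j}}F_j(z)$; $K_i^\pm(z)K_j^\pm(w)=K_j^\pm(w)K_i^\pm(z)$; $$\tfrac{d^{M_{i,j}}C^{-1}z-q^{A_{i,j}}w}{d^{M_{i,j}}Cz-q^{A_{i,j}}w}K^-_i(z)K^+_j(w)=\tfrac{d^{M_{i,j}}q^{A_{i,j}}C^{-1}z-w}{d^{M_{i,j}}q^{A_{i,j}}Cz-w}K^+_j(w)K^-_i(z);$$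 $$(d^{M_{i,j}}z-q^{A_{i,j}}w)K_i^\pm(C^{-(1\pm1)/2}z)E_j(w)=(d^{M_{i,j}}q^{A_{i,j}}z-w)E_j(w)K_i^\pm(C^{-(1\pm1)/2}z);$$ $$(d^{M_{i,j}}z-q^{-A_{i,j}}w)K_i^\pm(C^{-(1\mp1)/2}z)F_j(w)=(d^{M_{i,j}}q^{-A_{i,j}}z-w)F_j(w)K_i^\pm(C^{-(1\mp1)/2}z);$$ $$[E_i(z),F_j(w)]=\tfrac{\delta_{i,j}}{q-q^{-1}}\bigl(\delta(C\tfrac wz)K_i^+(w)-\delta(C\tfrac zw)K_i^-(z)\bigr);$$ $[E_i(z),E_j(w)]=[F_i(z),F_j(w)]=0$ if $A_{i,j}=0$; and, if $A_{i,j}\ne0$, with $X=E$, $s=1$ or $X=F$, $s=-1$, $$(d^{M_{i,j}}z-q^{sA_{i,j}}w)X_i(z)X_j(w)=(-1)^{|i||j|}(d^{M_{i,j}}q^{sA_{i,j}}z-w)X_j(w)X_i(z);$$ and, for $X=E$ and $X=F$, the Serre relations $\mathrm{Sym}_{z_1,z_2}[X_i(z_1),[X_i(z_2),X_{i\pm1}(w)]_q]_{q^{-1}}=0$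 ($i\notin\{0,m\}$); if $mn\ne2$, $\mathrm{Sym}_{z_1,z_2}[X_i(z_1),[X_{i+1}(w_1),[X_i(z_2),X_{i-1}(w_2)]_q]_{q^{-1}}]=0$ ($i\in\{0,m\}$); if $mn=2$, with $c$ the index different from $0,m$, $$\mathrm{Sym}_{z_1,z_2}\mathrm{Sym}_{w_1,w_2}[X_0(z_1),[X_m(w_1),[X_0(z_2),[X_m(w_2),X_c(y)]_q]]]_{q^{-1}}=\mathrm{Sym}_{z_1,z_2}\mathrm{Sym}_{w_1,w_2}[X_m(w_1),[X_0(z_1),[X_m(w_2),[X_0(z_2),X_c(y)]_q]]]_{q^{-1}}.$$ Put $K=\prod_{i\in\hat I}K_i$. The algebra is graded by $\deg_i(E_{j,k})=\delta_{i,j}$, $\deg_i(F_{j,k})=-\delta_{i,j}$ ($i\in\hat I$) and by the homogeneous degree $\deg_\delta(E_{j,k})=\deg_\delta(F_{j,k})=k$, $\deg_\delta(H_{j,r})=r$, all other degrees of generators being $0$. A module $V$ is *admissible* if for every $v\in V$ there is $N$ with $Xv=0$ for all homogeneous $X$ with $\deg_\delta X>N$; it has *level* $(k,l)$ if $C$ acts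 as $q^k$ and $K$ as $q^l$. **The Fock space.** Let $\mathcal H$ be the Heisenberg algebra generated by $H_{i,r}$ ($i\in\hat I$) and $c_{j,r}$ ($j\in J$), $r\in\mathbb Z\setminus0$, with $[H_{i,r},H_{j,s}]=\delta_{r+s,0}\frac{[rA_{i,j}][r]}{r}d^{-rM_{i,j}}$, $[c_{i,r},c_{j,s}]=\delta_{i,j}\delta_{r+s,0}\frac{[r]^2}{r}$, $[H_{i,r},c_{j,s}]=0$, and $\mathcal F$ its Fock space, generated by a vacuum killed by all $H_{i,r},c_{j,r}$, $r>0$, and free over the subalgebra generated by the $H_{i,r},c_{j,r}$ with $r<0$. Let $\bar\alpha_i,\bar\Lambda_i$ ($i\in I$) be the simple roots and fundamental weights of $\mathfrak{sl}_{m|n}$, $\langle\bar\alpha_i,\bar\alpha_j\rangle=A_{i,j}$, $\langle\bar\alpha_i,\bar\Lambda_j\rangle=\delta_{i,j}$, $\bar\alpha_0=-\sum_{i\in I}\bar\alpha_i$; let $c_j$ ($j\in J$) satisfy $\langle c_i,c_j\rangle=\delta_{i,j}$ and be orthogonal to all $\bar\alpha_i,\bar\Lambda_i$, and let $Q$ be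 the lattice spanned by the $\bar\alpha_i$ ($i\in I$) and $c_j$. Let $\mathbb C\{Q\}$ be the algebra generated by invertible $e^{\bar\alpha_i}$ ($i\in I$), $e^{c_j}$, where $e^{\bar\alpha_i}e^{\bar\alpha_j}=(-1)^{A_{i,j}}e^{\bar\alpha_j}e^{\bar\alpha_i}$ if $i,j\le m$ and all other pairs of generators commute; for $\alpha=\sum r_l\bar\alpha_l+\sum s_kc_k$ put $e^\alpha=(e^{\bar\alpha_1})^{r_1}\cdots(e^{\bar\alpha_{m+n-1}})^{r_{m+n-1}}(e^{c_m})^{s_m}\cdots(e^{c_{m+n-1}})^{s_{m+n-1}}$. Let $\tilde Q\subset Q$ be generated by $\bar\alpha_i$ ($i\in\hat I^+$), $\bar\alpha_m+c_m$, $\bar\alpha_j+c_j-c_{j-1}$ ($j\in\hat I^-$), and $\mathbb C\{\tilde Q\}$ the span of the $e^\alpha$, $\alpha\in\tilde Q$. The level $1$ partially integrable weights are $\Lambda=\Lambda_i$ ($i\in\hat I\setminus\{0,m\}$) and $\Lambda=(1-a)\Lambda_0+a\Lambda_m$ ($a\in\mathbb C$), where $\Lambda_i$ ($i\in\hat I$)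 are the fundamental weights of $\widehat{\mathfrak{sl}}_{m|n}$; put, respectively, $\tilde\Lambda=\bar\Lambda_i$ ($i\in\hat I^+$), $\tilde\Lambda=\bar\Lambda_i-\sum_{k=i}^{m+n-1}c_k$ ($i\in\hat I^-$), $\tilde\Lambda=a\bar\Lambda_m-a\sum_{k=m}^{m+n-1}c_k$. Let $\mathcal F_\Lambda=\mathcal F\otimes\mathbb C\{\tilde Q\}e^{\tilde\Lambda}$, where $v\otimes e^\alpha e^{\tilde\Lambda}$ has parity $r_m$ mod $2$. On $\mathcal F\otimes\mathbb C\{Q\}e^{\tilde\Lambda}$ let $\mathcal H$ act on the first factor, $\mathbb C\{Q\}$ by left multiplication on the second, and let $z^{\pm H_{i,0}},q^{\pm\alpha_{i,0}},z^{\pm c_{j,0}}$ act on $v\otimes e^\alpha e^{\tilde\Lambda}$ by $z^{\pm\langle\bar\alpha_i,\alpha+\tilde\Lambda\rangle}d^{\pm\frac12\sum_{l\in I}r_lA_{i,l}M_{i,l}}$, $q^{\pm\langle\bar\alpha_i,\alpha+\tilde\Lambda\rangle}$, $z^{\pm\langle c_j,\alpha+\tilde\Lambda\rangle}$. With $H_i^\pm(z)=\sum_{r>0}\frac{H_{i,\pm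 r}}{[r]}z^{\mp r}$, $c_j^\pm(z)=\sum_{r>0}\frac{c_{j,\pm r}}{[r]}z^{\mp r}$ and $e^{-\bar\alpha_i}:=(e^{\bar\alpha_i})^{-1}$ for $i\in\hat I$ (also for $i=0$), put $$\Gamma_i^+(z)=z\,e^{H_i^-(q^{-1}z)}e^{-H_i^+(z)}e^{\bar\alpha_i}z^{H_{i,0}},\quad \Gamma_i^-(z)=z\,e^{-H_i^-(z)}e^{H_i^+(q^{-1}z)}e^{-\bar\alpha_i}z^{-H_{i,0}},\quad C_j^\pm(z)=e^{\pm c_j^-(z)}e^{\mp c_j^+(z)}e^{\pm c_j}z^{\pm c_{j,0}},$$ and $\partial_zf(z)=\frac{f(qz)-f(q^{-1}z)}{(q-q^{-1})z}$. **Theorem.** For every level $1$ partially integrable weight $\Lambda$, the following currents contain only integral powers of $z$ on $\mathcal F_\Lambda$, their coefficients preserve $\mathcal F_\Lambda$, and the formulas $$C=q,\qquad K_i^{\pm1}=q^{\pm\alpha_{i,0}},\qquad H_{i,r}=H_{i,r}\qquad(i\in\hat I),$$ $$E_i(z)=\Gamma_i^+(z),\qquad F_i(z)=\Gamma_i^-(z)\qquad(i\in\hat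 I^+),$$ $$E_m(z)=d^m\,\Gamma_m^+(z)C_m^+(d^mz),\qquad F_m(z)=\Gamma_m^-(z)\,\partial_z[C_m^-(d^mz)],$$ $$E_i(z)=d^{2m-i}\,\Gamma_i^+(z)\,C_i^+(d^{2m-i}z)\,\partial_z[C_{i-1}^-(d^{2m-i}z)]\qquad(i\in\hat I^-),$$ $$F_i(z)=-d^{2m-i}\,\Gamma_i^-(z)\,C_{i-1}^+(d^{2m-i}z)\,\partial_z[C_i^-(d^{2m-i}z)]\qquad(i\in\hat I^-),$$ $$E_0(z)=\Gamma_0^+(z)\,\partial_z[C_{m+n-1}^-(d^{m-n}z)],\qquad F_0(z)=-d^{m-n}\,\Gamma_0^-(z)C_{m+n-1}^+(d^{m-n}z)$$ define on the superspace $\mathcal F_\Lambda$ the structure of an admissible module of level $(1,0)$ over the superalgebra $\mathcal E_{m|n}$ (so $C$ acts as $q$ and $K$ as $1$), which is graded with respect to the degree $\bigl((\deg_0,\dots,\deg_{m+n-1})\bmod\mathbb Z(1,\dots,1);\deg_\delta\bigr)$, in particular with respect to the homogeneous degree $\deg_\delta$. -/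

import Mathlib

noncomputable section

namespace QToroidal

/-! ### Parameters -/

/-- The standing data: `m, n ≥ 1`, `m ≠ n`, and generic nonzero `q, d`.
`dHalf` is a fixed square root of `d`. The logarithms `logq`, `logd` fix the meaning of the complex
powers `q ^ x = exp (x * logq)` and `d ^ x = exp (x * logd)`, which occur for weights with a
non-integral parameter; any choice of the three is allowed. -/
structure Params where
  m : ℕ
  n : ℕ
  one_le_m : 1 ≤ m
  one_le_n : 1 ≤ n
  m_ne_n : m ≠ n
  q : ℂ
  d : ℂ
  q_ne_zero : q ≠ 0
  d_ne_zero : d ≠ 0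
  /-- With `q₁ = d q⁻¹`, `q₂ = q²`, `q₃ = d⁻¹ q⁻¹`. -/
  generic : ∀ n₁ n₂ n₃ : ℤ,
    (d * q⁻¹) ^ n₁ * (q ^ 2) ^ n₂ * (d⁻¹ * q⁻¹) ^ n₃ = 1 ↔ n₁ = n₂ ∧ n₂ = n₃
  dHalf : ℂ
  dHalf_sq : dHalf ^ 2 = d
  logq : ℂ
  exp_logq : Complex.exp logq = q
  logd : ℂ
  exp_logd : Complex.exp logd = d

variable (P : Params)

/-- The affine index set `{0, …, m+n-1}`, read modulo `m+n`. -/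
abbrev Idx : Type := Fin (P.m + P.n)

/-- The finite index set `{1, …, m+n-1}`. -/
abbrev RootIdx : Type := {i : Idx P // i.val ≠ 0}

/-- The index set `{m, …, m+n-1}`. -/
abbrev CIdx : Type := {j : Idx P // P.m ≤ j.val}

/-- `i + 1` modulo `m+n`. -/
def next (i : Idx P) : Idx P :=
  ⟨(i.val + 1) % (P.m + P.n), Nat.mod_lt _ (Nat.lt_of_le_of_lt (Nat.zero_le _) i.isLt)⟩

/-- `i - 1` modulo `m+n`. -/
def prev (i : Idx P) : Idx P :=
  ⟨(i.val + (P.m + P.n) - 1) % (P.m + P.n),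
    Nat.mod_lt _ (Nat.lt_of_le_of_lt (Nat.zero_le _) i.isLt)⟩

/-- The odd indices `0` and `m`. -/
def IsOdd (i : Idx P) : Prop := i.val = 0 ∨ i.val = P.m

instance (i : Idx P) : Decidable (IsOdd P i) := inferInstanceAs (Decidable (_ ∨ _))

/-- The parity `|i|`. -/
def par (i : Idx P) : ℕ := if IsOdd P i then 1 else 0

/-- The label of the edge joining `j - 1` and `j`. -/
def edge (j : Idx P) : ℤ := if 1 ≤ j.val ∧ j.val ≤ P.m then -1 else 1

/-- The affine Cartan matrix. -/
def A (i j : Idx P) : ℤ :=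
  if i = j then (if IsOdd P i then 0 else if i.val < P.m then 2 else -2)
  else if j = next P i then edge P j
  else if i = next P j then edge P i
  else 0

/-- The skew-symmetric matrix `M`. -/
def M (i j : Idx P) : ℤ :=
  if j = next P i then edge P j
  else if i = next P j then -edge P i
  else 0

/-- The quantum integer `[k]`. -/
def qInt (k : ℤ) : ℂ := (P.q ^ k - P.q ^ (-k)) / (P.q - P.q⁻¹)

/-- The coefficient of `t ^ s` in `exp (∑_{r > 0} a r t ^ r)`, over a possibly noncommutative
algebra. -/
def expCoeff {R : Type*} [Ring R] [Algebra ℂ R] (a : ℕ → R) (s : ℕ) : R :=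
  ∑ k ∈ Finset.range (s + 1),
    ((k.factorial : ℂ)⁻¹) •
      PowerSeries.coeff s ((PowerSeries.mk fun r => if r = 0 then 0 else a r) ^ k)

/-! ### The quantum toroidal algebra -/

/-- Generators; `Kinv i` and `Cinv` are the inverses of `K i` and `C`. -/
inductive Gen : Type
  | E (i : Idx P) (k : ℤ)
  | F (i : Idx P) (k : ℤ)
  | H (i : Idx P) (r : {r : ℤ // r ≠ 0})
  | K (i : Idx P)
  | Kinv (i : Idx P)
  | C
  | Cinv

/-- The free algebra on the generators. -/
abbrev Fr : Type := FreeAlgebra ℂ (Gen P)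

namespace Fr

variable {P}

def E (i : Idx P) (k : ℤ) : Fr P := FreeAlgebra.ι ℂ (Gen.E i k)
def F (i : Idx P) (k : ℤ) : Fr P := FreeAlgebra.ι ℂ (Gen.F i k)
def K (i : Idx P) : Fr P := FreeAlgebra.ι ℂ (Gen.K i)
def Kinv (i : Idx P) : Fr P := FreeAlgebra.ι ℂ (Gen.Kinv i)
def C : Fr P := FreeAlgebra.ι ℂ Gen.C
def Cinv : Fr P := FreeAlgebra.ι ℂ Gen.Cinv

/-- `H_{i,r}`; the junk value at `r = 0` is never used. -/
def H (i : Idx P) (r : ℤ) : Fr P :=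
  if h : r ≠ 0 then FreeAlgebra.ι ℂ (Gen.H i ⟨r, h⟩) else 0

/-- `C ^ k` for an integer `k`. -/
def Cpow (k : ℤ) : Fr P := if 0 ≤ k then C ^ k.toNat else Cinv ^ (-k).toNat

/-- The coefficient of `z ^ (-s)` in `K⁺_i(z) = K_i exp ((q - q⁻¹) ∑_{r>0} H_{i,r} z^{-r})`. -/
def Kplus (i : Idx P) (s : ℤ) : Fr P :=
  if 0 ≤ s then K i * expCoeff (fun r => (P.q - P.q⁻¹) • H i (r : ℤ)) s.toNat else 0

/-- The coefficient of `z ^ (-s)` in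
`K⁻_i(z) = K_i⁻¹ exp (-(q - q⁻¹) ∑_{r>0} H_{i,-r} z^{r})`. -/
def Kminus (i : Idx P) (s : ℤ) : Fr P :=
  if s ≤ 0 then Kinv i * expCoeff (fun r => (-(P.q - P.q⁻¹)) • H i (-(r : ℤ))) (-s).toNat else 0

/-- For a formal series `f(z,w) = ∑ f a b z^{-a} w^{-b}`, the coefficients of
`(x z - y w) f(z,w)`. -/
def lin (x y : Fr P) (f : ℤ → ℤ → Fr P) : ℤ → ℤ → Fr P :=
  fun a b => x * f (a + 1) b - y * f a (b + 1)

/-- A complex scalar as an element of the algebra. -/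
def sc (x : ℂ) : Fr P := algebraMap ℂ (Fr P) x

/-- The bracket `[X, Y]_a = X Y - (-1)^{|X||Y|} a Y X` of elements that carry their parity. -/
def br (a : ℂ) (X Y : Fr P × ℕ) : Fr P × ℕ :=
  (X.1 * Y.1 - ((-1 : ℂ) ^ (X.2 * Y.2) * a) • (Y.1 * X.1), X.2 + Y.2)

/-- `E_{i,k}` (for `true`) or `F_{i,k}` (for `false`), together with its parity. -/
def X (e : Bool) (i : Idx P) (k : ℤ) : Fr P × ℕ := (if e then E i k else F i k, par P i)

/-- `[X_i(z₁), [X_i(z₂), X_j(w)]_q]_{q⁻¹}`, coefficientwise. -/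
def serre3 (e : Bool) (i j : Idx P) (k₁ k₂ l : ℤ) : Fr P :=
  (br P.q⁻¹ (X e i k₁) (br P.q (X e i k₂) (X e j l))).1

/-- `[X_i(z₁), [X_{i+1}(w₁), [X_i(z₂), X_{i-1}(w₂)]_q]_{q⁻¹}]`, coefficientwise. -/
def serre4 (e : Bool) (i : Idx P) (k₁ k₂ l₁ l₂ : ℤ) : Fr P :=
  (br 1 (X e i k₁) (br P.q⁻¹ (X e (next P i) l₁)
    (br P.q (X e i k₂) (X e (prev P i) l₂)))).1

/-- `[X_a(z₁), [X_b(w₁), [X_a(z₂), [X_b(w₂), X_c(y)]_q]]]_{q⁻¹}`, coefficientwise. -/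
def serre5 (e : Bool) (a b c : Idx P) (k₁ k₂ l₁ l₂ y : ℤ) : Fr P :=
  (br P.q⁻¹ (X e a k₁) (br 1 (X e b l₁) (br 1 (X e a k₂)
    (br P.q (X e b l₂) (X e c y))))).1

end Fr

open Fr in
/-- The defining relations, coefficient by coefficient. `Sym_{z₁,z₂}` is the sum over the two
orders of the variables. -/
inductive Rel : Fr P → Fr P → Prop
  | C_Cinv : Rel (C * Cinv) 1
  | Cinv_C : Rel (Cinv * C) 1
  | K_Kinv (i : Idx P) : Rel (K i * Kinv i) 1
  | Kinv_K (i : Idx P) : Rel (Kinv i * K i) 1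
  | C_central (g : Gen P) : Rel (C * FreeAlgebra.ι ℂ g) (FreeAlgebra.ι ℂ g * C)
  | K_comm (i j : Idx P) : Rel (K i * K j) (K j * K i)
  | K_E (i j : Idx P) (k : ℤ) : Rel (K i * E j k * Kinv i) (P.q ^ A P i j • E j k)
  | K_F (i j : Idx P) (k : ℤ) : Rel (K i * F j k * Kinv i) (P.q ^ (-A P i j) • F j k)
  -- the currents `K⁺`, `K⁻`
  | KK_plus (i j : Idx P) (a b : ℤ) : Rel (Kplus i a * Kplus j b) (Kplus j b * Kplus i a)
  | KK_minus (i j : Idx P) (a b : ℤ) : Rel (Kminus i a * Kminus j b) (Kminus j b * Kminus i a)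
  -- Both sides are series in `z` and `w⁻¹`, so the denominators can be cleared.
  | KK_mixed (i j : Idx P) (a b : ℤ) : Rel
      (lin (sc (P.d ^ M P i j) * Cinv) (sc (P.q ^ A P i j))
        (lin (sc (P.d ^ M P i j * P.q ^ A P i j) * C) 1
          (fun a b => Kminus i a * Kplus j b)) a b)
      (lin (sc (P.d ^ M P i j * P.q ^ A P i j) * Cinv) 1
        (lin (sc (P.d ^ M P i j) * C) (sc (P.q ^ A P i j))
          (fun a b => Kplus j b * Kminus i a)) a b)
  -- `K⁺_i(C⁻¹ z)` has the coefficients `C ^ a * Kplus i a`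
  | Kplus_E (i j : Idx P) (a b : ℤ) : Rel
      (lin (sc (P.d ^ M P i j)) (sc (P.q ^ A P i j))
        (fun a b => Cpow a * Kplus i a * E j b) a b)
      (lin (sc (P.d ^ M P i j * P.q ^ A P i j)) 1
        (fun a b => E j b * (Cpow a * Kplus i a)) a b)
  | Kminus_E (i j : Idx P) (a b : ℤ) : Rel
      (lin (sc (P.d ^ M P i j)) (sc (P.q ^ A P i j)) (fun a b => Kminus i a * E j b) a b)
      (lin (sc (P.d ^ M P i j * P.q ^ A P i j)) 1 (fun a b => E j b * Kminus i a) a b)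
  | Kplus_F (i j : Idx P) (a b : ℤ) : Rel
      (lin (sc (P.d ^ M P i j)) (sc (P.q ^ (-A P i j))) (fun a b => Kplus i a * F j b) a b)
      (lin (sc (P.d ^ M P i j * P.q ^ (-A P i j))) 1 (fun a b => F j b * Kplus i a) a b)
  | Kminus_F (i j : Idx P) (a b : ℤ) : Rel
      (lin (sc (P.d ^ M P i j)) (sc (P.q ^ (-A P i j)))
        (fun a b => Cpow a * Kminus i a * F j b) a b)
      (lin (sc (P.d ^ M P i j * P.q ^ (-A P i j))) 1
        (fun a b => F j b * (Cpow a * Kminus i a)) a b)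
  -- the coefficient of `z^{-k} w^{-l}`
  | EF (i j : Idx P) (k l : ℤ) : Rel
      (br 1 (X true i k) (X false j l)).1
      (if i = j then (P.q - P.q⁻¹)⁻¹ • (Cpow k * Kplus i (k + l) - Cpow l * Kminus i (k + l))
        else 0)
  | XX_zero (e : Bool) (i j : Idx P) (k l : ℤ) (h : A P i j = 0) :
      Rel (br 1 (X e i k) (X e j l)).1 0
  | EE (i j : Idx P) (a b : ℤ) (h : A P i j ≠ 0) : Rel
      (lin (sc (P.d ^ M P i j)) (sc (P.q ^ A P i j)) (fun a b => E i a * E j b) a b)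
      ((-1 : ℂ) ^ (par P i * par P j) •
        lin (sc (P.d ^ M P i j * P.q ^ A P i j)) 1 (fun a b => E j b * E i a) a b)
  | FF (i j : Idx P) (a b : ℤ) (h : A P i j ≠ 0) : Rel
      (lin (sc (P.d ^ M P i j)) (sc (P.q ^ (-A P i j))) (fun a b => F i a * F j b) a b)
      ((-1 : ℂ) ^ (par P i * par P j) •
        lin (sc (P.d ^ M P i j * P.q ^ (-A P i j))) 1 (fun a b => F j b * F i a) a b)
  -- Serre relations
  | serre_next (e : Bool) (i : Idx P) (k₁ k₂ l : ℤ) (h : ¬ IsOdd P i) :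
      Rel (serre3 e i (next P i) k₁ k₂ l + serre3 e i (next P i) k₂ k₁ l) 0
  | serre_prev (e : Bool) (i : Idx P) (k₁ k₂ l : ℤ) (h : ¬ IsOdd P i) :
      Rel (serre3 e i (prev P i) k₁ k₂ l + serre3 e i (prev P i) k₂ k₁ l) 0
  | serre_odd (e : Bool) (i : Idx P) (k₁ k₂ l₁ l₂ : ℤ) (h : IsOdd P i) (hmn : P.m * P.n ≠ 2) :
      Rel (serre4 e i k₁ k₂ l₁ l₂ + serre4 e i k₂ k₁ l₁ l₂) 0
  -- For `(m,n) = (2,1)` the even index is `c = 1`, for `(1,2)` it is `c = 2`; `m` is the odd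
  -- index different from `0`.
  | serre_small (e : Bool) (z o c : Idx P) (k₁ k₂ l₁ l₂ y : ℤ) (hmn : P.m * P.n = 2)
      (hz : z.val = 0) (ho : o.val = P.m) (hc : ¬ IsOdd P c) :
      Rel
        (serre5 e z o c k₁ k₂ l₁ l₂ y + serre5 e z o c k₂ k₁ l₁ l₂ y
          + serre5 e z o c k₁ k₂ l₂ l₁ y + serre5 e z o c k₂ k₁ l₂ l₁ y)
        (serre5 e o z c l₁ l₂ k₁ k₂ y + serre5 e o z c l₁ l₂ k₂ k₁ y
          + serre5 e o z c l₂ l₁ k₁ k₂ y + serre5 e o z c l₂ l₁ k₂ k₁ y)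

/-- The quantum toroidal algebra of `gl_{m|n}`. -/
abbrev Alg : Type := RingQuot (Rel P)

/-- The image of a generator in the algebra. -/
def gen (g : Gen P) : Alg P := RingQuot.mkAlgHom ℂ (Rel P) (FreeAlgebra.ι ℂ g)

/-- The central element `K = ∏ K_i`. -/
def KTot : Alg P := (List.ofFn fun i : Idx P => gen P (Gen.K i)).prod

/-! ### Gradings, admissibility, level -/

/-- The parity of the generators. -/
def parityDeg : Gen P → ZMod 2
  | .E i _ => (par P i : ZMod 2)
  | .F i _ => (par P i : ZMod 2)
  | _ => 0

/-- The homogeneous degree. -/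
def deltaDeg : Gen P → ℤ
  | .E _ k => k
  | .F _ k => k
  | .H _ r => r.1
  | _ => 0

/-- The degrees `(deg_0, …, deg_{m+n-1})`. -/
def rootDeg : Gen P → (Idx P → ℤ)
  | .E i _ => Pi.single i 1
  | .F i _ => -Pi.single i 1
  | _ => 0

/-- The group `ℤ^{m+n} / ℤ (1, …, 1)`: the root lattice of `sl_{m|n}`, the `i`-th basis vector
being the class of the simple root of index `i`. -/
abbrev RootClass : Type := (Idx P → ℤ) ⧸ AddSubgroup.zmultiples (fun _ : Idx P => (1 : ℤ))

/-- The degree in `ℤ^{m+n} / ℤ (1, …, 1) × ℤ`. -/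
def fullDeg (g : Gen P) : RootClass P × ℤ := (QuotientAddGroup.mk (rootDeg P g), deltaDeg P g)

/-- The elements of degree `g`: the span of the words in the generators whose degrees sum
to `g`. -/
def homogComp {G : Type*} [AddCommGroup G] (deg : Gen P → G) (g : G) : Submodule ℂ (Alg P) :=
  Submodule.span ℂ {x | ∃ l : List (Gen P), (l.map deg).sum = g ∧ x = (l.map (gen P)).prod}

section Modules

variable {P}
variable {V : Type*} [AddCommMonoid V] [Module ℂ V]

/-- `V = ⨁ 𝒱 g`, and elements of degree `g` map `𝒱 h` into `𝒱 (g + h)`. -/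
def IsGradedBy {G : Type*} [AddCommGroup G] (ρ : Alg P →ₐ[ℂ] Module.End ℂ V) (deg : Gen P → G)
    (𝒱 : G → Submodule ℂ V) : Prop :=
  iSupIndep 𝒱 ∧ iSup 𝒱 = ⊤ ∧
    ∀ g h : G, ∀ x ∈ homogComp P deg g, ∀ v ∈ 𝒱 h, ρ x v ∈ 𝒱 (g + h)

def IsAdmissible (ρ : Alg P →ₐ[ℂ] Module.End ℂ V) : Prop :=
  ∀ v : V, ∃ N : ℤ, ∀ k : ℤ, N < k → ∀ x ∈ homogComp P (deltaDeg P) k, ρ x v = 0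

/-- Level `(kv, kh)`: `C` acts as `q ^ kv` and `K` as `q ^ kh`. -/
def HasLevel (ρ : Alg P →ₐ[ℂ] Module.End ℂ V) (kv kh : ℤ) : Prop :=
  ρ (gen P Gen.C) = P.q ^ kv • (1 : Module.End ℂ V) ∧
    ρ (KTot P) = P.q ^ kh • (1 : Module.End ℂ V)

end Modules

/-! ### The Heisenberg algebra and its Fock space -/

/-- Labels of the bosons: `inl i` for `H_i`, `inr j` for `c_j`. -/
abbrev Boson : Type := Idx P ⊕ CIdx P

/-- The Fock space: polynomials in the creation operators, the variable `(x, r)` being `x_{-r}`,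
with vacuum `1`. -/
abbrev Fock : Type := MvPolynomial (Boson P × ℕ+) ℂ

/-- The scalar `[x_r, y_{-r}]`, `r > 0`. -/
def heis : Boson P → Boson P → ℕ+ → ℂ
  | .inl i, .inl j, r =>
      qInt P ((r : ℤ) * A P i j) * qInt P (r : ℤ) / (r : ℂ) * P.d ^ (-((r : ℤ) * M P i j))
  | .inr i, .inr j, r => if i = j then qInt P (r : ℤ) ^ 2 / (r : ℂ) else 0
  | _, _, _ => 0

/-- The creation operator `x_{-r}`. -/
def cre (x : Boson P) (r : ℕ+) : Module.End ℂ (Fock P) :=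
  LinearMap.mulLeft ℂ (MvPolynomial.X (x, r))

/-- The annihilation operator `x_r`: the derivation with `x_r y_{-s} = δ_{r,s} [x_r, y_{-r}]`. -/
def ann (x : Boson P) (r : ℕ+) : Module.End ℂ (Fock P) :=
  ∑ y : Boson P, heis P x y r • (MvPolynomial.pderiv (R := ℂ) (y, r)).toLinearMap

/-- The operator `x_r` for a nonzero integer `r`. -/
def mode (x : Boson P) (r : {r : ℤ // r ≠ 0}) : Module.End ℂ (Fock P) :=
  if r.1 < 0 then cre P x ⟨r.1.natAbs, Int.natAbs_pos.mpr r.2⟩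
  else ann P x ⟨r.1.natAbs, Int.natAbs_pos.mpr r.2⟩

/-! ### Lattices and weights -/

/-- The lattice `Q = Q_{m|n} ⊕ Q_c`, in the bases of the simple roots and of the `c_j`. -/
abbrev QLat : Type := (RootIdx P → ℤ) × (CIdx P → ℤ)

/-- The (finite part of the) simple root of index `i`; for `i = 0` it is minus the sum of the
others. -/
def root (i : Idx P) : RootIdx P → ℤ :=
  fun l => if i.val = 0 then -1 else if l.1 = i then 1 else 0

/-- The bilinear form on the root lattice. -/
def form (x y : RootIdx P → ℤ) : ℤ := ∑ k, ∑ l, x k * A P k.1 l.1 * y l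

/-- The lattice `Q̃`, generated by `α_i` (`0 < i < m`), `α_m + c_m` and `α_j + c_j - c_{j-1}`
(`m < j`); the `c`-part below vanishes for `i < m`, and is `c_m` for `i = m`. -/
def Qtilde : AddSubgroup (QLat P) :=
  AddSubgroup.closure (Set.range fun i : RootIdx P =>
    ((root P i.1, fun j => (if j.1 = i.1 then 1 else 0) -
      (if j.1.val + 1 = i.1.val then 1 else 0)) : QLat P))

/-- The level one partially integrable weights: `Λ_i` for `i ∉ {0, m}`, and
`(1 - a) Λ_0 + a Λ_m` for `a ∈ ℂ`. -/
inductive Weight : Type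
  | fund (i : Idx P) (h : ¬ IsOdd P i)
  | line (a : ℂ)

variable {P} in
/-- The coordinates of `Λ̃`, in the bases of the fundamental weights and of the `c_j`. -/
def Weight.tilde : Weight P → (RootIdx P → ℂ) × (CIdx P → ℂ)
  | .fund i _ => (fun l => if l.1 = i then 1 else 0,
      fun j => if P.m < i.val ∧ i ≤ j.1 then -1 else 0)
  | .line a => (fun l => if l.1.val = P.m then a else 0, fun _ => -a)

variable {P} (Λ : Weight P)

/-- `⟨α_i, α + Λ̃⟩`, where `⟨α_i, c_j⟩ = 0` and the fundamental weights are dual to the simple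
roots. -/
def rootPair (i : Idx P) (α : QLat P) : ℂ :=
  (form P (root P i) α.1 : ℂ) + ∑ l, (root P i l : ℂ) * Λ.tilde.1 l

/-- `⟨c_j, α + Λ̃⟩`. -/
def cPair (j : CIdx P) (α : QLat P) : ℂ := (α.2 j : ℂ) + Λ.tilde.2 j

variable (P) in
/-- `ℂ{Q}`, and with it `ℱ ⊗ ℂ{Q} e^Λ̃`, is written in the basis of the ordered monomials
`e^α`: `w` stands for `∑ (w α) ⊗ e^α e^Λ̃`. -/
abbrev Big : Type := QLat P →₀ Fock P

variable (P) in
/-- `ℱ_Λ = ℱ ⊗ ℂ{Q̃} e^Λ̃`, inside `ℱ ⊗ ℂ{Q} e^Λ̃`. As a vector space it does not depend on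
`Λ`. -/
def FSpace : Submodule ℂ (Big P) := Finsupp.supported (Fock P) ℂ (Qtilde P : Set (QLat P))

/-- The index `m`, as a simple root index. -/
def mRoot : RootIdx P :=
  ⟨⟨P.m, by have := P.one_le_n; omega⟩, by have := P.one_le_m; simp only; omega⟩

variable (P) in
/-- The part of `ℱ_Λ` of parity `p`: the vectors `v ⊗ e^α e^Λ̃` for which the coefficient of
`α_m` in `α` is congruent to `p`. -/
def parityPart (p : ZMod 2) : Submodule ℂ (FSpace P) :=
  (Finsupp.supported (Fock P) ℂ {α : QLat P | ((α.1 mRoot : ℤ) : ZMod 2) = p}).comap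
    (FSpace P).subtype

/-- The sign `s` in `e^β e^α = s e^{β+α}` for the ordered monomials `e^α` of the twisted group
algebra: `e^{α_k}` and `e^{α_l}` commute up to the sign `(-1)^{A_{k,l}}` if `k, l ≤ m`, and
commute otherwise. -/
def twist (β α : RootIdx P → ℤ) : ℂ :=
  (-1 : ℂ) ^ (∑ k : RootIdx P, ∑ l : RootIdx P,
    if l.1 < k.1 ∧ k.1.val ≤ P.m then A P k.1 l.1 * β k * α l else 0)

/-! ### Currents -/

variable (P) in
/-- A formal series `∑_x X x z^x` of operators, with exponents `x ∈ ℂ`. -/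
def Current : Type := ℂ → Big P → Big P

namespace Current

/-- The product of two series; all sums in the products below are finite on every vector. -/
def mul (X Y : Current P) : Current P := fun x w => ∑ᶠ y : ℂ, X y (Y (x - y) w)

instance : Mul (Current P) := ⟨mul⟩

instance : SMul ℂ (Current P) := ⟨fun c X x w => c • X x w⟩

/-- A constant series. -/
def const (T : Big P → Big P) : Current P := fun x w => if x = 0 then T w else 0

/-- `z X(z)`. -/
def zMul (X : Current P) : Current P := fun x w => X (x - 1) w

/-- `X(e^ℓ z)`. -/
def scale (ℓ : ℂ) (X : Current P) : Current P := fun x w => Complex.exp (x * ℓ) • X x w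

/-- `X(d^k z)`. -/
def dScale (k : ℤ) (X : Current P) : Current P := scale (k * P.logd) X

/-- The `q`-difference operator `∂_z X(z) = (X(qz) - X(q⁻¹z)) / ((q - q⁻¹) z)`. -/
def qDeriv (X : Current P) : Current P := fun x w =>
  (P.q - P.q⁻¹)⁻¹ • (scale P.logq X (x + 1) w - scale (-P.logq) X (x + 1) w)

/-- The series `∑_{r ≥ 0} T r z^{e r}`, the operators `T r` acting on the Fock space factor. -/
def ofFock (e : ℤ) (T : ℕ → Module.End ℂ (Fock P)) : Current P := fun x w =>
  ∑ᶠ (r : ℕ) (_ : (e : ℂ) * (r : ℂ) = x), Finsupp.mapRange.linearMap (T r) w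

/-- `exp (t x⁻(uz))`, where `x⁻(z) = ∑_{r>0} x_{-r} z^r / [r]`. -/
def expCre (x : Boson P) (t u : ℂ) : Current P :=
  ofFock 1 (expCoeff fun r => if h : 0 < r then (t * u ^ r / qInt P r) • cre P x ⟨r, h⟩ else 0)

/-- `exp (t x⁺(uz))`, where `x⁺(z) = ∑_{r>0} x_r z^{-r} / [r]`. -/
def expAnn (x : Boson P) (t u : ℂ) : Current P :=
  ofFock (-1)
    (expCoeff fun r => if h : 0 < r then (t * u⁻¹ ^ r / qInt P r) • ann P x ⟨r, h⟩ else 0)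

/-- Left multiplication by `e^{α_i}`. -/
def expRoot (i : Idx P) : Big P → Big P := fun w =>
  w.sum fun α f => Finsupp.single (α + (root P i, 0)) (twist (root P i) α.1 • f)

/-- Left multiplication by `e^{-α_i}`, the inverse of `e^{α_i}`. -/
def expRootInv (i : Idx P) : Big P → Big P := fun w =>
  w.sum fun α f =>
    Finsupp.single (α - (root P i, 0)) (twist (root P i) (α.1 - root P i) • f)

/-- Multiplication by `e^{k c_j}`. -/
def expC (k : ℤ) (j : CIdx P) : Big P → Big P := fun w =>
  w.sum fun α f => Finsupp.single (α + (0, Pi.single j k)) f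

/-- `z^{k H_{i,0}}`, for `k = 1, -1`. -/
def zH (k : ℤ) (i : Idx P) : Current P := fun x w =>
  w.sum fun α f =>
    if k * rootPair Λ i α = x then
      Finsupp.single α (P.dHalf ^ (k * ∑ l : RootIdx P, α.1 l * A P i l.1 * M P i l.1) • f)
    else 0

/-- `z^{k c_{j,0}}`, for `k = 1, -1`. -/
def zC (k : ℤ) (j : CIdx P) : Current P := fun x w =>
  w.sum fun α f => if k * cPair Λ j α = x then Finsupp.single α f else 0

/-- `Γ⁺_i(z)`. -/
def GammaPlus (i : Idx P) : Current P :=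
  zMul (expCre (.inl i) 1 P.q⁻¹ * (expAnn (.inl i) (-1) 1 * (const (expRoot i) * zH Λ 1 i)))

/-- `Γ⁻_i(z)`. -/
def GammaMinus (i : Idx P) : Current P :=
  zMul (expCre (.inl i) (-1) 1 *
    (expAnn (.inl i) 1 P.q⁻¹ * (const (expRootInv i) * zH Λ (-1) i)))

/-- `C⁺_j(z)` for `k = 1`, `C⁻_j(z)` for `k = -1`. -/
def CCur (k : ℤ) (j : CIdx P) : Current P :=
  expCre (.inr j) k 1 * (expAnn (.inr j) (-k) 1 * (const (expC k j) * zC Λ k j))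

/-- The index `m+n-1`. -/
def lastC : CIdx P :=
  ⟨⟨P.m + P.n - 1, by have := P.one_le_n; omega⟩, by have := P.one_le_n; simp only; omega⟩

/-- The index `i - 1`, for `m < i`. -/
def predC (i : Idx P) (h : P.m < i.val) : CIdx P :=
  ⟨⟨i.val - 1, by have := i.isLt; omega⟩, by simp only; omega⟩

/-- The current by which `E_i(z)` acts. The normally ordered products of `C⁺_i` and
`∂ C⁻_{i-1}` are plain products, since the modes of `c_i` and of `c_{i-1}` commute. -/
def ECur (i : Idx P) : Current P :=
  if i.val = 0 then
    GammaPlus Λ i * qDeriv (dScale ((P.m : ℤ) - P.n) (CCur Λ (-1) lastC))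
  else if i.val < P.m then GammaPlus Λ i
  else if h : P.m < i.val then
    P.d ^ (2 * (P.m : ℤ) - i.val) • (GammaPlus Λ i *
      (dScale (2 * (P.m : ℤ) - i.val) (CCur Λ 1 ⟨i, h.le⟩) *
        qDeriv (dScale (2 * (P.m : ℤ) - i.val) (CCur Λ (-1) (predC i h)))))
  else
    P.d ^ (P.m : ℤ) • (GammaPlus Λ i * dScale P.m (CCur Λ 1 ⟨mRoot.1, le_refl P.m⟩))

/-- The current by which `F_i(z)` acts. -/
def FCur (i : Idx P) : Current P :=
  if i.val = 0 then
    (-P.d ^ ((P.m : ℤ) - P.n)) •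
      (GammaMinus Λ i * dScale ((P.m : ℤ) - P.n) (CCur Λ 1 lastC))
  else if i.val < P.m then GammaMinus Λ i
  else if h : P.m < i.val then
    (-P.d ^ (2 * (P.m : ℤ) - i.val)) • (GammaMinus Λ i *
      (dScale (2 * (P.m : ℤ) - i.val) (CCur Λ 1 (predC i h)) *
        qDeriv (dScale (2 * (P.m : ℤ) - i.val) (CCur Λ (-1) ⟨i, h.le⟩))))
  else
    GammaMinus Λ i * qDeriv (dScale P.m (CCur Λ (-1) ⟨mRoot.1, le_refl P.m⟩))

/-- `J(z) = ∑_{k ∈ ℤ} X k z^{-k}` on `ℱ_Λ`; in particular only integral powers occur, and the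
coefficients preserve `ℱ_Λ`. -/
def HasModes (J : Current P) (X : ℤ → Module.End ℂ (FSpace P)) : Prop :=
  ∀ w : FSpace P, (∀ k : ℤ, J (-(k : ℂ)) w = (X k w : Big P)) ∧
    ∀ x : ℂ, x ∉ Set.range ((↑) : ℤ → ℂ) → J x w = 0

end Current

end QToroidal

end

open QToroidal

noncomputable section

namespace QToroidal

open AddMonoidAlgebra (lift_single)
open AddMonoidHom (fst snd)
open AlgHom (commutes)
open Algebra (lmul ofId ofId_apply smul_def)
open Bool (false_eq_true)
open Commute (all)
open Complex (exp exp_add exp_int_mul exp_zero)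
open Derivation (coeFn_coe leibniz)
open Fin (ext_iff)
open Finset (coe_range mem_coe mem_filter mem_range mem_univ min' min'_le mul_sum prod_congr
  prod_eq_one prod_mul_distrib range smul_sum sum_add_distrib sum_comm sum_congr sum_eq_single
  sum_eq_zero sum_insert sum_le_sum sum_mul sum_mul_sum sum_of_injOn sum_range_succ'
  sum_sub_distrib sum_subset univ)
open Finset.HasAntidiagonal (mem_antidiagonal)
open Finsupp (coe_lsum lhom_ext lsingle lsingle_apply lsum_single single_add single_apply
  single_mem_supported single_sub single_zero smul_single weight)
open Fintype (sum_bool sum_sum_type)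
open FreeAlgebra (lift_ι_apply)
open Function (comp_def update update_of_ne)
open Int (cast_id cast_neg cast_one)
open LinearMap (applyₗ comp_apply funLeft lsmul mulLeft mulLeft_apply)
open List (append_nil cons_append finRange length_cons map_congr_left map_cons map_map map_nil
  mem_cons mem_finRange mem_map nil_append nodup_cons pairwise_cons prod_cons prod_nil sum_cons
  sum_nil)
open List.Pairwise (imp_of_mem)
open Matrix (cons_val cons_val_one cons_val_zero)
open MultilinearMap (map_smul_univ)
open MvPolynomial (aeval aeval_X algebraMap_eq coeff_add coeff_zero induction_on
  isWeightedHomogeneous_X lcoeff lcoeff_apply ne_zero_iff pderiv pderiv_X smul_eq_C_mul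
  weightedHomogeneousSubmodule)
open Nat (cast_ne_zero lt_succ_self succ_ne_zero toPNat'_coe)
open Or (inl inr)
open PNat (eq)
open Pi (single_eq_of_ne)
open Polynomial (coeff_C coeff_mul_C induction_on' lsum_apply sum_monomial_index sum_over_range')
open PowerSeries (coeff coeff_C_mul coeff_derivative coeff_mk coeff_mul coeff_one coeff_rescale
  coeff_smul coeff_succ_X_mul derivative map_C mk)
open Prod (fst_add smul_fst smul_snd snd_add snd_neg)
open QuotientAddGroup (eq_zero_iff mk_add)
open Submodule (smul_mem span span_induction span_le subset_span)
open Finset.HasAntidiagonal (antidiagonal)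

variable {P : Params} (Λ : Weight P)

/-! ### Exponential series -/

section ExpCoeff

variable {R R' : Type*} [Ring R] [Algebra ℂ R] [Ring R'] [Algebra ℂ R']

lemma expCoeff_congr {a b : ℕ → R} (h : ∀ r, 0 < r → a r = b r) (s) :
    expCoeff a s = expCoeff b s := by grind [expCoeff]

lemma expCoeff_map (f : R →ₐ[ℂ] R') (a s) : f (expCoeff a s) = expCoeff (fun r => f (a r)) s := by
  have : (mk fun r => if r = 0 then 0 else f (a r)) = PowerSeries.map f (mk
    fun r => if r = 0 then 0 else a r) := by ext r; simp [apply_ite f]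
  simp only [expCoeff, this, map_sum, map_smul, ← map_pow]; rfl

lemma expCoeff_zero (a : ℕ → R) : expCoeff a 0 = 1 := by
  simp [expCoeff]

lemma expCoeff_succ_of_comm {S : Type*} [CommRing S] [Algebra ℂ S] (a : ℕ → S) (n) : ((n + 1 : ℕ) :
    ℂ) • expCoeff a (n + 1) = ∑ p ∈ antidiagonal n, ((p.1 + 1 : ℕ) : ℂ) • (a (p.1 + 1) * expCoeff a
    p.2) := by
  set f : PowerSeries S := mk fun r => if r = 0 then 0 else a r with hf
  have hf0 : PowerSeries.X ∣ f := by rw [PowerSeries.X_dvd_iff]; simp [hf]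
  have trunc : ∀ j N, j ≤ N → expCoeff a j = coeff j
      (∑ k ∈ range (N + 1), ((k.factorial : ℂ)⁻¹) • f ^ k) := by
    intro j N hj; rw [expCoeff, map_sum]; simp only [coeff_smul]
    apply sum_subset
    · intro k; simp only [mem_range]; omega
    · intro k _ hk
      rw [PowerSeries.X_pow_dvd_iff.1 (pow_dvd_pow_of_dvd hf0 k) j (by simpa using hk), smul_zero]
  have der : ∀ N, derivative S
      (∑ k ∈ range (N + 1 + 1), ((k.factorial : ℂ)⁻¹) • f ^ k) =
      derivative S f * ∑ k ∈ range (N + 1), ((k.factorial : ℂ)⁻¹) • f ^ k := by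
    intro N; have hsm : ∀ c (g : PowerSeries S), c • g = (algebraMap ℂ S c) • g := by
      intro c g; ext; rw [coeff_smul, coeff_smul, algebraMap_smul]
    rw [sum_range_succ', map_add, map_sum, mul_sum]
    have h0 : derivative S ((((0 : ℕ).factorial : ℂ)⁻¹) • f ^ 0) = 0 := by
      rw [hsm, Derivation.map_smul, pow_zero, Derivation.map_one_eq_zero, smul_zero]
    rw [h0, add_zero]; refine sum_congr rfl fun k _ => ?_
    rw [hsm, Derivation.map_smul, Derivation.leibniz_pow, hsm, Nat.add_sub_cancel, Nat.factorial_succ,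
      ← Nat.cast_smul_eq_nsmul S, smul_smul, smul_eq_mul, mul_smul_comm, mul_comm (f ^ k)]
    congr 1; have : (k + 1 : ℕ) = algebraMap ℂ S (k + 1 : ℕ) := by simp
    rw [this, ← map_mul]; congr 1
    have h1 : (k + 1 : ℕ) ≠ 0 := cast_ne_zero.2 (succ_ne_zero k)
    have h2 : k.factorial ≠ 0 := cast_ne_zero.2 (Nat.factorial_ne_zero k)
    push_cast at h1 ⊢; field_simp
  have key := congrArg (coeff n) (der n)
  rw [coeff_derivative, ← trunc (n + 1) (n + 1) le_rfl, coeff_mul] at key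
  rw [smul_def, mul_comm]; have e1 : algebraMap ℂ S (n + 1 : ℕ) = n + 1 := by simp
  rw [e1, key]; refine sum_congr rfl fun p hp => ?_
  rw [← trunc p.2 n (by have := mem_antidiagonal.1 hp; omega),
    coeff_derivative, smul_def]
  simp [hf]; ring

lemma expCoeff_succ (a : ℕ → R) (ha : ∀ r s, 0 < r → 0 < s → Commute (a r) (a s)) (n) : ((n + 1 : ℕ)
    : ℂ) • expCoeff a (n + 1) = ∑ p ∈ antidiagonal n, ((p.1 + 1 : ℕ) : ℂ) • (a (p.1 + 1) * expCoeff
    a p.2) := by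
  set U : Set R := {x | ∃ r, 0 < r ∧ x = a r}; have hU : ∀ x ∈ U, ∀ y ∈ U, x * y = y * x := by grind
  let _ : CommRing (Algebra.adjoin ℂ U) := { (inferInstance : Ring (Algebra.adjoin ℂ U)) with
      mul_comm := (Algebra.isMulCommutative_adjoin ℂ hU).is_comm.comm }
  set b : ℕ → Algebra.adjoin ℂ U := fun r =>
    if h : 0 < r then ⟨a r, Algebra.subset_adjoin ⟨r, h, rfl⟩⟩ else 0
  have hb : ∀ s, (Algebra.adjoin ℂ U).val (expCoeff b s) = expCoeff a s := by
    intro s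
    refine (expCoeff_map (Algebra.adjoin ℂ U).val b s).trans (expCoeff_congr (fun r hr => ?_) s)
    simp [b, hr]
  have key := congrArg (Algebra.adjoin ℂ U).val (expCoeff_succ_of_comm b n)
  rw [map_smul, map_sum, hb] at key; rw [key]; refine sum_congr rfl fun p _ => ?_
  rw [map_smul, map_mul, hb]; simp [b]

lemma expCoeff_unique {a} (ha : ∀ r s, 0 < r → 0 < s → Commute (a r) (a s)) {e : ℕ → R} (h0 : e 0 =
    1) (h : ∀ n, ((n + 1 : ℕ) : ℂ) • e (n + 1) = ∑ p ∈ antidiagonal n, ((p.1 + 1 : ℕ) : ℂ) • (a (p.1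
    + 1) * e p.2)) (s) : e s = expCoeff a s := by
  induction s using Nat.strong_induction_on with
  | _ s ih => cases s with
    | zero => rw [h0, expCoeff_zero]
    | succ n =>
      refine smul_right_injective _ (cast_ne_zero.2 (succ_ne_zero n) : ((n + 1 : ℕ) : ℂ) ≠
        0) ?_
      show ((n + 1 : ℕ) : ℂ) • e (n + 1) = ((n + 1 : ℕ) : ℂ) • expCoeff a (n + 1)
      rw [h, expCoeff_succ a ha]; refine sum_congr rfl fun p hp => ?_
      rw [ih p.2 (by have := mem_antidiagonal.1 hp; omega)]

variable {S : Type*} [CommRing S] [Algebra ℂ S]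

/-- `exp (∑ a r t ^ r)` as a power series. -/
def expSeries (a : ℕ → S) : PowerSeries S := mk (expCoeff a)

@[simp] lemma coeff_expSeries (a : ℕ → S) (s) :
    coeff s (expSeries a) = expCoeff a s := coeff_mk _ _

lemma derivative_expSeries (a) : derivative S (expSeries a) =
    mk (fun r => (r + 1 : ℕ) * a (r + 1)) * expSeries a := by
  ext n; rw [coeff_derivative, coeff_mul]; have := expCoeff_succ_of_comm a n
  grind [smul_def, map_natCast, coeff_expSeries, coeff_mk]

lemma eq_expSeries {a f} (h0 : coeff 0 f = 1) (h : derivative S f =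
    mk (fun r => ((r + 1 : ℕ) : S) * a (r + 1)) * f) : f = expSeries a := by
  ext s; rw [coeff_expSeries]
  refine expCoeff_unique (e := fun s => coeff s f) (fun _ _ _ _ => all _ _)
    h0 (fun n => ?_) s
  have := congrArg (coeff n) h
  rw [coeff_derivative, coeff_mul] at this
  grind [smul_def, map_natCast, mul_comm, coeff_mk]

lemma expSeries_add (a b : ℕ → S) : expSeries (fun r => a r + b r) = expSeries a * expSeries b := by
  symm; apply eq_expSeries
  · simp [expCoeff_zero, coeff_mul]
  · rw [leibniz, derivative_expSeries, derivative_expSeries, smul_eq_mul, smul_eq_mul]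
    have : (mk fun r => (r + 1 : ℕ) * (a (r + 1) + b (r + 1))) =
        mk (fun r => (r + 1 : ℕ) * a (r + 1)) +
        mk (fun r => (r + 1 : ℕ) * b (r + 1)) := by
      ext; simp [mul_add]
    grind

lemma expSeries_zero : expSeries (fun _ => (0 : S)) = 1 := by
  symm; apply eq_expSeries
  · simp
  · ext; simp

lemma expCoeff_add (a b : ℕ → S) (s) : expCoeff (fun r => a r + b r) s =
    ∑ p ∈ antidiagonal s, expCoeff a p.1 * expCoeff b p.2 := by
  rw [← coeff_expSeries, expSeries_add, coeff_mul]; simp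

lemma expSeries_pow_mul (c) (a : ℕ → S) :
    expSeries (fun r => c ^ r * a r) = PowerSeries.rescale c (expSeries a) := by
  symm; apply eq_expSeries
  · simp [expCoeff_zero]
  · ext n; rw [coeff_derivative, coeff_rescale, coeff_mul]
    have := congrArg (coeff n) (derivative_expSeries a)
    rw [coeff_derivative, coeff_mul] at this
    rw [mul_assoc, this, mul_sum]; refine sum_congr rfl fun p hp => ?_
    rw [← mem_antidiagonal.1 hp]
    grind [coeff_mk, coeff_rescale]

lemma expCoeff_pow_mul (c) (a : ℕ → S) (s) :
    expCoeff (fun r => c ^ r * a r) s = c ^ s * expCoeff a s := by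
  rw [← coeff_expSeries, expSeries_pow_mul, coeff_rescale, coeff_expSeries]

lemma expSeries_log (c : ℂ) :
    expSeries (fun r => -(c ^ r / r)) = 1 - PowerSeries.C c * PowerSeries.X := by
  symm; apply eq_expSeries
  · simp
  · have e : (mk fun r => (r + 1 : ℕ) * -(c ^ (r + 1) / (r + 1 : ℕ))) =
        - (PowerSeries.C c * mk fun r => c ^ r) := by
      ext r; have h1 : ((r + 1 : ℕ) : ℂ) ≠ 0 := cast_ne_zero.2 (succ_ne_zero r)
      grind [coeff_mk, map_neg, coeff_C_mul]
    have g : (mk fun r => c ^ r) * (1 - PowerSeries.C c * PowerSeries.X) = 1 := by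
      ext r; cases r with
      | zero => simp [mul_sub]
      | succ r =>
        rw [mul_sub, mul_one, mul_left_comm, map_sub, coeff_C_mul,
          PowerSeries.coeff_succ_mul_X]
        simp [coeff_one]; ring
    rw [e, neg_mul, mul_assoc, g, map_sub, Derivation.map_one_eq_zero, leibniz]
    simp [PowerSeries.derivative_C]

end ExpCoeff

/-! ### Oscillator parts of vertex operators -/

@[ext] structure Osc (Y : Type*) where
  cr : Y → ℕ+ → ℂ
  an : Y → ℕ+ → ℂ

namespace Osc

/-- The space on which oscillators act. -/
abbrev Sp (Y : Type*) : Type _ := MvPolynomial (Y × ℕ+) ℂ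

section Ann

variable {Y : Type*}

def T (X : Osc Y) : Sp Y →ₐ[ℂ] Polynomial (Sp Y) :=
  aeval fun v =>
    Polynomial.C (MvPolynomial.X v) +
      Polynomial.C (MvPolynomial.C (X.an v.1 v.2)) * Polynomial.X ^ (v.2 : ℕ)

/-- The coefficients of the annihilation part. -/
def Tc (X : Osc Y) (n : ℕ) : Module.End ℂ (Sp Y) :=
  (Polynomial.lcoeff (Sp Y) n).restrictScalars ℂ ∘ₗ X.T.toLinearMap

lemma Tc_apply (X : Osc Y) (n f) : X.Tc n f = (X.T f).coeff n := rfl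

lemma T_X (X : Osc Y) (v) : X.T (MvPolynomial.X v) = Polynomial.C (MvPolynomial.X v) + Polynomial.C
    (MvPolynomial.C (X.an v.1 v.2)) * Polynomial.X ^ (v.2 : ℕ) := by
  rw [T, aeval_X]

lemma Tc_mul_X (X : Osc Y) (n f v) : X.Tc n (f * MvPolynomial.X v) = X.Tc n f * MvPolynomial.X v +
    X.an v.1 v.2 • (if v.2 ≤ n then X.Tc (n - v.2) f else 0) := by
  rw [Tc_apply, map_mul, T_X, mul_add, Polynomial.coeff_add, coeff_mul_C, ← mul_assoc,
    Polynomial.coeff_mul_X_pow', smul_eq_C_mul]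
  congr 1; split_ifs
  · rw [coeff_mul_C, mul_comm]; rfl
  · simp

lemma Tc_C (X : Osc Y) (n c) :
    X.Tc n (MvPolynomial.C c) = if n = 0 then MvPolynomial.C c else 0 := by simp [Tc_apply, coeff_C]

lemma Tc_zero (X : Osc Y) : X.Tc 0 = 1 := by
  refine LinearMap.ext fun f => ?_; induction f using induction_on with
  | C c => rw [Tc_C]; simp
  | add f g hf hg => rw [map_add, map_add, hf, hg]
  | mul_X f v hf => rw [Tc_mul_X, hf]; simp

lemma Tc_comm (X Z : Osc Y) (r s f) : X.Tc r (Z.Tc s f) = Z.Tc s (X.Tc r f) := by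
  induction f using induction_on generalizing r s with
  | C c => simp [Tc_C]; split_ifs <;> simp_all [Tc_C]
  | add f g hf hg => simp [hf, hg]
  | mul_X f v hf => grind [Tc_mul_X, map_smul]

lemma pderiv_mul_X (u v) (f : Sp Y) [DecidableEq (Y × ℕ+)] : pderiv u (f *
    MvPolynomial.X v) = pderiv u f * MvPolynomial.X v + if u = v then f else 0 := by
  rw [leibniz, smul_eq_mul, smul_eq_mul, pderiv_X, Pi.single_apply]; grind

lemma Tc_eq_zero (X : Osc Y) {f r} (h : (X.T f).natDegree < r) : X.Tc r f = 0 :=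
  Polynomial.coeff_eq_zero_of_natDegree_lt h

variable [Fintype Y]

def annLin (X : Osc Y) (r : ℕ) : Module.End ℂ (Sp Y) :=
  ∑ y, X.an y r.toPNat' • (pderiv (R := ℂ) (y, r.toPNat')).toLinearMap

lemma annLin_mul_X (X : Osc Y) (r) (hr : 0 < r) (f v) : X.annLin r (f * MvPolynomial.X v) = X.annLin
    r f * MvPolynomial.X v + if v.2 = r then X.an v.1 v.2 • f else 0 := by
  classical
  simp only [annLin, LinearMap.sum_apply, LinearMap.smul_apply, coeFn_coe,
    pderiv_mul_X, smul_add, sum_add_distrib, sum_mul, smul_mul_assoc]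
  congr 1; obtain ⟨y, s⟩ := v; by_cases h : s = r
  · have hs : r.toPNat' = s := by apply eq; rw [toPNat'_coe, if_pos hr, h]
    simp_all
  · rw [if_neg h]; refine sum_eq_zero fun b _ => ?_; rw [if_neg, smul_zero]; rintro h'
    apply h; have := congrArg (fun p => (p.2 : ℕ)) h'
    simp only [toPNat'_coe, if_pos hr] at this; exact this.symm

lemma annLin_C (X : Osc Y) (r c) : X.annLin r (MvPolynomial.C c) = 0 := by
  simp [annLin]

lemma annLin_comm (X Z : Osc Y) (r s) (hr : 0 < r) (hs : 0 < s) :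
    Commute (X.annLin r) (Z.annLin s) := by
  refine LinearMap.ext fun f => ?_; simp; induction f using induction_on with
  | C c => simp [annLin_C]
  | add f g hf hg => simp [hf, hg]
  | mul_X f v hf => grind [annLin_mul_X, map_add, map_smul]

lemma succ_smul_Tc (X : Osc Y) (n f) : ((n + 1 : ℕ) : ℂ) • X.Tc (n + 1) f =
    ∑ p ∈ antidiagonal n, ((p.1 + 1 : ℕ) : ℂ) • X.annLin (p.1 + 1) (X.Tc p.2 f) := by
  induction f using induction_on generalizing n with
  | C c =>
    rw [Tc_C, if_neg (succ_ne_zero n), smul_zero, sum_eq_zero]; intro p _; rw [Tc_C]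
    split_ifs <;> simp [annLin_C]
  | add f g hf hg => simp only [map_add, smul_add, hf, hg, sum_add_distrib]
  | mul_X f v hf =>
    obtain ⟨w, hw⟩ : ∃ w, (v.2 : ℕ) = w + 1 := ⟨_, (Nat.succ_pred_eq_of_pos v.2.pos).symm⟩
    simp only [Tc_mul_X, map_add, map_smul, annLin_mul_X _ _ (Nat.succ_pos _), smul_add,
      sum_add_distrib]
    have e1 : ∑ p ∈ antidiagonal n, ((p.1 + 1 : ℕ) : ℂ) •
        (X.annLin (p.1 + 1) (X.Tc p.2 f) * MvPolynomial.X v) =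
        (((n + 1 : ℕ) : ℂ) • X.Tc (n + 1) f) * MvPolynomial.X v := by
      rw [hf, sum_mul]; simp only [smul_mul_assoc]
    rw [e1, smul_mul_assoc, add_assoc]; congr 1
    have e2 : ∑ p ∈ antidiagonal n, ((p.1 + 1 : ℕ) : ℂ) •
        (if v.2 = p.1 + 1 then X.an v.1 v.2 • X.Tc p.2 f else 0) =
        if w ≤ n then ((w + 1 : ℕ) : ℂ) • X.an v.1 v.2 • X.Tc (n - w) f else 0 := by
      split_ifs with hwn
      · rw [sum_eq_single (w, n - w)]
        · simp [hw]
        · rintro ⟨a, b⟩ hab hne; rw [mem_antidiagonal] at hab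
          rw [if_neg, smul_zero]; rintro h; apply hne; simp only [Prod.mk.injEq] at *; omega
        · intro h; exact absurd (mem_antidiagonal.2 (by simp; omega)) h
      · refine sum_eq_zero fun p hp => ?_
        have := mem_antidiagonal.1 hp; rw [if_neg (by omega), smul_zero]
    rw [e2]; by_cases hwn : w ≤ n
    · rw [if_pos (by omega), if_pos hwn, hw, Nat.add_sub_add_right]
      obtain ⟨k, rfl⟩ := Nat.exists_eq_add_of_le hwn; rw [Nat.add_sub_cancel_left]
      have e3 : ∑ p ∈ antidiagonal (w + k), ((p.1 + 1 : ℕ) : ℂ) • X.an v.1 v.2 •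
          X.annLin (p.1 + 1) (if w + 1 ≤ p.2 then X.Tc (p.2 - (w + 1)) f else 0) =
          X.an v.1 v.2 • (k : ℂ) • X.Tc k f := by
        cases k with
        | zero =>
          rw [Nat.cast_zero, zero_smul, smul_zero]; refine sum_eq_zero fun p hp => ?_
          have := mem_antidiagonal.1 hp
          rw [if_neg (by omega), map_zero, smul_zero, smul_zero]
        | succ k =>
          rw [hf k, smul_sum]; symm
          refine sum_of_injOn (fun p => (p.1, p.2 + (w + 1))) ?_ ?_ ?_ ?_
          · rintro ⟨a, b⟩ _ ⟨c, d⟩ _ h; simp only [Prod.mk.injEq] at h ⊢; omega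
          · rintro ⟨a, b⟩ h
            simp only [mem_coe, mem_antidiagonal] at h ⊢; omega
          · rintro ⟨a, b⟩ h1 h2; rw [mem_antidiagonal] at h1
            rw [if_neg, map_zero, smul_zero, smul_zero]; intro h3; apply h2
            refine ⟨(a, b - (w + 1)), ?_, ?_⟩
            · simp only [mem_coe, mem_antidiagonal] at h1 ⊢; omega
            · simp only [Prod.mk.injEq, true_and]; omega
          · rintro ⟨a, b⟩ _; simp only; rw [if_pos (by omega), Nat.add_sub_cancel, smul_comm]
      rw [e3]; push_cast; simp only [smul_smul, ← add_smul]; congr 1; ring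
    · rw [if_neg (by omega), if_neg hwn, smul_zero, smul_zero, zero_add]; symm
      refine sum_eq_zero fun p hp => ?_; have := mem_antidiagonal.1 hp
      rw [if_neg (by omega), map_zero, smul_zero, smul_zero]

lemma Tc_eq_expCoeff (X : Osc Y) (n) : X.Tc n = expCoeff X.annLin n := by
  refine expCoeff_unique (fun r s hr hs => annLin_comm X X r s hr hs) X.Tc_zero (fun n => ?_) n
  refine LinearMap.ext fun f => ?_; rw [LinearMap.smul_apply, succ_smul_Tc, LinearMap.sum_apply]
  rfl

end Ann

section Cre

variable {Y : Type*} [Fintype Y]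

def creLin (X : Osc Y) (r : ℕ) : Sp Y :=
  ∑ y, X.cr y r.toPNat' • MvPolynomial.X (y, r.toPNat')

/-- The coefficients of the creation part. -/
def E (X : Osc Y) (s : ℤ) : Sp Y := if 0 ≤ s then expCoeff X.creLin s.toNat else 0

def contr (X Z : Osc Y) (r : ℕ) : ℂ := ∑ y, X.an y r.toPNat' * Z.cr y r.toPNat'

/-- The contraction of two vertex operators. -/
def phi (X Z : Osc Y) : PowerSeries ℂ := expSeries (contr X Z)

lemma E_of_neg (X : Osc Y) {s} (h : s < 0) : X.E s = 0 := if_neg (not_le.2 h)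

lemma E_natCast (X : Osc Y) (s : ℕ) : X.E s = expCoeff X.creLin s := by
  simp [E]

lemma T_creLin (X Z r) (hr : 0 < r) : X.T (Z.creLin r) = Polynomial.CAlgHom (R := ℂ) (Z.creLin r) +
    Polynomial.X ^ r * ofId ℂ (Polynomial (Sp Y)) (contr X Z r) := by
  simp only [creLin, contr, map_sum, mul_sum, ← sum_add_distrib]
  refine sum_congr rfl fun y _ => ?_
  rw [map_smul, T_X, smul_add, map_smul, toPNat'_coe, if_pos hr, map_mul]; congr 1
  rw [smul_def, ofId_apply, ofId_apply, Polynomial.algebraMap_apply,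
    Polynomial.algebraMap_apply]
  grind [algebraMap_eq]

lemma T_E (X Z : Osc Y) (s : ℕ) : X.T (Z.E s) = ∑ p ∈ antidiagonal s, Polynomial.C
    (coeff p.2 (phi X Z) • Z.E p.1) * Polynomial.X ^ p.2 := by
  have h1 : X.T (Z.E s) = expCoeff (fun r => Polynomial.CAlgHom (R := ℂ) (Z.creLin r) +
      Polynomial.X ^ r * ofId ℂ (Polynomial (Sp Y)) (contr X Z r)) s := by
    rw [E_natCast, expCoeff_map]; grind [expCoeff_congr, T_creLin]
  rw [h1, expCoeff_add]; refine sum_congr rfl fun p _ => ?_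
  rw [← expCoeff_map, expCoeff_pow_mul, ← expCoeff_map, E_natCast, phi, coeff_expSeries,
    ofId_apply, Polynomial.algebraMap_apply, smul_eq_C_mul, map_mul,
    algebraMap_eq]
  show Polynomial.C _ * _ = _; ring

lemma T_E' (X Z : Osc Y) (s : ℤ) (B : ℕ) (hB : s < B) : X.T (Z.E s) = ∑ k ∈ range B,
    Polynomial.C (coeff k (phi X Z) • Z.E (s - k)) * Polynomial.X ^ k := by
  by_cases hs : 0 ≤ s
  · obtain ⟨s, rfl⟩ := Int.eq_ofNat_of_zero_le hs; rw [T_E]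
    refine sum_of_injOn (fun p => p.2) ?_ ?_ ?_ ?_
    · rintro ⟨a, b⟩ h ⟨c, d⟩ h'  h2
      grind [mem_coe, mem_antidiagonal, Prod.mk.injEq]
    · rintro ⟨a, b⟩ h
      grind [mem_coe, mem_antidiagonal, mem_range]
    · intro k _ hk; rw [E_of_neg, smul_zero, map_zero, zero_mul]; by_contra h; apply hk
      refine ⟨(s - k, k), ?_, rfl⟩
      simp only [mem_coe, mem_antidiagonal]; omega
    · rintro ⟨a, b⟩ h; rw [mem_antidiagonal] at h; simp only at h ⊢; congr 4
      omega
  · rw [E_of_neg Z (by omega), map_zero]; symm; refine sum_eq_zero fun k _ => ?_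
    rw [E_of_neg Z (by omega), smul_zero, map_zero, zero_mul]

def lam (X : Osc Y) (n : ℤ) : Polynomial (Sp Y) →ₗ[ℂ] Sp Y :=
  Polynomial.lsum fun r => mulLeft ℂ (X.E (n + r))

lemma lam_C_mul (X : Osc Y) (n a p) : X.lam n (Polynomial.C a * p) = a * X.lam n p := by
  induction p using induction_on' with
  | add p q hp hq => rw [mul_add, map_add, map_add, hp, hq, mul_add]
  | monomial k b =>
    rw [Polynomial.C_mul_monomial]; simp only [lam, lsum_apply]
    rw [sum_monomial_index _ _ (by simp), sum_monomial_index _ _ (by simp)]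
    grind [mulLeft_apply]

lemma lam_X_pow_mul (X : Osc Y) (n) (k : ℕ) (p) :
    X.lam n (Polynomial.X ^ k * p) = X.lam (n + k) p := by
  induction p using induction_on' with
  | add p q hp hq => rw [mul_add, map_add, map_add, hp, hq]
  | monomial j b =>
    rw [Polynomial.X_pow_mul, Polynomial.monomial_mul_X_pow]; simp only [lam, lsum_apply]
    rw [sum_monomial_index _ _ (by simp), sum_monomial_index _ _ (by simp)]
    grind

def N1 (X : Osc Y) (n : ℤ) : Module.End ℂ (Sp Y) := X.lam n ∘ₗ X.T.toLinearMap

lemma N1_apply (X : Osc Y) (n f) : X.N1 n f = X.lam n (X.T f) := rfl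

lemma N1_eq_sum (X : Osc Y) (n f) {B} (hB : (X.T f).natDegree < B) :
    X.N1 n f = ∑ r ∈ range B, X.E (n + r) * X.Tc r f := by
  rw [N1_apply, lam, lsum_apply, sum_over_range' _ (by simp) B hB]; rfl

lemma N1_E_mul (X Z) (n s : ℤ) (g : Sp Y) {B : ℕ} (hB : s < B) : X.N1 n (Z.E s * g) = ∑ k ∈
    range B, coeff k (phi X Z) • (Z.E (s - k) * X.N1 (n + k) g) := by
  rw [N1_apply, map_mul, T_E' X Z s B hB, sum_mul, map_sum]
  refine sum_congr rfl fun k _ => ?_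
  rw [mul_assoc, lam_C_mul, lam_X_pow_mul, smul_mul_assoc]; rfl

end Cre

end Osc

/-! ### Multiplication of formal distributions by power series -/

section Kop

variable {G : Type*} [AddCommGroup G] {S : Type*} [CommRing S]

variable {W : Type*} [AddCommGroup W] [Module S W]

def Bd (h : G →+ ℤ) (n : G → W) : Prop := ∃ B : ℤ, ∀ e, n e ≠ 0 → B ≤ h e

/-- Multiplication by `φ (z ^ v)`. -/
def kop (φ : PowerSeries S) (v : G) (n : G → W) : G → W :=
  fun e => ∑ᶠ k : ℕ, coeff k φ • n (e - k • v)

lemma Bd.exists_bound {h} {n : G → W} (hn : Bd h n) {v} (hv : 0 < h v) (e) :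
    ∃ M : ℕ, ∀ k, M ≤ k → n (e - k • v) = 0 := by
  obtain ⟨B, hB⟩ := hn; refine ⟨(h e - B).toNat + 1, fun k hk => ?_⟩; by_contra hne
  have h1 := hB _ hne; rw [map_sub, map_nsmul, nsmul_eq_mul] at h1
  have h2 : k ≤ k * h v := le_mul_of_one_le_right (by positivity) (by omega); omega

lemma kop_eq_sum (φ : PowerSeries S) (v) (n : G → W) (e) {M} (hM : ∀ k, M ≤ k → n (e - k
    • v) = 0) : kop φ v n e = ∑ k ∈ range M, coeff k φ • n (e - k • v) := by
  refine finsum_eq_sum_of_support_subset _ fun k hk => ?_; by_contra h; simp_all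

lemma Bd.kop {h} {n : G → W} (hn : Bd h n) {v} (hv : 0 ≤ h v)
    (φ : PowerSeries S) : Bd h (kop φ v n) := by
  obtain ⟨B, hB⟩ := hn; refine ⟨B, fun e he => ?_⟩
  obtain ⟨k, hk⟩ : ∃ k, coeff k φ • n (e - k • v) ≠ 0 := by
    by_contra! hall; exact he (finsum_eq_zero_of_forall_eq_zero hall)
  have h1 := hB _ (right_ne_zero_of_smul hk); rw [map_sub, map_nsmul, nsmul_eq_mul] at h1
  have h2 : 0 ≤ k * h v := by positivity
  omega

lemma Bd.shift {h} {n : G → W} (hn : Bd h n) (u) : Bd h fun e => n (e - u) := by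
  obtain ⟨B, hB⟩ := hn; refine ⟨B + h u, fun e he => ?_⟩; grind

lemma Bd.add {h} {n n' : G → W} (hn : Bd h n) (hn' : Bd h n') : Bd h fun e => n e + n' e := by
  obtain ⟨B, hB⟩ := hn; obtain ⟨B', hB'⟩ := hn'; refine ⟨min B B', fun e he => ?_⟩; grind

lemma Bd.zero (h : G →+ ℤ) : Bd h fun _ => (0 : W) := ⟨0, fun _ he => absurd rfl he⟩

lemma Bd.sum {h} {κ : Type*} (s) {n : κ → G → W} (hn : ∀ k ∈ s, Bd h (n k)) :
    Bd h fun e => ∑ k ∈ s, n k e := by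
  classical
  induction s using Finset.induction_on with
  | empty => exact Bd.zero h
  | insert a s ha ih =>
    simp [sum_insert ha]; exact (hn a (by simp)).add (ih fun k hk => hn k (by simp [hk]))

lemma Bd.comp {W' : Type*} [AddCommGroup W'] {h n} (hn : Bd h n)
    (L : G → W →+ W') : Bd h fun e => L e (n e) := by
  obtain ⟨B, hB⟩ := hn; exact ⟨B, fun e he => hB e fun h0 => he (by simp [h0])⟩

lemma kop_add (φ : PowerSeries S) {h v} (hv : 0 < h v) {n n' : G → W} (hn : Bd h n)
    (hn' : Bd h n') : kop φ v (fun e => n e + n' e) = fun e => kop φ v n e + kop φ v n' e := by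
  funext e; obtain ⟨M, hM⟩ := hn.exists_bound hv e; obtain ⟨M', hM'⟩ := hn'.exists_bound hv e
  have a1 : ∀ k, max M M' ≤ k → n (e - k • v) = 0 := fun k hk => hM k (by omega)
  have a2 : ∀ k, max M M' ≤ k → n' (e - k • v) = 0 := fun k hk => hM' k (by omega)
  rw [kop_eq_sum φ v n e a1, kop_eq_sum φ v n' e a2, kop_eq_sum φ v _ e (fun k hk => by rw [a1 k
    hk, a2 k hk, add_zero]), ← sum_add_distrib]
  simp

lemma kop_comp {S' : Type*} [CommRing S'] {W' : Type*} [AddCommGroup W'] [Module S' W'] (σ : S →+*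
    S') (φ) {h v} (hv : 0 < h v) {n} (hn : Bd h n) (L : G → W →ₛₗ[σ] W') (e) (hL : ∀ k : ℕ, L (e - k
    • v) = L e) : kop (PowerSeries.map σ φ) v (fun e => L e (n e)) e = L e (kop φ v n e) := by
  obtain ⟨M, hM⟩ := hn.exists_bound hv e
  rw [kop_eq_sum φ v n e hM, kop_eq_sum _ v _ e (fun k hk => by rw [hM k hk, map_zero]), map_sum]
  simp_all

lemma kop_shift (φ : PowerSeries S) (v u) (n : G → W) :
    kop φ v (fun e => n (e - u)) = fun e => kop φ v n (e - u) := by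
  funext e; simp [kop, sub_right_comm]

lemma kop_one (v) (n : G → W) : kop (1 : PowerSeries S) v n = n := by
  funext e; rw [kop, finsum_eq_single _ 0]
  · simp
  · simp_all

lemma kop_linear_mul (φ) {h v} (hv : 0 < h v) {n : G → W} (hn : Bd h
    n) (a b : S) : kop ((PowerSeries.C a - PowerSeries.C b * PowerSeries.X) * φ) v n = fun e => a •
    kop φ v n e - b • kop φ v n (e - v) := by
  funext e; obtain ⟨M, hM⟩ := hn.exists_bound hv e
  have hM1 : ∀ k, M ≤ k → n (e - v - k • v) = 0 := by
    intro k hk; have := hM (k + 1) (by omega); grind [add_smul, one_smul, add_comm, sub_sub]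
  rw [kop_eq_sum _ v n e (M := M + 1) (fun k hk => hM k (by omega)), kop_eq_sum φ v n e (M := M +
    1) (fun k hk => hM k (by omega)), kop_eq_sum φ v n (e - v) hM1]
  rw [sum_range_succ' (fun k => coeff k (_ * φ) • _),
    sum_range_succ' (fun k => coeff k φ • n (e - k • v)), smul_add,
    smul_sum, smul_sum, add_sub_right_comm, ← sum_sub_distrib]
  congr 1
  · refine sum_congr rfl fun k _ => ?_
    have e1 : e - v - k • v = e - (k + 1) • v := by rw [add_smul, one_smul, add_comm, ← sub_sub]
    rw [e1, smul_smul, smul_smul, ← sub_smul]; congr 1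
    rw [sub_mul, map_sub, coeff_C_mul, mul_assoc, coeff_C_mul,
      coeff_succ_X_mul]
  · rw [smul_smul]; congr 1; simp [sub_mul]

end Kop

/-! ### Contraction operators of a word -/

section Words

variable {ι : Type*} [DecidableEq ι] {S : Type*} [CommRing S]

variable {W : Type*} [AddCommGroup W] [Module S W]

/-- The direction of `z_j / z_i`. -/
def dir (i j : ι) : ι → ℤ := Pi.single j 1 - Pi.single i 1

/-- Multiplication by `z_i ^ g φ (z_j / z_i)`. -/
def rop (g : ℤ) (φ : PowerSeries S) (i j : ι) (n : (ι → ℤ) → W) : (ι → ℤ) → W :=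
  fun e => kop φ (dir i j) n (e - Pi.single i g)

structure PairData (ι S : Type*) where
  g : ι → ι → ℤ
  φ : ι → ι → PowerSeries S

variable (pd : PairData ι S)

def rops (i : ι) : List ι → ((ι → ℤ) → W) → (ι → ℤ) → W
  | [], n => n
  | j :: w, n => rop (pd.g i j) (pd.φ i j) i j (rops i w n)

/-- The contractions of all pairs in a word. -/
def wop : List ι → ((ι → ℤ) → W) → (ι → ℤ) → W
  | [], n => n
  | i :: w, n => wop w (rops pd i w n)

/-- `z_j / z_i` is small with respect to `h`. -/
def Lt (h : (ι → ℤ) →+ ℤ) (i j : ι) : Prop := 0 < h (dir i j)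

lemma Bd.rop {h i j} (hij : Lt h i j) {n : (ι → ℤ) → W} (hn : Bd h n)
    (g) (φ : PowerSeries S) : Bd h (rop g φ i j n) :=
  (hn.kop (le_of_lt hij) φ).shift _

lemma Bd.rops {h i w} (hw : ∀ j ∈ w, Lt h i j)
    {n : (ι → ℤ) → W} (hn : Bd h n) : Bd h (rops pd i w n) := by
  induction w with
  | nil => exact hn
  | cons j w ih => exact (ih fun k hk => hw k (by simp [hk])).rop (hw j (by simp)) _ _

section Comp

variable {S' : Type*} [CommRing S'] {W' : Type*} [AddCommGroup W'] [Module S' W']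
  (σ : S →+* S')

/-- Base change of contraction data. -/
def PairData.map (pd : PairData ι S) : PairData ι S' := ⟨pd.g, fun i j => (pd.φ i j).map σ⟩

lemma rop_comp {h i j} (hij : Lt h i j) {n} (hn : Bd h n) (L : (ι → ℤ) → W →ₛₗ[σ] W') (hL : ∀ e e',
    (∀ k, k ≠ i → k ≠ j → e k = e' k) → L e = L e') (g : ℤ) (φ) : rop g (φ.map σ) i j (fun e => L e
    (n e)) = fun e => L e (rop g φ i j n e) := by
  funext e; have h1 : L e = L (e - Pi.single i g) := hL _ _ fun k hki _ => by simp [hki]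
  rw [h1]; refine kop_comp σ φ hij hn L _ fun k => hL _ _ fun l hli hlj => ?_; simp [dir, hli, hlj]

lemma rops_comp {h i w} (hw : ∀ j ∈ w, Lt h i j) {n}
    (hn : Bd h n) (L : (ι → ℤ) → W →ₛₗ[σ] W') (hL : ∀ e e', (∀ k, k ∉ i :: w → e k = e' k) →
    L e = L e') : rops (pd.map σ) i w (fun e => L e (n e)) = fun e => L e (rops pd i w n e) := by
  induction w with
  | nil => rfl
  | cons j w ih =>
    have hw' : ∀ j ∈ w, Lt h i j := fun k hk => hw k (by simp [hk]); rw [rops, ih hw']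
    · exact rop_comp σ (hw j (by simp)) (hn.rops pd hw') L
        (fun e e' he => hL e e' fun k hk => he k (by aesop) (by aesop)) _ _
    · grind

lemma wop_comp {h} {w : List ι} (hw : w.Pairwise (Lt h)) {n} (hn : Bd h
    n) (L : (ι → ℤ) → W →ₛₗ[σ] W') (hL : ∀ e e', (∀ k, k ∉ w → e k = e' k) → L e = L e') :
    wop (pd.map σ) w (fun e => L e (n e)) = fun e => L e (wop pd w n e) := by
  induction w generalizing n with
  | nil => rfl
  | cons i w ih =>
    rw [pairwise_cons] at hw; rw [wop, rops_comp pd σ hw.1 hn L hL]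
    exact ih hw.2 (hn.rops pd hw.1) fun e e' he => hL e e' fun k hk => he k (by aesop)

end Comp

omit [DecidableEq ι] in
lemma PairData.map_id : pd.map (RingHom.id S) = pd := by simp [PairData.map]

lemma rops_add {h i w} (hw : ∀ j ∈ w, Lt h i j) {n n' : (ι → ℤ) → W} (hn : Bd h n) (hn' : Bd h n') :
    rops pd i w (fun e => n e + n' e) = fun e => rops pd i w n e + rops pd i w n' e := by
  induction w with
  | nil => rfl
  | cons j w ih =>
    have hw' : ∀ j ∈ w, Lt h i j := fun k hk => hw k (by simp [hk]); funext e
    simp [rops, ih hw', rop, kop_add _ (hw j (by simp)) (hn.rops pd hw') (hn'.rops pd hw')]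

lemma rops_zero (i w) : rops pd i w (fun _ => (0 : W)) = fun _ => 0 := by
  induction w with
  | nil => rfl
  | cons j w ih => rw [rops, ih]; funext e; simp [rop, kop]

lemma rops_sum {h i w} (hw : ∀ j ∈ w, Lt h i j) {κ : Type*}
    (s) {n : κ → (ι → ℤ) → W} (hn : ∀ k ∈ s, Bd h (n k)) :
    rops pd i w (fun e => ∑ k ∈ s, n k e) = fun e => ∑ k ∈ s, rops pd i w (n k) e := by
  classical
  induction s using Finset.induction_on with
  | empty => exact rops_zero pd i w
  | insert a s ha ih =>
    simp [sum_insert ha]; have h2 : ∀ k ∈ s, Bd h (n k) := fun k hk => hn k (by simp [hk])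
    rw [rops_add pd hw (hn a (by simp)) (Bd.sum s h2), ih h2]

def posHeight (w : List ι) : (ι → ℤ) →+ ℤ :=
  ∑ l ∈ w.toFinset, (w.idxOf l : ℤ) • Pi.evalAddMonoidHom (fun _ => ℤ) l

lemma posHeight_apply (w) (e : ι → ℤ) : posHeight w e = ∑ l ∈ w.toFinset, (w.idxOf l) * e l := by
  simp [posHeight]

lemma posHeight_pairwise {w : List ι} (hw : w.Nodup) : w.Pairwise (Lt (posHeight w)) := by
  rw [List.pairwise_iff_getElem]; intro a b ha hb hab
  rw [Lt, dir, map_sub, posHeight_apply, posHeight_apply, sum_eq_single w[b],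
    sum_eq_single w[a]]
  · grind
  · grind
  · simp
  · grind
  · simp

lemma Bd.posHeight {w} {n : (ι → ℤ) → W}
    (hn : ∃ B, ∀ e, n e ≠ 0 → ∀ l ∈ w, B ≤ e l) : Bd (posHeight w) n := by
  obtain ⟨B, hB⟩ := hn; refine ⟨∑ l ∈ w.toFinset, (w.idxOf l) * B, fun e he => ?_⟩
  rw [posHeight_apply]; exact sum_le_sum fun l hl =>
    mul_le_mul_of_nonneg_left (hB e he l (by simpa using hl)) (by positivity)

end Words

/-! ### Normally ordered products -/

namespace Osc

variable {Y : Type*} [Fintype Y] {ι : Type*} (X : ι → Osc Y)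

def nprod : List ι → (ι → ℤ) → Module.End ℂ (Sp Y)
  | [], _ => 1
  | i :: w, e => Polynomial.lsum (fun r => mulLeft ℂ ((X i).E (e i + r)) ∘ₗ nprod w e) ∘ₗ
      (X i).T.toLinearMap

lemma nprod_cons (i w e f) {B} (hB : ((X i).T f).natDegree < B) : nprod X (i :: w) e f = ∑ r ∈
    range B, (X i).E (e i + r) * nprod X w e ((X i).Tc r f) := by
  exact sum_over_range' ((X i).T f) (fun _ => map_zero _) B hB

lemma nprod_singleton (i e) : nprod X [i] e = (X i).N1 (e i) := by
  rfl

lemma nprod_congr {w e e'} (h : ∀ l ∈ w, e l = e' l) : nprod X w e = nprod X w e' := by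
  induction w with
  | nil => rfl
  | cons i w ih => rw [nprod, nprod, ih fun l hl => h l (by simp [hl]), h i (by simp)]

lemma nprod_swap (i j w e) : nprod X (i :: j :: w) e = nprod X (j :: i :: w) e := by
  refine LinearMap.ext fun f => ?_
  obtain ⟨B, hi, hj, hij, hji⟩ : ∃ B, ((X i).T f).natDegree < B ∧ ((X j).T f).natDegree < B ∧
      (∀ r ∈ range (((X i).T f).natDegree + 1), ((X j).T ((X i).Tc r f)).natDegree < B) ∧
      (∀ r ∈ range (((X j).T f).natDegree + 1), ((X i).T ((X j).Tc r f)).natDegree < B) := by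
    refine ⟨((X i).T f).natDegree + ((X j).T f).natDegree + 1 +
      ∑ r ∈ range (((X i).T f).natDegree + 1), ((X j).T ((X i).Tc r f)).natDegree +
      ∑ r ∈ range (((X j).T f).natDegree + 1), ((X i).T ((X j).Tc r f)).natDegree,
      by omega, by omega, fun r hr => ?_, fun r hr => ?_⟩
    · have := Finset.single_le_sum (f := fun r => ((X j).T ((X i).Tc r f)).natDegree)
        (fun _ _ => Nat.zero_le _) hr
      omega
    · have := Finset.single_le_sum (f := fun r => ((X i).T ((X j).Tc r f)).natDegree)
        (fun _ _ => Nat.zero_le _) hr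
      omega
  have deg : ∀ a b, ((X a).T f).natDegree < B →
      (∀ r ∈ range (((X a).T f).natDegree + 1), ((X b).T ((X a).Tc r f)).natDegree < B) →
      ∀ r, ((X b).T ((X a).Tc r f)).natDegree < B := by
    intro a b ha hab r; by_cases hr : r ∈ range (((X a).T f).natDegree + 1)
    · grind
    · grind [Tc_eq_zero, map_zero, Polynomial.natDegree_zero]
  rw [nprod_cons X i _ e f hi, nprod_cons X j _ e f hj]
  have e1 : ∀ a b, (∀ r, ((X b).T ((X a).Tc r f)).natDegree < B) →
      ∑ r ∈ range B, (X a).E (e a + r) * nprod X (b :: w) e ((X a).Tc r f) =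
      ∑ r ∈ range B, ∑ s ∈ range B, (X a).E (e a + r) * ((X b).E (e b + s) *
        nprod X w e ((X b).Tc s ((X a).Tc r f))) := by
    intro a b hab; refine sum_congr rfl fun r _ => ?_
    rw [nprod_cons X b w e _ (hab r), mul_sum]
  rw [e1 i j (deg i j hi hij), e1 j i (deg j i hj hji), sum_comm]
  refine sum_congr rfl fun r _ => sum_congr rfl fun s _ => ?_; rw [Tc_comm]; ring

lemma nprod_perm {w w'} (h : w.Perm w') (e) : nprod X w e = nprod X w' e := by
  induction h with
  | nil => rfl
  | cons i _ ih => rw [nprod, nprod, ih]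
  | swap i j w => rw [nprod_swap]
  | trans _ _ h1 h2 => rw [h1, h2]

lemma nprod_bounded (w f) : ∃ B, ∀ e, nprod X w e f ≠ 0 → ∀ l ∈ w, B ≤ e l := by
  induction w generalizing f with
  | nil => exact ⟨0, by simp⟩
  | cons i w ih =>
    choose B hB using ih; set D := ((X i).T f).natDegree
    have hne : (insert (-(D : ℤ)) ((range (D + 1)).image fun r => B ((X i).Tc r f))).Nonempty :=
      Finset.insert_nonempty _ _
    refine ⟨min' _ hne, fun e he l hl => ?_⟩
    rw [nprod_cons X i w e f (lt_succ_self _)] at he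
    obtain ⟨r, hr, hr'⟩ := Finset.exists_ne_zero_of_sum_ne_zero he
    rcases mem_cons.1 hl with rfl | hl
    · have h1 : 0 ≤ e l + r := by by_contra h; exact hr' (by rw [E_of_neg _ (not_le.1 h), zero_mul])
      have h2 : r ≤ D := Nat.lt_succ_iff.1 (mem_range.1 hr)
      exact (min'_le _ _ (Finset.mem_insert_self _ _)).trans (by omega)
    · refine (min'_le _ _ ?_).trans (hB _ e (right_ne_zero_of_mul hr') l hl)
      exact Finset.mem_insert_of_mem (Finset.mem_image_of_mem _ hr)

variable [DecidableEq ι]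

def pairData (g : ι → ι → ℤ) : PairData ι ℂ := ⟨g, fun i j => phi (X i) (X j)⟩

variable (g : ι → ι → ℤ)

lemma N1_nprod (i w) (hw : (i :: w).Nodup) (e f) : (X i).N1 (e i - (w.map (g i)).sum) (nprod X w e
    f) = rops (pairData X g) i w (fun e => nprod X (i :: w) e f) e := by
  induction w generalizing e f with
  | nil => rw [rops, nprod_singleton]; simp [nprod]
  | cons j w ih =>
    have hnd : (i :: w).Nodup := by simp only [nodup_cons, mem_cons] at hw ⊢; tauto
    have hij : i ≠ j := by simp only [nodup_cons, mem_cons] at hw; tauto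
    have hiw : i ∉ w := by simp only [nodup_cons, mem_cons] at hw; tauto
    have hjw : j ∉ w := by simp only [nodup_cons, mem_cons] at hw; tauto
    set e' := e - Pi.single i (g i j) with he'; have hej : e' j = e j := by simp [he', hij.symm]
    have hei : e' i = e i - g i j := by simp [he']
    set D := ((X j).T f).natDegree + 1 with hD
    -- the contractions of `i` with the rest of the word
    have key : ∀ e, rops (pairData X g) i w (fun e => nprod X (i :: j :: w) e f) e =
        ∑ r ∈ range D, (X j).E (e j + r) *
          (X i).N1 (e i - (w.map (g i)).sum) (nprod X w e ((X j).Tc r f)) := by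
      intro e; have hp := posHeight_pairwise hnd; rw [pairwise_cons] at hp
      have b1 : ∀ r, Bd (posHeight (i :: w)) fun e => nprod X (i :: w) e ((X j).Tc r f) :=
        fun r => Bd.posHeight (nprod_bounded X _ _)
      have h1 : (fun e => nprod X (i :: j :: w) e f) = fun e => ∑ r ∈ range D,
          mulLeft ℂ ((X j).E (e j + r)) (nprod X (i :: w) e ((X j).Tc r f)) := by
        funext e; rw [nprod_swap, nprod_cons X j _ e f (lt_succ_self _)]; rfl
      have b3 : ∀ r ∈ range D, Bd (posHeight (i :: w)) fun e =>
          mulLeft ℂ ((X j).E (e j + r)) (nprod X (i :: w) e ((X j).Tc r f)) := fun r _ =>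
        (b1 r).comp fun e => (mulLeft ℂ ((X j).E (e j + r))).toAddMonoidHom
      rw [h1, rops_sum _ hp.1 _ b3]; refine sum_congr rfl fun r _ => ?_
      have h2 := rops_comp (pairData X g) (RingHom.id ℂ) hp.1 (b1 r)
        (fun e => mulLeft ℂ ((X j).E (e j + r))) (fun e e' he => by
          rw [he j (by simp [hij.symm, hjw])])
      rw [PairData.map_id] at h2; rw [h2, ih hnd]; rfl
    have b2 : Bd (posHeight (i :: j :: w)) fun e => nprod X (i :: j :: w) e f :=
      Bd.posHeight (nprod_bounded X _ _)
    have hp := posHeight_pairwise hw; rw [pairwise_cons] at hp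
    obtain ⟨M, hM⟩ := (b2.rops (pairData X g) (w := w) fun k hk => hp.1 k (by simp [hk])).exists_bound
      (hp.1 j (by simp)) e'
    set M' := max M ((e j + D).toNat + 1) with hM'; rw [rops, rop]
    change _ = kop (phi (X i) (X j)) (dir i j) _ e'
    rw [kop_eq_sum _ _ _ _ (M := M') fun k hk => hM k (by omega)]
    have h3 : ∀ k : ℕ, rops (pairData X g) i w (fun e => nprod X (i :: j :: w) e f)
        (e' - k • dir i j) = ∑ r ∈ range D, (X j).E (e j + r - k) *
          (X i).N1 (e i - ((j :: w).map (g i)).sum + k) (nprod X w e ((X j).Tc r f)) := by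
      intro k; rw [key]; refine sum_congr rfl fun r _ => ?_; congr 2
      · simp [dir, hij.symm, hej]; ring
      · congr 1; simp [dir, hij, hei]; ring
      · congr 1; refine nprod_congr X fun l hl => ?_; have h1 : l ≠ i := fun h => hiw (h ▸ hl)
        have h2 : l ≠ j := fun h => hjw (h ▸ hl); simp [dir, h1, h2, he']
    simp only [h3]; rw [nprod_cons X j w e f (lt_succ_self _), map_sum]
    simp only [smul_sum]; rw [sum_comm]; refine sum_congr rfl fun r hr => ?_
    rw [N1_E_mul (X i) (X j) _ _ _ (B := M')]; rw [mem_range] at hr; omega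

def wprod : List ι → (ι → ℤ) → Module.End ℂ (Sp Y)
  | [], _ => 1
  | i :: w, e => (X i).N1 (e i - (w.map (g i)).sum) * wprod w e

lemma wprod_eq (w) (hw : w.Nodup) (e f) :
    wprod X g w e f = wop (pairData X g) w (fun e => nprod X w e f) e := by
  induction w generalizing e with
  | nil => rfl
  | cons i w ih =>
    have hwn := (nodup_cons.1 hw).2; rw [wprod, Module.End.mul_apply, ih hwn, wop]
    have h1 : rops (pairData X g) i w (fun e => nprod X (i :: w) e f) = fun e =>
        (X i).N1 (e i - (w.map (g i)).sum) (nprod X w e f) := by simp [N1_nprod X g i w hw]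
    have b : Bd (posHeight w) fun e => nprod X w e f := Bd.posHeight (nprod_bounded X _ _)
    have h2 := wop_comp (pairData X g) (RingHom.id ℂ) (posHeight_pairwise hwn) b (fun e => (X i).N1
      (e i - (w.map (g i)).sum)) (fun e e' he => by rw [he i ((nodup_cons.1 hw).1)])
    rw [PairData.map_id] at h2; rw [h1, h2]

end Osc

/-! ### Laurent polynomials acting on formal distributions -/

section Act

variable {ι : Type*} {S : Type*} [CommRing S]

variable {W : Type*} [AddCommGroup W] [Module S W]

/-- Laurent polynomials in the variables `z_i`. -/
abbrev Laurent (ι S : Type*) [CommRing S] : Type _ := AddMonoidAlgebra S (ι → ℤ)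

/-- Multiplication by a monomial. -/
def shiftHom (ι S W : Type*) [CommRing S] [AddCommGroup W] [Module S W] :
    Multiplicative (ι → ℤ) →* Module.End S ((ι → ℤ) → W) where
  toFun u := funLeft S W fun e => e - u.toAdd
  map_one' := by ext; simp [funLeft]
  map_mul' u v := by
    refine LinearMap.ext fun n => funext fun e => ?_
    simp [funLeft, sub_sub]

/-- Multiplication by a Laurent polynomial. -/
def act : Laurent ι S →ₐ[S] Module.End S ((ι → ℤ) → W) :=
  AddMonoidAlgebra.lift _ _ _ (shiftHom ι S W)

lemma act_single (u : ι → ℤ) (c : S) (n : (ι → ℤ) → W) :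
    act (AddMonoidAlgebra.single u c) n = fun e => c • n (e - u) := by
  rw [act, lift_single]; rfl

lemma act_algebraMap (c) (n : (ι → ℤ) → W) : act (algebraMap S (Laurent ι S) c) n = c • n := by
  rw [commutes]; rfl

lemma laurent_induction {M : Laurent ι S → Prop} (p)
    (hs : ∀ u c, M (AddMonoidAlgebra.single u c)) (ha : ∀ p q, M p → M q → M (p + q)) : M p :=
  AddMonoidAlgebra.induction_linear p (by simpa using hs 0 0) ha hs

lemma Bd.act {h : (ι → ℤ) →+ ℤ} {n : (ι → ℤ) → W} (hn : Bd h n) (p : Laurent ι S) :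
    Bd h (act p n) := by
  induction p using laurent_induction with
  | hs u c => rw [act_single]; exact (hn.shift u).comp fun _ => (DistribSMul.toAddMonoidHom W c)
  | ha p q hp hq => rw [map_add]; exact hp.add hq

variable [DecidableEq ι]

/-- The variable `z_i`. -/
def zv (i : ι) : Laurent ι S := AddMonoidAlgebra.single (Pi.single i 1) 1

/-- The linear polynomial `a z_i - b z_j`. -/
def lf (a b : S) (i j : ι) : Laurent ι S :=
  algebraMap S _ a * zv i - algebraMap S _ b * zv j

lemma act_zv (i) (n : (ι → ℤ) → W) :
    act (zv i : Laurent ι S) n = fun e => n (e - Pi.single i 1) := by simp [zv, act_single]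

lemma act_lf (a b : S) (i j : ι) (n : (ι → ℤ) → W) : act (lf a b i j) n =
    fun e => a • n (e - Pi.single i 1) - b • n (e - Pi.single j 1) := by
  rw [lf, map_sub, map_mul, map_mul]
  simp only [LinearMap.sub_apply, Module.End.mul_apply, act_zv, act_algebraMap]; rfl

lemma lf_swap (a b : S) (i j : ι) : lf (-b) (-a) j i = lf a b i j := by
  simp [lf]; ring

omit [DecidableEq ι] in
lemma act_kop (φ : PowerSeries S) {h : (ι → ℤ) →+ ℤ} {v} (hv : 0 < h v) {n : (ι → ℤ) → W}
    (hn : Bd h n) (p : Laurent ι S) : act p (kop φ v n) = kop φ v (act p n) := by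
  induction p using laurent_induction with
  | hs u c =>
    rw [act_single, act_single]; funext e
    have := kop_comp (RingHom.id S) φ hv (hn.shift u) (fun _ => lsmul S W c) e
      fun _ => rfl
    simp [PowerSeries.map_id, LinearMap.lsmul_apply, kop_shift] at this; grind
  | ha p q hp hq =>
    rw [map_add, LinearMap.add_apply, LinearMap.add_apply, hp, hq]
    exact (kop_add φ hv (hn.act p) (hn.act q)).symm

omit [DecidableEq ι] in
lemma act_shift (u) (n : (ι → ℤ) → W) (p : Laurent ι S) :
    act p (fun e => n (e - u)) = fun e => act p n (e - u) := by
  induction p using laurent_induction with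
  | hs v c => simp [act_single, sub_right_comm]
  | ha p q hp hq => rw [map_add, LinearMap.add_apply, LinearMap.add_apply, hp, hq]; rfl

lemma act_rop (g) (φ : PowerSeries S) {h i j} (hij : Lt h i j) {n : (ι → ℤ)
    → W} (hn : Bd h n) (p : Laurent ι S) : act p (rop g φ i j n) = rop g φ i j (act p n) := by
  unfold rop; rw [act_shift, act_kop φ hij hn]

variable (pd : PairData ι S)

lemma act_rops {h i w} (hw : ∀ j ∈ w, Lt h i j) {n : (ι → ℤ) → W}
    (hn : Bd h n) (p : Laurent ι S) : act p (rops pd i w n) = rops pd i w (act p n) := by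
  induction w with
  | nil => rfl
  | cons j w ih =>
    have hw' : ∀ j ∈ w, Lt h i j := fun k hk => hw k (by simp [hk])
    simp [rops, act_rop _ _ (hw j (by simp)) (hn.rops pd hw'), ih hw']

lemma act_wop {h} {w : List ι} (hw : w.Pairwise (Lt h)) {n : (ι → ℤ) → W} (hn : Bd h
    n) (p : Laurent ι S) : act p (wop pd w n) = wop pd w (act p n) := by
  induction w generalizing n with
  | nil => rfl
  | cons i w ih =>
    rw [pairwise_cons] at hw; rw [wop, wop, ih hw.2 (hn.rops pd hw.1), act_rops pd hw.1 hn]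

/-! ### Rational contractions -/

def linP (l : List (S × S)) (i j : ι) : Laurent ι S := (l.map fun p => lf p.1 p.2 i j).prod

lemma linP_nil (i j : ι) : linP ([] : List (S × S)) i j = 1 := rfl

lemma linP_cons (p) (l : List (S × S)) (i j : ι) :
    linP (p :: l) i j = lf p.1 p.2 i j * linP l i j := by simp [linP]

def linS (l : List (S × S)) : PowerSeries S :=
  (l.map fun p => PowerSeries.C p.1 - PowerSeries.C p.2 * PowerSeries.X).prod

lemma act_lf_rop (g) (φ) {h} {i j} (hij : Lt h i j) {n : (ι →
    ℤ) → W} (hn : Bd h n) (a b : S) : act (lf a b i j) (rop g φ i j n) = rop (g + 1) ((PowerSeries.C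
    a - PowerSeries.C b * PowerSeries.X) * φ) i j n := by
  rw [act_lf]; funext e; simp [rop, kop_linear_mul φ hij hn]
  congr 3 <;> simp [dir, Pi.single_add] <;> abel

lemma act_linP_rop (g) (φ) {h} {i j} (hij : Lt h i j) {n : (ι → ℤ) → W} (hn : Bd h n) (l : List (S ×
    S)) : act (linP l i j) (rop g φ i j n) = rop (g + l.length) (linS l * φ) i j n := by
  induction l with
  | nil => simp [linP, linS]
  | cons p l ih =>
    have e1 : (linP (p :: l) i j) = lf p.1 p.2 i j * linP l i j := by simp [linP]
    have e2 : linS (p :: l) = (PowerSeries.C p.1 - PowerSeries.C p.2 * PowerSeries.X) * linS l := by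
      simp [linS]
    rw [e1, e2, map_mul, Module.End.mul_apply, ih, act_lf_rop _ _ hij hn, length_cons, mul_assoc]
    push_cast; rw [add_assoc]

structure Rat2 (S : Type*) where
  c : S
  num : List (S × S)
  den : List (S × S)

def IsRat (g : ℤ) (φ : PowerSeries S) (r : Rat2 S) : Prop :=
  linS r.den * φ = PowerSeries.C r.c * linS r.num ∧ g + r.den.length = r.num.length

lemma rop_C_mul (c g) (φ : PowerSeries S) {h i j} (hij : Lt h i j)
    {n : (ι → ℤ) → W} (hn : Bd h n) : rop g (PowerSeries.C c * φ) i j n = c • rop g φ i j n := by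
  have := kop_linear_mul φ hij hn c 0; simp at this; funext e; simp [rop, this]

lemma IsRat.act_rop {g} {φ} {r} (hr : IsRat g φ r) {h}
    {i j} (hij : Lt h i j) {n : (ι → ℤ) → W} (hn : Bd h n) : act (linP r.den i j) (rop g φ i j
    n) = act (algebraMap S _ r.c * linP r.num i j) n := by
  rw [act_linP_rop g φ hij hn, hr.1, hr.2, rop_C_mul _ _ _ hij hn, map_mul, Module.End.mul_apply,
    act_algebraMap]
  have h1 : rop 0 (1 : PowerSeries S) i j n = n := by funext e; simp [rop, kop_one]
  have h2 := act_linP_rop 0 1 hij hn r.num; grind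

variable (rt : ι → ι → Rat2 S)

def denW : List ι → Laurent ι S
  | [] => 1
  | i :: w => (w.map fun j => linP (rt i j).den i j * linP (rt j i).den j i).prod * denW w

def pairP (i j : ι) : Laurent ι S :=
  algebraMap S _ (rt i j).c * linP (rt i j).num i j * linP (rt j i).den j i

def wordP (q : ι → ι → Laurent ι S) : List ι → Laurent ι S
  | [] => 1
  | i :: w => (w.map fun j => q i j).prod * wordP q w

lemma denW_perm {w w'} (h : w.Perm w') : denW rt w = denW rt w' := by
  induction h with
  | nil => rfl
  | cons i h ih => rw [denW, denW, ih, (h.map _).prod_eq]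
  | swap i j w => simp [denW]; ring
  | trans _ _ h1 h2 => rw [h1, h2]

variable {rt} {pd}

lemma act_denW_rops {h i} {w : List ι} (hw : ∀ j ∈ w, Lt h i j) (hr : ∀ j ∈ w, IsRat (pd.g i j)
    (pd.φ i j) (rt i j)) {n : (ι → ℤ) → W} (hn : Bd h n) : act (w.map fun j => linP (rt i j).den i j
    * linP (rt j i).den j i).prod (rops pd i w n) = act (w.map fun j => pairP rt i j).prod n := by
  induction w with
  | nil => rfl
  | cons j w ih =>
    have hw' : ∀ j ∈ w, Lt h i j := fun k hk => hw k (by simp [hk])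
    rw [rops, map_cons, prod_cons, map_cons, prod_cons,
      mul_comm, map_mul, Module.End.mul_apply, mul_comm (linP (rt i j).den i j), map_mul,
      Module.End.mul_apply, (hr j (by simp)).act_rop (hw j (by simp)) (hn.rops pd hw'),
      ← Module.End.mul_apply, ← Module.End.mul_apply, ← map_mul, ← map_mul]
    have e1 : (w.map fun j => linP (rt i j).den i j * linP (rt j i).den j i).prod *
        (linP (rt j i).den j i * (algebraMap S _ (rt i j).c * linP (rt i j).num i j) : Laurent ι S)
          = pairP rt i j *
        (w.map fun j => linP (rt i j).den i j * linP (rt j i).den j i).prod := by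
      rw [pairP]; ring
    rw [mul_assoc, e1, map_mul, Module.End.mul_apply, ih hw' (fun k hk => hr k (by simp [hk])),
      map_mul, Module.End.mul_apply]

lemma act_denW_wop {h} {w : List ι} (hw : w.Pairwise (Lt h)) (hr : w.Pairwise fun i j
    => IsRat (pd.g i j) (pd.φ i j) (rt i j)) {n : (ι → ℤ) → W} (hn : Bd h n) : act (denW rt w) (wop
    pd w n) = act (wordP (pairP rt) w) n := by
  induction w generalizing n with
  | nil => rfl
  | cons i w ih =>
    rw [pairwise_cons] at hw hr
    rw [wop, denW, map_mul, Module.End.mul_apply, ih hw.2 hr.2 (hn.rops pd hw.1),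
      ← Module.End.mul_apply, ← map_mul, mul_comm, map_mul, Module.End.mul_apply,
      act_denW_rops hw.1 hr.1 hn, ← Module.End.mul_apply, ← map_mul, wordP, mul_comm]

lemma rops_congr {pd' i w} (h : ∀ j ∈ w, pd.g i j = pd'.g i j ∧ pd.φ
    i j = pd'.φ i j) (n : (ι → ℤ) → W) : rops pd i w n = rops pd' i w n := by
  induction w with
  | nil => rfl
  | cons j w ih =>
    rw [rops, rops, (h j (by simp)).1, (h j (by simp)).2, ih fun k hk => h k (by simp [hk])]

lemma wop_congr {pd' w} (h : w.Pairwise fun i j => pd.g i j = pd'.g i j ∧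
    pd.φ i j = pd'.φ i j) (n : (ι → ℤ) → W) : wop pd w n = wop pd' w n := by
  induction w generalizing n with
  | nil => rfl
  | cons i w ih => rw [pairwise_cons] at h; simp [wop, rops_congr h.1, ih h.2]

lemma act_lf_wop {pd pd'} {a b} {α β : S} (hab : pd'.g a b = pd.g a b + 1 ∧ pd'.φ a b =
    (PowerSeries.C α - PowerSeries.C β * PowerSeries.X) * pd.φ a b) (hba : pd'.g b a = pd.g b a + 1
    ∧ pd'.φ b a = (PowerSeries.C (-β) - PowerSeries.C (-α) * PowerSeries.X) * pd.φ b a) (hne : ∀ i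
    j, ¬ (i = a ∧ j = b) → ¬ (i = b ∧ j = a) → pd.g i j = pd'.g i j ∧ pd.φ i j = pd'.φ i j) {h : (ι
    → ℤ) →+ ℤ} {w} (hw : w.Pairwise (Lt h)) (hnd : w.Nodup) (ha : a ∈ w) (hb : b ∈ w) (hneab : a ≠
    b) {n : (ι → ℤ) → W} (hn : Bd h n) : wop pd' w n = act (lf α β a b) (wop pd w n) := by
  have aux : ∀ i j α β, pd'.g i j = pd.g i j + 1 →
      pd'.φ i j = (PowerSeries.C α - PowerSeries.C β * PowerSeries.X) * pd.φ i j →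
      (∀ k, k ≠ j → pd.g i k = pd'.g i k ∧ pd.φ i k = pd'.φ i k) →
      ∀ w (n : (ι → ℤ) → W), (∀ k ∈ w, Lt h i k) → w.Nodup → j ∈ w → Bd h n →
      rops pd' i w n = act (lf α β i j) (rops pd i w n) := by
    intro i j α β h1 h2 h3 w n hw hnd hj hn; induction w with
    | nil => simp at hj
    | cons k w ih =>
      have hw' : ∀ j ∈ w, Lt h i j := fun k hk => hw k (by simp [hk]); rw [nodup_cons] at hnd
      by_cases hk : k = j
      · subst hk; rw [rops, rops, h1, h2, act_lf_rop _ _ (hw k (by simp)) (hn.rops pd hw'),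
          rops_congr fun l hl => h3 l fun h => hnd.1 (h ▸ hl)]
      · rw [rops, rops, act_rop _ _ (hw k (by simp)) (hn.rops pd hw'), (h3 k hk).1, (h3 k hk).2,
          ih hw' hnd.2 (by simpa [Ne.symm hk] using hj)]
  induction w generalizing n with
  | nil => simp at ha
  | cons i w ih =>
    rw [pairwise_cons] at hw; rw [nodup_cons] at hnd
    have wcongr : (a ∉ w ∨ b ∉ w) → ∀ n : (ι → ℤ) → W, wop pd' w n = wop pd w n := by
      intro hor n; refine (wop_congr ?_ n).symm
      refine imp_of_mem (R := fun _ _ => True) ?_ (by simp [List.pairwise_iff_getElem])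
      intro x y hx hy _; exact hne x y (by rintro ⟨rfl, rfl⟩; tauto) (by rintro ⟨rfl, rfl⟩; tauto)
    rw [wop, wop]; by_cases hia : i = a
    · subst hia; rw [wcongr (inl hnd.1), aux i b α β hab.1 hab.2
        (fun k hk => hne i k (by tauto) (by tauto)) w n hw.1 hnd.2
        (by simpa [Ne.symm hneab] using hb) hn, act_wop pd hw.2 (hn.rops pd hw.1)]
    · by_cases hib : i = b
      · subst hib; rw [wcongr (inr hnd.1), aux i a (-β) (-α) hba.1 hba.2
          (fun k hk => hne i k (by tauto) (by tauto)) w n hw.1 hnd.2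
          (by simpa [hneab] using ha) hn, act_wop pd hw.2 (hn.rops pd hw.1), lf_swap]
      · rw [ih hw.2 hnd.2 (by simpa [Ne.symm hia] using ha) (by simpa [Ne.symm hib] using hb)
          (hn.rops pd' hw.1), rops_congr fun k _ => hne i k (by tauto) (by tauto)]

end Act

/-! ### Deformation to a common domain of expansion -/

section Deform

open Polynomial (eval₂RingHom)

variable {ι : Type*} [DecidableEq ι]

def ratS {S : Type*} [CommRing S] (r : Rat2 S) : PowerSeries S :=
  PowerSeries.C r.c * linS r.num * (r.den.map fun p => mk fun k => p.2 ^ k).prod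

lemma geom_mul {S : Type*} [CommRing S] (c : S) :
    (PowerSeries.C 1 - PowerSeries.C c * PowerSeries.X) * (mk fun k => c ^ k) = 1 := by
  ext r; cases r with
  | zero => simp
  | succ r =>
    rw [map_one, sub_mul, one_mul, map_sub, mul_assoc, coeff_C_mul,
      coeff_succ_X_mul]
    simp; ring

lemma linS_mul_geom {S : Type*} [CommRing S] (den : List (S × S)) (hd : ∀ p ∈ den, p.1 = 1) :
    linS den * (den.map fun p => mk fun k => p.2 ^ k).prod = 1 := by
  induction den with
  | nil => simp [linS]
  | cons p den ih => grind [linS, geom_mul]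

lemma linS_mul_ratS {S : Type*} [CommRing S] (r : Rat2 S) (hd : ∀ p ∈ r.den, p.1 = 1) :
    linS r.den * ratS r = PowerSeries.C r.c * linS r.num := by grind [ratS, linS_mul_geom]

lemma eq_ratS {S : Type*} [CommRing S] {r} (hd : ∀ p ∈ r.den, p.1 = 1)
    {φ : PowerSeries S} (h : linS r.den * φ = PowerSeries.C r.c * linS r.num) : φ = ratS r := by grind [ratS, linS_mul_geom]

lemma map_linS {S S' : Type*} [CommRing S] [CommRing S'] (σ : S →+* S') (l) :
    (linS l).map σ = linS (l.map (Prod.map σ σ)) := by simp [linS, map_list_prod, comp_def]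

/-- Base change of a rational function. -/
def Rat2.map {S S' : Type*} [CommRing S] [CommRing S'] (σ : S →+* S') (r : Rat2 S) : Rat2 S' :=
  ⟨σ r.c, r.num.map (Prod.map σ σ), r.den.map (Prod.map σ σ)⟩

lemma map_ratS {S S' : Type*} [CommRing S] [CommRing S'] (σ : S →+* S') (r) :
    (ratS r).map σ = ratS (r.map σ) := by
  simp only [ratS, Rat2.map]
  rw [map_mul, map_mul, map_linS, map_list_prod, map_map, map_map, map_C]
  congr 3; ext k; simp

lemma eq_zero_of_act_lf {c : Polynomial ℂ} (hc : Polynomial.X ∣ c) {i j : ι}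
    {m : (ι → ℤ) → Polynomial ℂ} (hm : act (lf 1 c i j) m = 0) : m = 0 := by
  have h1 : ∀ e, m e = c * m (e + Pi.single i 1 - Pi.single j 1) := by
    intro e; have := congrFun hm (e + Pi.single i 1); rw [act_lf] at this
    simp [add_sub_cancel_right, smul_eq_mul, Pi.zero_apply, one_mul] at this; grind
  have h2 : ∀ k e, Polynomial.X ^ k ∣ m e := by intro k; induction k with
    | zero => intro e; simp
    | succ k ih => intro e; rw [h1, pow_succ']; exact mul_dvd_mul hc (ih _)
  funext e; by_contra hne
  have := Polynomial.le_natDegree_of_coe_le_degree (p := m e) (n := (m e).natDegree + 1) ?_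
  · omega
  · have h3 := Polynomial.degree_le_of_dvd (h2 ((m e).natDegree + 1) e) hne
    rwa [Polynomial.degree_X_pow] at h3

lemma eq_zero_of_act_denW {rt : ι → ι → Rat2 (Polynomial ℂ)}
    (hd : ∀ i j, ∀ p ∈ (rt i j).den, p.1 = 1 ∧ Polynomial.X ∣ p.2) (w)
    {m : (ι → ℤ) → Polynomial ℂ} (hm : act (denW rt w) m = 0) : m = 0 := by
  have h1 : ∀ i j (l : List (Polynomial ℂ × Polynomial ℂ)),
      (∀ p ∈ l, p.1 = 1 ∧ Polynomial.X ∣ p.2) → ∀ m : (ι → ℤ) → Polynomial ℂ,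
      act (linP l i j) m = 0 → m = 0 := by
    intro i j l; induction l with
    | nil => intro _ m hm; simpa [linP] using hm
    | cons p l ih =>
      intro hl m hm; have e1 : (linP (p :: l) i j) = lf p.1 p.2 i j * linP l i j := by simp [linP]
      rw [e1, map_mul, Module.End.mul_apply, (hl p (by simp)).1] at hm
      exact ih (fun q hq => hl q (by simp [hq])) m (eq_zero_of_act_lf (hl p (by simp)).2 hm)
  have h2 : ∀ i (w : List ι) (m : (ι → ℤ) → Polynomial ℂ),
      act (w.map fun j => linP (rt i j).den i j * linP (rt j i).den j i).prod m = 0 → m = 0 := by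
    intro i w; induction w with
    | nil => intro m hm; simpa using hm
    | cons j w ih =>
      intro m hm; rw [map_cons, prod_cons, map_mul, map_mul, Module.End.mul_apply,
        Module.End.mul_apply] at hm
      exact ih m (h1 _ _ _ (hd j i) _ (h1 _ _ _ (hd i j) _ hm))
  induction w generalizing m with
  | nil => simpa [denW] using hm
  | cons i w ih => rw [denW, map_mul, Module.End.mul_apply] at hm; exact ih (h2 i w _ hm)

/-- Evaluation of the deformation parameter. -/
abbrev ev : Polynomial ℂ →+* ℂ := Polynomial.evalRingHom 1

lemma sum_wop_eq_zero {pd} (rt : ι → ι → Rat2 (Polynomial ℂ)) (hd : ∀ i j, ∀ p ∈ (rt i j).den, p.1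
    = 1 ∧ Polynomial.X ∣ p.2) (hpd : ∀ i j, i ≠ j → IsRat (pd.g i j) (pd.φ i j) ((rt i j).map ev))
    {u} (hu : u.Nodup) (words : List (Polynomial ℂ × List ι)) (hw : ∀ p ∈ words, p.2.Perm u) (hpoly
    : (words.map fun p => algebraMap _ _ p.1 * wordP (pairP rt) p.2).sum = 0) {n} (hn : ∃ B, ∀ e, n
    e ≠ 0 → ∀ l ∈ u, B ≤ e l) (e) : (words.map fun p => ev p.1 * wop pd p.2 n e).sum = 0 := by
  set pd' : PairData ι (Polynomial ℂ) :=
    ⟨fun i j => (rt i j).num.length - (rt i j).den.length, fun i j => ratS (rt i j)⟩ with hpd'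
  set n' : (ι → ℤ) → Polynomial ℂ := fun e => Polynomial.C (n e) with hn'
  have hb : ∀ p ∈ words, Bd (posHeight p.2) n' := by
    intro p hp; obtain ⟨B, hB⟩ := hn
    refine Bd.posHeight ⟨B, fun e he l hl => hB e (fun h => he (by simp [hn', h])) l ?_⟩; grind
  have hnd := fun p hp => (hw p hp).nodup_iff.2 hu
  have hrat : ∀ i j, IsRat (pd'.g i j) (pd'.φ i j) (rt i j) := fun i j =>
    ⟨linS_mul_ratS _ fun p hp => (hd i j p hp).1, by simp [hpd']⟩
  -- the deformed relation
  have h1 : (words.map fun p => p.1 • wop pd' p.2 n').sum = 0 := by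
    refine eq_zero_of_act_denW hd u ?_
    have h2 : ∀ p ∈ words, act (denW rt u) (p.1 • wop pd' p.2 n') =
        act (algebraMap _ (Laurent ι (Polynomial ℂ)) p.1 * wordP (pairP rt) p.2) n' := by
      intro p hp
      rw [map_smul, ← denW_perm rt (hw p hp), act_denW_wop (posHeight_pairwise (hnd p hp))
        (List.pairwise_of_forall fun i j => hrat i j) (hb p hp), map_mul, Module.End.mul_apply,
        act_algebraMap]
    rw [map_list_sum, map_map]; have h3 : words.map (⇑(act (denW rt u)) ∘ fun p => p.1 • wop
      pd' p.2 n') = words.map fun p => act (algebraMap _ (Laurent ι (Polynomial ℂ)) p.1 * wordP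
        (pairP rt) p.2) n' := map_congr_left h2
    have h4 : (words.map fun p => act
        (algebraMap _ (Laurent ι (Polynomial ℂ)) p.1 * wordP (pairP rt) p.2) n').sum =
        act (words.map fun p => algebraMap _ _ p.1 * wordP (pairP rt) p.2).sum n' := by
      generalize words = ws; induction ws with
      | nil => simp
      | cons p ws ih =>
        simp only [map_cons, sum_cons, ih]; rw [map_add, LinearMap.add_apply]
    rw [h3, h4, hpoly, map_zero, LinearMap.zero_apply]
  -- specialization
  have h5 : ∀ p ∈ words, ∀ e, ev (wop pd' p.2 n' e) = wop pd p.2 n e := by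
    intro p hp e; have h6 := congrFun (wop_comp pd' ev (posHeight_pairwise (hnd p hp)) (hb p hp)
      (fun _ => ev.toSemilinearMap) fun _ _ _ => rfl) e
    have h7 : (fun e => ev.toSemilinearMap (n' e)) = n := by funext e; simp [hn']
    rw [h7] at h6; have h8 : wop pd p.2 n = wop (pd'.map ev) p.2 n := by
      refine wop_congr ((hnd p hp).imp ?_) n; intro i j hij; obtain ⟨a1, a2⟩ := hpd i j hij
      constructor
      · simp [Rat2.map, List.length_map] at a2; simp [PairData.map, hpd']; omega
      · simp [PairData.map, hpd']; rw [map_ratS]; refine eq_ratS (fun q hq => ?_) a1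
        obtain ⟨r, hr, rfl⟩ := mem_map.1 hq; simp [(hd i j r hr).1]
    rw [h8, h6]; rfl
  have h9 := congrArg ev (congrFun h1 e)
  rw [← Pi.evalAddMonoidHom_apply (fun _ => Polynomial ℂ) e (List.sum _), map_list_sum,
    Pi.zero_apply, map_zero, map_list_sum, map_map, map_map] at h9
  rw [← h9]; congr 1; refine map_congr_left fun p hp => ?_; rw [← h5 p hp e, ← map_mul]; rfl

end Deform

notation "cst" => algebraMap ℂ (Laurent (Fin 2) ℂ)

/-! ### Vertex operators with zero modes -/

structure Letter (L Y : Type*) where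
  osc : Osc Y
  β : L
  ex : L → ℤ
  σ : L → ℂ

namespace Letter

variable {L : Type*} [AddCommGroup L] {Y : Type*} [Fintype Y]

/-- The coefficient of `z ^ e`. -/
def op (X : Letter L Y) (e : ℤ) : Module.End ℂ (L →₀ Osc.Sp Y) :=
  Finsupp.lsum ℂ fun α => lsingle (α + X.β) ∘ₗ (X.σ α • X.osc.N1 (e - X.ex α))

lemma op_single (X : Letter L Y) (e α f) : X.op e (Finsupp.single α f) = Finsupp.single (α + X.β)
    (X.σ α • X.osc.N1 (e - X.ex α) f) := by simp [op]

variable {ι : Type*} (X : ι → Letter L Y)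

/-- The commutation data of the zero modes. -/
structure Compat (g : ι → ι → ℤ) (τ : ι → ι → ℂ) : Prop where
  ex : ∀ i j α, (X i).ex (α + (X j).β) = (X i).ex α + g i j
  σ : ∀ i j α, (X i).σ (α + (X j).β) = (X i).σ α * τ i j

def wordOp (w : List ι) (e : ι → ℤ) : Module.End ℂ (L →₀ Osc.Sp Y) :=
  (w.map fun i => (X i).op (e i)).prod

def tauW (τ : ι → ι → ℂ) : List ι → ℂ
  | [] => 1
  | i :: w => (w.map (τ i)).prod * tauW τ w

/-- The contractions of vertex operators. -/
def pairData (g : ι → ι → ℤ) (τ : ι → ι → ℂ) : PairData ι ℂ :=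
  ⟨g, fun i j => PowerSeries.C (τ i j) * Osc.phi (X i).osc (X j).osc⟩

variable {X} {g : ι → ι → ℤ} {τ : ι → ι → ℂ}

omit [Fintype Y] in
lemma Compat.ex_sum (hX : Compat X g τ) (i) (w : List ι) (α) :
    (X i).ex (α + (w.map fun j => (X j).β).sum) = (X i).ex α + (w.map (g i)).sum := by
  induction w generalizing α with
  | nil => simp
  | cons j w ih => grind [hX.ex]

omit [Fintype Y] in
lemma Compat.σ_sum (hX : Compat X g τ) (i) (w : List ι) (α) :
    (X i).σ (α + (w.map fun j => (X j).β).sum) = (X i).σ α * (w.map (τ i)).prod := by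
  induction w generalizing α with
  | nil => simp
  | cons j w ih => rw [map_cons, sum_cons, ← add_assoc, ih, hX.σ, map_cons,
    prod_cons, mul_assoc]

lemma wordOp_single_aux (hX : Compat X g τ) (w e α f) : wordOp X w e (Finsupp.single α f) =
    Finsupp.single (α + (w.map fun j => (X j).β).sum) (((w.map fun i => (X i).σ α).prod * tauW τ w)
    • Osc.wprod (fun i => (X i).osc) g w (fun i => e i - (X i).ex α) f) := by
  induction w with
  | nil => simp [wordOp, tauW, Osc.wprod]
  | cons i w ih =>
    have : wordOp X (i :: w) e = (X i).op (e i) * wordOp X w e := by simp [wordOp]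
    rw [this, Module.End.mul_apply, ih, op_single, hX.ex_sum, hX.σ_sum, Osc.wprod, map_smul,
      smul_smul, Module.End.mul_apply]
    grind [tauW]

variable [DecidableEq ι]

omit [AddCommGroup L] in
lemma wop_pairData {h} {w : List ι} (hw : w.Pairwise (Lt h))
    {W : Type*} [AddCommGroup W] [Module ℂ W] {n : (ι → ℤ) → W} (hn : Bd h n) :
    wop (pairData X g τ) w n = tauW τ w • wop (Osc.pairData (fun i => (X i).osc) g) w n := by
  have h1 : ∀ i w (n : (ι → ℤ) → W), (∀ j ∈ w, Lt h i j) → Bd h n → rops (pairData X g τ) i w n =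
        (w.map (τ i)).prod • rops (Osc.pairData (fun i => (X i).osc) g) i w n := by
    intro i w n hw hn; induction w with
    | nil => simp [rops]
    | cons j w ih =>
      have hw' : ∀ j ∈ w, Lt h i j := fun k hk => hw k (by simp [hk])
      have hb := hn.rops (Osc.pairData (fun i => (X i).osc) g) hw'
      rw [rops, rops, ih hw', pairData]; simp only
      rw [rop_C_mul _ _ _ (hw j (by simp)), map_cons, prod_cons, mul_smul]
      · congr 1; have := act_rop (g i j) (Osc.phi (X i).osc (X j).osc) (hw j (by simp)) hb
          (algebraMap ℂ _ (w.map (τ i)).prod)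
        rw [act_algebraMap, act_algebraMap] at this; exact this.symm
      · have := hb.act (algebraMap ℂ (Laurent ι ℂ) (w.map (τ i)).prod); rwa [act_algebraMap] at this
  induction w generalizing n with
  | nil => simp [wop, tauW]
  | cons i w ih =>
    rw [pairwise_cons] at hw; have hb := hn.rops (Osc.pairData (fun i => (X i).osc) g) hw.1
    rw [wop, wop, h1 i w n hw.1 hn, ih hw.2, tauW, mul_comm, mul_smul]
    · congr 1; have := act_wop (Osc.pairData (fun i => (X i).osc) g) hw.2 hb
        (algebraMap ℂ _ (w.map (τ i)).prod)
      rw [act_algebraMap, act_algebraMap] at this; exact this.symm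
    · have := hb.act (algebraMap ℂ (Laurent ι ℂ) (w.map (τ i)).prod); rwa [act_algebraMap] at this

lemma wordOp_single (hX : Compat X g τ) {w} (hw : w.Nodup) (e α f) : wordOp X w e (Finsupp.single α
    f) = Finsupp.single (α + (w.map fun j => (X j).β).sum) ((w.map fun i => (X i).σ α).prod • wop
    (pairData X g τ) w (fun e => Osc.nprod (fun i => (X i).osc) w e f) (fun i => e i - (X i).ex α))
    := by simp [wordOp_single_aux hX, Osc.wprod_eq _ _ _ hw, wop_pairData (posHeight_pairwise hw)
    (Bd.posHeight (Osc.nprod_bounded _ _ _)), mul_smul]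

lemma sum_wordOp_eq_zero (hX : Compat X g τ) {u} (hu : u.Nodup) (terms : List (ℂ × (ι → ℤ) × List
    ι)) (hw : ∀ p ∈ terms, p.2.2.Perm u) (hs : ∀ n, (∃ B, ∀ e, n e ≠ 0 → ∀ l ∈ u, B ≤ e l) → ∀ e,
    (terms.map fun p => p.1 * wop (pairData X g τ) p.2.2 n (e - p.2.1)).sum = 0) (e) : (terms.map
    fun p => p.1 • wordOp X p.2.2 (e - p.2.1)).sum = 0 := by
  refine lhom_ext fun α f => ?_
  set N : (ι → ℤ) → Osc.Sp Y := fun e => Osc.nprod (fun i => (X i).osc) u e f with hN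
  obtain ⟨B, hB⟩ := Osc.nprod_bounded (fun i => (X i).osc) u f
  have h1 : (terms.map fun p => p.1 • wop (pairData X g τ) p.2.2 N
      ((e - p.2.1) - fun i => (X i).ex α)).sum = 0 := by
    ext μ; rw [coeff_zero, ← hs (fun e => MvPolynomial.coeff μ (N e)) ⟨B, fun e he =>
      hB e fun h => he (by simp only [hN, h, coeff_zero])⟩ (e - fun i => (X i).ex α)]
    have h3 := map_list_sum (lcoeff ℂ μ) (terms.map fun p => p.1 •
      wop (pairData X g τ) p.2.2 N ((e - p.2.1) - fun i => (X i).ex α))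
    rw [lcoeff_apply] at h3; rw [h3, map_map]; congr 1
    refine map_congr_left fun p hp => ?_; have hnd := (hw p hp).nodup_iff.2 hu
    have h4 := congrFun (wop_comp (pairData X g τ) (RingHom.id ℂ) (posHeight_pairwise hnd)
      (Bd.posHeight (n := N) ⟨B, fun e he l hl => hB e he l ((hw p hp).subset hl)⟩) (fun _ =>
        lcoeff ℂ μ) fun _ _ _ => rfl) (e - p.2.1 - fun i => (X i).ex α)
    rw [PairData.map_id] at h4
    simp only [Function.comp_apply, map_smul, smul_eq_mul, ← h4, lcoeff_apply]
    rw [sub_right_comm]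
  have h5 : ∀ p ∈ terms, (p.1 • wordOp X p.2.2 (e - p.2.1)) (Finsupp.single α f) =
      (lsingle (α + (u.map fun j => (X j).β).sum) ∘ₗ
        lsmul ℂ (Osc.Sp Y) (u.map fun i => (X i).σ α).prod)
      (p.1 • wop (pairData X g τ) p.2.2 N ((e - p.2.1) - fun i => (X i).ex α)) := by
    intro p hp; rw [LinearMap.smul_apply, wordOp_single hX ((hw p hp).nodup_iff.2 hu), map_smul,
      comp_apply, ((hw p hp).map _).sum_eq, ((hw p hp).map _).prod_eq]
    simp only [Osc.nprod_perm _ (hw p hp)]; rfl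
  have h6 : (terms.map fun p => p.1 • wordOp X p.2.2 (e - p.2.1)).sum (Finsupp.single α f) =
      (terms.map fun p => (p.1 • wordOp X p.2.2 (e - p.2.1)) (Finsupp.single α f)).sum := by
    have := map_list_sum (applyₗ (R := ℂ) (M₂ := L →₀ Osc.Sp Y) (Finsupp.single α f))
      (terms.map fun p => p.1 • wordOp X p.2.2 (e - p.2.1))
    rw [LinearMap.applyₗ_apply_apply, map_map] at this; exact this
  rw [h6, map_congr_left h5]
  have h7 := map_list_sum (lsingle (α + (u.map fun j => (X j).β).sum) ∘ₗ
      lsmul ℂ (Osc.Sp Y) (u.map fun i => (X i).σ α).prod)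
    (terms.map fun p => p.1 • wop (pairData X g τ) p.2.2 N ((e - p.2.1) - fun i => (X i).ex α))
  rw [h1, map_zero, map_map] at h7; exact h7.symm

end Letter

/-! ### Multilinearity of words -/

section Multilinear

variable {ι : Type*} [DecidableEq ι] {A : Type*} [Ring A] [Algebra ℂ A]

omit [DecidableEq ι] in
lemma prod_map_update {w} (hw : w.Nodup) {i} (hi : i ∈ w) :
    ∃ l r : List ι, i ∉ l ∧ i ∉ r ∧ w = l ++ i :: r := by
  obtain ⟨l, r, rfl⟩ := List.append_of_mem hi; grind

def wordMul (w : List ι) (hw : w.Nodup) (hall : ∀ i, i ∈ w) (e : ι → ℤ) :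
    MultilinearMap ℂ (fun _ : ι => ℤ → A) A where
  toFun F := (w.map fun i => F i (e i)).prod
  map_update_add' F i x y := by
    obtain ⟨l, r, hl, hr, rfl⟩ := prod_map_update hw (hall i)
    have h1 : ∀ z, l.map (fun j => update F i z j (e j)) = l.map fun j => F j (e j) :=
      fun z => map_congr_left fun j hj => by
        rw [update_of_ne (ne_of_mem_of_not_mem hj hl)]
    have h2 : ∀ z, r.map (fun j => update F i z j (e j)) = r.map fun j => F j (e j) :=
      fun z => map_congr_left fun j hj => by
        rw [update_of_ne (ne_of_mem_of_not_mem hj hr)]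
    simp [h1, h2, add_mul, mul_add]
  map_update_smul' F i c x := by
    obtain ⟨l, r, hl, hr, rfl⟩ := prod_map_update hw (hall i)
    have h1 : ∀ z, l.map (fun j => update F i z j (e j)) = l.map fun j => F j (e j) :=
      fun z => map_congr_left fun j hj => by
        rw [update_of_ne (ne_of_mem_of_not_mem hj hl)]
    have h2 : ∀ z, r.map (fun j => update F i z j (e j)) = r.map fun j => F j (e j) :=
      fun z => map_congr_left fun j hj => by
        rw [update_of_ne (ne_of_mem_of_not_mem hj hr)]
    simp [h1, h2]

variable {L : Type*} [AddCommGroup L] {Y : Type*} [Fintype Y] [Fintype ι]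

lemma sum_words_eq_zero {κ : Type*} [Fintype κ] (X : ι → κ → Letter L Y) (c : ι → κ → ℂ) {u} (hu :
    u.Nodup) (hall : ∀ i, i ∈ u) (terms : List (ℂ × (ι → ℤ) × List ι)) (hw : ∀ p ∈ terms, p.2.2.Perm
    u) (hX : ∀ ε : ι → κ, (∀ i, c i (ε i) ≠ 0) → ∃ g τ, Letter.Compat (fun i => X i (ε i)) g τ ∧ ∀
    n, (∃ B, ∀ e, n e ≠ 0 → ∀ l ∈ u, B ≤ e l) → ∀ e, (terms.map fun p => p.1 * wop (Letter.pairData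
    (fun i => X i (ε i)) g τ) p.2.2 n (e - p.2.1)).sum = 0) (e : ι → ℤ) : (terms.map fun p => p.1 •
    (p.2.2.map fun i => ∑ k, c i k • (X i k).op (e i - p.2.1 i)).prod).sum = 0 := by
  classical
  have h1 : ∀ p ∈ terms, (p.2.2.map fun i => ∑ k, c i k • (X i k).op (e i - p.2.1 i)).prod =
      ∑ ε : ι → κ, (∏ i, c i (ε i)) • Letter.wordOp (fun i => X i (ε i)) p.2.2 (e - p.2.1) := by
    intro p hp; have hnd := (hw p hp).nodup_iff.2 hu
    have hmem := fun i => (hw p hp).symm.subset (hall i)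
    have h2 := (wordMul (A := Module.End ℂ (L →₀ Osc.Sp Y)) p.2.2 hnd hmem (e - p.2.1)).map_sum
      (fun i k => c i k • fun z => (X i k).op z)
    have h3 : ∀ ε : ι → κ, wordMul p.2.2 hnd hmem (e - p.2.1) (fun i => c i (ε i) • fun z => (X i
      (ε i)).op z) = (∏ i, c i (ε i)) • Letter.wordOp (fun i => X i (ε i)) p.2.2 (e - p.2.1) := by
        intro ε; rw [map_smul_univ]; rfl
    rw [sum_congr rfl fun ε _ => h3 ε] at h2; rw [← h2]; simp [wordMul]
  have h4 : (terms.map fun p => p.1 • (p.2.2.map fun i =>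
      ∑ k, c i k • (X i k).op (e i - p.2.1 i)).prod).sum = ∑ ε : ι → κ, (∏ i, c i (ε i)) •
        (terms.map fun p => p.1 • Letter.wordOp (fun i => X i (ε i)) p.2.2 (e - p.2.1)).sum := by
    rw [map_congr_left fun p hp => by rw [h1 p hp]]; clear h1 hX hw; induction terms with
    | nil => simp
    | cons p terms ih =>
      simp only [map_cons, sum_cons]; rw [ih]
      simp only [smul_add, sum_add_distrib]; congr 1; rw [smul_sum]
      exact sum_congr rfl fun ε _ => smul_comm _ _ _
  rw [h4]; refine sum_eq_zero fun ε _ => ?_; by_cases hc : ∀ i, c i (ε i) ≠ 0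
  · obtain ⟨g, τ, hcomp, hs⟩ := hX ε hc
    rw [Letter.sum_wordOp_eq_zero hcomp hu terms hw hs, smul_zero]
  · push Not at hc; obtain ⟨i, hi⟩ := hc; rw [Finset.prod_eq_zero (mem_univ i) hi, zero_smul]

end Multilinear

/-! ### The Dynkin diagram -/

section Diagram

variable (P : Params)

lemma three_le : 3 ≤ P.m + P.n := by grind [P.one_le_m, P.one_le_n, P.m_ne_n]

variable {P}

lemma next_val (i) : (next P i).1 = if i.1 + 1 = P.m + P.n then 0 else i.1 + 1 := by
  simp [next]; split_ifs with h
  · simp_all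
  · exact Nat.mod_eq_of_lt (by omega)

lemma prev_val (i) : (prev P i).1 = if i.1 = 0 then P.m + P.n - 1 else i.1 - 1 := by
  simp [prev]; split_ifs with h
  · simp_all
  · rw [show i.1 + (P.m + P.n) - 1 = (i.1 - 1) + (P.m + P.n) by omega, Nat.add_mod_right]
    exact Nat.mod_eq_of_lt (by omega)

lemma next_cases (i) : (i.1 + 1 = P.m + P.n ∧ (next P i).1 = 0) ∨
    (i.1 + 1 < P.m + P.n ∧ (next P i).1 = i.1 + 1) := by grind [next_val]

lemma prev_cases (i) : (i.1 = 0 ∧ (prev P i).1 + 1 = P.m + P.n) ∨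
    (i.1 ≠ 0 ∧ (prev P i).1 + 1 = i.1) := by grind [prev_val]

lemma next_prev (i) : next P (prev P i) = i := by grind [next_val, prev_val]

lemma prev_next (i) : prev P (next P i) = i := by grind [next_val, prev_val]

lemma next_ne (i) : next P i ≠ i := by
  have := three_le P; grind [next_val]

lemma next_next_ne (i) : next P (next P i) ≠ i := by
  have := three_le P; grind [next_val]

lemma prev_ne (i) : prev P i ≠ i := by grind [next_ne, next_prev]

lemma next_ne_prev (i) : next P i ≠ prev P i := by grind [next_next_ne, next_prev]

lemma next_inj {i j} (h : next P i = next P j) : i = j := by grind [prev_next]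

lemma eq_next_iff {i j} : i = next P j ↔ j = prev P i := by grind [prev_next, next_prev]

lemma A_next (i) : A P i (next P i) = edge P (next P i) := by
  rw [A, if_neg (next_ne i).symm, if_pos rfl]

lemma A_prev (i) : A P i (prev P i) = edge P i := by
  rw [A, if_neg (prev_ne i).symm, if_neg (next_ne_prev i).symm, if_pos (next_prev i).symm]

lemma A_next_left (i) : A P (next P i) i = edge P (next P i) := by
  conv_lhs => rw [← prev_next i, next_prev, A_prev]

lemma A_far {i j} (h1 : i ≠ j) (h2 : j ≠ next P i) (h3 : i ≠ next P j) : A P i j = 0 := by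
  rw [A, if_neg h1, if_neg h2, if_neg h3]

lemma M_next (i) : M P i (next P i) = edge P (next P i) := by
  rw [M, if_pos rfl]

lemma M_next_left (i) : M P (next P i) i = -edge P (next P i) := by
  rw [M, if_neg (next_next_ne i).symm, if_pos rfl]

lemma M_prev (i) : M P i (prev P i) = -edge P i := by
  conv_lhs => rw [← next_prev i, prev_next, M_next_left, next_prev]

lemma M_self (i) : M P i i = 0 := by simp [M, if_neg (next_ne i).symm]

lemma M_far {i j} (h2 : j ≠ next P i) (h3 : i ≠ next P j) : M P i j = 0 := by
  rw [M, if_neg h2, if_neg h3]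

lemma A_symm (i j) : A P i j = A P j i := by grind [A_next, A_next_left, A_far]

lemma edge_sq (i) : edge P i * edge P i = 1 := by
  unfold edge; split_ifs <;> rfl

lemma sum_nbr {R : Type*} [AddCommMonoid R] (i) (f : Idx P → R) (hf : ∀ j, j ≠ i → j ≠ next P i → j
    ≠ prev P i → f j = 0) : ∑ j, f j = f i + (f (next P i) + f (prev P i)) := by
  rw [← sum_subset (Finset.subset_univ {i, next P i, prev P i})]
  · rw [sum_insert, Finset.sum_pair (next_ne_prev i)]; grind [next_ne, prev_ne]
  · grind

lemma A_self (i) : A P i i = -(edge P i + edge P (next P i)) := by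
  have h0 := P.one_le_m; have h1 := P.one_le_n; have := i.isLt; rw [A, if_pos rfl]
  have h := next_cases i; unfold edge IsOdd; grind

lemma A_row_sum (i) : ∑ j, A P i j = 0 := by
  rw [sum_nbr i, A_next, A_prev, A_self]
  · ring
  · grind [A_far, eq_next_iff.1]

lemma AM_row_sum (i) : ∑ j, A P i j * M P i j = 0 := by
  rw [sum_nbr i, A_next, A_prev, M_next, M_prev, M_self, mul_neg, edge_sq, edge_sq]
  · ring
  · grind [A_far, eq_next_iff.1]

/-- The index `0`. -/
def zeroIdx : Idx P := ⟨0, by have := three_le P; omega⟩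

lemma sum_rootIdx {R : Type*} [AddCommGroup R] (f : Idx P → R) :
    ∑ l : RootIdx P, f l.1 = (∑ l, f l) - f zeroIdx := by
  have h1 : ∑ l : RootIdx P, f l.1 = ∑ l ∈ univ.filter (fun i => i.1 ≠ 0), f l := by
    rw [Finset.sum_subtype (p := fun i : Idx P => i.1 ≠ 0)]; simp
  have h2 : (univ.filter fun i : Idx P => i.1 ≠ 0) = univ.erase zeroIdx := by
    ext i
    simp only [mem_filter, mem_univ, true_and, Finset.mem_erase, ne_eq, and_true]
    rw [ext_iff]; rfl
  rw [h1, h2, Finset.sum_erase_eq_sub (mem_univ _)]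

lemma sum_root_mul {R : Type*} [CommRing R] (i) (f : Idx P → R) (hf : ∑ l, f l = 0) :
    ∑ l, root P i l * f l.1 = f i := by
  by_cases h : i.1 = 0
  · have hi : i = zeroIdx := Fin.ext h; simp only [root, if_pos h]; simp [sum_rootIdx, hf, hi]
  · rw [sum_eq_single (⟨i, h⟩ : RootIdx P)]
    · simp [root, h]
    · intro b _ hb; have : b.1 ≠ i := fun h' => hb (Subtype.ext h'); simp [root, h, this]
    · simp

lemma form_root_left (i y) : form P (root P i) y = ∑ l, A P i l.1 * y l := by
  unfold form; rw [sum_comm]; refine sum_congr rfl fun l _ => ?_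
  have := sum_root_mul i (fun k => A P k l.1) (by simp [A_symm _ l.1]; exact A_row_sum l.1)
  grind [cast_id, sum_mul]

lemma form_root_root (i j) : form P (root P i) (root P j) = A P i j := by
  rw [form_root_left]; have := sum_root_mul j (fun k => A P i k) (A_row_sum i); grind [cast_id]

lemma form_add_right (x y z) : form P x (y + z) = form P x y + form P x z := by
  simp [form, ← sum_add_distrib, mul_add]

lemma form_zsmul_right (c x y) : form P x (c • y) = c * form P x y := by
  simp [form, mul_sum]; grind

def amForm (i : Idx P) (y : RootIdx P → ℤ) : ℤ := ∑ l : RootIdx P, y l * A P i l.1 * M P i l.1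

lemma amForm_add (i) (y z : RootIdx P → ℤ) : amForm i (y + z) = amForm i y + amForm i z := by
  simp [amForm, ← sum_add_distrib, add_mul]

lemma amForm_zsmul (i c) (y : RootIdx P → ℤ) : amForm i (c • y) = c * amForm i y := by
  simp [amForm, mul_sum]; grind

lemma amForm_root (i j) : amForm i (root P j) = A P i j * M P i j := by
  have := sum_root_mul j (fun k => A P i k * M P i k) (AM_row_sum i); rw [← this]
  exact sum_congr rfl fun _ _ => mul_assoc _ _ _

/-! ### Signs -/

/-- The exponent of the sign `twist`. -/
def twistExp (β α : RootIdx P → ℤ) : ℤ :=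
  ∑ k : RootIdx P, ∑ l : RootIdx P,
    if l.1 < k.1 ∧ k.1.1 ≤ P.m then A P k.1 l.1 * β k * α l else 0

lemma twist_eq (β α : RootIdx P → ℤ) : twist β α = (-1) ^ twistExp β α := rfl

lemma twistExp_add_right (β α α' : RootIdx P → ℤ) :
    twistExp β (α + α') = twistExp β α + twistExp β α' := by
  simp only [twistExp, ← sum_add_distrib]; grind [Pi.add_apply]

lemma twistExp_zsmul_right (c) (β α : RootIdx P → ℤ) : twistExp β (c • α) = c * twistExp β α := by
  simp only [twistExp, mul_sum]
  refine sum_congr rfl fun _ _ => sum_congr rfl fun _ _ => ?_; split_ifs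
  · rw [Pi.smul_apply, smul_eq_mul]; ring
  · ring

lemma neg_one_zpow_eq_of_parity {a b : ℤ} (h : Even (a + b)) : (-1) ^ a = (-1 : ℂ) ^ b := by
  have h1 : a = b + (a + b - 2 * b) := by ring
  rw [h1, zpow_add₀ (by simp), Even.neg_one_zpow (n := a + b - 2 * b), mul_one]; grind

lemma twistExp_add_swap (β α) : twistExp β α + twistExp α β = ∑ k, ∑ l : RootIdx P, if l.1 ≠ k.1 ∧
    k.1.1 ≤ P.m ∧ l.1.1 ≤ P.m then A P k.1 l.1 * β k * α l else 0 := by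
  rw [twistExp, twistExp, sum_comm (f := fun k l =>
    if l.1 < k.1 ∧ k.1.1 ≤ P.m then A P k.1 l.1 * α k * β l else 0)]
  simp only [← sum_add_distrib]
  refine sum_congr rfl fun k _ => sum_congr rfl fun l _ => ?_
  grind [A_symm, lt_trichotomy, not_lt.2, add_zero, lt_irrefl, zero_add]

def signMat (k l : Idx P) : ℤ :=
  if l ≠ k ∧ k.1 ≤ P.m ∧ l.1 ≤ P.m ∧ k.1 ≠ 0 ∧ l.1 ≠ 0 then A P k l else 0

lemma twistExp_add_swap_roots (i j) : twistExp (root P i) (root P j) + twistExp (root P j) (root P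
    i) = ∑ k, ∑ l, root P i k * signMat k.1 l.1 * root P j l := by
  rw [twistExp_add_swap]; grind [signMat]

lemma signMat_symm (k l : Idx P) : signMat k l = signMat l k := by grind [signMat, A_symm]

lemma sum_signMat (j) : ∑ k, signMat k j =
    signMat (next P j) j + signMat (prev P j) j := by grind [sum_nbr, signMat, A_far, eq_next_iff.1]

lemma root_sum_signMat (i l) : ∑ k, root P i k * signMat k.1 l = if i.1 = 0 then -(signMat (next P
    l) l + signMat (prev P l) l) else signMat i l := by
  by_cases h : i.1 = 0
  · simp only [root, if_pos h]; grind [mul_sum, sum_rootIdx, signMat, sum_signMat, zeroIdx]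
  · rw [if_neg h, sum_eq_single (⟨i, h⟩ : RootIdx P)]
    · simp [root, h]
    · intro b _ hb; have : b.1 ≠ i := fun h' => hb (Subtype.ext h'); simp [root, h, this]
    · simp

lemma edge_eq_neg_one_iff (i) : edge P i = -1 ↔ 1 ≤ i.1 ∧ i.1 ≤ P.m := by
  unfold edge; split_ifs with h
  · simp [h]
  · simp [h]

lemma A_eq_neg_one_iff {i j} (hij : i ≠ j) : A P i j = -1 ↔
    (j = next P i ∧ 1 ≤ j.1 ∧ j.1 ≤ P.m) ∨ (i = next P j ∧ 1 ≤ i.1 ∧ i.1 ≤ P.m) := by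
  rw [A, if_neg hij]; grind [next_next_ne, edge_eq_neg_one_iff]

lemma signMat_eq {k l} (hkl : k ≠ l) : signMat k l =
    if A P k l = -1 ∧ k.1 ≠ 0 ∧ l.1 ≠ 0 then -1 else 0 := by grind [signMat, A_eq_neg_one_iff, next_cases, A_far]

lemma twist_mul_swap {i j} (hij : i ≠ j) : twist (root P i) (root P j) * twist (root P j) (root P i)
    = (-1) ^ (par P i * par P j) * (if A P i j = -1 then -1 else 1) := by
  have key : Even ((twistExp (root P i) (root P j) + twistExp (root P j) (root P i)) +
      ((par P i * par P j : ℕ) + if A P i j = -1 then 1 else 0)) := by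
    rw [twistExp_add_swap_roots]; wlog hj : j.1 ≠ 0 generalizing i j
    · have hi : i.1 ≠ 0 := fun h => hij (Fin.ext (by omega)); have := this (Ne.symm hij) hi
      rw [sum_comm, mul_comm (par P j), A_symm j i] at this; grind [signMat_symm]
    have h1 : ∑ k, ∑ l, root P i k * signMat k.1 l.1 * root P j l =
        ∑ k, root P i k * signMat k.1 j := by
      refine sum_congr rfl fun k _ => ?_; rw [sum_eq_single (⟨j, hj⟩ : RootIdx P)]
      · simp [root, hj]
      · intro b _ hb; have : b.1 ≠ j := fun h' => hb (Subtype.ext h'); simp [root, hj, this]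
      · simp
    rw [h1, root_sum_signMat]; have hv : i.1 ≠ j.1 := fun h => hij (Fin.ext h)
    have b1 := P.one_le_m; have b2 := P.one_le_n; have b4 := j.isLt; have b5 := three_le P
    have b6 := P.m_ne_n; have hpar : (par P i * par P j : ℕ) =
        if (i.1 = 0 ∨ i.1 = P.m) ∧ (j.1 = 0 ∨ j.1 = P.m) then 1 else 0 := by
      unfold par IsOdd
      by_cases h1 : i.1 = 0 ∨ i.1 = P.m <;> by_cases h2 : j.1 = 0 ∨ j.1 = P.m <;>
        simp [h1, h2]
    rw [hpar, Int.even_iff]; by_cases hi : i.1 = 0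
    · have e1 := next_cases j; have e2 := prev_cases j; have e3 := next_cases i
      have e4 := next_cases (next P j)
      have f1 : (A P (next P j) j = -1 ∧ (next P j).1 ≠ 0 ∧ j.1 ≠ 0) ↔ j.1 + 1 ≤ P.m := by
        rw [A_eq_neg_one_iff (next_ne j)]; simp only [ext_iff, true_and]; omega
      have f2 : (A P (prev P j) j = -1 ∧ (prev P j).1 ≠ 0 ∧ j.1 ≠ 0) ↔
          2 ≤ j.1 ∧ j.1 ≤ P.m := by
        rw [A_eq_neg_one_iff (prev_ne j), next_prev]
        have : ¬ (prev P j = next P j) := ((next_ne_prev j).symm)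
        simp only [this, false_and, or_false, true_and, ne_eq]; omega
      have f3 : A P i j = -1 ↔ j.1 = 1 := by
        rw [A_eq_neg_one_iff hij]; simp only [ext_iff]; omega
      rw [if_pos hi, signMat_eq (next_ne j), signMat_eq (prev_ne j)]; simp only [f1, f2, f3]
      split_ifs <;> omega
    · rw [if_neg hi, signMat_eq hij]; by_cases hA : A P i j = -1
      · rw [if_pos hA, if_pos ⟨hA, hi, hj⟩, if_neg (by omega)]; rfl
      · rw [if_neg hA, if_neg (fun h => hA h.1), if_neg (by omega)]; rfl
  rw [twist_eq, twist_eq, ← zpow_add₀ (by norm_num), neg_one_zpow_eq_of_parity key,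
    zpow_add₀ (by norm_num), zpow_natCast]
  split_ifs <;> simp

lemma twist_mul_self (α β : RootIdx P → ℤ) : twist α β * twist α β = 1 := by
  rw [twist_eq, ← zpow_add₀ (by simp)]; grind [Even.neg_one_zpow]

end Diagram

/-! ### The vertex operators of the Fock space -/

lemma linS_cons {S : Type*} [CommRing S] (p) (l : List (S × S)) :
    linS (p :: l) = (PowerSeries.C p.1 - PowerSeries.C p.2 * PowerSeries.X) * linS l := by
  simp [linS]

lemma linS_nil {S : Type*} [CommRing S] : linS ([] : List (S × S)) = 1 := by
  simp [linS]

lemma expSeries_neg_powerSum (l : List ℂ) :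
    expSeries (fun r => -(l.map fun c => c ^ r / (r : ℂ)).sum) = linS (l.map fun c => (1, c)) := by
  induction l with
  | nil => grind [linS_nil, expSeries_zero]
  | cons c l ih =>
    rw [map_cons, linS_cons, ← ih, map_one, ← expSeries_log, ← expSeries_add]; grind

lemma linS_mul_expSeries {a} (num den : List ℂ) (h : ∀ r : ℕ, 0 < r → a r = (den.map fun c => c ^ r
    / (r : ℂ)).sum - (num.map fun c => c ^ r / (r : ℂ)).sum) : linS (den.map fun c => (1, c)) *
    expSeries a = linS (num.map fun c => (1, c)) := by
  rw [← expSeries_neg_powerSum, ← expSeries_neg_powerSum, ← expSeries_add]; ext n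
  grind [coeff_expSeries, expCoeff_congr]

lemma isRat_of_contr {Y : Type*} [Fintype Y] {X Z : Osc Y} (τ) {g : ℤ} (num den : List ℂ) (h : ∀ r,
    0 < r → Osc.contr X Z r = (den.map fun c => c ^ r / (r : ℂ)).sum - (num.map fun c => c ^ r / (r
    : ℂ)).sum) (hg : g + den.length = num.length) : IsRat g (PowerSeries.C τ * Osc.phi X Z) ⟨τ,
    num.map fun c => (1, c), den.map fun c => (1, c)⟩ := by
  refine ⟨?_, by simpa using hg⟩; rw [mul_left_comm, Osc.phi, linS_mul_expSeries num den h]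

section Letters

variable {P : Params}

/-- The sign `1` for `E`, `-1` for `F`. -/
def sg (b : Bool) : ℤ := if b then 1 else -1

lemma q_pow_ne_one (k : ℤ) (hk : k ≠ 0) : P.q ^ (2 * k) ≠ 1 := by
  intro h
  have := (P.generic 0 k 0).1 (by rw [zpow_zero, zpow_zero, one_mul, mul_one, ← h, zpow_mul]; rfl)
  grind

lemma qInt_ne_zero {r} (hr : r ≠ 0) : qInt P r ≠ 0 := by
  have h1 : ∀ k : ℤ, k ≠ 0 → P.q ^ k - P.q ^ (-k) ≠ 0 := by
    intro k hk h; apply q_pow_ne_one k hk; rw [two_mul, zpow_add₀ P.q_ne_zero]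
    nth_rewrite 2 [sub_eq_zero.1 h]; rw [← zpow_add₀ P.q_ne_zero, add_neg_cancel, zpow_zero]
  have h2 := h1 1 one_ne_zero; rw [zpow_neg, zpow_one] at h2; exact div_ne_zero (h1 r hr) h2

variable (P) in
lemma q_sub_ne_zero : P.q - P.q⁻¹ ≠ 0 := by
  intro h; apply q_pow_ne_one (P := P) 1 one_ne_zero; grind [P.q_ne_zero, zpow_two]

def kvec (i j : Idx P) : ℤ := (if j = i then 1 else 0) - (if next P j = i then 1 else 0)

lemma kvec_self (i : Idx P) : kvec i i = 1 := by
  rw [kvec, if_pos rfl, if_neg (next_ne i), sub_zero]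

lemma kvec_prev (i) : kvec i (prev P i) = -1 := by
  rw [kvec, if_neg (prev_ne i), if_pos (next_prev i), zero_sub]

lemma kvec_next_self (i) : kvec (next P i) i = -1 := by
  rw [kvec, if_neg (next_ne i).symm, if_pos rfl, zero_sub]

lemma kvec_eq_zero {i j} (h1 : j ≠ i) (h2 : next P j ≠ i) : kvec i j = 0 := by
  rw [kvec, if_neg h1, if_neg h2, sub_zero]

@[to_additive] lemma prod_charged {R : Type*} [CommMonoid R] (i) (f : CIdx P → R) (hf : ∀ j, j.1 ≠ i
    → next P j.1 ≠ i → f j = 1) : ∏ j, f j = (if h : P.m ≤ i.1 then f ⟨i, h⟩ else 1) * (if h : P.m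
    ≤ (prev P i).1 then f ⟨prev P i, h⟩ else 1) := by
  have h1 : ∏ j, f j = ∏ j, if h : P.m ≤ j.1 then f ⟨j, h⟩ else 1 := by
    rw [Finset.prod_dite]; simp; refine Finset.prod_bij' (fun j _ => ⟨j.1, by simpa using j.2⟩)
      (fun j _ => ⟨j.1, (mem_filter.1 j.2).2⟩) ?_ ?_ ?_ ?_ ?_ <;> simp
  rw [h1, Finset.prod_eq_mul i (prev P i) (prev_ne i).symm]
  · grind [eq_next_iff.1]
  · simp
  · simp

def dsc (i : Idx P) : ℤ := 2 * (P.m : ℤ) - if i.1 = 0 then ((P.m + P.n : ℕ) : ℤ) else i.1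

lemma dsc_next {i} (h : P.m ≤ i.1) : dsc (next P i) = dsc i - 1 := by
  have := next_cases i; have := P.one_le_m; unfold dsc; grind

/-- `q` or `q⁻¹`. -/
def qe (P : Params) (ε : Bool) : ℂ := if ε then P.q else P.q⁻¹

lemma qe_ne_zero (ε) : qe P ε ≠ 0 := by
  cases ε
  · exact inv_ne_zero P.q_ne_zero
  · exact P.q_ne_zero

def usc (b : Bool) (i : Idx P) (ε : Bool) (j : Idx P) : ℂ :=
  P.d ^ dsc i * if (if b then next P j else j) = i then qe P ε else 1

lemma usc_ne_zero (b i ε) (j : Idx P) : usc b i ε j ≠ 0 := by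
  refine mul_ne_zero (zpow_ne_zero _ P.d_ne_zero) ?_; grind [qe_ne_zero]

lemma usc_true_self (i : Idx P) (ε) : usc true i ε i = P.d ^ dsc i := by simp [usc, next_ne i]

lemma usc_true_prev (i ε) : usc true i ε (prev P i) = P.d ^ dsc i * qe P ε := by simp [usc, next_prev i]

lemma usc_false_self (i : Idx P) (ε) : usc false i ε i = P.d ^ dsc i * qe P ε := by
  simp [usc]

lemma usc_false_prev (i ε) : usc false i ε (prev P i) = P.d ^ dsc i := by simp [usc, prev_ne i]

/-- Whether the current contains a `q`-derivative. -/
def dpart (b : Bool) (i : Idx P) : Prop := if b then P.m ≤ (prev P i).1 else P.m ≤ i.1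

instance (b : Bool) (i : Idx P) : Decidable (dpart b i) := by unfold dpart; infer_instance

def vosc (b : Bool) (i : Idx P) (ε : Bool) : Osc (Boson P) where
  cr
    | .inl l, r => if l = i then (if b then P.q⁻¹ ^ (r : ℕ) else -1) / qInt P r else 0
    | .inr j, r => sg b * kvec i j.1 * usc b i ε j.1 ^ (r : ℕ) / qInt P r
  an
    | .inl l, r => (if b then -1 else P.q ^ (r : ℕ)) / qInt P r * heis P (.inl i) (.inl l) r
    | .inr j, r => -(sg b * kvec i j.1 * (usc b i ε j.1)⁻¹ ^ (r : ℕ) / qInt P r) *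
        heis P (.inr j) (.inr j) r

/-- The integer `⟨α_i + c-charges, Λ̃⟩`. -/
def lint (Λ : Weight P) (i : Idx P) : ℤ :=
  match Λ with
  | .fund i₀ _ => if i₀.1 < P.m then (if i = i₀ then 1 else 0) - (if i.1 = 0 then 1 else 0) else 0
  | .line _ => 0

/-- The vertex operators in `E_i` and `F_i`. -/
def vlet (Λ : Weight P) (b : Bool) (i : Idx P) (ε : Bool) : Letter (QLat P) (Boson P) where
  osc := vosc b i ε
  β := sg b • (root P i, fun j => kvec i j.1)
  ex α := 1 + sg b * (form P (root P i) α.1 + ∑ j, kvec i j.1 * α.2 j + lint Λ i) -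
    if dpart b i then 1 else 0
  σ α := (if b then twist (root P i) α.1 else twist (root P i) (α.1 - root P i)) *
    P.dHalf ^ (sg b * amForm i α.1) * ∏ j : CIdx P, usc b i ε j.1 ^ (sg b * kvec i j.1 * α.2 j)

def klet (Λ : Weight P) (b : Bool) (i : Idx P) : Letter (QLat P) (Boson P) where
  osc :=
    { cr := fun y _ => if b then 0 else if y = .inl i then -(P.q - P.q⁻¹) else 0
      an := fun y r => if b then (P.q - P.q⁻¹) * heis P (.inl i) y r else 0 }
  β := 0
  ex _ := 0
  σ α := exp (sg b * rootPair Λ i α * P.logq)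

/-- The labels of the vertex operators. -/
inductive Lab (P : Params)
  | V (b : Bool) (i : Idx P) (ε : Bool)
  | K (b : Bool) (i : Idx P)

/-- The vertex operator with a given label. -/
def llet (Λ : Weight P) : Lab P → Letter (QLat P) (Boson P)
  | .V b i ε => vlet Λ b i ε
  | .K b i => klet Λ b i

/-- The exponents of the contractions. -/
def lg : Lab P → Lab P → ℤ
  | .V b i _, .V b' i' _ => sg b * sg b' * (A P i i' + ∑ j : CIdx P, kvec i j.1 * kvec i' j.1)
  | _, _ => 0

/-- The constants of the contractions. -/
def lt : Lab P → Lab P → ℂ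
  | .V b i ε, .V b' i' _ => twist (root P i) (root P i') *
      P.dHalf ^ (sg b * sg b' * (A P i i' * M P i i')) *
      ∏ j : CIdx P, usc b i ε j.1 ^ (sg b * sg b' * (kvec i j.1 * kvec i' j.1))
  | .K b i, .V b' i' _ => P.q ^ (sg b * sg b' * A P i i')
  | _, .K _ _ => 1

variable (P) in
lemma dHalf_ne_zero : P.dHalf ≠ 0 := by grind [P.dHalf_sq, P.d_ne_zero]

lemma twist_add_zsmul (β α α' : RootIdx P → ℤ) (b) :
    twist β (α + sg b • α') = twist β α * twist β α' := by
  rw [twist_eq, twist_eq, twist_eq, ← zpow_add₀ (by simp)]; apply neg_one_zpow_eq_of_parity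
  rw [twistExp_add_right, twistExp_zsmul_right]; cases b
  · simp [sg]; grind
  · simp [sg]

lemma exp_int_mul_logq (k : ℤ) : exp (k * P.logq) = P.q ^ k := by
  rw [exp_int_mul, P.exp_logq]

lemma compat_llet (Λ) {ι : Type*} (f : ι → Lab P) : Letter.Compat (fun i => llet Λ (f i)) (fun i j
    => lg (f i) (f j)) (fun i j => lt (f i) (f j)) := by
  constructor
  · intro x y α; rcases f x with ⟨b, i, ε⟩ | ⟨b, i⟩ <;> rcases f y with ⟨b', i', ε'⟩ | ⟨b', i'⟩
    · simp only [llet, vlet, lg, fst_add, smul_fst, form_add_right, form_zsmul_right,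
        form_root_root, snd_add, smul_snd, Pi.add_apply, Pi.smul_apply, smul_eq_mul,
        mul_add, sum_add_distrib]
      have : ∑ j : CIdx P, kvec i j.1 * (sg b' * kvec i' j.1) = sg b' * ∑ j : CIdx P, kvec i j.1 *
        kvec i' j.1 := by rw [mul_sum]; exact sum_congr rfl fun _ _ => by ring
      grind
    · simp [llet, vlet, klet, lg]
    · simp [llet, klet, lg]
    · simp [llet, klet, lg]
  · intro x y α; rcases f x with ⟨b, i, ε⟩ | ⟨b, i⟩ <;> rcases f y with ⟨b', i', ε'⟩ | ⟨b', i'⟩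
    · have h1 : ∏ j, usc b i ε j.1 ^ (sg b * kvec i j.1 * (α.2 j + sg b' * kvec i' j.1)) =
          (∏ j, usc b i ε j.1 ^ (sg b * kvec i j.1 * α.2 j)) *
          ∏ j : CIdx P, usc b i ε j.1 ^ (sg b * sg b' * (kvec i j.1 * kvec i' j.1)) := by
        rw [← prod_mul_distrib]; refine prod_congr rfl fun j _ => ?_
        rw [← zpow_add₀ (usc_ne_zero _ _ _ _)]; congr 1; ring
      have h2 : sg b * (amForm i α.1 + sg b' * (A P i i' * M P i i')) =
          sg b * amForm i α.1 + sg b * sg b' * (A P i i' * M P i i') := by ring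
      simp only [llet, vlet, lt, fst_add, smul_fst, amForm_add, amForm_zsmul,
        amForm_root, snd_add, smul_snd, Pi.add_apply, Pi.smul_apply, smul_eq_mul,
        add_sub_right_comm, twist_add_zsmul, h1, h2, zpow_add₀ (dHalf_ne_zero P)]
      split_ifs <;> ring
    · simp [llet, vlet, klet, lt]
    · simp only [llet, klet, vlet, lt, rootPair, fst_add, smul_fst, form_add_right,
        form_zsmul_right, form_root_root]
      rw [← exp_int_mul_logq, ← exp_add]; congr 1; push_cast; ring
    · simp [llet, klet, lt]

end Letters

/-! ### Contractions -/

lemma sg_mul_self (b) : sg b * sg b = 1 := by cases b <;> rfl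

def losc : Lab P → Osc (Boson P)
  | .V b i ε => vosc b i ε
  | .K b i =>
    { cr := fun y _ => if b then 0 else if y = .inl i then -(P.q - P.q⁻¹) else 0
      an := fun y r => if b then (P.q - P.q⁻¹) * heis P (.inl i) y r else 0 }

lemma llet_osc (Λ) (x : Lab P) : (llet Λ x).osc = losc x := by cases x <;> rfl

def LRat (x y : Lab P) (r : Rat2 ℂ) : Prop :=
  IsRat (lg x y) (PowerSeries.C (lt x y) * Osc.phi (losc x) (losc y)) r

lemma LRat.pairData {ι : Type*} {Λ} {f : ι → Lab P} {i j} {r} (h : LRat (f i) (f j) r) : IsRat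
    ((Letter.pairData (fun i => llet Λ (f i)) (fun i j => lg (f i) (f j)) (fun i j => lt (f i) (f
    j))).g i j) ((Letter.pairData (fun i => llet Λ (f i)) (fun i j => lg (f i) (f j)) (fun i j => lt
    (f i) (f j))).φ i j) r := by
  simp [Letter.pairData, llet_osc]; exact h

/-- The parameter `q⁻¹` for `E`, `q` for `F`. -/
def xb (P : Params) (b : Bool) : ℂ := if b then P.q⁻¹ else P.q

lemma xb_ne_zero (b) : xb P b ≠ 0 := by
  cases b
  · exact P.q_ne_zero
  · exact inv_ne_zero P.q_ne_zero

lemma contr_vosc (b b') (i i') (ε ε') {r} (hr : 0 < r) : Osc.contr (vosc b i ε) (vosc b' i' ε') r =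
    -(sg b * sg b') * (qInt P (r * A P i i') / qInt P r * (P.d ^ (-M P i i') * if b = b' then xb P b
    else 1) ^ r / r + ∑ j : CIdx P, (kvec i j.1 * kvec i' j.1) * (usc b' i' ε' j.1 / usc b i ε j.1)
    ^ r / r) := by
  have hq : qInt P r ≠ 0 := qInt_ne_zero (by exact_mod_cast hr.ne')
  have hr' : r ≠ 0 := by exact_mod_cast hr.ne'
  have hp : (r.toPNat' : ℕ+) = r := by simp_all
  rw [Osc.contr, sum_sum_type, mul_add, mul_sum]; congr 1
  · rw [sum_eq_single i']
    · simp only [vosc, heis, if_true, hp]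
      have e1 : P.d ^ (-(r * M P i i')) = (P.d ^ (-M P i i')) ^ r := by
        rw [← zpow_natCast, ← zpow_mul]; congr 1; ring
      rw [e1, mul_pow]
      cases b <;> cases b' <;> simp only [sg, xb, if_true, if_false, false_eq_true,
        reduceCtorEq, one_pow, inv_pow] <;> · grind [pow_ne_zero, P.q_ne_zero]
    · intro l _ hl; simp [vosc, hl]
    · simp
  · refine sum_congr rfl fun j _ => ?_; simp only [vosc, heis, if_true, hp]
    have h1 := pow_ne_zero r (usc_ne_zero b i ε j.1); rw [div_pow, inv_pow]; field_simp

lemma qInt_neg (k) : qInt P (-k) = -qInt P k := by grind [qInt]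

lemma qInt_two_mul (r : ℕ) (hr : 0 < r) : qInt P (r * 2) / qInt P r = P.q ^ r + (P.q⁻¹) ^ r := by
  rw [div_eq_iff (qInt_ne_zero (by exact_mod_cast hr.ne'))]; unfold qInt
  rw [mul_two, neg_add, zpow_add₀ P.q_ne_zero, zpow_add₀ P.q_ne_zero, zpow_neg, zpow_natCast,
    inv_pow]
  ring

lemma qInt_two_mul_xb (b) (r : ℕ) (hr : 0 < r) :
    qInt P (r * 2) / qInt P r * (P.d ^ (-0 : ℤ) * xb P b) ^ r = 1 + (xb P b ^ 2) ^ r := by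
  have h1 := pow_ne_zero r P.q_ne_zero
  rw [qInt_two_mul r hr, neg_zero, zpow_zero, one_mul, ← pow_mul, mul_comm 2 r, pow_mul, pow_two]
  cases b
  · simp [xb]; grind
  · simp [xb]; field_simp

lemma kvec_sum_self (i) : ∑ j : CIdx P, kvec i j.1 * kvec i j.1 =
    (if P.m ≤ i.1 then 1 else 0) + (if P.m ≤ (prev P i).1 then 1 else 0) := by
  rw [sum_charged i]
  · simp [kvec_self, kvec_prev]
  · grind [kvec_eq_zero]

lemma charged_next {i} (j) (h1 : j ≠ i) : kvec i j * kvec (next P i) j = 0 := by grind [kvec_eq_zero, next_next_ne]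

lemma charged_far {i i'} (h1 : i ≠ i') (h2 : i' ≠ next P i) (h3 : i ≠ next P i')
    (j) : kvec i j * kvec i' j = 0 := by grind [kvec_eq_zero]

@[to_additive]
lemma prod_charged_next {R : Type*} [CommMonoid R] (i) (f : CIdx P → R)
    (hf : ∀ j, j.1 ≠ i → f j = 1) :
    ∏ j, f j = if h : P.m ≤ i.1 then f ⟨i, h⟩ else 1 := by grind [prod_charged, prev_ne]

lemma prev_ge_iff (i) : P.m ≤ (prev P i).1 ↔ i.1 = 0 ∨ P.m < i.1 := by grind [prev_cases, P.one_le_n]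

def lamb (b : Bool) (i : Idx P) (ε : Bool) : ℂ := if dpart b i then qe P ε else 1

lemma lamb_true (i ε) :
    lamb true i ε = if P.m ≤ (prev P i).1 then qe P ε else 1 := by simp [lamb, dpart]

lemma lamb_false (i : Idx P) (ε) :
    lamb false i ε = if P.m ≤ i.1 then qe P ε else 1 := by simp [lamb, dpart]

lemma lamb_ne_zero (b) (i : Idx P) (ε) : lamb b i ε ≠ 0 := by
  unfold lamb; split_ifs
  · grind [qe_ne_zero]
  · simp

lemma IsRat.rescale {S : Type*} [CommRing S] {g φ c u a} {num den : List (S × S)} (h : IsRat g φ ⟨c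
    * u, (1, a) :: num, den⟩) : IsRat g φ ⟨c, (u, u * a) :: num, den⟩ := by
  refine ⟨?_, h.2⟩; have := h.1; grind [linS_cons]

lemma A_pos {i} (h0 : i.1 ≠ 0) (h : i.1 < P.m) : A P i i = 2 := by
  rw [A, if_pos rfl, if_neg (by unfold IsOdd; omega), if_pos h]

lemma A_neg {i} (h : P.m < i.1) : A P i i = -2 := by
  rw [A, if_pos rfl, if_neg (by unfold IsOdd; omega), if_neg (by omega)]

lemma A_odd {i} (h : IsOdd P i) : A P i i = 0 := by
  rw [A, if_pos rfl, if_pos h]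

lemma qInt_zero : qInt P 0 = 0 := by simp [qInt]

lemma rat_self_pos (b) {i} (h0 : i.1 ≠ 0) (h : i.1 < P.m) (ε ε') :
    LRat (.V b i ε) (.V b i ε') ⟨twist (root P i) (root P i), [(1, 1), (1, xb P b ^ 2)], []⟩ := by
  have hp : ¬ P.m ≤ (prev P i).1 := by grind [prev_ge_iff]
  have hlt : lt (.V b i ε) (.V b i ε') = twist (root P i) (root P i) := by
    rw [lt, M_self, mul_zero, mul_zero, zpow_zero, prod_charged i, dif_neg (by omega), dif_neg hp]
    · ring
    · grind [kvec_eq_zero, zero_mul, mul_zero, zpow_zero]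
  have := isRat_of_contr (X := losc (.V b i ε)) (Z := losc (.V b i ε')) (lt (.V b i ε) (.V b i ε'))
    (g := lg (.V b i ε) (.V b i ε')) [1, xb P b ^ 2] [] ?_ ?_
  · rw [hlt] at this; unfold LRat; grind
  · intro r hr; simp only [losc]
    rw [contr_vosc _ _ _ _ _ _ hr, A_pos h0 h, sum_charged i, dif_neg (by omega),
      dif_neg hp, M_self, if_pos rfl, qInt_two_mul_xb b r hr]
    · have e1 : (sg b * sg b : ℂ) = 1 := by exact_mod_cast sg_mul_self b
      rw [e1]; simp only [map_cons, map_nil, sum_cons, sum_nil, one_pow]; ring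
    · intro j h1 h2; rw [kvec_eq_zero h1 h2]; simp
  · rw [lg, A_pos h0 h, kvec_sum_self, if_neg (by omega), if_neg hp, sg_mul_self]; rfl

lemma rat_self_neg (b) {i} (h : P.m < i.1) (ε ε') : LRat (.V b i ε) (.V b i ε') ⟨twist (root P i)
    (root P i) * (P.d ^ dsc i) ^ 2, [(qe P ε, qe P ε')], [(1, xb P b ^ 2)]⟩ := by
  have hp : P.m ≤ (prev P i).1 := by grind [prev_ge_iff]
  have hlt : lt (.V b i ε) (.V b i ε') =
      twist (root P i) (root P i) * (P.d ^ dsc i) ^ 2 * qe P ε := by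
    rw [lt, M_self, mul_zero, mul_zero, zpow_zero, prod_charged i, dif_pos (by omega), dif_pos hp,
      sg_mul_self]
    · simp only [kvec_self, kvec_prev, mul_neg, neg_neg, mul_one, zpow_one]; cases b
      · grind [usc_false_self, usc_false_prev]
      · grind [usc_true_self, usc_true_prev]
    · intro j h1 h2; rw [kvec_eq_zero h1 h2, zero_mul, mul_zero, zpow_zero]
  have := isRat_of_contr (X := losc (.V b i ε)) (Z := losc (.V b i ε')) (lt (.V b i ε) (.V b i ε'))
    (g := lg (.V b i ε) (.V b i ε')) [qe P ε' / qe P ε] [xb P b ^ 2] ?_ ?_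
  · rw [hlt] at this; unfold LRat; rw [hlt]; have := this.rescale
    rwa [mul_div_cancel₀ _ (qe_ne_zero ε)] at this
  · intro r hr; simp only [losc]
    rw [contr_vosc _ _ _ _ _ _ hr, A_neg h, mul_neg, qInt_neg, neg_div, sum_charged i, dif_pos (by
      omega), dif_pos hp, M_self, if_pos rfl, neg_mul (qInt P _ / _), qInt_two_mul_xb b r hr]
    · have e1 : (sg b * sg b : ℂ) = 1 := by exact_mod_cast sg_mul_self b
      rw [e1]; have h2 : P.d ^ dsc i ≠ 0 := zpow_ne_zero _ P.d_ne_zero; cases b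
      · simp only [kvec_self, kvec_prev, usc_false_self, usc_false_prev,
          mul_div_mul_left _ _ h2, div_self h2]
        simp only [map_cons, map_nil, sum_cons, sum_nil, one_pow]; push_cast
        ring
      · simp only [kvec_self, kvec_prev, usc_true_self, usc_true_prev,
          mul_div_mul_left _ _ h2, div_self h2]
        simp only [map_cons, map_nil, sum_cons, sum_nil, one_pow]; push_cast
        ring
    · intro j h1 h2; rw [kvec_eq_zero h1 h2]; simp
  · rw [lg, A_neg h, kvec_sum_self, if_pos (by omega), if_pos hp, sg_mul_self]; rfl

lemma rat_self_odd (b) {i} (h : IsOdd P i) (ε ε') : LRat (.V b i ε) (.V b i ε') ⟨twist (root P i)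
    (root P i) * P.d ^ dsc i, [(lamb b i ε, lamb b i ε')], []⟩ := by
  have hm := P.one_le_m; have hn := P.one_le_n
  have h2 : P.d ^ dsc i ≠ 0 := zpow_ne_zero _ P.d_ne_zero
  have hcase : (P.m ≤ i.1 ∧ ¬ P.m ≤ (prev P i).1) ∨ (¬ P.m ≤ i.1 ∧ P.m ≤ (prev P i).1) := by
    rw [prev_ge_iff]; unfold IsOdd at h; omega
  have hlt : lt (.V b i ε) (.V b i ε') =
      twist (root P i) (root P i) * P.d ^ dsc i * lamb b i ε := by
    rw [lt, M_self, mul_zero, mul_zero, zpow_zero, prod_charged i, sg_mul_self]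
    · rcases hcase with ⟨c1, c2⟩ | ⟨c1, c2⟩
      · rw [dif_pos c1, dif_neg c2]; simp only [kvec_self, mul_one, zpow_one]; cases b
        · grind [usc_false_self, lamb_false]
        · simp [usc_true_self, lamb_true, if_neg c2]
      · rw [dif_neg c1, dif_pos c2]; simp only [kvec_prev, mul_neg, neg_neg, mul_one, zpow_one]
        cases b
        · rw [usc_false_prev, lamb_false, if_neg c1]; ring
        · rw [usc_true_prev, lamb_true, if_pos c2]; ring
    · intro j h1 h2; rw [kvec_eq_zero h1 h2, zero_mul, mul_zero, zpow_zero]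
  have := isRat_of_contr (X := losc (.V b i ε)) (Z := losc (.V b i ε')) (lt (.V b i ε) (.V b i ε'))
    (g := lg (.V b i ε) (.V b i ε')) [lamb b i ε' / lamb b i ε] [] ?_ ?_
  · rw [hlt] at this; unfold LRat; rw [hlt]; have := this.rescale
    rwa [mul_div_cancel₀ _ (lamb_ne_zero _ _ _)] at this
  · intro r hr; simp only [losc]
    rw [contr_vosc _ _ _ _ _ _ hr, A_odd h, mul_zero, qInt_zero, zero_div, sum_charged i]
    · have e1 : (sg b * sg b : ℂ) = 1 := by exact_mod_cast sg_mul_self b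
      rw [e1]; rcases hcase with ⟨c1, c2⟩ | ⟨c1, c2⟩
      · rw [dif_pos c1, dif_neg c2]; cases b
        · simp only [kvec_self, usc_false_self, mul_div_mul_left _ _ h2]; simp [lamb, dpart, c1]
        · simp only [kvec_self, usc_true_self, div_self h2]; simp [lamb, dpart, c2]
      · rw [dif_neg c1, dif_pos c2]; cases b
        · simp only [kvec_prev, usc_false_prev, div_self h2]; simp [lamb, dpart, c1]
        · simp only [kvec_prev, usc_true_prev, mul_div_mul_left _ _ h2]; simp [lamb, dpart, c2]
    · intro j h1 h2; rw [kvec_eq_zero h1 h2]; simp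
  · rw [lg, A_odd h, kvec_sum_self, sg_mul_self]; rcases hcase with ⟨c1, c2⟩ | ⟨c1, c2⟩
    · rw [if_pos c1, if_neg c2]; rfl
    · rw [if_neg c1, if_pos c2]; rfl

/-! ### Contractions of neighbours -/

lemma edge_next_of_lt {i} (h : i.1 < P.m) : edge P (next P i) = -1 := by grind [next_cases, P.one_le_n, edge_eq_neg_one_iff]

lemma edge_next_of_le {i} (h : P.m ≤ i.1) : edge P (next P i) = 1 := by
  have := next_cases i; have := P.one_le_n; rw [edge, if_neg]; omega

lemma sgc_mul_self (b) : (sg b * sg b : ℂ) = 1 := by exact_mod_cast sg_mul_self b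

lemma sg_mul_ne {b b'} (h : b ≠ b') : sg b * sg b' = -1 := by
  cases b <;> cases b' <;> simp_all [sg]

def hx (P : Params) (b b' : Bool) : ℂ := if b = b' then xb P b else 1

lemma hx_comm (b b') : hx P b b' = hx P b' b := by
  cases b <;> cases b' <;> rfl

lemma contr_next (b b' i ε ε') {r} (hr : 0 < r) : Osc.contr (vosc b i ε) (vosc b' (next P i) ε') r =
    -(sg b * sg b') * (if P.m ≤ i.1 then (P.d⁻¹ * hx P b b') ^ r / r - (usc b' (next P i) ε' i /
    usc b i ε i) ^ r / r else -((P.d * hx P b b') ^ r / r)) := by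
  have hq : qInt P r ≠ 0 := qInt_ne_zero (by exact_mod_cast hr.ne')
  rw [contr_vosc _ _ _ _ _ _ hr, A_next, M_next, sum_charged_next i]
  · congr 1; by_cases h : P.m ≤ i.1
    · rw [dif_pos h, if_pos h, edge_next_of_le h, mul_one, div_self hq, kvec_self, kvec_next_self,
        zpow_neg, zpow_one, hx]
      grind
    · rw [dif_neg h, if_neg h, edge_next_of_lt (by omega), mul_neg, mul_one, qInt_neg, neg_div,
        div_self hq, neg_neg, zpow_one, hx]
      ring
  · intro j hj
    have : (kvec i j.1 * kvec (next P i) j.1 : ℂ) = 0 := by exact_mod_cast charged_next j.1 hj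
    grind

lemma contr_next_swap (b b' i ε ε') {r} (hr : 0 < r) : Osc.contr (vosc b' (next P i) ε') (vosc b i
    ε) r = -(sg b * sg b') * (if P.m ≤ i.1 then (P.d * hx P b b') ^ r / r - (usc b i ε i / usc b'
    (next P i) ε' i) ^ r / r else -((P.d⁻¹ * hx P b b') ^ r / r)) := by
  have hq : qInt P r ≠ 0 := qInt_ne_zero (by exact_mod_cast hr.ne')
  rw [contr_vosc _ _ _ _ _ _ hr, A_next_left, M_next_left, sum_charged_next i, hx_comm,
    mul_comm (sg b : ℂ)]
  · congr 1; by_cases h : P.m ≤ i.1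
    · rw [dif_pos h, if_pos h, edge_next_of_le h, mul_one, div_self hq, kvec_self, kvec_next_self,
        neg_neg, zpow_one, hx]
      grind
    · rw [dif_neg h, if_neg h, edge_next_of_lt (by omega), mul_neg, mul_one, qInt_neg, neg_div,
        div_self hq, neg_neg, zpow_neg, zpow_one, hx]
      ring
  · intro j hj; have : (kvec (next P i) j.1 * kvec i j.1 : ℂ) = 0 := by
      rw [mul_comm]; exact_mod_cast charged_next j.1 hj
    grind

lemma lg_next (b b' i ε ε') :
    lg (.V b i ε) (.V b' (next P i) ε') = if P.m ≤ i.1 then 0 else -(sg b * sg b') := by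
  rw [lg, A_next, sum_charged_next i (fun j => kvec i j.1 * kvec (next P i) j.1)
    fun j hj => charged_next j.1 hj]
  by_cases h : P.m ≤ i.1
  · simp [if_pos h, edge_next_of_le h, kvec_self, kvec_next_self]
  · rw [dif_neg h, if_neg h, edge_next_of_lt (by omega)]; ring

lemma lg_next_swap (b b' i ε ε') :
    lg (.V b' (next P i) ε') (.V b i ε) = if P.m ≤ i.1 then 0 else -(sg b * sg b') := by
  rw [← lg_next b b' i ε ε', lg, lg, A_symm, mul_comm (sg b)]; grind

lemma lt_next (b b' i ε ε') : lt (.V b i ε) (.V b' (next P i) ε') = twist (root P i) (root P (next P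
    i)) * P.dHalf ^ (sg b * sg b') * if P.m ≤ i.1 then usc b i ε i ^ (-(sg b * sg b')) else 1
    := by
  rw [lt, A_next, M_next, edge_sq, mul_one, prod_charged_next i]
  · by_cases h : P.m ≤ i.1
    · simp [if_pos h, kvec_self, kvec_next_self]
    · grind
  · grind [charged_next, zpow_zero]

lemma lt_next_swap (b b' i ε ε') : lt (.V b' (next P i) ε') (.V b i ε) = twist (root P (next P i))
    (root P i) * P.dHalf ^ (-(sg b * sg b')) * if P.m ≤ i.1 then usc b' (next P i) ε' i ^ (-(sg b
    * sg b')) else 1 := by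
  rw [lt, A_next_left, M_next_left, mul_neg, edge_sq, prod_charged_next i]
  · have e : sg b' * sg b * -1 = -(sg b * sg b') := by ring
    rw [e]; by_cases h : P.m ≤ i.1
    · rw [dif_pos h, if_pos h, kvec_self, kvec_next_self]; congr 2
    · grind
  · grind [charged_next, zpow_zero]

/-- The sign `(-1)^{|i||j|}`. -/
def psgn (i j : Idx P) : ℂ := (-1) ^ (par P i * par P j)

lemma psgn_comm (i j : Idx P) : psgn i j = psgn j i := by rw [psgn, psgn, mul_comm]

lemma twist_swap {i j} (hij : i ≠ j) : twist (root P j) (root P i) =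
    psgn i j * (if A P i j = -1 then -1 else 1) * twist (root P i) (root P j) := by
  rw [psgn, ← twist_mul_swap hij, mul_right_comm, twist_mul_self, one_mul]

lemma twist_next_of_lt {i} (h : i.1 < P.m) : twist (root P (next P i)) (root P i) =
    -psgn i (next P i) * twist (root P i) (root P (next P i)) := by simp [twist_swap (next_ne i).symm, A_next, if_pos (edge_next_of_lt h)]

lemma twist_next_of_le {i} (h : P.m ≤ i.1) : twist (root P (next P i)) (root P i) =
    psgn i (next P i) * twist (root P i) (root P (next P i)) := by grind [twist_swap, next_ne, A_next, edge_next_of_le]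

lemma dHalf_inv : P.dHalf⁻¹ = P.dHalf * P.d⁻¹ := by grind [P.dHalf_sq]

lemma rat_negEdge (b) {i} (h : i.1 < P.m) (ε ε') : ∃ κ : ℂ, LRat (.V b i ε) (.V b (next P i) ε')
    ⟨κ, [], [(1, xb P b * P.d)]⟩ ∧ LRat (.V b (next P i) ε') (.V b i ε) ⟨-κ * psgn i (next P i) *
    P.d⁻¹, [], [(1, xb P b * P.d⁻¹)]⟩ := by
  have hm : ¬ P.m ≤ i.1 := by omega
  refine ⟨lt (.V b i ε) (.V b (next P i) ε'), ?_, ?_⟩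
  · refine isRat_of_contr _ [] [xb P b * P.d] (fun r hr => ?_) ?_
    · simp [losc, contr_next _ _ _ _ _ hr, if_neg hm, sgc_mul_self, hx, mul_comm]
    · simp [lg_next, if_neg hm, sg_mul_self]
  · have hlt : lt (.V b (next P i) ε') (.V b i ε) =
        -lt (.V b i ε) (.V b (next P i) ε') * psgn i (next P i) * P.d⁻¹ := by
      rw [lt_next, lt_next_swap, if_neg hm, if_neg hm, sg_mul_self, twist_next_of_lt h, zpow_neg,
        zpow_one, dHalf_inv]
      ring
    rw [← hlt]; refine isRat_of_contr _ [] [xb P b * P.d⁻¹] (fun r hr => ?_) ?_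
    · simp [losc, contr_next_swap _ _ _ _ _ hr, if_neg hm, sgc_mul_self, hx, if_pos rfl, mul_comm]
    · simp [lg_next_swap, if_neg hm, sg_mul_self]

lemma usc_next_ratio (b) {i} (h : P.m ≤ i.1) (ε ε') : usc b (next P i) ε' i / usc b i ε i = P.d⁻¹
    * if (if b then ε' else ε) then (xb P b)⁻¹ else xb P b := by
  have h2 : P.d ^ dsc i ≠ 0 := zpow_ne_zero _ P.d_ne_zero; have h4 := P.q_ne_zero
  have e : P.d ^ dsc (next P i) = P.d⁻¹ * P.d ^ dsc i := by
    rw [dsc_next h, sub_eq_add_neg, zpow_add₀ P.d_ne_zero, zpow_neg_one, mul_comm]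
  cases b
  · have := usc_false_prev (next P i) ε'; rw [prev_next] at this; rw [this, usc_false_self, e]
    cases ε <;> simp [xb, qe] <;> field_simp
  · have := usc_true_prev (next P i) ε'; rw [prev_next] at this; rw [this, usc_true_self, e]
    cases ε' <;> simp [xb, qe] <;> field_simp

lemma rat_posEdge (b : Bool) {i} (h : P.m ≤ i.1) (ε ε') : ∃ κ : ℂ, ((if b then ε' else ε) = false
    → LRat (.V b i ε) (.V b (next P i) ε') ⟨κ, [], []⟩ ∧ LRat (.V b (next P i) ε') (.V b i ε) ⟨κ *
    psgn i (next P i) * (xb P b)⁻¹, [(1, xb P b * P.d)], [(1, (xb P b)⁻¹ * P.d)]⟩) ∧ ((if b then ε'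
    else ε) = true → LRat (.V b i ε) (.V b (next P i) ε') ⟨κ * (xb P b)⁻¹, [(1, xb P b * P.d⁻¹)],
    [(1, (xb P b)⁻¹ * P.d⁻¹)]⟩ ∧ LRat (.V b (next P i) ε') (.V b i ε) ⟨κ * psgn i (next P i), [],
    []⟩) := by
  have hr := usc_next_ratio b h ε ε'; have hr' : usc b i ε i / usc b (next P i) ε' i =
      P.d * if (if b then ε' else ε) then xb P b else (xb P b)⁻¹ := by grind
  have h3 := P.d_ne_zero; have h5 := usc_ne_zero b i ε i; have h6 := usc_ne_zero b (next P i) ε' i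
  have hlt : lt (.V b (next P i) ε') (.V b i ε) = lt (.V b i ε) (.V b (next P i) ε') *
      psgn i (next P i) * if (if b then ε' else ε) then xb P b else (xb P b)⁻¹ := by
    rw [lt_next, lt_next_swap, if_pos h, if_pos h, sg_mul_self, twist_next_of_le h, zpow_neg,
      zpow_neg, zpow_neg, zpow_one, zpow_one, zpow_one, dHalf_inv]
    grind
  have hg : lg (.V b i ε) (.V b (next P i) ε') = 0 := by grind [lg_next]
  have hg' : lg (.V b (next P i) ε') (.V b i ε) = 0 := by rw [lg_next_swap, if_pos h]
  refine ⟨lt (.V b i ε) (.V b (next P i) ε') * if (if b then ε' else ε) then xb P b else 1,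
    fun hε => ?_, fun hε => ?_⟩
  · rw [hε] at hr hr' hlt ⊢; simp only [false_eq_true, if_false, mul_one] at hr hr' hlt ⊢
    rw [← hlt]; constructor
    · refine isRat_of_contr _ [] [] (fun r hr0 => ?_) (by rw [hg]; rfl); simp only [losc,
        contr_next _ _ _ _ _ hr0, if_pos h, hr, hx, if_pos rfl]; simp
    · refine isRat_of_contr _ [xb P b * P.d] [(xb P b)⁻¹ * P.d] (fun r hr0 => ?_) (by rw [hg']; rfl)
      simp only [losc]
      rw [contr_next_swap _ _ _ _ _ hr0, if_pos h, hr', hx, if_pos rfl, sgc_mul_self]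
      simp only [map_cons, map_nil, sum_cons, sum_nil]
      rw [mul_comm P.d, mul_comm P.d]; ring
  · rw [hε] at hr hr' hlt ⊢; simp only [if_true] at hr hr' hlt ⊢
    rw [mul_inv_cancel_right₀ (xb_ne_zero (P := P) b), mul_right_comm, ← hlt]; constructor
    · refine isRat_of_contr _ [xb P b * P.d⁻¹] [(xb P b)⁻¹ * P.d⁻¹] (fun r hr0 => ?_)
        (by rw [hg]; rfl)
      simp only [losc]; rw [contr_next _ _ _ _ _ hr0, if_pos h, hr, hx, if_pos rfl, sgc_mul_self]
      simp only [map_cons, map_nil, sum_cons, sum_nil]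
      rw [mul_comm P.d⁻¹, mul_comm P.d⁻¹]; ring
    · refine isRat_of_contr _ [] [] (fun r hr0 => ?_) (by rw [hg']; rfl); simp only [losc,
        contr_next_swap _ _ _ _ _ hr0, if_pos h, hr', hx, if_pos rfl]; simp

lemma rat_far (b b') {i i'} (h1 : i ≠ i') (h2 : i' ≠ next P i) (h3 : i ≠ next P i') (ε ε') : LRat
    (.V b i ε) (.V b' i' ε') ⟨twist (root P i) (root P i'), [], []⟩ := by
  have hA := A_far h1 h2 h3
  have hlt : lt (.V b i ε) (.V b' i' ε') = twist (root P i) (root P i') := by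
    rw [lt, hA, M_far h2 h3]
    simp [charged_far h1 h2 h3, mul_zero, zpow_zero, Finset.prod_const_one, mul_one]
  rw [← hlt]; refine isRat_of_contr _ [] [] (fun r hr => ?_) ?_
  · simp only [losc]; rw [contr_vosc _ _ _ _ _ _ hr, hA, mul_zero, qInt_zero]
    have : ∀ j : CIdx P, (kvec i j.1 * kvec i' j.1 : ℂ) = 0 := fun j => by
      exact_mod_cast charged_far h1 h2 h3 j.1
    simp [this]
  · rw [lg, hA]; simp [charged_far h1 h2 h3]

lemma twist_far {i i'} (h1 : i ≠ i') (h2 : i' ≠ next P i) (h3 : i ≠ next P i') :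
    twist (root P i') (root P i) = psgn i i' * twist (root P i) (root P i') := by grind [twist_swap, A_far]

/-! ### Two-point relations -/

section TwoPoint

open PowerSeries (C X)

lemma linS_mul_left_cancel {S : Type*} [CommRing S] {c} {f g : PowerSeries S}
    (h : (C 1 - C c * X) * f = (C 1 - C c * X) * g) : f = g := by grind [geom_mul]

lemma IsRat.mul_lf {S : Type*} [CommRing S] {g} {φ} {κ} {num den} (h : IsRat g φ ⟨κ, num, den⟩) (a b
    : S) : IsRat (g + 1) ((C a - C b * X) * φ) ⟨κ, (a, b) :: num, den⟩ := by
  constructor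
  · have := h.1; grind [linS_cons]
  · have := h.2; grind

lemma IsRat.cancel {S : Type*} [CommRing S] {g φ κ u c} {num den : List (S × S)} (h : IsRat g φ ⟨κ,
    (u, u * c) :: num, (1, c) :: den⟩) : IsRat g φ ⟨κ * u, num, den⟩ := by
  refine ⟨?_, ?_⟩
  · have := h.1; simp only [linS_cons] at this ⊢; refine linS_mul_left_cancel (c := c) ?_; grind
  · have := h.2; grind

lemma IsRat.rop_eq {ι S W : Type*} [DecidableEq ι] [CommRing S] [AddCommGroup W] [Module S W] {g φ κ
    num} (hr : IsRat g φ ⟨κ, num, []⟩) {h i j} (hij : Lt h i j) {n : (ι → ℤ) → W} (hn : Bd h n) :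
    rop g φ i j n = act (algebraMap S _ κ * linP num i j) n := by
  have := hr.act_rop hij hn; simpa [linP] using this

variable {P : Params} (Λ : Weight P)

/-- Sums of vertex operators. -/
def lsum {κ : Type*} [Fintype κ] (f : κ → Lab P) (c : κ → ℂ) (e : ℤ) :
    Module.End ℂ (QLat P →₀ Osc.Sp (Boson P)) :=
  ∑ k, c k • (llet Λ (f k)).op e

lemma bd_of_bounded {ι : Type*} [DecidableEq ι] {W : Type*} [AddCommGroup W] {w} {n : (ι → ℤ) → W}
    (hn : ∃ B, ∀ e, n e ≠ 0 → ∀ l ∈ w, B ≤ e l) : Bd (posHeight w) n := Bd.posHeight hn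

lemma wop_pair {ι S W : Type*} [DecidableEq ι] [CommRing S] [AddCommGroup W] [Module S W] (pd :
    PairData ι S) (i j) (n : (ι → ℤ) → W) : wop pd [i, j] n = rop (pd.g i j) (pd.φ i j) i j n := rfl

def Exch (x y : Lab P) (s : ℂ) : Prop :=
  ∃ κ κ' num num', LRat x y ⟨κ, num, []⟩ ∧ LRat y x ⟨κ', num', []⟩ ∧
    (cst κ * linP num 0 1 =
      algebraMap ℂ _ s * algebraMap ℂ _ κ' * linP num' 1 0)

def ExchLin (x y : Lab P) (a b s a' b' : ℂ) : Prop :=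
  ∃ κ κ' num num',
    IsRat (lg x y + 1) ((C a - C b * X) * (C (lt x y) * Osc.phi (losc x) (losc y)))
      ⟨κ, num, []⟩ ∧
    IsRat (lg y x + 1) ((C (-b') - C (-a') * X) * (C (lt y x) * Osc.phi (losc y) (losc x)))
      ⟨κ', num', []⟩ ∧
    (cst κ * linP num 0 1 =
      algebraMap ℂ _ s * algebraMap ℂ _ κ' * linP num' 1 0)

lemma perm_swap_fin_two : ([1, 0] : List (Fin 2)).Perm [0, 1] := List.Perm.swap 0 1 []

variable {κ κ' : Type*} [Fintype κ]

lemma lsum_comm_of_exch (f f') (c c' : κ → ℂ) (s) (h : ∀ k k', c k ≠ 0 → c' k' ≠ 0 → Exch (f k)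
    (f' k') s) (e e') : lsum Λ f c e * lsum Λ f' c' e' = s • (lsum Λ f' c' e' * lsum Λ f c e) := by
  have key := sum_words_eq_zero (ι := Fin 2) (fun i k => llet Λ (![f, f'] i k)) ![c, c']
    (u := [0, 1]) (by decide) (by decide) [(1, 0, [0, 1]), (-s, 0, [1, 0])]
    (by simp [perm_swap_fin_two]) ?_ ![e, e']
  · simp only [map_cons, map_nil, prod_cons, prod_nil, mul_one, sum_cons,
      sum_nil, add_zero, cons_val_zero, cons_val_one, Pi.zero_apply,
      sub_zero] at key
    rw [← sub_eq_zero, ← key]; simp only [lsum]; module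
  · intro ε hε; refine ⟨_, _, compat_llet Λ (fun i => ![f, f'] i (ε i)), fun n hn e => ?_⟩
    set pd := Letter.pairData (fun i => llet Λ (![f, f'] i (ε i))) (fun i j => lg (![f, f'] i (ε
      i)) (![f, f'] j (ε j))) (fun i j => lt (![f, f'] i (ε i)) (![f, f'] j (ε j))) with hpd
    obtain ⟨κ, κ', num, num', h1, h2, h3⟩ := h (ε 0) (ε 1) (by exact hε 0) (by exact hε 1)
    have b2 : Bd (posHeight [1, 0]) n := bd_of_bounded (by
      obtain ⟨B, hB⟩ := hn; exact ⟨B, fun e he l hl => hB e he l (by simpa [or_comm] using hl)⟩)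
    have e2 := ((LRat.pairData (Λ := Λ) (f := fun i => ![f, f'] i (ε i)) (i := 1) (j := 0)
      h2)).rop_eq ((pairwise_cons.1 (posHeight_pairwise (w := [1, 0]) (by
        decide))).1 0 (by simp)) b2
    simp only [map_cons, map_nil, sum_cons, sum_nil, wop_pair, sub_zero]
    have e3 := congrFun (congrArg (fun p => act p n) h3) e
    rw [← ((LRat.pairData (Λ := Λ) (f := fun i => ![f, f'] i (ε i)) (i := 0) (j := 1) h1)).rop_eq
      ((pairwise_cons.1 (posHeight_pairwise (w := [0, 1]) (by decide))).1 1 (by simp))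
        (bd_of_bounded hn), mul_assoc, map_mul, Module.End.mul_apply, ← e2, act_algebraMap,
          Pi.smul_apply, smul_eq_mul] at e3
    rw [e3]; ring

lemma lsum_comm_of_exchLin (f f') (c c' : κ → ℂ) (a b s a' b') (h : ∀ k k', c k ≠ 0 → c' k' ≠ 0 →
    ExchLin (f k) (f' k') a b s a' b') (e e') : a • (lsum Λ f c (e - 1) * lsum Λ f' c' e') - b •
    (lsum Λ f c e * lsum Λ f' c' (e' - 1)) = s • (a' • (lsum Λ f' c' e' * lsum Λ f c (e - 1)) - b' •
    (lsum Λ f' c' (e' - 1) * lsum Λ f c e)) := by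
  have key := sum_words_eq_zero (ι := Fin 2) (fun i k => llet Λ (![f, f'] i k)) ![c, c']
    (u := [0, 1]) (by decide) (by decide) [(a, Pi.single 0 1, [0, 1]), (-b, Pi.single 1 1, [0, 1]),
      (-(s * a'), Pi.single 0 1, [1, 0]), (s * b', Pi.single 1 1, [1, 0])]
    (by simp [perm_swap_fin_two]) ?_ ![e, e']
  · simp only [map_cons, map_nil, prod_cons, prod_nil, mul_one, sum_cons,
      sum_nil, add_zero, cons_val_zero, cons_val_one, Pi.single_eq_same,
      single_eq_of_ne (one_ne_zero : (1 : Fin 2) ≠ 0),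
      single_eq_of_ne (zero_ne_one : (0 : Fin 2) ≠ 1), sub_zero] at key
    rw [← sub_eq_zero, ← key]; simp only [lsum]; module
  · intro ε hε; refine ⟨_, _, compat_llet Λ (fun i => ![f, f'] i (ε i)), fun n hn e => ?_⟩
    set pd := Letter.pairData (fun i => llet Λ (![f, f'] i (ε i))) (fun i j => lg (![f, f'] i (ε
      i)) (![f, f'] j (ε j))) (fun i j => lt (![f, f'] i (ε i)) (![f, f'] j (ε j))) with hpd
    obtain ⟨κ, κ', num, num', h1, h2, h3⟩ := h (ε 0) (ε 1) (by exact hε 0) (by exact hε 1)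
    have b1 := bd_of_bounded hn; have b2 : Bd (posHeight [1, 0]) n := bd_of_bounded (by
      obtain ⟨B, hB⟩ := hn; exact ⟨B, fun e he l hl => hB e he l (by simpa [or_comm] using hl)⟩)
    have l1 :=
      (pairwise_cons.1 (posHeight_pairwise (w := [(0 : Fin 2), 1]) (by decide))).1 1 (by simp)
    have l2 :=
      (pairwise_cons.1 (posHeight_pairwise (w := [(1 : Fin 2), 0]) (by decide))).1 0 (by simp)
    have e1 := h1.rop_eq l1 b1; have e2 := h2.rop_eq l2 b2
    have p1 : pd.g 0 1 = lg (f (ε 0)) (f' (ε 1)) ∧ pd.φ 0 1 = C (lt (f (ε 0)) (f' (ε 1))) * Osc.phi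
      (losc (f (ε 0))) (losc (f' (ε 1))) := by simp [hpd, Letter.pairData, llet_osc]
    have p2 : pd.g 1 0 = lg (f' (ε 1)) (f (ε 0)) ∧ pd.φ 1 0 = C (lt (f' (ε 1)) (f (ε 0))) * Osc.phi
      (losc (f' (ε 1))) (losc (f (ε 0))) := by simp [hpd, Letter.pairData, llet_osc]
    rw [← p1.1, ← p1.2, ← act_lf_rop _ _ l1 b1] at e1
    rw [← p2.1, ← p2.2, ← act_lf_rop _ _ l2 b2] at e2
    simp only [map_cons, map_nil, sum_cons, sum_nil, wop_pair]
    have e3 := congrFun (congrArg (fun p => act p n) h3) e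
    rw [← e1, mul_assoc, map_mul, Module.End.mul_apply, ← e2, act_algebraMap, Pi.smul_apply,
      smul_eq_mul, act_lf, act_lf] at e3
    simp only [smul_eq_mul] at e3; linear_combination e3

end TwoPoint

/-! ### The currents -/

def vcf (b : Bool) (i : Idx P) (ε : Bool) : ℂ :=
  (if b then (if P.m ≤ i.1 then P.d ^ dsc i else 1)
    else if P.m ≤ (prev P i).1 then -P.d ^ dsc i else 1) *
  (∏ j : CIdx P, exp (sg b * kvec i j.1 * Λ.tilde.2 j * (dsc i * P.logd))) *
  if dpart b i then (P.q - P.q⁻¹)⁻¹ * (sg ε * ∏ j : CIdx P,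
    if (if b then next P j.1 else j.1) = i then exp (-Λ.tilde.2 j * (sg ε * P.logq)) else 1)
  else if ε then 1 else 0

lemma eq_true_of_vcf {b i ε} (h : vcf Λ b i ε ≠ 0) (hd : ¬ dpart b i) : ε = true := by
  by_contra hε; apply h; rw [vcf, if_neg hd, if_neg hε, mul_zero]

def cur (b : Bool) (i : Idx P) (e : ℤ) : Module.End ℂ (Big P) :=
  lsum Λ (fun ε => .V b i ε) (vcf Λ b i) e

def kcur (b : Bool) (i : Idx P) (e : ℤ) : Module.End ℂ (Big P) := (klet Λ b i).op e

lemma kcur_eq (b i e) :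
    kcur Λ b i e = lsum Λ (fun _ : Bool => .K b i) (fun ε => if ε then 1 else 0) e := by simp [kcur, lsum, llet]

/-! ### Relations between currents of the same type -/

lemma psgn_mul_self (i j : Idx P) : psgn i j * psgn i j = 1 := by
  rw [psgn, ← mul_pow]; simp

lemma psgn_of_not_odd {i} (h : ¬ IsOdd P i) (j) : psgn i j = 1 := by simp [psgn, par, h]

lemma psgn_odd_self {i} (h : IsOdd P i) : psgn i i = -1 := by simp [psgn, par, h]

lemma exch_far (b b') {i i'} (h1 : i ≠ i') (h2 : i' ≠ next P i)
    (h3 : i ≠ next P i') (ε ε') : Exch (.V b i ε) (.V b' i' ε') (psgn i i') := by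
  refine ⟨_, _, _, _, rat_far b b' h1 h2 h3 ε ε', rat_far b' b h1.symm h3 h2 ε' ε, ?_⟩
  rw [twist_far h1 h2 h3, ← map_mul, ← mul_assoc, psgn_mul_self, one_mul]; simp [linP]

lemma exch_odd_self (b) {i} (h : IsOdd P i) (ε ε') : Exch (.V b i ε) (.V b i ε') (psgn i i) := by
  refine ⟨_, _, _, _, rat_self_odd b h ε ε', rat_self_odd b h ε' ε, ?_⟩; rw [psgn_odd_self h]
  simp [linP, lf]; ring

lemma alg_inv {ι : Type*} {x} (h : x ≠ 0) : algebraMap ℂ (Laurent ι ℂ) x *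
    algebraMap ℂ (Laurent ι ℂ) x⁻¹ = 1 := by
  rw [← map_mul, mul_inv_cancel₀ h, map_one]

lemma exchLin_self (b) {i} (h : ¬ IsOdd P i) (ε ε') : ExchLin (.V b i ε) (.V b i ε') (P.d ^ M P i i)
    (xb P b ^ (-A P i i)) (psgn i i) (P.d ^ M P i i * xb P b ^ (-A P i i)) 1 := by
  rw [M_self, zpow_zero, one_mul, psgn_of_not_odd h]; unfold IsOdd at h
  rcases lt_or_gt_of_ne (show i.1 ≠ P.m by tauto) with hi | hi
  · have r1 := (rat_self_pos b (by tauto) hi ε ε').mul_lf 1 (xb P b ^ (-A P i i))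
    have r2 := (rat_self_pos b (by tauto) hi ε' ε).mul_lf (-1) (-xb P b ^ (-A P i i))
    refine ⟨_, _, _, _, r1, r2, ?_⟩; rw [A_pos (by tauto) hi]
    have e : xb P b ^ (-2 : ℤ) = (xb P b)⁻¹ ^ 2 := by simp
    simp only [linP_cons, linP_nil, mul_one, lf, map_neg, map_one, e, map_pow, one_mul]
    set x := cst (xb P b); set y := cst (xb P b)⁻¹; set z : Laurent (Fin 2) ℂ := zv 0
    set w : Laurent (Fin 2) ℂ := zv 1
    have h2 : x ^ 2 * y ^ 2 = 1 := by rw [← mul_pow, alg_inv (ι := Fin 2) (xb_ne_zero (P := P) b),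
      one_pow]
    linear_combination (cst (twist (root P i) (root P i)) *
      (z * w ^ 2 + z ^ 2 * w - z ^ 3 - w ^ 3)) * h2
  · have e : -A P i i = 2 := by rw [A_neg hi]; rfl
    rw [e]; have r1 := (rat_self_neg b hi ε ε').mul_lf 1 (1 * xb P b ^ 2); rw [one_mul] at r1
    have e2 : (xb P b ^ (2 : ℤ)) = xb P b ^ 2 := rfl; rw [e2]
    have c2 := IsRat.cancel ((rat_self_neg b hi ε' ε).mul_lf (-1) (-1 * xb P b ^ 2))
    rw [neg_one_mul (xb P b ^ 2)] at c2
    refine ⟨_, _, _, _, IsRat.cancel (c := xb P b ^ 2) (u := 1) (by rw [one_mul]; exact r1), c2, ?_⟩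
    · simp only [linP_cons, linP_nil, mul_one, lf, map_neg, map_mul, map_one]; ring

lemma exchLin_next (b i ε ε') : ExchLin (.V b i ε) (.V b (next P i) ε') (P.d ^ M P i (next P i)) (xb
    P b ^ (-A P i (next P i))) (psgn i (next P i)) (P.d ^ M P i (next P i) * xb P b ^ (-A P i (next
    P i))) 1 := by
  have hd := P.d_ne_zero; have ha := alg_inv (ι := Fin 2) (xb_ne_zero (P := P) b)
  have hs : cst (psgn i (next P i)) * cst (psgn i (next P i)) = 1 := by rw [← map_mul,
    psgn_mul_self, map_one]
  rw [A_next, M_next]; by_cases h : P.m ≤ i.1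
  · rw [edge_next_of_le h, zpow_one, zpow_neg_one]; obtain ⟨κ, hα, hβ⟩ := rat_posEdge b h ε ε'
    by_cases hε : (if b then ε' else ε) = true
    · obtain ⟨r1, r2⟩ := hβ hε; have r1' := IsRat.mul_lf r1 P.d (P.d * ((xb P b)⁻¹ * P.d⁻¹))
      have e1 : P.d * ((xb P b)⁻¹ * P.d⁻¹) = (xb P b)⁻¹ := by field_simp
      have c1 := r1'.cancel; rw [e1] at c1; refine ⟨_, _, _, _, c1, IsRat.mul_lf r2 _ _, ?_⟩
      · simp only [linP_cons, linP_nil, mul_one, lf, map_neg, map_mul, map_one]; grind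
    · obtain ⟨r1, r2⟩ := hα (by simpa using hε)
      have r2' := IsRat.mul_lf r2 (-1) (-1 * ((xb P b)⁻¹ * P.d))
      have e1 : -1 * ((xb P b)⁻¹ * P.d) = -(P.d * (xb P b)⁻¹) := by ring
      have c2 := r2'.cancel; rw [e1] at c2; refine ⟨_, _, _, _, IsRat.mul_lf r1 _ _, c2, ?_⟩
      · simp only [linP_cons, linP_nil, mul_one, lf, map_neg, map_mul, map_one]; set k := cst κ
        set x := cst (xb P b); set y := cst (xb P b)⁻¹; set d := cst P.d
        set s := cst (psgn i (next P i))
        linear_combination (-k * d * zv 0) * ha + (k * y * (zv 1 - x * d * zv 0)) * hs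
  · have h' : i.1 < P.m := by omega
    rw [edge_next_of_lt h', neg_neg, zpow_one, zpow_neg_one]
    obtain ⟨κ, r1, r2⟩ := rat_negEdge b h' ε ε'
    have e1 : P.d⁻¹ * (xb P b * P.d) = xb P b := by field_simp
    have e2 : -1 * (xb P b * P.d⁻¹) = -(P.d⁻¹ * xb P b) := by ring
    have c1 := (IsRat.mul_lf r1 P.d⁻¹ (P.d⁻¹ * (xb P b * P.d))).cancel
    have c2 := (IsRat.mul_lf r2 (-1) (-1 * (xb P b * P.d⁻¹))).cancel; rw [e1] at c1; rw [e2] at c2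
    refine ⟨_, _, _, _, c1, c2, ?_⟩
    · simp only [linP, map_nil, prod_nil, mul_one, map_neg, map_mul, map_one]
      set s := cst (psgn i (next P i)); set k := cst κ; set d' := cst P.d⁻¹
      linear_combination (-k * d') * hs

lemma quadratic_swap {V : Type*} [AddCommGroup V] [Module ℂ V] {a1 a2 a3 a4 : V} {u v s p : ℂ} (hd :
    u * v = 1) (hs : s * s = 1) (key : u • a1 - p • a2 = s • ((u * p) • a3 - (1 : ℂ) • a4)) : v • a4
    - p • a3 = s • ((v * p) • a2 - (1 : ℂ) • a1) := by
  have k2 := congrArg (fun t => (-(s * v)) • t) key; simp only [smul_sub, smul_smul] at k2 ⊢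
  have e1 : -(s * v) * u = -s := by grind
  have e2 : -(s * v) * p = -(s * (v * p)) := by ring
  have e3 : -(s * v) * (s * (u * p)) = -p := by grind
  have e4 : -(s * v) * (s * 1) = -v := by grind
  rw [e1, e2, e3, e4] at k2; rw [mul_one]; linear_combination (norm := module) (-1 : ℂ) • k2

lemma cur_comm (b) {i j} (h : A P i j = 0) (e e') :
    cur Λ b i e * cur Λ b j e' = psgn i j • (cur Λ b j e' * cur Λ b i e) := by
  refine lsum_comm_of_exch Λ _ _ _ _ _ (fun ε ε' _ _ => ?_) e e'; by_cases hij : i = j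
  · subst hij; refine exch_odd_self b ?_ ε ε'; by_contra ho; rw [A, if_pos rfl, if_neg ho] at h
    grind
  · grind [exch_far, A_next, edge_sq, A_next_left]

lemma cur_quadratic (b) {i j} (h : A P i j ≠ 0) (e e') : P.d ^ M P i j • (cur Λ b i (e - 1) * cur
    Λ b j e') - xb P b ^ (-A P i j) • (cur Λ b i e * cur Λ b j (e' - 1)) = psgn i j • ((P.d ^ M P i
    j * xb P b ^ (-A P i j)) • (cur Λ b j e' * cur Λ b i (e - 1)) - (1 : ℂ) • (cur Λ b j (e' - 1) *
    cur Λ b i e)) := by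
  by_cases hij : i = j
  · subst hij
    exact lsum_comm_of_exchLin Λ _ _ _ _ _ _ _ _ _ (fun ε ε' _ _ => exchLin_self b (fun ho => h
      (A_odd ho)) ε ε') e e'
  · by_cases h1 : j = next P i
    · subst h1
      exact lsum_comm_of_exchLin Λ _ _ _ _ _ _ _ _ _ (fun ε ε' _ _ => exchLin_next b i ε ε') e e'
    · by_cases h2 : i = next P j
      · subst h2; have key := lsum_comm_of_exchLin Λ _ _ (vcf Λ b j) (vcf Λ b (next P j)) _ _ _ _ _
          (fun ε ε' _ _ => exchLin_next b j ε ε') e' e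
        have hd : P.d ^ M P j (next P j) * P.d ^ M P (next P j) j = 1 := by
          rw [M_next, M_next_left, ← zpow_add₀ P.d_ne_zero, add_neg_cancel, zpow_zero]
        rw [A_symm (next P j) j, psgn_comm (next P j)]; set s := psgn j (next P j)
        set u := P.d ^ M P j (next P j); set v := P.d ^ M P (next P j) j
        set p := xb P b ^ (-A P j (next P j))
        change u • (cur Λ b j (e' - 1) * cur Λ b (next P j) e) - p • (cur Λ b j e' * cur Λ b (next
          P j) (e - 1)) = s • ((u * p) • (cur Λ b (next P j) e * cur Λ b j (e' - 1)) - 1 • (cur Λ b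
            (next P j) (e - 1) * cur Λ b j e')) at key
        set a1 := cur Λ b j (e' - 1) * cur Λ b (next P j) e
        set a2 := cur Λ b j e' * cur Λ b (next P j) (e - 1)
        set a3 := cur Λ b (next P j) e * cur Λ b j (e' - 1)
        set a4 := cur Λ b (next P j) (e - 1) * cur Λ b j e'
        exact quadratic_swap (V := Module.End ℂ (Big P)) hd (psgn_mul_self j (next P j)) key
      · exact absurd (A_far hij h1 h2) h

/-! ### Relations with the currents `K^±` -/

section KRelations

open PowerSeries (C X)

variable {P : Params}

def hk (P : Params) (b b' : Bool) : ℂ :=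
  if b then (if b' then P.q⁻¹ else 1) else (if b' then 1 else P.q)

lemma hk_ne_zero (b b') : hk P b b' ≠ 0 := by
  cases b <;> cases b' <;> simp [hk, P.q_ne_zero]

lemma qInt_mul_sub (k) : qInt P k * (P.q - P.q⁻¹) = P.q ^ k - P.q ^ (-k) :=
  div_mul_cancel₀ _ (q_sub_ne_zero P)

lemma q_zpow_mul_natCast (a) (r : ℕ) : P.q ^ ((r : ℤ) * a) = (P.q ^ a) ^ r := by
  rw [mul_comm, zpow_mul, zpow_natCast]

lemma d_zpow_mul_natCast (a) (r : ℕ) : P.d ^ (-((r : ℤ) * a)) = (P.d ^ (-a)) ^ r := by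
  rw [← zpow_natCast, ← zpow_mul]; congr 1; ring

lemma M_neg_swap (i j) : -M P j i = M P i j := by
  by_cases h1 : j = next P i
  · subst h1; rw [M_next, M_next_left, neg_neg]
  · by_cases h2 : i = next P j
    · subst h2; rw [M_next, M_next_left]
    · rw [M_far h1 h2, M_far h2 h1, neg_zero]

lemma qInt_natCast_mul_sub (r : ℕ) (a) :
    qInt P (r * a) * (P.q - P.q⁻¹) = (P.q ^ a) ^ r - (P.q ^ (-a)) ^ r := by
  rw [qInt_mul_sub, ← mul_neg, q_zpow_mul_natCast, q_zpow_mul_natCast]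

lemma toPNat'_of_pos {r} (hr : 0 < r) : r.toPNat' = r := by simp [toPNat'_coe, hr]

lemma contr_kplus (i j b ε) {r} (hr : 0 < r) : Osc.contr (losc (.K true i)) (losc (.V b j ε)) r =
    ([P.q ^ (sg b * A P i j) * P.d ^ (-M P i j) * hk P true b].map fun c => c ^ r / (r : ℂ)).sum -
    ([P.q ^ (-(sg b * A P i j)) * P.d ^ (-M P i j) * hk P true b].map fun c => c ^ r / (r : ℂ)).sum
    := by
  have hq : qInt P r ≠ 0 := qInt_ne_zero (by exact_mod_cast hr.ne')
  have hr' : r ≠ 0 := by exact_mod_cast hr.ne'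
  have e1 := qInt_natCast_mul_sub (P := P) r (A P i j)
  rw [Osc.contr, sum_sum_type, sum_eq_single j, sum_eq_zero, add_zero]
  · simp only [losc, vosc, heis, if_true, toPNat'_of_pos hr, d_zpow_mul_natCast, map_cons, map_nil,
      sum_cons, sum_nil, add_zero, mul_pow]
    cases b
    · simp only [sg, hk, if_false, if_true, false_eq_true, neg_mul, one_mul, neg_neg, one_pow]
      generalize P.q - P.q⁻¹ = Q at e1 ⊢
      have e4 : ∀ D a, Q * (a * qInt P r / r * D) * (-1 / qInt P r) = -(a * Q) * D / r := by
        intro D a; field_simp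
      rw [e4, e1]; ring
    · simp only [sg, hk, if_true, one_mul]; generalize P.q - P.q⁻¹ = Q at e1 ⊢
      have e4 : ∀ D a c, Q * (a * qInt P r / r * D) * (c / qInt P r) = (a * Q) * D * c / r := by
        intro D a c; field_simp
      rw [e4, e1]; ring
  · intro l _; simp [losc, heis]
  · intro l _ hl; simp [losc, vosc, hl]
  · simp

lemma contr_kminus (i j b ε) {r} (hr : 0 < r) : Osc.contr (losc (.V b j ε)) (losc (.K false i)) r =
    ([P.q ^ (sg b * A P i j) * P.d ^ M P i j * hk P false b].map fun c => c ^ r / (r : ℂ)).sum -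
    ([P.q ^ (-(sg b * A P i j)) * P.d ^ M P i j * hk P false b].map fun c => c ^ r / (r : ℂ)).sum
    := by
  have hq : qInt P r ≠ 0 := qInt_ne_zero (by exact_mod_cast hr.ne')
  have hr' : r ≠ 0 := by exact_mod_cast hr.ne'
  have e1 := qInt_natCast_mul_sub (P := P) r (A P i j)
  rw [Osc.contr, sum_sum_type, sum_eq_single i, sum_eq_zero, add_zero]
  · simp only [losc, vosc, heis, if_true, toPNat'_of_pos hr, d_zpow_mul_natCast, map_cons, map_nil,
      sum_cons, sum_nil, add_zero, mul_pow, A_symm j i, M_neg_swap i j, if_false, false_eq_true]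
    cases b
    · simp only [sg, hk, if_false, false_eq_true, neg_mul, one_mul, neg_neg]
      generalize P.q - P.q⁻¹ = Q at e1 ⊢
      have e4 : ∀ D a c, c / qInt P r * (a * qInt P r / r * D) * -Q = -((a * Q) * D * c / r) := by
        intro D a c; field_simp
      rw [e4, e1]; ring
    · simp only [sg, hk, if_true, if_false, false_eq_true, one_mul, one_pow]
      generalize P.q - P.q⁻¹ = Q at e1 ⊢
      have e4 : ∀ D a c, c / qInt P r * (a * qInt P r / r * D) * -Q = -((a * Q) * D * c / r) := by
        intro D a c; field_simp
      rw [e4, e1]; ring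
  · intro l _; simp [losc]
  · intro l _ hl; simp [losc, hl]
  · simp

lemma contr_zero_left (i) (x : Lab P) (r) :
    Osc.contr (losc (.K false i)) (losc x) r = 0 := by simp [Osc.contr, losc]

lemma contr_zero_right (i) (x : Lab P) (r) :
    Osc.contr (losc x) (losc (.K true i)) r = 0 := by simp [Osc.contr, losc]

lemma lrat_const {x y : Lab P} (h : ∀ r, Osc.contr (losc x) (losc y) r = 0) (hg : lg x y = 0) :
    LRat x y ⟨lt x y, [], []⟩ := by
  refine isRat_of_contr _ [] [] (fun r _ => ?_) (by rw [hg]; rfl); rw [h]; simp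

lemma exch_kk (b) (i j : Idx P) : Exch (.K b i) (.K b j) 1 := by
  cases b
  · refine ⟨_, _, _, _, lrat_const (contr_zero_left i _) rfl, lrat_const (contr_zero_left j _) rfl,
      ?_⟩
    simp [linP, lt]
  · refine ⟨_, _, _, _, lrat_const (contr_zero_right j _) rfl,
      lrat_const (contr_zero_right i _) rfl, ?_⟩
    simp [linP, lt]

lemma exchLin_kplus (i j b ε) : ExchLin (.K true i) (.V b j ε) (P.d ^ M P i j * (hk P true b)⁻¹)
    (P.q ^ (sg b * A P i j)) 1 (P.d ^ M P i j * P.q ^ (sg b * A P i j) * (hk P true b)⁻¹) 1 := by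
  have h1 := hk_ne_zero (P := P) true b; have h2 : P.d ^ M P i j ≠ 0 := zpow_ne_zero _ P.d_ne_zero
  have c1 := ((isRat_of_contr (lt (.K true i) (.V b j ε)) (g := lg (.K true i) (.V b j ε)) _ _ (fun
    r hr => contr_kplus i j b ε hr) rfl).mul_lf (P.d ^ M P i j * (hk P true b)⁻¹) (P.d ^ M P i j *
      (hk P true b)⁻¹ * (P.q ^ (sg b * A P i j) * P.d ^ (-M P i j) * hk P true b))).cancel
  have e1 : P.d ^ M P i j * (hk P true b)⁻¹ * (P.q ^ (sg b * A P i j) * P.d ^ (-M P i j) * hk P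
    true b) = P.q ^ (sg b * A P i j) := by rw [zpow_neg]; field_simp
  rw [e1] at c1; refine ⟨_, _, _, _, c1, IsRat.mul_lf (lrat_const (x := .V b j ε) (y := .K true i)
    (contr_zero_right i _) rfl) _ _, ?_⟩
  have e2 : lt (.K true i) (.V b j ε) = P.q ^ (sg b * A P i j) := by simp [lt, sg]
  have e3 : lt (.V b j ε) (.K true i) = 1 := rfl; rw [e2, e3, zpow_neg P.q, zpow_neg P.d]
  simp only [linP_cons, linP_nil, List.map, mul_one, lf, map_neg, map_one, map_mul, one_mul]
  set x := cst (hk P true b); set x' := cst (hk P true b)⁻¹; set y := cst (P.d ^ M P i j)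
  set y' := cst (P.d ^ M P i j)⁻¹; set z := cst (P.q ^ (sg b * A P i j))
  set z' := cst (P.q ^ (sg b * A P i j))⁻¹
  linear_combination (-zv 1 * z * z' * y * y') * (alg_inv (ι := Fin 2) h1) - zv 1 * z * z' *
    (alg_inv (ι := Fin 2) h2) - zv 1 * (alg_inv (ι := Fin 2) (zpow_ne_zero _ P.q_ne_zero))

lemma exchLin_kminus (i j b ε) : ExchLin (.K false i) (.V b j ε) (P.d ^ M P i j * hk P false b) (P.q
    ^ (sg b * A P i j)) 1 (P.d ^ M P i j * P.q ^ (sg b * A P i j) * hk P false b) 1 := by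
  have c2 := ((isRat_of_contr (lt (.V b j ε) (.K false i)) (g := lg (.V b j ε) (.K false i)) _ _
    (fun r hr => contr_kminus i j b ε hr) rfl).mul_lf (-1) (-1 * (P.q ^ (sg b * A P i j) * P.d ^ M
      P i j * hk P false b))).cancel
  have e1 : -1 * (P.q ^ (sg b * A P i j) * P.d ^ M P i j * hk P false b) =
      -(P.d ^ M P i j * P.q ^ (sg b * A P i j) * hk P false b) := by ring
  rw [e1] at c2
  refine ⟨_, _, _, _, IsRat.mul_lf (lrat_const (x := .K false i) (y := .V b j ε) (contr_zero_left i
    _) rfl) _ _, c2, ?_⟩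
  have e2 : lt (.K false i) (.V b j ε) = (P.q ^ (sg b * A P i j))⁻¹ := by
    rw [lt, ← zpow_neg]; cases b <;> simp [sg]
  have e3 : lt (.V b j ε) (.K false i) = 1 := rfl; rw [e2, e3, zpow_neg P.q]
  simp only [linP_cons, linP_nil, List.map, mul_one, lf, map_neg, map_one, map_mul, one_mul]
  set x := cst (hk P false b); set y := cst (P.d ^ M P i j); set z := cst (P.q ^ (sg b * A P i j))
  set z' := cst (P.q ^ (sg b * A P i j))⁻¹
  linear_combination (-zv 1) * (alg_inv (ι := Fin 2) (zpow_ne_zero _ P.q_ne_zero))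

variable (Λ : Weight P)

lemma kcur_comm (b i j e e') : kcur Λ b i e * kcur Λ b j e' = kcur Λ b j e' * kcur Λ b i e := by
  have := lsum_comm_of_exch Λ (fun _ => .K b i) (fun _ : Bool => .K b j) (fun ε => if ε then 1 else
    0) (fun ε => if ε then 1 else 0) 1 (fun _ _ _ _ => exch_kk b i j) e e'
  grind [kcur_eq, one_smul]

lemma kplus_cur (b i j e e') : (P.d ^ M P i j * (hk P true b)⁻¹) • (kcur Λ true i (e - 1) * cur Λ
    b j e') - P.q ^ (sg b * A P i j) • (kcur Λ true i e * cur Λ b j (e' - 1)) = (P.d ^ M P i j * P.q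
    ^ (sg b * A P i j) * (hk P true b)⁻¹) • (cur Λ b j e' * kcur Λ true i (e - 1)) - cur Λ b j (e' -
    1) * kcur Λ true i e := by
  have := lsum_comm_of_exchLin Λ (fun _ => .K true i) (fun ε => .V b j ε) (fun ε => if ε then 1
    else 0) (vcf Λ b j) _ _ _ _ _ (fun _ ε _ _ => exchLin_kplus i j b ε) e e'
  simp [← kcur_eq] at this; exact this

lemma kminus_cur (b i j e e') : (P.d ^ M P i j * hk P false b) • (kcur Λ false i (e - 1) * cur Λ b
    j e') - P.q ^ (sg b * A P i j) • (kcur Λ false i e * cur Λ b j (e' - 1)) = (P.d ^ M P i j * P.q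
    ^ (sg b * A P i j) * hk P false b) • (cur Λ b j e' * kcur Λ false i (e - 1)) - cur Λ b j (e' -
    1) * kcur Λ false i e := by
  have := lsum_comm_of_exchLin Λ (fun _ => .K false i) (fun ε => .V b j ε) (fun ε => if ε then 1
    else 0) (vcf Λ b j) _ _ _ _ _ (fun _ ε _ _ => exchLin_kminus i j b ε) e e'
  simp [← kcur_eq] at this; exact this

end KRelations

section KMixed

open PowerSeries (C X)

variable {P : Params}

lemma contr_kk (i j) {r} (hr : 0 < r) : Osc.contr (losc (.K true j)) (losc (.K false i))
    r = ([P.q ^ A P i j * P.q⁻¹ * P.d ^ M P i j, P.q ^ (-A P i j) * P.q * P.d ^ M P i j].map fun c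
    => c ^ r / (r : ℂ)).sum - ([P.q ^ A P i j * P.q * P.d ^ M P i j, P.q ^ (-A P i j) * P.q⁻¹ * P.d
    ^ M P i j].map fun c => c ^ r / (r : ℂ)).sum := by
  have hr' : r ≠ 0 := by exact_mod_cast hr.ne'
  have e1 := qInt_natCast_mul_sub (P := P) r (A P i j); have e2 := qInt_mul_sub (P := P) r
  rw [zpow_neg, zpow_natCast, ← inv_pow] at e2
  rw [Osc.contr, sum_sum_type, sum_eq_single i, sum_eq_zero, add_zero]
  · simp only [losc, heis, if_true, toPNat'_of_pos hr, d_zpow_mul_natCast, map_cons, map_nil,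
      sum_cons, sum_nil, add_zero, mul_pow, A_symm j i, M_neg_swap i j, if_false, false_eq_true]
    generalize P.q - P.q⁻¹ = Q at e1 e2 ⊢
    have e4 : ∀ D a c, Q * (a * c / r * D) * -Q = -((a * Q) * (c * Q) * D / r) := by
      intro D a c; ring
    rw [e4, e1, e2]; ring
  · intro l _; simp [losc]
  · intro l _ hl; simp [losc, hl]
  · simp

variable (Λ : Weight P)

lemma kcur_mixed (i j e e') : (P.d ^ M P i j * P.q⁻¹) • ((P.d ^ M P i j * P.q ^ A P
    i j * P.q) • (kcur Λ false i (e - 1 - 1) * kcur Λ true j e') - kcur Λ false i (e - 1) * kcur Λ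
    true j (e' - 1)) - P.q ^ A P i j • ((P.d ^ M P i j * P.q ^ A P i j * P.q) • (kcur Λ false i (e -
    1) * kcur Λ true j (e' - 1)) - kcur Λ false i e * kcur Λ true j (e' - 1 - 1)) = (P.d ^ M P i j *
    P.q ^ A P i j * P.q⁻¹) • ((P.d ^ M P i j * P.q) • (kcur Λ true j e' * kcur Λ false i (e - 1 -
    1)) - P.q ^ A P i j • (kcur Λ true j (e' - 1) * kcur Λ false i (e - 1))) - ((P.d ^ M P i j *
    P.q) • (kcur Λ true j (e' - 1) * kcur Λ false i (e - 1)) - P.q ^ A P i j • (kcur Λ true j (e' -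
    1 - 1) * kcur Λ false i e)) := by
  set u := P.d ^ M P i j with hu; set p := P.q ^ A P i j with hp
  set s0 : Fin 2 → ℤ := Pi.single 0 1 with hs0; set s1 : Fin 2 → ℤ := Pi.single 1 1 with hs1
  have hp0 : p ≠ 0 := zpow_ne_zero _ P.q_ne_zero
  have key := sum_words_eq_zero (ι := Fin 2) (κ := Unit)
    (fun l _ => llet Λ (![Lab.K false i, Lab.K true j] l)) (fun _ _ => 1)
    (u := [0, 1]) (by decide) (by decide)
    [(u * P.q⁻¹ * (u * p * P.q), s0 + s0, [0, 1]), (-(u * P.q⁻¹) - p * (u * p * P.q), s0 + s1, [0, 1]),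
      (p, s1 + s1, [0, 1]), (-(u * p * P.q⁻¹ * (u * P.q)), s0 + s0, [1, 0]),
      (u * p * P.q⁻¹ * p + u * P.q, s0 + s1, [1, 0]), (-p, s1 + s1, [1, 0])]
    (by simp [perm_swap_fin_two]) ?_ ![e, e']
  · simp only [map_cons, map_nil, prod_cons, prod_nil, mul_one, sum_cons,
      sum_nil, add_zero, cons_val_zero, cons_val_one, Pi.add_apply,
      hs0, hs1, Pi.single_eq_same, single_eq_of_ne (one_ne_zero : (1 : Fin 2) ≠ 0),
      single_eq_of_ne (zero_ne_one : (0 : Fin 2) ≠ 1), sub_zero, Finset.univ_unique,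
      Finset.sum_singleton, one_smul, ← sub_sub] at key
    rw [← sub_eq_zero, ← key]; simp only [kcur, llet]; module
  · intro ε _; refine ⟨_, _, compat_llet Λ ![Lab.K false i, Lab.K true j], fun n hn e => ?_⟩
    set pd := Letter.pairData (fun l => llet Λ (![Lab.K false i, Lab.K true j] l))
      (fun l l' => lg (![Lab.K false i, Lab.K true j] l) (![Lab.K false i, Lab.K true j] l'))
      (fun l l' => lt (![Lab.K false i, Lab.K true j] l) (![Lab.K false i, Lab.K true j] l')) with hpd
    have h1 : LRat (.K false i) (.K true j) _ := lrat_const (contr_zero_left i _) rfl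
    have h2 : LRat (.K true j) (.K false i) _ := isRat_of_contr (lt (.K true j) (.K false i)) _ _
      (fun r hr => contr_kk i j hr) rfl
    have h1' := (LRat.pairData (Λ := Λ) (f := ![Lab.K false i, Lab.K true j]) (i := 0) (j := 1) h1)
    have h2' := (LRat.pairData (Λ := Λ) (f := ![Lab.K false i, Lab.K true j]) (i := 1) (j := 0) h2)
    have b1 : Bd (posHeight [0, 1]) n := bd_of_bounded hn
    have b2 : Bd (posHeight [1, 0]) n := bd_of_bounded (by
      obtain ⟨B, hB⟩ := hn; exact ⟨B, fun e he l hl => hB e he l (by simpa [or_comm] using hl)⟩)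
    have l1 : Lt (posHeight [0, 1]) (0 : Fin 2) 1 :=
      (pairwise_cons.1 (posHeight_pairwise (w := [0, 1]) (by decide))).1 1 (by simp)
    have l2 : Lt (posHeight [1, 0]) (1 : Fin 2) 0 :=
      (pairwise_cons.1 (posHeight_pairwise (w := [1, 0]) (by decide))).1 0 (by simp)
    have e1 := h1'.rop_eq l1 b1
    have e2 : act (linP _ 1 0) (rop (pd.g 1 0) (pd.φ 1 0) 1 0 n) = _ := h2'.act_rop l2 b2
    have c1 : lt (P := P) (.K false i) (.K true j) = 1 := rfl
    have c2 : lt (P := P) (.K true j) (.K false i) = 1 := rfl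
    simp only [c1, c2, map_one, one_mul, linP_cons, linP_nil, List.map, mul_one, Module.End.one_apply] at e1 e2
    change rop (pd.g 0 1) (pd.φ 0 1) 0 1 n = n at e1
    simp only [map_mul, Module.End.mul_apply, act_lf] at e2; have e3 := congrFun e2 e
    simp only [smul_eq_mul, sub_sub, ← hs0, ← hs1, one_mul] at e3
    simp only [map_cons, map_nil, sum_cons, sum_nil, wop_pair, e1]
    rw [zpow_neg, ← hp] at e3; have hq := P.q_ne_zero; have s10 : s1 + s0 = s0 + s1 := add_comm _ _
    rw [s10] at e3; have f1 : p * (p⁻¹ * P.q * u) = P.q * u := by field_simp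
    have f2 : p * (p⁻¹ * P.q⁻¹ * u) = P.q⁻¹ * u := by field_simp
    have f3 : p * (p * P.q⁻¹ * u * (p⁻¹ * P.q * u)) = u * p * P.q⁻¹ * (u * P.q) := by field_simp
    have f4 : p * (p * P.q * u * (p⁻¹ * P.q⁻¹ * u)) = u * P.q⁻¹ * (u * p * P.q) := by field_simp
    rw [← f3, ← f4]; linear_combination (-p) * e3 + (n (e - (s0 + s1))) * f2 -
      rop (pd.g 1 0) (pd.φ 1 0) 1 0 n (e - (s0 + s1)) * f1

end KMixed

/-! ### Fusion of vertex operators -/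

namespace Osc

variable {Y : Type*} [Fintype Y]

lemma N1_C (X : Osc Y) (n c) : X.N1 n (MvPolynomial.C c) = c • X.E n := by
  have h : X.T (MvPolynomial.C c) = Polynomial.C (MvPolynomial.C c) := by simp
  rw [N1_apply, h, ← mul_one (Polynomial.C _), lam_C_mul, smul_eq_C_mul, lam,
    lsum_apply, ← Polynomial.C_1, Polynomial.sum_C_index]
  · simp
  · simp

lemma N1_mul_X (X : Osc Y) (n f v) : X.N1 n (f * MvPolynomial.X v) = X.N1 n f * MvPolynomial.X v +
    X.an v.1 v.2 • X.N1 (n + v.2) f := by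
  rw [N1_apply, map_mul, T_X, mul_add, map_add, mul_comm (X.T f), lam_C_mul, mul_comm (X.T f),
    mul_assoc, lam_C_mul, lam_X_pow_mul, smul_eq_C_mul, mul_comm (MvPolynomial.X v)]
  rfl

lemma N1_scale {X Z : Osc Y} {a} (ha : a ≠ 0) (hc : ∀ y r, Z.cr y r = a ^ (r : ℕ) * X.cr y r) (hn :
    ∀ y r, Z.an y r = a⁻¹ ^ (r : ℕ) * X.an y r) (n f) : Z.N1 n f = a ^ n • X.N1 n f := by
  induction f using induction_on generalizing n with
  | C c =>
    rw [N1_C, N1_C, smul_comm]; congr 1; by_cases h : 0 ≤ n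
    · obtain ⟨n, rfl⟩ := Int.eq_ofNat_of_zero_le h
      have h1 : ∀ r, 0 < r → Z.creLin r = MvPolynomial.C a ^ r * X.creLin r := by
        intro r hr; rw [creLin, creLin, mul_sum]; refine sum_congr rfl fun y _ => ?_
        grind [toPNat'_coe, smul_eq_C_mul, map_mul, map_pow, mul_assoc]
      rw [E_natCast, E_natCast, expCoeff_congr h1, expCoeff_pow_mul, zpow_natCast,
        smul_eq_C_mul, map_pow]
    · rw [E_of_neg _ (not_le.1 h), E_of_neg _ (not_le.1 h), smul_zero]
  | add f g hf hg => rw [map_add, map_add, hf, hg, smul_add]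
  | mul_X f v hf =>
    rw [N1_mul_X, N1_mul_X, hf, hf, hn, smul_add, smul_mul_assoc, smul_smul, smul_smul]; congr 2
    rw [zpow_add₀ ha, zpow_natCast, inv_pow]; have := pow_ne_zero v.2 ha; field_simp

lemma nprod_pair_mul_X (X) (e : Fin 2 → ℤ) (f) (v : Y × ℕ+) : nprod X [0, 1] e (f * MvPolynomial.X
    v) = nprod X [0, 1] e f * MvPolynomial.X v + (X 0).an v.1 v.2 • nprod X [0, 1] (e + Pi.single 0
    (v.2 : ℕ)) f + (X 1).an v.1 v.2 • nprod X [0, 1] (e + Pi.single 1 (v.2 : ℕ)) f := by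
  set B := ((X 0).T f).natDegree + ((X 0).T (f * MvPolynomial.X v)).natDegree + 1 with hB
  rw [nprod_cons X 0 [1] e (f * MvPolynomial.X v) (B := B + v.2) (by omega), nprod_cons X 0 [1] e f
    (B := B + v.2) (by omega), nprod_cons X 0 [1] (e + Pi.single 0 _) f (B := B) (by omega),
      nprod_cons X 0 [1] (e + Pi.single 1 _) f (B := B + v.2) (by omega)]
  simp only [fun e' => nprod_singleton X 1 e', Tc_mul_X, Pi.add_apply, Pi.single_eq_same,
    single_eq_of_ne (one_ne_zero : 1 ≠ 0),
    single_eq_of_ne (zero_ne_one : 0 ≠ 1), add_zero, map_add, N1_mul_X, map_smul,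
    mul_add, sum_add_distrib, sum_mul, smul_sum, mul_smul_comm, mul_assoc]
  have h2 : ∑ x ∈ range (B + v.2), (X 0).an v.1 v.2 • ((X 0).E (e 0 + x) *
        (X 1).N1 (e 1) (if v.2 ≤ x then (X 0).Tc (x - v.2) f else 0)) =
      ∑ x ∈ range B, (X 0).an v.1 v.2 • ((X 0).E (e 0 + (v.2 : ℕ) + x) *
        (X 1).N1 (e 1) ((X 0).Tc x f)) := by
    rw [add_comm B, Finset.sum_range_add, sum_eq_zero, zero_add]
    · grind
    · intro x hx; rw [if_neg (by simpa using hx)]; simp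
  grind

lemma nprod_pair_C (X : Fin 2 → Osc Y) (e c) :
    nprod X [0, 1] e (MvPolynomial.C c) = c • ((X 0).E (e 0) * (X 1).E (e 1)) := by
  have h : ((X 0).T (MvPolynomial.C c)).natDegree < 1 := by simp
  rw [nprod_cons X 0 [1] e _ h, nprod_singleton]; simp [Tc_zero, N1_C]

end Osc

section Dsum

variable {W : Type*} [AddCommGroup W] [Module ℂ W]

/-- Boundedness from below in both variables. -/
def Bd2 (n : (Fin 2 → ℤ) → W) : Prop := ∃ B : ℤ, ∀ e, n e ≠ 0 → ∀ l ∈ [(0 : Fin 2), 1], B ≤ e l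

def dsum (c : ℂ) (n : (Fin 2 → ℤ) → W) (s : ℤ) : W := ∑ᶠ a : ℤ, c ^ a • n ![a, s - a]

omit [Module ℂ W] in
lemma Bd2.le {n : (Fin 2 → ℤ) → W} {B}
    (hB : ∀ e, n e ≠ 0 → ∀ l ∈ [0, 1], B ≤ e l) {a b} (h : a < B ∨ b < B) :
    n ![a, b] = 0 := by
  by_contra hne; have h0 := hB _ hne 0 (by simp); have h1 := hB _ hne 1 (by simp); simp at h0 h1
  omega

lemma dsum_eq_sum (c) {n : (Fin 2 → ℤ) → W} {B} (hB : ∀ e, n e ≠ 0 → ∀ l ∈ [0, 1], B ≤ e l) (s) {a₀}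
    (ha : a₀ ≤ B) {N : ℕ} (hN : s - B < a₀ + N) : dsum c n s = ∑ k ∈ range N, c ^ (a₀ + k) •
    n ![a₀ + k, s - (a₀ + k)] := by
  rw [dsum, finsum_eq_sum_of_support_subset (s := (range N).image fun k : ℕ => a₀ + k)]
  · simp
  · intro a ha'; have hne : n ![a, s - a] ≠ 0 := fun h => ha' (by simp [h])
    have h0 := hB _ hne 0 (by simp); have h1 := hB _ hne 1 (by simp); simp at h0 h1
    simp only [Finset.coe_image, coe_range, Set.mem_image, Set.mem_Iio]
    exact ⟨(a - a₀).toNat, by omega, by omega⟩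

lemma Bd2.lf {n : (Fin 2 → ℤ) → W} (hn : Bd2 n) (a b : ℂ) : Bd2 (act (lf a b 0 1) n) := by
  obtain ⟨B, hB⟩ := hn; refine ⟨B, fun e he l hl => ?_⟩; rw [act_lf] at he
  by_cases h1 : n (e - Pi.single 0 1) = 0
  · by_cases h2 : n (e - Pi.single 1 1) = 0
    · simp_all
    · grind [Pi.sub_apply]
  · have := hB _ h1 l hl; rw [Pi.sub_apply] at this
    have h3 : 0 ≤ (Pi.single 0 1 : Fin 2 → ℤ) l := by fin_cases l <;> simp
    omega

lemma dsum_lf (c) (hc : c ≠ 0) {n : (Fin 2 → ℤ) → W} (hn : Bd2 n) (a b s) :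
    dsum c (act (lf a b 0 1) n) s = (a * c - b) • dsum c n (s - 1) := by
  obtain ⟨B, hB⟩ := hn; obtain ⟨B', hB'⟩ := Bd2.lf ⟨B, hB⟩ a b
  set N := (s - min B B' - min B B' + 1).toNat
  rw [dsum_eq_sum c hB' s (a₀ := min B B') (N := N) (by omega) (by omega), sub_smul, mul_smul]
  have v0 : ∀ x y, (![x, y] - Pi.single 0 1 : Fin 2 → ℤ) = ![x - 1, y] := by
    intro x y; ext l; fin_cases l <;> simp
  have v1 : ∀ x y, (![x, y] - Pi.single 1 1 : Fin 2 → ℤ) = ![x, y - 1] := by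
    intro x y; ext l; fin_cases l <;> simp
  simp [act_lf, v0, v1, smul_sub]; congr 1
  · rw [dsum_eq_sum c hB (s - 1) (a₀ := min B B' - 1) (N := N) (by omega) (by omega),
      smul_sum, smul_sum]
    refine sum_congr rfl fun k _ => ?_; rw [smul_comm, smul_smul c, ← zpow_one_add₀ hc]
    congr 3
    · ring
    · ring_nf
  · rw [dsum_eq_sum c hB (s - 1) (a₀ := min B B') (N := N) (by omega) (by omega), smul_sum]
    refine sum_congr rfl fun k _ => ?_; rw [smul_comm, sub_right_comm]

lemma dsum_smul (c t : ℂ) (n : (Fin 2 → ℤ) → W) (s) : dsum c (t • n) s = t • dsum c n s := by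
  rw [dsum, dsum, smul_finsum]; grind [Pi.smul_apply, smul_comm]

end Dsum

section Fuse

variable {Y : Type*} [Fintype Y]

/-- The oscillators of `X(c w) Y(w)`. -/
def Osc.fuse (c : ℂ) (X Z : Osc Y) : Osc Y where
  cr y r := c ^ (r : ℕ) * X.cr y r + Z.cr y r
  an y r := c⁻¹ ^ (r : ℕ) * X.an y r + Z.an y r

lemma dsum_nprod {c} (hc : c ≠ 0) (X) (f : Osc.Sp Y) (s) :
    dsum c (fun e => Osc.nprod X [0, 1] e f) s = (Osc.fuse c (X 0) (X 1)).N1 s f := by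
  induction f using induction_on generalizing s with
  | C t =>
    rw [Osc.N1_C]; simp only [Osc.nprod_pair_C]
    have h1 : (fun e => t • ((X 0).E (e 0) * (X 1).E (e 1))) =
      t • fun e : Fin 2 → ℤ => ((X 0).E (e 0) * (X 1).E (e 1)) := rfl
    rw [h1, dsum_smul]; congr 1; have hb : ∀ e : Fin 2 → ℤ, (X 0).E (e 0) * (X 1).E (e 1) ≠ 0 →
        ∀ l ∈ [0, 1], 0 ≤ e l := by grind [Osc.E_of_neg, not_le.1, zero_mul, mul_zero]
    by_cases hs : 0 ≤ s
    · obtain ⟨s, rfl⟩ := Int.eq_ofNat_of_zero_le hs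
      rw [dsum_eq_sum c hb s (a₀ := 0) (N := s + 1) le_rfl (by push_cast; omega), Osc.E_natCast]
      have h2 : ∀ r, 0 < r → (Osc.fuse c (X 0) (X 1)).creLin r =
          MvPolynomial.C c ^ r * (X 0).creLin r + (X 1).creLin r := by
        intro r hr; simp only [Osc.creLin, mul_sum, ← sum_add_distrib]
        refine sum_congr rfl fun y _ => ?_
        simp only [Osc.fuse, toPNat'_coe, if_pos hr, smul_eq_C_mul, map_add,
          map_mul, map_pow]
        ring
      rw [expCoeff_congr h2, expCoeff_add (fun r => MvPolynomial.C c ^ r * (X 0).creLin r),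
        Finset.Nat.sum_antidiagonal_eq_sum_range_succ (fun i j => expCoeff (fun r => MvPolynomial.C
          c ^ r * (X 0).creLin r) i * expCoeff (X 1).creLin j)]
      refine sum_congr rfl fun k hk => ?_
      have hk' : k ≤ s := by simpa [Nat.lt_succ_iff] using hk
      rw [expCoeff_pow_mul]; have e2 : (s - (0 + k)) = ((s - k : ℕ) : ℤ) := by omega
      rw [e2, zero_add]; simp only [cons_val_zero, cons_val_one, Osc.E_natCast,
        zpow_natCast, smul_eq_C_mul, map_pow, mul_assoc]
    · rw [Osc.E_of_neg _ (not_le.1 hs), dsum_eq_sum c hb s (a₀ := 0) (N := 0) le_rfl (by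
        push_cast; omega)]
      rfl
  | add f g hf hg =>
    rw [map_add, ← hf, ← hg]; obtain ⟨B, hB⟩ := Osc.nprod_bounded X [0, 1] f
    obtain ⟨B', hB'⟩ := Osc.nprod_bounded X [0, 1] g; simp only [map_add]
    have hB1 : ∀ e, Osc.nprod X [0, 1] e f ≠ 0 → ∀ l ∈ [0, 1], min B B' ≤ e l :=
      fun e he l hl => (min_le_left _ _).trans (hB e he l hl)
    have hB2 : ∀ e, Osc.nprod X [0, 1] e g ≠ 0 → ∀ l ∈ [0, 1], min B B' ≤ e l :=
      fun e he l hl => (min_le_right _ _).trans (hB' e he l hl)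
    have hB3 : ∀ e, Osc.nprod X [0, 1] e f + Osc.nprod X [0, 1] e g ≠ 0 →
        ∀ l ∈ [0, 1], min B B' ≤ e l := by
      intro e he; by_cases h1 : Osc.nprod X [0, 1] e f = 0
      · exact hB2 e fun h2 => he (by rw [h1, h2, add_zero])
      · exact hB1 e h1
    set N := (s - min B B' - min B B' + 1).toNat
    rw [dsum_eq_sum c hB1 s (a₀ := min B B') (N := N) le_rfl (by omega),
      dsum_eq_sum c hB2 s (a₀ := min B B') (N := N) le_rfl (by omega),
      dsum_eq_sum c hB3 s (a₀ := min B B') (N := N) le_rfl (by omega), ← sum_add_distrib]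
    exact sum_congr rfl fun _ _ => smul_add _ _ _
  | mul_X f v hf =>
    rw [Osc.N1_mul_X, ← hf, ← hf]; obtain ⟨B, hB⟩ := Osc.nprod_bounded X [0, 1] f
    obtain ⟨B', hB'⟩ := Osc.nprod_bounded X [0, 1] (f * MvPolynomial.X v)
    set b := min B B' - v.2 with hb; set N := (s + v.2 - b - b + 1).toNat
    rw [dsum_eq_sum c hB' s (a₀ := b) (N := N) (by omega) (by omega),
      dsum_eq_sum c hB s (a₀ := b) (N := N) (by omega) (by omega)]
    simp only [Osc.nprod_pair_mul_X, smul_add, sum_add_distrib, Osc.fuse, add_smul]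
    have v0 : ∀ x y k, (![x, y] + Pi.single 0 k : Fin 2 → ℤ) = ![x + k, y] := by
      intro x y k; ext l; fin_cases l <;> simp
    have v1 : ∀ x y k, (![x, y] + Pi.single 1 k : Fin 2 → ℤ) = ![x, y + k] := by
      intro x y k; ext l; fin_cases l <;> simp
    rw [add_assoc]; congr 1
    · rw [sum_mul]; exact sum_congr rfl fun _ _ => (smul_mul_assoc _ _ _).symm
    · congr 1
      · rw [dsum_eq_sum c hB (s + v.2) (a₀ := b + v.2) (N := N) (by omega) (by omega),
          smul_sum]
        refine sum_congr rfl fun k _ => ?_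
        have e1 : b + (v.2 : ℕ) + k = b + k + (v.2 : ℕ) := by ring
        have e2 : s + (v.2 : ℕ) - (b + k + (v.2 : ℕ)) = s - (b + k) := by ring
        rw [v0, smul_smul, smul_smul, e1, e2, zpow_add₀ hc _ (v.2 : ℕ), zpow_natCast, inv_pow]
        have hp := pow_ne_zero v.2 hc; congr 1; field_simp
      · rw [dsum_eq_sum c hB (s + v.2) (a₀ := b) (N := N) (by omega) (by omega), smul_sum]
        refine sum_congr rfl fun k _ => ?_; rw [v1, smul_comm, sub_add_eq_add_sub s (b + k)]

end Fuse

/-! ### Poles in the products of currents of opposite type -/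

section Poles

variable {W : Type*} [AddCommGroup W] [Module ℂ W]

lemma vec_sub_zero (x y k) : (![x, y] - Pi.single 0 k : Fin 2 → ℤ) = ![x - k, y] := by
  ext l; fin_cases l <;> simp

lemma vec_sub_one (x y k) : (![x, y] - Pi.single 1 k : Fin 2 → ℤ) = ![x, y - k] := by
  ext l; fin_cases l <;> simp

def BdR (R : (Fin 2 → ℤ) → W) : Prop := ∃ B : ℤ, ∀ a b, b < B → R ![a, b] = 0

def BdL (R : (Fin 2 → ℤ) → W) : Prop := ∃ B : ℤ, ∀ a b, a < B → R ![a, b] = 0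

lemma BdR.lf {R : (Fin 2 → ℤ) → W} (h : BdR R) (x y : ℂ) : BdR (act (lf x y 0 1) R) := by
  obtain ⟨B, hB⟩ := h; refine ⟨B, fun a b hb => ?_⟩; simp only [act_lf, vec_sub_zero, vec_sub_one]
  rw [hB _ _ hb, hB _ _ (by omega)]; simp

lemma BdL.lf {R : (Fin 2 → ℤ) → W} (h : BdL R) (x y : ℂ) : BdL (act (lf x y 0 1) R) := by
  obtain ⟨B, hB⟩ := h; refine ⟨B, fun a b hb => ?_⟩; simp only [act_lf, vec_sub_zero, vec_sub_one]
  rw [hB _ _ hb, hB _ _ (by omega)]; simp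

lemma sub_of_simple_pole {c} (hc : c ≠ 0) {R S N : (Fin 2 → ℤ) → W} (hN : Bd2 N)
    (hR : BdR R) (hS : BdL S) (h1 : act (lf 1 c 0 1) R = N) (h2 : act (lf 1 c 0 1) S = N)
    (a b) : R ![a, b] - S ![a, b] = c ^ (-a - 1) • dsum c N (a + b + 1) := by
  obtain ⟨B, hB⟩ := hN; obtain ⟨B1, hB1⟩ := hR; obtain ⟨B2, hB2⟩ := hS
  have r1 : ∀ a b, R ![a - 1, b] = N ![a, b] + c • R ![a, b - 1] := by
    intro a b; have := congrFun h1 ![a, b]; grind [act_lf, vec_sub_zero, vec_sub_one, one_smul]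
  have r2 : ∀ a b, S ![a - 1, b] = N ![a, b] + c • S ![a, b - 1] := by
    intro a b; have := congrFun h2 ![a, b]
    simp only [act_lf, vec_sub_zero, vec_sub_one, one_smul] at this; rw [← this]; abel
  have rec1 : ∀ K a b, R ![a - 1, b] = ∑ k ∈ range K, c ^ k • N ![a + k, b - k] +
      c ^ K • R ![a - 1 + K, b - K] := by
    intro K; induction K with
    | zero => intro a b; simp
    | succ K ih =>
      intro a b; have e1 := r1 (a + K) (b - K); have e2 : a + K - 1 = a - 1 + K := by ring
      have e3 : a - 1 + (K + 1 : ℕ) = a + K := by push_cast; ring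
      have e4 : b - (K + 1 : ℕ) = b - K - 1 := by push_cast; ring
      rw [ih a b, Finset.sum_range_succ, e3, e4, ← e2, e1, smul_add, smul_smul, pow_succ]; abel
  have diff : ∀ (K : ℕ) a b, R ![a, b] - S ![a, b] =
      c ^ (-(K : ℤ)) • (R ![a - K, b + K] - S ![a - K, b + K]) := by
    intro K; induction K with
    | zero => intro a b; simp
    | succ K ih =>
      intro a b; have e1 := r1 (a - K) (b + K + 1); have e2 := r2 (a - K) (b + K + 1)
      have e3 : a - (K + 1 : ℕ) = a - K - 1 := by push_cast; ring
      have e4 : b + (K + 1 : ℕ) = b + K + 1 := by push_cast; ring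
      have e5 : c ^ (-((K + 1 : ℕ) : ℤ)) * c = c ^ (-(K : ℤ)) := by
        rw [← zpow_add_one₀ hc]; congr 1; push_cast; ring
      rw [add_sub_cancel_right] at e1 e2
      rw [ih a b, e3, e4, e1, e2, add_sub_add_left_eq_sub, ← smul_sub, smul_smul, e5]
  set K := (a - min B B2).toNat + 1 with hK; set N' := (b + K - min B1 B).toNat + 1 with hN'
  have hr := rec1 N' (a - K + 1) (b + K)
  rw [hB1 _ (b + K - N') (by omega), smul_zero, add_zero, add_sub_cancel_right] at hr
  rw [diff K a b, hr, hB2 _ _ (by omega), sub_zero, dsum_eq_sum c hB (a + b + 1) (a₀ := a - K + 1)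
    (N := N') (by omega) (by omega), smul_sum, smul_sum]
  refine sum_congr rfl fun k _ => ?_
  have e1 : a + b + 1 - (a - K + 1 + k) = b + K - k := by ring
  rw [smul_smul, smul_smul, ← zpow_add₀ hc, e1, ← zpow_natCast, ← zpow_add₀ hc]; congr 2; ring

lemma dsum_linP (c) (hc : c ≠ 0) {n : (Fin 2 → ℤ) → W} (hn : Bd2 n) (l) : Bd2 (act (linP l 0 1) n) ∧
    ∀ s, dsum c (act (linP l 0 1) n) s = (l.map fun p => p.1 * c - p.2).prod • dsum c n (s -
    l.length) := by
  induction l with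
  | nil => simpa [linP] using hn
  | cons p l ih =>
    have e1 : (linP (p :: l) 0 1 : Laurent (Fin 2) ℂ) = lf p.1 p.2 0 1 * linP l 0 1 := by
      simp [linP]
    rw [e1, map_mul, Module.End.mul_apply]; refine ⟨ih.1.lf _ _, fun s => ?_⟩
    grind [dsum_lf, map_cons, prod_cons, mul_smul, length_cons]

lemma dsum_num (c) (hc : c ≠ 0) {n : (Fin 2 → ℤ) → W} (hn : Bd2 n) (κ) (l) : Bd2 (act (algebraMap ℂ
    _ κ * linP l 0 1) n) ∧ ∀ s, dsum c (act (algebraMap ℂ _ κ * linP l 0 1) n) s = (κ * (l.map fun p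
    => p.1 * c - p.2).prod) • dsum c n (s - l.length) := by
  have h := dsum_linP c hc hn l; rw [map_mul, Module.End.mul_apply, act_algebraMap]
  refine ⟨?_, fun s => ?_⟩
  · obtain ⟨B, hB⟩ := h.1
    exact ⟨B, fun e he => hB e fun h0 => he (by rw [Pi.smul_apply, h0, smul_zero])⟩
  · rw [dsum_smul, h.2, mul_smul]

lemma BdR.rop {n : (Fin 2 → ℤ) → W} (hn : Bd2 n) (g) (φ : PowerSeries ℂ) : BdR (rop g φ 0 1 n) := by
  obtain ⟨B, hB⟩ := hn; refine ⟨B, fun a b hb => ?_⟩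
  refine finsum_eq_zero_of_forall_eq_zero fun k => ?_
  have e : (![a, b] - Pi.single 0 g - k • dir 0 1 : Fin 2 → ℤ) = ![a - g + k, b - k] := by
    rw [vec_sub_zero]; ext l; fin_cases l <;> simp [dir]
  rw [e, Bd2.le hB (inr (by omega)), smul_zero]

lemma BdL.rop {n : (Fin 2 → ℤ) → W} (hn : Bd2 n) (g) (φ : PowerSeries ℂ) : BdL (rop g φ 1 0 n) := by
  obtain ⟨B, hB⟩ := hn; refine ⟨B, fun a b hb => ?_⟩
  refine finsum_eq_zero_of_forall_eq_zero fun k => ?_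
  have e : (![a, b] - Pi.single 1 g - k • dir 1 0 : Fin 2 → ℤ) = ![a - k, b - g + k] := by
    rw [vec_sub_one]; ext l; fin_cases l <;> simp [dir]
  rw [e, Bd2.le hB (inl (by omega)), smul_zero]

lemma BdL.smul {R : (Fin 2 → ℤ) → W} (h : BdL R) (s : ℂ) : BdL (s • R) := by
  obtain ⟨B, hB⟩ := h; exact ⟨B, fun a b hb => by rw [Pi.smul_apply, hB _ _ hb, smul_zero]⟩

omit [Module ℂ W] in
lemma Bd2.bd {n : (Fin 2 → ℤ) → W} (hn : Bd2 n) : Bd (posHeight [0, 1]) n := bd_of_bounded hn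

omit [Module ℂ W] in
lemma Bd2.bd_swap {n : (Fin 2 → ℤ) → W} (hn : Bd2 n) : Bd (posHeight [1, 0]) n := by
  obtain ⟨B, hB⟩ := hn
  exact bd_of_bounded ⟨B, fun e he l hl => hB e he l (by simpa [or_comm] using hl)⟩

lemma lt_posHeight : Lt (posHeight [0, 1]) (0 : Fin 2) 1 :=
  (pairwise_cons.1 (posHeight_pairwise (by decide))).1 1 (by simp)

lemma lt_posHeight_swap : Lt (posHeight [1, 0]) (1 : Fin 2) 0 :=
  (pairwise_cons.1 (posHeight_pairwise (by decide))).1 0 (by simp)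

variable {g g' : ℤ} {φ φ' : PowerSeries ℂ} {κ κ' s : ℂ} {num num' : List (ℂ × ℂ)}

lemma rop_sub_of_simple_pole {c} (hc : c ≠ 0) (h1 : IsRat g φ ⟨κ, num, [(1, c)]⟩) (h2 : IsRat g'
    φ' ⟨κ', num', [(1, c⁻¹)]⟩) (hp : cst κ * linP num 0 1 = algebraMap ℂ _ (-c * s * κ') * linP num'
    1 0) {n : (Fin 2 → ℤ) → W} (hn : Bd2 n) (a b) : rop g φ 0 1 n ![a, b] - s • rop g' φ' 1 0 n ![a,
    b] = (c ^ (-a - 1) * (κ * (num.map fun p => p.1 * c - p.2).prod)) • dsum c n (a + b + 1 -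
    num.length) := by
  have d := dsum_num c hc hn κ num
  have := sub_of_simple_pole hc (R := rop g φ 0 1 n) (S := s • rop g' φ' 1 0 n) d.1
    (BdR.rop hn _ _) ((BdL.rop hn _ _).smul s) ?_ ?_ a b
  · rw [Pi.smul_apply, d.2, smul_smul] at this; exact this
  · have e := h1.act_rop lt_posHeight hn.bd; simpa [linP] using e
  · have e := h2.act_rop lt_posHeight_swap hn.bd_swap
    have e1 : (lf 1 c 0 1 : Laurent (Fin 2) ℂ) = algebraMap ℂ _ (-c) * linP [(1, c⁻¹)] 1 0 := by
      simp only [linP_cons, linP_nil, mul_one, lf, map_neg, map_one]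
      linear_combination (-zv 0) * alg_inv (ι := Fin 2) hc
    rw [e1, map_mul, Module.End.mul_apply, map_smul, e, hp, act_algebraMap, ← smul_assoc,
      ← act_algebraMap (S := ℂ), ← Module.End.mul_apply, ← map_mul, ← mul_assoc, ← map_mul,
      smul_eq_mul]

lemma rop_sub_of_double_pole {c} (hc : c ≠ 0) (hcc : c - c⁻¹ ≠ 0) (h1 : IsRat g φ ⟨κ, num, [(1,
    c), (1, c⁻¹)]⟩) (h2 : IsRat g' φ' ⟨κ', num', [(1, c), (1, c⁻¹)]⟩) (hp : cst κ * linP num 0 1 =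
    algebraMap ℂ _ (s * κ') * linP num' 1 0) {n : (Fin 2 → ℤ) → W} (hn : Bd2 n) (a b) : rop g φ 0 1
    n ![a, b] - s • rop g' φ' 1 0 n ![a, b] = (c - c⁻¹)⁻¹ • ((c ^ (-a - 1) * (κ * (num.map fun p =>
    p.1 * c - p.2).prod)) • dsum c n (a + b + 2 - num.length) - (c⁻¹ ^ (-a - 1) * (κ * (num.map fun
    p => p.1 * c⁻¹ - p.2).prod)) • dsum c⁻¹ n (a + b + 2 - num.length)) := by
  set R := rop g φ 0 1 n with hR; set S := s • rop g' φ' 1 0 n with hS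
  set N := act (algebraMap ℂ _ κ * linP num 0 1) n with hN; have bR : BdR R := BdR.rop hn _ _
  have bS : BdL S := (BdL.rop hn _ _).smul s
  have e1 : act (lf 1 c 0 1) (act (lf 1 c⁻¹ 0 1) R) = N := by
    have e := h1.act_rop lt_posHeight hn.bd; grind [Module.End.mul_apply, map_mul, linP]
  have e2 : act (lf 1 c 0 1) (act (lf 1 c⁻¹ 0 1) S) = N := by
    have e3 : (lf 1 c 0 1 * lf 1 c⁻¹ 0 1 : Laurent (Fin 2) ℂ) = linP [(1, c), (1, c⁻¹)] 1 0 := by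
      simp only [linP_cons, linP_nil, mul_one, lf, map_one]
      linear_combination (zv 1 * zv 1 - zv 0 * zv 0) * alg_inv (ι := Fin 2) hc
    rw [← Module.End.mul_apply, ← map_mul, e3, hS, map_smul, h2.act_rop lt_posHeight_swap
      hn.bd_swap, hN, hp]
    simp only [map_mul, mul_assoc, Module.End.mul_apply, act_algebraMap]
  have e1' : act (lf 1 c⁻¹ 0 1) (act (lf 1 c 0 1) R) = N := by
    rw [← e1, ← Module.End.mul_apply, ← Module.End.mul_apply, ← map_mul, ← map_mul, mul_comm]
  have e2' : act (lf 1 c⁻¹ 0 1) (act (lf 1 c 0 1) S) = N := by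
    rw [← e2, ← Module.End.mul_apply, ← Module.End.mul_apply, ← map_mul, ← map_mul, mul_comm]
  have d1 := dsum_num c hc hn κ num
  have k1 := sub_of_simple_pole hc d1.1 (bR.lf 1 c⁻¹) (bS.lf 1 c⁻¹) e1 e2 a (b + 1)
  have k2 := sub_of_simple_pole (inv_ne_zero hc) d1.1 (bR.lf 1 c) (bS.lf 1 c) e1' e2' a (b + 1)
  have e5 : a + (b + 1) + 1 = a + b + 2 := by ring
  rw [d1.2, smul_smul, e5] at k1
  rw [(dsum_num c⁻¹ (inv_ne_zero hc) hn κ num).2, smul_smul, e5] at k2; rw [← k1, ← k2]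
  simp only [act_lf, vec_sub_zero, vec_sub_one, add_sub_cancel_right]
  have e6 : s • rop g' φ' 1 0 n ![a, b] = S ![a, b] := rfl; rw [e6, eq_inv_smul_iff₀ hcc]; module

end Poles

/-! ### Currents of opposite type -/

def npair (x y : Lab P) (v : Osc.Sp (Boson P)) (e : Fin 2 → ℤ) : Osc.Sp (Boson P) :=
  Osc.nprod ![losc x, losc y] [0, 1] e v

lemma bd2_npair (x y) (v : Osc.Sp (Boson P)) : Bd2 (npair x y v) :=
  Osc.nprod_bounded _ _ v

lemma dsum_npair {c} (hc : c ≠ 0) (x y) (v : Osc.Sp (Boson P)) (s) :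
    dsum c (npair x y v) s = (Osc.fuse c (losc x) (losc y)).N1 s v :=
  dsum_nprod hc _ v s

lemma op_mul_single (x y) (e e') (α) (v) : ((llet Λ x).op e
    * (llet Λ y).op e') (Finsupp.single α v) = Finsupp.single (α + ((llet Λ x).β + (llet Λ y).β))
    (((llet Λ x).σ α * (llet Λ y).σ α) • rop (lg x y) (PowerSeries.C (lt x y) * Osc.phi (losc x)
    (losc y)) 0 1 (npair x y v) ![e - (llet Λ x).ex α, e' - (llet Λ y).ex α]) := by
  have h := Letter.wordOp_single (compat_llet Λ ![x, y]) (w := [0, 1]) (by decide) ![e, e'] α v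
  have e2 : (fun i => ![e, e'] i - (llet Λ (![x, y] i)).ex α) = ![e - (llet Λ x).ex α, e' -
    (llet Λ y).ex α] := by funext i; fin_cases i <;> simp
  simp [e2, Letter.wordOp, List.map, prod_cons, prod_nil,
    mul_one, sum_cons, sum_nil, add_zero, wop_pair, Letter.pairData,
    cons_val_zero, cons_val_one, llet_osc] at h
  exact h

lemma op_mul_single_swap (x y e e' α v) : ((llet Λ
    y).op e' * (llet Λ x).op e) (Finsupp.single α v) = Finsupp.single (α + ((llet Λ x).β + (llet Λ
    y).β)) (((llet Λ x).σ α * (llet Λ y).σ α) • rop (lg y x) (PowerSeries.C (lt y x) * Osc.phi (losc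
    y) (losc x)) 1 0 (npair x y v) ![e - (llet Λ x).ex α, e' - (llet Λ y).ex α]) := by
  have h := Letter.wordOp_single (compat_llet Λ ![x, y]) (w := [1, 0]) (by decide) ![e, e'] α v
  have e2 : (fun i => ![e, e'] i - (llet Λ (![x, y] i)).ex α) = ![e - (llet Λ x).ex α, e' -
    (llet Λ y).ex α] := by funext i; fin_cases i <;> simp
  simp only [e2, Letter.wordOp, map_cons, map_nil, prod_cons, prod_nil,
    mul_one, sum_cons, sum_nil, add_zero, wop_pair, Letter.pairData,
    cons_val_zero, cons_val_one, llet_osc, Osc.nprod_perm _ perm_swap_fin_two] at h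
  rw [add_comm (llet Λ x).β, mul_comm ((llet Λ x).σ α)]; exact h

lemma lsum_commutator_single {κ : Type*} [Fintype κ] (f f') (c c' : κ → ℂ) (s : ℂ) (e e'
    : ℤ) (α) (v) : (lsum Λ f c e * lsum Λ f' c' e' - s • (lsum Λ f' c'
    e' * lsum Λ f c e)) (Finsupp.single α v) = ∑ k, ∑ k', Finsupp.single (α + ((llet Λ (f k)).β +
    (llet Λ (f' k')).β)) ((c k * c' k' * ((llet Λ (f k)).σ α * (llet Λ (f' k')).σ α)) • (rop (lg (f
    k) (f' k')) (PowerSeries.C (lt (f k) (f' k')) * Osc.phi (losc (f k)) (losc (f' k'))) 0 1 (npair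
    (f k) (f' k') v) ![e - (llet Λ (f k)).ex α, e' - (llet Λ (f' k')).ex α] - s • rop (lg (f' k') (f
    k)) (PowerSeries.C (lt (f' k') (f k)) * Osc.phi (losc (f' k')) (losc (f k))) 1 0 (npair (f k)
    (f' k') v) ![e - (llet Λ (f k)).ex α, e' - (llet Λ (f' k')).ex α])) := by
  have h1 : lsum Λ f c e * lsum Λ f' c' e' = ∑ k, ∑ k', (c k * c' k') • ((llet Λ (f k)).op e *
    (llet Λ (f' k')).op e') := by simp only [lsum, sum_mul_sum, smul_mul_smul_comm]
  have h2 : lsum Λ f' c' e' * lsum Λ f c e = ∑ k, ∑ k', (c k * c' k') •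
      ((llet Λ (f' k')).op e' * (llet Λ (f k)).op e) := by
    simp only [lsum, sum_mul_sum, smul_mul_smul_comm]; rw [sum_comm]
    simp only [mul_comm (c' _)]
  rw [h1, h2, LinearMap.sub_apply, LinearMap.smul_apply]
  simp only [LinearMap.sum_apply, LinearMap.smul_apply]
  rw [smul_sum, ← sum_sub_distrib]; refine sum_congr rfl fun k _ => ?_
  rw [smul_sum, ← sum_sub_distrib]; refine sum_congr rfl fun k' _ => ?_
  rw [op_mul_single, op_mul_single_swap Λ (f k)]
  simp only [smul_single, ← single_sub, smul_sub, smul_smul]; congr 3; ring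

lemma exch_next_of_lt {b b'} (hb : b ≠ b') {i} (h : i.1 < P.m) (ε ε') :
    Exch (.V b i ε) (.V b' (next P i) ε') (psgn i (next P i)) := by
  have hm : ¬ P.m ≤ i.1 := by omega
  have hs : (sg b * sg b' : ℂ) = -1 := by exact_mod_cast sg_mul_ne hb
  refine ⟨lt (.V b i ε) (.V b' (next P i) ε'), lt (.V b' (next P i) ε') (.V b i ε), [(1, P.d)],
    [(1, P.d⁻¹)], ?_, ?_, ?_⟩
  · refine isRat_of_contr _ [P.d] [] (fun r hr => ?_) ?_
    · simp [losc]; rw [contr_next _ _ _ _ _ hr, if_neg hm, hs, hx, if_neg hb]; simp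
    · rw [lg_next, if_neg hm, sg_mul_ne hb]; rfl
  · refine isRat_of_contr _ [P.d⁻¹] [] (fun r hr => ?_) ?_
    · simp [losc]; rw [contr_next_swap _ _ _ _ _ hr, if_neg hm, hs, hx, if_neg hb]; simp
    · rw [lg_next_swap, if_neg hm, sg_mul_ne hb]; rfl
  · have hlt : lt (.V b (i) ε) (.V b' (next P i) ε') =
        -psgn i (next P i) * lt (.V b' (next P i) ε') (.V b i ε) * P.d⁻¹ := by
      rw [lt_next, lt_next_swap, if_neg hm, if_neg hm, sg_mul_ne hb, twist_next_of_lt h, neg_neg,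
        zpow_neg, zpow_one, dHalf_inv]
      linear_combination (-(twist (root P i) (root P (next P i))) * P.dHalf * P.d⁻¹) *
        psgn_mul_self i (next P i)
    rw [hlt]; simp only [linP_cons, linP_nil, mul_one, lf, map_neg, map_mul, map_one]
    linear_combination (cst (psgn i (next P i)) *
      algebraMap ℂ _ (lt (.V b' (next P i) ε') (.V b i ε)) * zv 1) * alg_inv P.d_ne_zero

lemma usc_true_false {i} (h : P.m ≤ i.1) (ε ε') :
    usc true i ε i = P.d * usc false (next P i) ε' i := by
  have h1 := usc_false_prev (next P i) ε'; rw [prev_next] at h1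
  rw [usc_true_self, h1, dsc_next h, zpow_sub_one₀ P.d_ne_zero]; grind [P.d_ne_zero]

lemma exch_next_of_le {i} (h : P.m ≤ i.1) (ε ε') :
    Exch (.V true i ε) (.V false (next P i) ε') (psgn i (next P i)) := by
  have hs : (sg true * sg false) = -1 := rfl; have hd := P.d_ne_zero
  have h1 := usc_true_false h ε ε'; have h2 := usc_ne_zero false (next P i) ε' i
  refine ⟨lt (.V true i ε) (.V false (next P i) ε'), lt (.V false (next P i) ε') (.V true i ε), [],
    [], ?_, ?_, ?_⟩
  · refine isRat_of_contr _ [] [] (fun r hr => ?_) ?_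
    · simp only [losc]; rw [contr_next _ _ _ _ _ hr, if_pos h, hx, if_neg (by simp), h1]
      simp [div_mul_cancel_right₀ h2]
    · rw [lg_next, if_pos h]; rfl
  · refine isRat_of_contr _ [] [] (fun r hr => ?_) ?_
    · simp only [losc]; rw [contr_next_swap _ _ _ _ _ hr, if_pos h, hx, if_neg (by simp), h1]
      simp [mul_div_cancel_right₀ _ h2]
    · rw [lg_next_swap, if_pos h]; rfl
  · have hlt : lt (.V true i ε) (.V false (next P i) ε') =
        psgn i (next P i) * lt (.V false (next P i) ε') (.V true i ε) := by
      rw [lt_next, lt_next_swap, if_pos h, if_pos h, hs, twist_next_of_le h, neg_neg,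
        zpow_neg, zpow_one, dHalf_inv, zpow_one, zpow_one, h1]
      field_simp; linear_combination (-(twist (root P i) (root P (next P i))) * P.dHalf) *
        psgn_mul_self i (next P i)
    rw [hlt]; simp [linP]

/-- The boson under the `q`-derivative. -/
def dj (b : Bool) (i : Idx P) (h : dpart b i) : CIdx P :=
  ⟨if b then prev P i else i, by cases b <;> simpa [dpart] using h⟩

lemma prod_dpart {R : Type*} [CommMonoid R] (b : Bool) (i) (f : CIdx P → R) : (∏ j : CIdx P,
    if (if b then next P j.1 else j.1) = i then f j else 1) = if h : dpart b i then f (dj b i h)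
    else 1 := by
  have key : ∀ j : CIdx P, (if b then next P j.1 else j.1) = i ↔ j.1 = if b then prev P i else i := by
    intro j; cases b
    · simp
    · simp only [if_true]; rw [eq_comm, eq_next_iff]
  by_cases h : dpart b i
  · rw [dif_pos h, Finset.prod_eq_single (dj b i h)]
    · rw [if_pos]; rw [key]; rfl
    · intro j _ hj; rw [if_neg]; intro h'; exact hj (Subtype.ext ((key j).1 h'))
    · simp
  · rw [dif_neg h]; refine prod_eq_one fun j _ => if_neg fun h' => h ?_; have := j.2
    rw [(key j).1 h'] at this; cases b <;> simpa [dpart] using this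

lemma vcf_eq (b i ε) : vcf Λ b i ε = (if b then (if P.m ≤ i.1 then P.d ^ dsc i else 1) else if P.m
    ≤ (prev P i).1 then -P.d ^ dsc i else 1) * (∏ j : CIdx P, exp (sg b * kvec i j.1 *
    Λ.tilde.2 j * (dsc i * P.logd))) * if h : dpart b i then (P.q - P.q⁻¹)⁻¹ * (sg ε * exp
    (-Λ.tilde.2 (dj b i h) * (sg ε * P.logq))) else if ε then 1 else 0 := by
  rw [vcf, prod_dpart b i fun j => exp (-Λ.tilde.2 j * (sg ε * P.logq))]; grind

lemma zpow_sum {κ : Type*} {x : ℂ} (hx : x ≠ 0) (s) (f : κ → ℤ) :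
    x ^ (∑ k ∈ s, f k) = ∏ k ∈ s, x ^ f k := by
  classical
  induction s using Finset.induction_on with
  | empty => simp
  | insert a s ha ih => rw [sum_insert ha, Finset.prod_insert ha, zpow_add₀ hx, ih]

lemma vlet_sigma_eq (b i ε α) : (vlet Λ b i ε).σ α = (if b then twist (root P i) α.1 else twist
    (root P i) (α.1 - root P i)) * P.dHalf ^ (sg b * amForm i α.1) * (P.d ^ dsc i) ^ (sg b * ∑ j,
    kvec i j.1 * α.2 j) * if h : dpart b i then qe P ε ^ (-α.2 (dj b i h)) else 1 := by
  rw [vlet]; simp only; rw [mul_assoc (_ * _)]; congr 1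
  rw [← prod_dpart b i fun j => qe P ε ^ (-α.2 j), mul_sum,
    zpow_sum (zpow_ne_zero _ P.d_ne_zero), ← prod_mul_distrib]
  refine prod_congr rfl fun j _ => ?_; rw [usc, mul_zpow, ← mul_assoc (sg b)]; congr 1
  split_ifs with h1 h2 h2
  · have : kvec i j.1 = -1 := by rw [← h2, kvec_next_self]
    rw [this, h1]; congr 1; simp [sg]
  · aesop
  · have : kvec i j.1 = 1 := by rw [h2, kvec_self]
    rw [this]; congr 1; simp [sg, h1]
  · exact one_zpow _

lemma sum_root_tilde (i) : lint Λ i =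
    ∑ l, root P i l * Λ.tilde.1 l + ∑ j, (kvec i j.1) * Λ.tilde.2 j := by
  have hi := i.isLt; have hm := P.one_le_m; have hn := P.one_le_n; have hpc := prev_cases i
  rw [sum_charged i (fun j => (kvec i j.1) * Λ.tilde.2 j)
    (fun j h1 h2 => by rw [kvec_eq_zero h1 h2]; simp)]
  simp [kvec_self, kvec_prev, cast_one, one_mul, cast_neg, neg_mul]
  have hr : ∑ l, root P i l * Λ.tilde.1 l =
      if h : i.1 = 0 then -∑ l, Λ.tilde.1 l else Λ.tilde.1 ⟨i, h⟩ := by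
    split_ifs with h
    · simp [root, h]
    · rw [sum_eq_single ⟨i, h⟩]
      · simp [root, h]
      · intro l _ hl; have : l.1 ≠ i := fun h' => hl (Subtype.ext h'); simp [root, h, this]
      · simp
  rw [hr]; rcases Λ with ⟨i₀, h₀⟩ | a
  · have h₀' : i₀.1 ≠ 0 ∧ i₀.1 ≠ P.m := by grind [IsOdd]
    have hs : ∑ l, (Weight.fund i₀ h₀).tilde.1 l = 1 := by
      rw [sum_eq_single ⟨i₀, h₀'.1⟩]
      · simp [Weight.tilde]
      · intro l _ hl; have : l.1 ≠ i₀ := fun h' => hl (Subtype.ext h'); simp [Weight.tilde, this]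
      · simp
    have e1 : i = i₀ ↔ i.1 = i₀.1 := ext_iff; have := i₀.isLt; rw [hs]
    simp only [lint, Weight.tilde, e1, Fin.le_def]; split_ifs <;> first | omega | simp
  · have hs : ∑ l : RootIdx P, (Weight.line a).tilde.1 l = a := by
      rw [sum_eq_single mRoot]
      · simp [Weight.tilde, mRoot]
      · intro l _ hl; have : l.1.1 ≠ P.m := fun h' => hl (Subtype.ext (Fin.ext h'))
        simp [Weight.tilde, this]
      · simp
    rw [hs]; simp [lint, Weight.tilde]; split_ifs <;> first | omega | simp

lemma qe_eq_exp (p) (k : ℤ) : qe P p ^ k = exp (k * (sg p * P.logq)) := by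
  rw [exp_int_mul, exp_int_mul_logq]; simp [qe, sg]

lemma qe_not (p) : qe P (!p) = (qe P p)⁻¹ := by cases p <;> simp [qe]

lemma sg_not (p) : sg (!p) = -sg p := by cases p <;> rfl

def numEF (i : Idx P) (ε ε' : Bool) : List ℂ :=
  (if P.m ≤ i.1 then [(qe P ε')⁻¹] else []) ++ if P.m ≤ (prev P i).1 then [qe P ε] else []

def numFE (i : Idx P) (ε ε' : Bool) : List ℂ :=
  (if P.m ≤ i.1 then [qe P ε'] else []) ++ if P.m ≤ (prev P i).1 then [(qe P ε)⁻¹] else []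

lemma lt_EF (i ε ε') : lt (.V true i ε) (.V false i ε') = twist (root P i) (root P
    i) * ((if P.m ≤ i.1 then (P.d ^ dsc i)⁻¹ else 1) * if P.m ≤ (prev P i).1 then (P.d ^ dsc i *
    qe P ε)⁻¹ else 1) := by
  rw [lt, M_self, mul_zero, mul_zero, zpow_zero, prod_charged i, mul_one]
  · simp [kvec_self, kvec_prev, usc_true_self, usc_true_prev, sg, if_true, false_eq_true,
      if_false, mul_one, mul_neg, neg_neg, zpow_neg_one, dite_eq_ite]
  · grind [kvec_eq_zero, zpow_zero]

lemma lt_FE (i ε ε') : lt (.V false i ε') (.V true i ε) = twist (root P i) (root P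
    i) * ((if P.m ≤ i.1 then (P.d ^ dsc i * qe P ε')⁻¹ else 1) * if P.m ≤ (prev P i).1 then (P.d
    ^ dsc i)⁻¹ else 1) := by
  rw [lt, M_self, mul_zero, mul_zero, zpow_zero, prod_charged i, mul_one]
  · simp [kvec_self, kvec_prev, usc_false_self, usc_false_prev, sg, if_true,
      mul_one, mul_neg, neg_neg, zpow_neg_one, dite_eq_ite]
  · grind [kvec_eq_zero, zpow_zero]

lemma A_self_cases (i) : A P i i = 2 * (1 - (if P.m ≤ i.1 then 1 else 0) -
    if P.m ≤ (prev P i).1 then 1 else 0) := by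
  have := P.one_le_m; rw [A, if_pos rfl]; grind [IsOdd, prev_ge_iff]

lemma lg_opp (i) {b b'} (h : b ≠ b') (ε ε') : lg (.V b i ε) (.V b' i ε') =
    (if P.m ≤ i.1 then 1 else 0) + (if P.m ≤ (prev P i).1 then 1 else 0) - 2 := by
  rw [lg, kvec_sum_self, A_self_cases, sg_mul_ne h]; ring

lemma contr_opp (i) {b b'} (h : b ≠ b') (ε ε') {r} (hr : 0 < r) : Osc.contr (vosc b i ε) (vosc b' i
    ε') r = (P.q ^ r + P.q⁻¹ ^ r) / r * (1 - (if P.m ≤ i.1 then 1 else 0) - if P.m ≤ (prev P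
    i).1 then 1 else 0) + ((if P.m ≤ i.1 then (usc b' i ε' i / usc b i ε i) ^ r / r else 0) + if
    P.m ≤ (prev P i).1 then (usc b' i ε' (prev P i) / usc b i ε (prev P i)) ^ r / r else 0) := by
  have hs : (sg b * sg b' : ℂ) = -1 := by exact_mod_cast sg_mul_ne h
  have hA : qInt P (r * A P i i) / qInt P r = (P.q ^ r + P.q⁻¹ ^ r) *
      (1 - (if P.m ≤ i.1 then 1 else 0) - if P.m ≤ (prev P i).1 then 1 else 0) := by
    rw [A_self_cases, ← qInt_two_mul r hr]; split_ifs <;> simp [qInt_zero, qInt_neg, neg_div]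
  rw [contr_vosc _ _ _ _ _ _ hr, hA, hs, M_self, if_neg h, sum_charged i]
  · simp [kvec_self, kvec_prev, neg_zero, zpow_zero, mul_one, one_pow, neg_neg, one_mul,
      cast_one, cast_neg, mul_neg, dite_eq_ite]
    ring
  · intro j h1 h2; simp [kvec_eq_zero h1 h2]

lemma qe_cases (ε r) : qe P ε ^ r + (qe P ε)⁻¹ ^ r = P.q ^ r + P.q⁻¹ ^ r := by
  cases ε <;> simp [qe, add_comm]

lemma rat_EF (i : Idx P) (ε ε') : LRat (.V true i ε) (.V false i ε') ⟨lt (.V true i ε) (.V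
    false i ε'), (numEF i ε ε').map fun c => (1, c), [(1, P.q), (1, P.q⁻¹)]⟩ := by
  have hd : P.d ^ dsc i ≠ 0 := zpow_ne_zero _ P.d_ne_zero; have hq := qe_ne_zero (P := P) ε
  refine isRat_of_contr _ (numEF i ε ε') [P.q, P.q⁻¹] (fun r hr => ?_) ?_
  · simp [losc]
    rw [contr_opp i (by simp) ε ε' hr, usc_true_self, usc_true_prev, usc_false_self, usc_false_prev,
      mul_div_cancel_left₀ _ hd, div_mul_cancel_left₀ hd]
    have e1 := qe_cases (P := P) ε r; have e2 := qe_cases (P := P) ε' r; unfold numEF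
    split_ifs <;> simp [append_nil, nil_append, cons_append, map_cons,
      map_nil, sum_cons, sum_nil]
    · linear_combination (1 / r) * e1 + (1 / r) * e2
    · linear_combination (1 / r) * e2
    · linear_combination (1 / r) * e1
    · ring
  · rw [lg_opp i (by simp)]; unfold numEF; split_ifs <;> simp

lemma rat_FE (i : Idx P) (ε ε') : LRat (.V false i ε') (.V true i ε) ⟨lt (.V false i ε') (.V
    true i ε), (numFE i ε ε').map fun c => (1, c), [(1, P.q), (1, P.q⁻¹)]⟩ := by
  have hd : P.d ^ dsc i ≠ 0 := zpow_ne_zero _ P.d_ne_zero; have hq := qe_ne_zero (P := P) ε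
  refine isRat_of_contr _ (numFE i ε ε') [P.q, P.q⁻¹] (fun r hr => ?_) ?_
  · simp [losc]
    rw [contr_opp i (by simp) ε' ε hr, usc_true_self, usc_true_prev, usc_false_self, usc_false_prev,
      mul_div_cancel_left₀ _ hd, div_mul_cancel_left₀ hd]
    have e1 := qe_cases (P := P) ε r; have e2 := qe_cases (P := P) ε' r; unfold numFE
    split_ifs <;> simp [append_nil, nil_append, cons_append, map_cons,
      map_nil, sum_cons, sum_nil]
    · linear_combination (1 / r) * e1 + (1 / r) * e2
    · linear_combination (1 / r) * e2
    · linear_combination (1 / r) * e1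
    · ring
  · rw [lg_opp i (by simp)]; unfold numFE; split_ifs <;> simp

lemma poly_EF (i : Idx P) (ε ε') : cst (lt (.V true i ε) (.V false i ε')) * linP ((numEF i ε
    ε').map fun c => (1, c)) 0 1 = algebraMap ℂ _ (psgn i i * lt (.V false i ε') (.V true i ε)) *
    linP ((numFE i ε ε').map fun c => (1, c)) 1 0 := by
  have hq := alg_inv (ι := Fin 2) (qe_ne_zero (P := P) ε)
  have hq' := alg_inv (ι := Fin 2) (qe_ne_zero (P := P) ε'); have hm := P.one_le_m
  have hn := P.one_le_n
  have hs : psgn i i = (if P.m ≤ i.1 then -1 else 1) * if P.m ≤ (prev P i).1 then -1 else 1 :=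
    by
    rw [psgn, par]; simp [prev_ge_iff i, IsOdd]
    by_cases h1 : P.m ≤ i.1 <;> by_cases h2 : i.1 = 0 ∨ P.m < i.1 <;> by_cases h3 : i.1 = 0
      ∨ i.1 = P.m <;> simp [h1, h2, h3, if_true, if_false] <;> first | (exfalso; omega) | simp
  rw [lt_EF, lt_FE, hs, numEF, numFE]
  split_ifs <;> simp only [append_nil, nil_append, cons_append, map_cons,
    map_nil, linP, prod_cons, prod_nil, lf, mul_inv, map_mul, map_one, map_neg]
  all_goals
    set x := cst (qe P ε); set x' := cst (qe P ε)⁻¹; set y := cst (qe P ε')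
    set y' := cst (qe P ε')⁻¹; set t := cst (twist (root P i) (root P i))
    set D := cst (P.d ^ dsc i)⁻¹; set z : Laurent (Fin 2) ℂ := zv 0
    set w : Laurent (Fin 2) ℂ := zv 1
  · linear_combination (t * D * D * (y' * w ^ 2 - z * w)) * hq +
      (t * D * D * (z * w - x' * z ^ 2)) * hq'
  · linear_combination (-(t * D * z)) * hq'
  · linear_combination (-(t * D * w)) * hq
  · ring

def resE (i : Idx P) (p : Bool) : Bool := if dpart true i then !p else true

def resF (i : Idx P) (p : Bool) : Bool := if dpart false i then p else true

lemma vcf_residue_eq_zero (Λ) (i : Idx P) (p ε ε') (h : ¬ (ε = resE i p ∧ ε' =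
    resF i p)) : vcf Λ true i ε * vcf Λ false i ε' * (((numEF i ε ε').map fun c => (1, c)).map
    fun x => x.1 * qe P p - x.2).prod = 0 := by
  by_cases h1 : ε = resE i p
  · have h2 := fun h2 => h ⟨h1, h2⟩; by_cases hF : dpart false i
    · have hF' : P.m ≤ i.1 := by simpa [dpart] using hF
      rw [resF, if_pos hF] at h2; have : ε' = !p := by cases ε' <;> cases p <;> simp_all
      simp [numEF, if_pos hF', this, qe_not]
    · grind [resF, eq_true_of_vcf]
  · by_cases hE : dpart true i
    · have hE' : P.m ≤ (prev P i).1 := by simpa [dpart] using hE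
      rw [resE, if_pos hE] at h1; have : ε = p := by cases ε <;> cases p <;> simp_all
      rw [numEF, if_pos hE', this]; simp
    · rw [resE, if_neg hE] at h1; have : vcf Λ true i ε = 0 := by
        by_contra h0; exact h1 (eq_true_of_vcf Λ h0 hE)
      rw [this]; ring

lemma residue_coeff (Λ) (i) (p) (α : QLat P) (e) : vcf Λ true i (resE i p) * vcf Λ false i (resF i
    p) * ((vlet Λ true i (resE i p)).σ α * (vlet Λ false i (resF i p)).σ α) * (qe P p ^ (-(e - (vlet
    Λ true i (resE i p)).ex α) - 1) * (lt (.V true i (resE i p)) (.V false i (resF i p)) * (((numEF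
    i (resE i p) (resF i p)).map fun c => (1, c)).map fun x => x.1 * qe P p - x.2).prod)) = qe P p ^
    (-e) * exp (sg p * rootPair Λ i α * P.logq) := by
  have hd : P.d ^ dsc i ≠ 0 := zpow_ne_zero _ P.d_ne_zero; have hc := qe_ne_zero (P := P) p
  have hQ := q_sub_ne_zero P
  have hcc : qe P p - (qe P p)⁻¹ = sg p * (P.q - P.q⁻¹) := by cases p <;> simp [qe, sg]
  have hsp : (sg p : ℂ) * sg p = 1 := sgc_mul_self p
  have hE : dpart true i ↔ P.m ≤ (prev P i).1 := by simp [dpart]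
  have hF : dpart false i ↔ P.m ≤ i.1 := by simp [dpart]
  have ht : twist (root P i) α.1 * twist (root P i) (α.1 - root P i) *
      twist (root P i) (root P i) = 1 := by
    have := twist_add_zsmul (root P i) (α.1 - root P i) (root P i) true
    rw [sg, if_pos rfl, one_smul, sub_add_cancel] at this; rw [this]
    linear_combination twist_mul_self (root P i) (α.1 - root P i) *
      twist (root P i) (root P i) ^ 2 + twist_mul_self (root P i) (root P i)
  have hX : (∏ j, exp (sg true * kvec i j.1 * Λ.tilde.2 j * (dsc i * P.logd))) *
      (∏ j, exp (sg false * kvec i j.1 * Λ.tilde.2 j * (dsc i * P.logd))) = 1 := by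
    rw [← prod_mul_distrib]; refine prod_eq_one fun j _ => ?_
    rw [← exp_add, ← exp_zero]; congr 1; simp [sg]
  have hH : P.dHalf ^ (sg true * amForm i α.1) * P.dHalf ^ (sg false * amForm i α.1) = 1 := by
    rw [← zpow_add₀ (dHalf_ne_zero P)]; simp [sg]
  have hD : (P.d ^ dsc i) ^ (sg true * ∑ j, kvec i j.1 * α.2 j) * (P.d ^ dsc i) ^ (sg false * ∑ j,
    kvec i j.1 * α.2 j) = 1 := by rw [← zpow_add₀ hd]; simp [sg]
  have hex : qe P p ^ (-(e - (vlet Λ true i (resE i p)).ex α) - 1) = qe P p ^ (-e) *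
      (qe P p ^ (form P (root P i) α.1 + ∑ j, kvec i j.1 * α.2 j + lint Λ i) *
        if P.m ≤ (prev P i).1 then (qe P p)⁻¹ else 1) := by
    have : (if P.m ≤ (prev P i).1 then (qe P p)⁻¹ else 1) =
      qe P p ^ (-(if P.m ≤ (prev P i).1 then 1 else 0 : ℤ)) := by split_ifs <;> simp
    rw [this, ← zpow_add₀ hc, ← zpow_add₀ hc]; congr 1; simp only [vlet, sg, if_true, hE]; ring
  rw [vcf_eq, vcf_eq, vlet_sigma_eq, vlet_sigma_eq, hex, lt_EF]
  have hr : exp (sg p * rootPair Λ i α * P.logq) =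
      qe P p ^ (form P (root P i) α.1 + ∑ j, kvec i j.1 * α.2 j + lint Λ i) *
      exp (-(∑ j, kvec i j.1 * α.2 j + ∑ j, kvec i j.1 * Λ.tilde.2 j) *
        (sg p * P.logq)) := by
    rw [qe_eq_exp, ← exp_add, rootPair]; have := sum_root_tilde Λ i; congr 1; push_cast
    linear_combination (-(sg p * P.logq)) * this
  rw [hr]; simp only [if_true, false_eq_true, if_false]
  generalize hL : form P (root P i) α.1 + ∑ j, kvec i j.1 * α.2 j + lint Λ i = L
  generalize (∏ j, exp (sg true * kvec i j.1 * Λ.tilde.2 j * (dsc i * P.logd))) = X1 at hX ⊢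
  generalize (∏ j, exp (sg false * kvec i j.1 * Λ.tilde.2 j *
    (dsc i * P.logd))) = X2 at hX ⊢
  generalize twist (root P i) α.1 = t1 at ht ⊢
  generalize twist (root P i) (α.1 - root P i) = t2 at ht ⊢
  generalize twist (root P i) (root P i) = t3 at ht ⊢
  generalize P.dHalf ^ (sg true * amForm i α.1) = H1 at hH ⊢
  generalize P.dHalf ^ (sg false * amForm i α.1) = H2 at hH ⊢
  generalize (P.d ^ dsc i) ^ (sg true * ∑ j, kvec i j.1 * α.2 j) = D1 at hD ⊢
  generalize (P.d ^ dsc i) ^ (sg false * ∑ j, kvec i j.1 * α.2 j) = D2 at hD ⊢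
  have hall : t1 * t2 * t3 * (X1 * X2) * (H1 * H2) * (D1 * D2) = 1 := by
    rw [ht, hX, hH, hD]; norm_num
  have sα := sum_charged i (fun j => (kvec i j.1 : ℂ) * α.2 j)
    (fun j h1 h2 => by rw [kvec_eq_zero h1 h2]; simp)
  have sμ := sum_charged i (fun j => (kvec i j.1) * Λ.tilde.2 j)
    (fun j h1 h2 => by rw [kvec_eq_zero h1 h2]; simp)
  simp only [kvec_self, kvec_prev, cast_one, one_mul, cast_neg, neg_mul] at sα sμ
  have e3 : ∀ (k : ℤ) x, qe P p ^ k * exp (x * (sg p * P.logq)) = exp ((k + x) *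
    (sg p * P.logq)) := by intro k x; rw [qe_eq_exp, ← exp_add]; congr 1; ring
  have hprod : (((numEF i (resE i p) (resF i p)).map fun c => (1, c)).map fun x => x.1 * qe P p -
    x.2).prod = (if P.m ≤ i.1 then qe P p - (qe P (resF i p))⁻¹ else 1) * if P.m ≤ (prev P i).1
      then qe P p - qe P (resE i p) else 1 := by unfold numEF; split_ifs <;> simp
  generalize P.q - P.q⁻¹ = Q at hQ hcc ⊢
  have hFp : (if P.m ≤ i.1 then P.d ^ dsc i else 1) * (if h : dpart false i then
        Q⁻¹ * (sg (resF i p) * exp (-Λ.tilde.2 (dj false i h) * (sg (resF i p) * P.logq)))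
        else if resF i p then 1 else 0) *
      (if h : dpart false i then qe P (resF i p) ^ (-α.2 (dj false i h)) else 1) *
      (if P.m ≤ i.1 then (P.d ^ dsc i)⁻¹ else 1) *
      (if P.m ≤ i.1 then qe P p - (qe P (resF i p))⁻¹ else 1) =
      exp (-((if h : P.m ≤ i.1 then (α.2 ⟨i, h⟩ : ℂ) else 0) +
        if h : P.m ≤ i.1 then Λ.tilde.2 ⟨i, h⟩ else 0) * (sg p * P.logq)) := by
    by_cases h1 : P.m ≤ i.1
    · have c1 := hF.2 h1; have j1 : dj false i c1 = ⟨i, h1⟩ := Subtype.ext (by simp [dj])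
      simp only [resF, if_pos h1, if_pos c1, dif_pos c1, dif_pos h1, j1, hcc]
      rw [neg_add, ← cast_neg, ← e3]; field_simp; linear_combination hsp
    · have c1 := mt hF.1 h1; simp [resF, h1, c1]
  have hEp : (if P.m ≤ (prev P i).1 then -P.d ^ dsc i else 1) * (if h : dpart true i then
        Q⁻¹ * (sg (resE i p) * exp (-Λ.tilde.2 (dj true i h) * (sg (resE i p) * P.logq)))
        else if resE i p then 1 else 0) *
      (if h : dpart true i then qe P (resE i p) ^ (-α.2 (dj true i h)) else 1) *
      (if P.m ≤ (prev P i).1 then (qe P p)⁻¹ else 1) *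
      (if P.m ≤ (prev P i).1 then (P.d ^ dsc i * qe P (resE i p))⁻¹ else 1) *
      (if P.m ≤ (prev P i).1 then qe P p - qe P (resE i p) else 1) =
      exp (-((if h : P.m ≤ (prev P i).1 then -(α.2 ⟨prev P i, h⟩ : ℂ) else 0) +
        if h : P.m ≤ (prev P i).1 then -Λ.tilde.2 ⟨prev P i, h⟩ else 0) * (sg p * P.logq)) := by
    by_cases h1 : P.m ≤ (prev P i).1
    · have c1 := hE.2 h1; have j1 : dj true i c1 = ⟨prev P i, h1⟩ := Subtype.ext (by simp [dj])
      simp only [resE, if_pos h1, if_pos c1, dif_pos c1, dif_pos h1, j1, qe_not, sg_not, hcc]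
      rw [neg_add, neg_neg, neg_neg, ← e3, inv_zpow, zpow_neg, inv_inv]
      have e4 : -Λ.tilde.2 ⟨prev P i, h1⟩ * ((-sg p : ℤ) * P.logq) =
          Λ.tilde.2 ⟨prev P i, h1⟩ * (sg p * P.logq) := by push_cast; ring
      rw [e4]; push_cast; field_simp; linear_combination hsp
    · have c1 := mt hE.1 h1; simp [resE, h1, c1]
  rw [hprod]; have e2 : ∀ x y x' y', exp (-(x + y + (x' + y')) * (sg p * P.logq)) =
      exp (-(x + x') * (sg p * P.logq)) * exp (-(y + y') * (sg p * P.logq)) := by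
    intro x y x' y'; rw [← exp_add]; congr 1; ring
  have e5 : (∑ j : CIdx P, kvec i j.1 * α.2 j : ℤ) =
      ∑ j, (kvec i j.1 : ℂ) * α.2 j := by push_cast; rfl
  rw [e5, sα, sμ, e2, ← hFp, ← hEp]; refine Eq.trans ?_ ((congrArg (_ * ·) hall).trans (mul_one _))
  beta_reduce; ring

lemma usc_res {i j : Idx P} (h : kvec i j ≠ 0) (hj : P.m ≤ j.1) (p) :
    qe P p * usc true i (resE i p) j = usc false i (resF i p) j := by
  have hq := qe_ne_zero (P := P) p; by_cases h1 : j = i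
  · subst h1; rw [usc_true_self, usc_false_self, resF, if_pos (by simpa [dpart] using hj), mul_comm]
  · have h2 : j = prev P i := by grind [kvec_eq_zero, eq_next_iff.1]
    subst h2; rw [usc_true_prev, usc_false_prev, resE, if_pos (by simpa [dpart] using hj), qe_not]
    field_simp

lemma fuse_EF (i p n) (v : Osc.Sp (Boson P)) : (Osc.fuse (qe P p) (vosc true i (resE i p)) (vosc
    false i (resF i p))).N1 n v = (if p then 1 else P.q⁻¹) ^ n • (losc (.K p i)).N1 n v := by
  have hq0 := P.q_ne_zero; have hu : ∀ j : CIdx P, kvec i j.1 ≠ 0 → usc false i (resF i p) j.1 = qe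
    P p * usc true i (resE i p) j.1 := fun j hj => (usc_res hj j.2 p).symm
  refine Osc.N1_scale (by cases p <;> simp [hq0]) ?_ ?_ n v
  · rintro (l | j) r
    · have hr : qInt P (r : ℕ) ≠ 0 := qInt_ne_zero (by exact_mod_cast r.ne_zero)
      by_cases hl : l = i
      · subst hl; cases p
        · simp only [Osc.fuse, vosc, losc, qe, if_true, false_eq_true, if_false]
          rw [← mul_div_assoc, ← add_div, div_eq_iff hr]; have hQ := q_sub_ne_zero P; unfold qInt
          grind [mul_assoc, neg_mul, mul_div_cancel₀, zpow_neg, zpow_natCast, inv_pow, pow_ne_zero]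
        · simp only [Osc.fuse, vosc, losc, qe, if_true, false_eq_true, if_false]
          rw [← mul_div_assoc, ← mul_pow, mul_inv_cancel₀ hq0]; simp [neg_div]
      · cases p <;> simp [Osc.fuse, vosc, losc, hl]
    · have hz : (losc (.K p i)).cr (.inr j) r = 0 := by cases p <;> simp [losc]
      rw [hz, mul_zero]; by_cases hk : kvec i j.1 = 0
      · simp [Osc.fuse, vosc, hk]
      · simp only [Osc.fuse, vosc, hu j hk, sg, if_true, false_eq_true, if_false]; push_cast
        ring
  · rintro (l | j) r
    · have hr : qInt P (r : ℕ) ≠ 0 := qInt_ne_zero (by exact_mod_cast r.ne_zero); cases p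
      · simp only [Osc.fuse, vosc, losc, qe, if_true, false_eq_true, if_false, inv_inv]; ring
      · simp only [Osc.fuse, vosc, losc, qe, if_true, false_eq_true, if_false, inv_one,
          one_pow, one_mul]
        rw [← mul_assoc, ← add_mul]; congr 1; rw [← mul_div_assoc, ← add_div, div_eq_iff hr]
        unfold qInt; rw [mul_div_cancel₀ _ (q_sub_ne_zero P), zpow_neg, zpow_natCast, inv_pow]; ring
    · have hz : (losc (.K p i)).an (.inr j) r = 0 := by cases p <;> simp [losc, heis]
      rw [hz, mul_zero]; by_cases hk : kvec i j.1 = 0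
      · simp [Osc.fuse, vosc, hk]
      · simp only [Osc.fuse, vosc, hu j hk, sg, if_true, false_eq_true, if_false, mul_inv,
          mul_pow]
        push_cast; ring

lemma cur_EF_self (i e e') : cur Λ true i e * cur Λ false i e' - psgn i i • (cur Λ false i e' *
    cur Λ true i e) = (P.q - P.q⁻¹)⁻¹ • (P.q ^ (-e) • kcur Λ true i (e + e') - P.q ^ (-e') • kcur Λ
    false i (e + e')) := by
  have hq0 := P.q_ne_zero; refine lhom_ext fun α v => ?_; unfold cur
  rw [lsum_commutator_single]; set G : Bool → Bool → Bool → Osc.Sp (Boson P) := fun p ε ε' =>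
    (vcf Λ true i ε * vcf Λ false i ε' * ((vlet Λ true i ε).σ α * (vlet Λ false i ε').σ α) *
      (qe P p ^ (-(e - (vlet Λ true i ε).ex α) - 1) * (lt (.V true i ε) (.V false i ε') *
        (((numEF i ε ε').map fun c => (1, c)).map fun x => x.1 * qe P p - x.2).prod))) •
      (Osc.fuse (qe P p) (vosc true i ε) (vosc false i ε')).N1 (e + e') v with hG
  have hβ : ∀ ε ε', α + ((llet Λ (.V true i ε)).β + (llet Λ (.V false i ε')).β) = α := by
    intro ε ε'
    simp only [llet, vlet, sg, if_true, false_eq_true, if_false, one_smul, neg_smul,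
      add_neg_cancel, add_zero]
  have hterm : ∀ ε ε', (vcf Λ true i ε * vcf Λ false i ε' *
      ((llet Λ (.V true i ε)).σ α * (llet Λ (.V false i ε')).σ α)) •
      (rop (lg (.V true i ε) (.V false i ε')) (PowerSeries.C (lt (.V true i ε) (.V false i ε')) *
          Osc.phi (losc (.V true i ε)) (losc (.V false i ε'))) 0 1
          (npair (.V true i ε) (.V false i ε') v)
          ![e - (llet Λ (.V true i ε)).ex α, e' - (llet Λ (.V false i ε')).ex α] -
        psgn i i • rop (lg (.V false i ε') (.V true i ε)) (PowerSeries.C (lt (.V false i ε') (.V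
          true i ε)) * Osc.phi (losc (.V false i ε')) (losc (.V true i ε))) 1 0 (npair (.V true i
            ε) (.V false i ε') v) ![e - (llet Λ (.V true i ε)).ex α, e' - (llet Λ (.V false i
              ε')).ex α]) =
      (P.q - P.q⁻¹)⁻¹ • (G true ε ε' - G false ε ε') := by
    intro ε ε'; rw [rop_sub_of_double_pole hq0 (q_sub_ne_zero P) (rat_EF i ε ε') (rat_FE i ε ε')
      (poly_EF i ε ε') (bd2_npair _ _ v), dsum_npair hq0, dsum_npair (inv_ne_zero hq0)]
    have hlen : e - (llet Λ (.V true i ε)).ex α + (e' - (llet Λ (.V false i ε')).ex α) + 2 -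
        (((numEF i ε ε').map fun c => ((1 : ℂ), c)).length : ℤ) = e + e' := by
      have h1 : (((numEF i ε ε').map fun c => ((1 : ℂ), c)).length : ℤ) = (if P.m ≤ i.1 then 1
        else 0) + if P.m ≤ (prev P i).1 then 1 else 0 := by unfold numEF; split_ifs <;> simp
      rw [h1]; simp only [llet, vlet, sg, dpart, if_true, false_eq_true, if_false]; ring
    rw [hlen, smul_comm]; congr 1; rw [smul_sub, smul_smul, smul_smul, hG]; rfl
  have hsum : ∀ p, ∑ ε, ∑ ε', G p ε ε' = (qe P p ^ (-e) * (if p then 1 else P.q⁻¹) ^ (e + e')) •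
      (exp (sg p * rootPair Λ i α * P.logq) • (losc (.K p i)).N1 (e + e') v) := by
    intro p; rw [sum_eq_single (resE i p), sum_eq_single (resF i p)]
    · simp only [hG]; rw [residue_coeff, fuse_EF, smul_smul, smul_smul]; congr 1; ring
    · intro ε' _ h; simp only [hG]; have := vcf_residue_eq_zero Λ i p (resE i p) ε' (by tauto)
      convert zero_smul ℂ _ using 2
      linear_combination ((vlet Λ true i (resE i p)).σ α * (vlet Λ false i ε').σ α * (qe P p ^ (-(e
        - (vlet Λ true i (resE i p)).ex α) - 1) * lt (.V true i (resE i p)) (.V false i ε'))) * this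
    · simp
    · intro ε _ h; refine sum_eq_zero fun ε' _ => ?_; simp only [hG]
      have := vcf_residue_eq_zero Λ i p ε ε' (by tauto); convert zero_smul ℂ _ using 2
      linear_combination ((vlet Λ true i ε).σ α * (vlet Λ false i ε').σ α * (qe P p ^ (-(e - (vlet
        Λ true i ε).ex α) - 1) * lt (.V true i ε) (.V false i ε'))) * this
    · simp
  simp only [hterm, hβ]
  have h1 : ∑ k, ∑ k', Finsupp.single α ((P.q - P.q⁻¹)⁻¹ • (G true k k' - G false k k')) =
      Finsupp.single α ((P.q - P.q⁻¹)⁻¹ • (∑ k, ∑ k', G true k k' - ∑ k, ∑ k', G false k k')) := by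
    simp only [sum_bool, ← single_add]; congr 1; module
  have hk : ∀ p, kcur Λ p i (e + e') (Finsupp.single α v) = Finsupp.single α
      (exp (sg p * rootPair Λ i α * P.logq) • (losc (.K p i)).N1 (e + e') v) := by
    intro p; rw [kcur, Letter.op_single]; simp only [klet, losc, add_zero, sub_zero]
  rw [h1, hsum, hsum, LinearMap.smul_apply, LinearMap.sub_apply, LinearMap.smul_apply,
    LinearMap.smul_apply, hk, hk]
  simp only [smul_single, ← single_sub, qe, if_true, false_eq_true, if_false,
    one_zpow, mul_one]
  congr 4; rw [inv_zpow, inv_zpow, zpow_neg, inv_inv, zpow_add₀ hq0, zpow_neg]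
  have := zpow_ne_zero e hq0; field_simp

lemma rat_pole_edge {i} (h : P.m ≤ i.1) (ε ε') : ∃ κ : ℂ, LRat (.V true (next P i) ε') (.V false i
    ε) ⟨psgn (next P i) i * (κ * P.d ^ dsc (next P i)), [(qe P ε', P.d * qe P ε)], [(1, P.d)]⟩ ∧
    LRat (.V false i ε) (.V true (next P i) ε') ⟨κ * P.d ^ dsc (next P i), [(qe P ε, P.d⁻¹ * qe P
    ε')], [(1, P.d⁻¹)]⟩ ∧ κ = twist (root P i) (root P (next P i)) * P.dHalf := by
  have hd := P.d_ne_zero; have h1 : usc true (next P i) ε' i = P.d ^ dsc (next P i) * qe P ε' := by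
    have := usc_true_prev (next P i) ε'; grind [prev_next]
  have h2 : usc false i ε i = P.d * P.d ^ dsc (next P i) * qe P ε := by
    rw [usc_false_self, dsc_next h, zpow_sub_one₀ hd]; field_simp
  have hD : P.d ^ dsc (next P i) ≠ 0 := zpow_ne_zero _ hd
  have hs : (sg false * sg true) = -1 := rfl
  have hs' : (sg false * sg true : ℂ) = -1 := by exact_mod_cast hs
  have e1 : usc false i ε i / usc true (next P i) ε' i = P.d * qe P ε / qe P ε' := by grind
  have e2 : usc true (next P i) ε' i / usc false i ε i = P.d⁻¹ * qe P ε' / qe P ε := by grind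
  refine ⟨_, ?_, ?_, rfl⟩
  · have hlt : lt (.V true (next P i) ε') (.V false i ε) = psgn (next P i) i *
        (twist (root P i) (root P (next P i)) * P.dHalf * P.d ^ dsc (next P i)) * qe P ε' := by
      rw [lt_next_swap, if_pos h, hs, h1, twist_next_of_le h, psgn_comm, neg_neg, zpow_one,
        zpow_one]
      ring
    have := isRat_of_contr (X := losc (.V true (next P i) ε')) (Z := losc (.V false i ε))
      (lt (.V true (next P i) ε') (.V false i ε)) (g := lg (.V true (next P i) ε') (.V false i ε))
      [P.d * qe P ε / qe P ε'] [P.d] ?_ ?_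
    · unfold LRat; rw [hlt] at this ⊢; have := this.rescale
      rwa [mul_div_cancel₀ _ (qe_ne_zero (P := P) ε')] at this
    · intro r hr; simp only [losc]
      rw [contr_next_swap _ _ _ _ _ hr, if_pos h, hs', e1, hx, if_neg (by simp)]; simp
    · rw [lg_next_swap, if_pos h]; rfl
  · have hlt : lt (.V false i ε) (.V true (next P i) ε') =
        twist (root P i) (root P (next P i)) * P.dHalf * P.d ^ dsc (next P i) * qe P ε := by
      rw [lt_next, if_pos h, hs, h2, neg_neg, zpow_one, zpow_neg_one, dHalf_inv]; field_simp
    have := isRat_of_contr (X := losc (.V false i ε)) (Z := losc (.V true (next P i) ε'))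
      (lt (.V false i ε) (.V true (next P i) ε')) (g := lg (.V false i ε) (.V true (next P i) ε'))
      [P.d⁻¹ * qe P ε' / qe P ε] [P.d⁻¹] ?_ ?_
    · unfold LRat; rw [hlt] at this ⊢; have := this.rescale
      rwa [mul_div_cancel₀ _ (qe_ne_zero (P := P) ε)] at this
    · intro r hr; simp only [losc]
      rw [contr_next _ _ _ _ _ hr, if_pos h, hs', e2, hx, if_neg (by simp)]; simp
    · rw [lg_next, if_pos h]; rfl

lemma vcf_mul_symm {i} (h : P.m ≤ i.1) (ε ε') :
    vcf Λ true (next P i) ε' * vcf Λ false i ε = vcf Λ true (next P i) ε * vcf Λ false i ε' := by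
  have hF : dpart false i := by simpa [dpart] using h
  have hE : dpart true (next P i) := by simpa [dpart, prev_next] using h
  have hj : dj true (next P i) hE = dj false i hF := Subtype.ext (by simp [dj, prev_next])
  simp only [vcf_eq, dif_pos hF, dif_pos hE, hj]; ring

lemma sigma_mul_symm {i} (h : P.m ≤ i.1) (ε ε' α) : (vlet Λ true (next P i) ε').σ α * (vlet Λ
    false i ε).σ α = (vlet Λ true (next P i) ε).σ α * (vlet Λ false i ε').σ α := by
  have hF : dpart false i := by simpa [dpart] using h
  have hE : dpart true (next P i) := by simpa [dpart, prev_next] using h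
  have hj : dj true (next P i) hE = dj false i hF := Subtype.ext (by simp [dj, prev_next])
  simp [vlet_sigma_eq, dif_pos hF, dif_pos hE, hj]; ring

lemma fuse_symm {i} (h : P.m ≤ i.1) (ε ε') : Osc.fuse P.d (vosc true (next P i) ε') (vosc false i
    ε) = Osc.fuse P.d (vosc true (next P i) ε) (vosc false i ε') := by
  have hd := P.d_ne_zero; have h1 := fun ε => by
    have := usc_true_prev (next P i) ε; rwa [prev_next] at this
  have h2 : ∀ ε, usc false i ε i = P.d * P.d ^ dsc (next P i) * qe P ε := fun ε => by
    rw [usc_false_self, dsc_next h, zpow_sub_one₀ hd]; field_simp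
  have h3 : ∀ j, j ≠ i → ∀ ε ε', usc true (next P i) ε j = usc true (next P i) ε' j := by
    intro j hj ε ε'; have : next P j ≠ next P i := fun hh => hj (next_inj hh); simp [usc, this]
  have h4 : ∀ j, j ≠ i → ∀ ε ε', usc false i ε j = usc false i ε' j := by
    intro j hj ε ε'; simp [usc, hj]
  unfold Osc.fuse; congr 1
  · funext y r; rcases y with l | j
    · rfl
    · by_cases hj : j.1 = i
      · simp only [vosc, hj, h1, h2, kvec_self, kvec_next_self, sg, if_true, false_eq_true,
          if_false]
        push_cast; ring
      · simp only [vosc, h3 j.1 hj ε' ε, h4 j.1 hj ε ε']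
  · funext y r; rcases y with l | j
    · rfl
    · by_cases hj : j.1 = i
      · simp only [vosc, hj, h1, h2, kvec_self, kvec_next_self, sg, if_true, false_eq_true,
          if_false, mul_inv, mul_pow]
        push_cast; ring
      · simp only [vosc, h3 j.1 hj ε' ε, h4 j.1 hj ε ε']

lemma cur_EF_pole {i} (h : P.m ≤ i.1) (e e') : cur Λ true (next P i) e * cur Λ false i e' - psgn
    (next P i) i • (cur Λ false i e' * cur Λ true (next P i) e) = 0 := by
  have hd := P.d_ne_zero; refine lhom_ext fun α v => ?_; unfold cur
  rw [lsum_commutator_single]; set κ := twist (root P i) (root P (next P i)) * P.dHalf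
  set l := next P i with hl; have hterm : ∀ ε' ε, (rop (lg (.V true l ε') (.V false i ε))
        (PowerSeries.C (lt (.V true l ε') (.V false i ε)) * Osc.phi (losc (.V true l ε')) (losc (.V
          false i ε))) 0 1 (npair (.V true l ε') (.V false i ε) v) ![e - (llet Λ (.V true l ε')).ex
            α, e' - (llet Λ (.V false i ε)).ex α] -
        psgn l i • rop (lg (.V false i ε) (.V true l ε')) (PowerSeries.C (lt (.V false i ε) (.V
          true l ε')) * Osc.phi (losc (.V false i ε)) (losc (.V true l ε'))) 1 0 (npair (.V true l
            ε') (.V false i ε) v) ![e - (llet Λ (.V true l ε')).ex α, e' - (llet Λ (.V false i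
              ε)).ex α]) =
      (P.d ^ (-(e - (llet Λ (.V true l ε')).ex α) - 1) * (psgn l i * (κ * P.d ^ dsc l) *
        (qe P ε' * P.d - P.d * qe P ε))) • (Osc.fuse P.d (vosc true l ε') (vosc false i ε)).N1
        (e - (llet Λ (.V true l ε')).ex α + (e' - (llet Λ (.V false i ε)).ex α) + 1 - 1) v := by
    intro ε' ε; obtain ⟨κ', r1, r2, rfl⟩ := rat_pole_edge h ε ε'
    rw [rop_sub_of_simple_pole hd r1 r2 ?_ (bd2_npair _ _ v), dsum_npair hd]
    · simp only [losc, map_cons, map_nil, prod_cons, prod_nil, mul_one,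
        length_cons, List.length_nil, zero_add, Nat.cast_one]
      rfl
    · simp only [linP_cons, linP_nil, mul_one, lf, map_mul, map_neg]
      linear_combination (-(cst (psgn l i) * (algebraMap ℂ _ (twist (root P i) (root P l)) *
        algebraMap ℂ _ P.dHalf * algebraMap ℂ _ (P.d ^ dsc l)) * algebraMap ℂ _ (qe P ε') * zv 0))
          * alg_inv (ι := Fin 2) hd
  simp only [hterm, sum_bool]; have c1 := vcf_mul_symm Λ h true false
  have c2 := sigma_mul_symm Λ h true false α; have c3 := fuse_symm h true false
  rw [← hl] at c1 c2 c3
  simp only [sub_self, mul_comm P.d, mul_zero, zero_smul, smul_zero, single_zero, zero_add,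
    add_zero, llet, c1, c2, c3, LinearMap.zero_apply]
  rw [show (vlet Λ true l false).ex α = (vlet Λ true l true).ex α from rfl,
    show (vlet Λ false i false).ex α = (vlet Λ false i true).ex α from rfl,
    show (vlet Λ true l false).β = (vlet Λ true l true).β from rfl,
    show (vlet Λ false i false).β = (vlet Λ false i true).β from rfl, ← single_add]
  rw [Finsupp.single_eq_zero]; module

lemma cur_EF_ne {i j} (h : i ≠ j) (e e') :
    cur Λ true i e * cur Λ false j e' = psgn i j • (cur Λ false j e' * cur Λ true i e) := by
  by_cases h1 : j = next P i
  · subst h1; refine lsum_comm_of_exch Λ _ _ _ _ _ (fun ε ε' _ _ => ?_) e e'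
    grind [exch_next_of_le, exch_next_of_lt]
  · by_cases h2 : i = next P j
    · subst h2; by_cases hm : P.m ≤ j.1
      · grind [sub_eq_zero.1, cur_EF_pole]
      · have key := lsum_comm_of_exch Λ (fun ε => .V false j ε) (fun ε => .V true (next P j) ε)
          (vcf Λ false j) (vcf Λ true (next P j)) (psgn j (next P j))
          (fun ε ε' _ _ => exch_next_of_lt (by simp) (by omega) ε ε') e' e
        change cur Λ false j e' * cur Λ true (next P j) e = _ at key
        rw [key, smul_smul, psgn_comm, psgn_mul_self, one_smul]; rfl
    · exact lsum_comm_of_exch Λ _ _ _ _ _ (fun ε ε' _ _ => exch_far true false h h1 h2 ε ε') e e'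

/-! ### Relations between words with rational contractions -/

structure Bond (S : Type*) where
  fwd : Rat2 S
  bwd : Rat2 S

def Rat2.Equiv {S : Type*} [CommRing S] (r r' : Rat2 S) : Prop :=
  IsRat ((r.num.length : ℤ) - r.den.length) (ratS r) r'

namespace Bond

variable {S : Type*} [CommRing S]

def mulLin (B : Bond S) (α β : S) : Bond S :=
  ⟨⟨B.fwd.c, (α, β) :: B.fwd.num, B.fwd.den⟩, ⟨B.bwd.c, (-β, -α) :: B.bwd.num, B.bwd.den⟩⟩

/-- The denominators are of the form `z - c w`. -/
def Monic (B : Bond S) : Prop := (∀ p ∈ B.fwd.den, p.1 = 1) ∧ ∀ p ∈ B.bwd.den, p.1 = 1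

/-- Equality of the expansions. -/
def Equiv (B B' : Bond S) : Prop := B.fwd.Equiv B'.fwd ∧ B.bwd.Equiv B'.bwd

def map {S' : Type*} [CommRing S'] (σ : S →+* S') (B : Bond S) : Bond S' :=
  ⟨B.fwd.map σ, B.bwd.map σ⟩

variable {k : ℕ}

/-- The contractions of all pairs. -/
def rat (B : Fin k → Fin k → Bond S) (i j : Fin k) : Rat2 S :=
  if i < j then (B i j).fwd else (B j i).bwd

def pairData (B : Fin k → Fin k → Bond S) : PairData (Fin k) S :=
  ⟨fun i j => ((rat B i j).num.length : ℤ) - (rat B i j).den.length, fun i j => ratS (rat B i j)⟩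

def mulList (B : Fin k → Fin k → Bond S) : List (Fin k × Fin k × S × S) → Fin k → Fin k → Bond S
  | [] => B
  | l :: L => fun i j => if i = l.1 ∧ j = l.2.1 then (mulList B L i j).mulLin l.2.2.1 l.2.2.2
      else mulList B L i j

/-- The product of linear factors. -/
def prodList (L : List (Fin k × Fin k × S × S)) : Laurent (Fin k) S :=
  (L.map fun l => lf l.2.2.1 l.2.2.2 l.1 l.2.1).prod

lemma rat_mulList_cons (B) {a b} (hab : a < b) (α β) (L : List (Fin k × Fin k × S × S)) : (rat
    (mulList B ((a, b, α, β) :: L)) a b = ((mulList B L a b).mulLin α β).fwd) ∧ (rat (mulList B ((a,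
    b, α, β) :: L)) b a = ((mulList B L a b).mulLin α β).bwd) ∧ ∀ i j, ¬ (i = a ∧ j = b) → ¬ (i = b
    ∧ j = a) → rat (mulList B ((a, b, α, β) :: L)) i j = rat (mulList B L) i j := by
  refine ⟨by simp [rat, mulList, hab], by simp [rat, mulList, hab.le], fun i j h1 h2 => ?_⟩
  have h3 : ¬ (j = a ∧ i = b) := by tauto
  simp [rat, mulList, h1, h3]

lemma ratS_cons (c α β) (num den : List (S × S)) : ratS ⟨c, (α, β) :: num, den⟩ =
    (PowerSeries.C α - PowerSeries.C β * PowerSeries.X) * ratS ⟨c, num, den⟩ := by grind [ratS, linS_cons]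

variable {W : Type*} [AddCommGroup W] [Module S W]

lemma wop_mulList (B) {L : List (Fin k × Fin k × S × S)} (hL : ∀ l ∈ L, l.1 < l.2.1) {h} {w : List
    (Fin k)} (hw : w.Pairwise (Lt h)) (hnd : w.Nodup) (hall : ∀ i, i ∈ w) {n : (Fin k → ℤ) → W} (hn
    : Bd h n) : wop (pairData (mulList B L)) w n = act (prodList L) (wop (pairData B) w n) := by
  induction L with
  | nil => simp [prodList, mulList]
  | cons l L ih =>
    obtain ⟨a, b, α, β⟩ := l; have hab := hL (a, b, α, β) List.mem_cons_self
    obtain ⟨h1, h2, h3⟩ := rat_mulList_cons B hab α β L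
    have := act_lf_wop (pd := pairData (mulList B L)) (pd' := pairData (mulList B ((a, b, α, β) ::
      L))) (a := a) (b := b) (α := α) (β := β) ?_ ?_ ?_ hw hnd (hall _) (hall _) hab.ne hn
    · rw [this, ih fun l hl => hL l (by simp [hl]), ← Module.End.mul_apply, ← map_mul]
      simp [prodList]
    · simp only [pairData, h1]
      rw [show rat (mulList B L) a b = (mulList B L a b).fwd by simp [rat, hab]]
      refine ⟨?_, ratS_cons _ _ _ _ _⟩; simp only [mulLin, length_cons]; push_cast; ring
    · simp only [pairData, h2]
      rw [show rat (mulList B L) b a = (mulList B L a b).bwd by simp [rat, hab.le]]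
      refine ⟨?_, ratS_cons _ _ _ _ _⟩; simp only [mulLin, length_cons]; push_cast; ring
    · intro i j hi hj; simp only [pairData, h3 i j hi hj]; trivial

def Vanish (B : Fin k → Fin k → Bond ℂ) (words : List (ℂ × List (Fin k))) : Prop :=
  ∀ n : (Fin k → ℤ) → ℂ, (∃ b : ℤ, ∀ e, n e ≠ 0 → ∀ l, b ≤ e l) → ∀ e,
    (words.map fun p => p.1 * wop (pairData B) p.2 n e).sum = 0

/-- Every word contains each letter once. -/
def Words {T : Type*} (words : List (T × List (Fin k))) : Prop :=
  ∀ p ∈ words, p.2.Perm (finRange k)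

variable {words : List (ℂ × List (Fin k))}

lemma Words.nodup {T : Type*} {words} (hw : Words words)
    {p : T × List (Fin k)} (hp : p ∈ words) : p.2.Nodup :=
  (hw p hp).nodup_iff.2 (List.nodup_finRange k)

lemma Words.mem {T : Type*} {words} (hw : Words words)
    {p : T × List (Fin k)} (hp : p ∈ words) (i) : i ∈ p.2 :=
  (hw p hp).symm.subset (mem_finRange i)

lemma vanish_of_isRat {pd B} (hw : Words words) (hm : ∀ i j, i < j → (B i j).Monic) (h : ∀ i j, i <
    j → IsRat (pd.g i j) (pd.φ i j) (B i j).fwd ∧ IsRat (pd.g j i) (pd.φ j i) (B i j).bwd) (hB :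
    Vanish B words) {n} (hn : ∃ b, ∀ e, n e ≠ 0 → ∀ l, b ≤ e l) (e) : (words.map fun p => p.1 * wop
    pd p.2 n e).sum = 0 := by
  rw [← hB n hn e]; congr 1; refine map_congr_left fun p hp => ?_
  rw [wop_congr (pd' := pairData B)]; refine (hw.nodup hp).imp fun {i j} hij => ?_
  rcases lt_or_gt_of_ne hij with h1 | h1
  · obtain ⟨⟨h2, h3⟩, -⟩ := h i j h1; simp only [pairData, rat, if_pos h1]
    exact ⟨by omega, eq_ratS (hm i j h1).1 h2⟩
  · obtain ⟨-, ⟨h2, h3⟩⟩ := h j i h1; simp only [pairData, rat, if_neg h1.not_gt]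
    exact ⟨by omega, eq_ratS (hm j i h1).2 h2⟩

lemma Vanish.of_equiv {B B'} (v : Vanish B' words) (hw : Words words)
    (h : ∀ i j, i < j → (B i j).Equiv (B' i j) ∧ (B' i j).Monic) : Vanish B words := fun _ hn e =>
  vanish_of_isRat hw (fun i j hij => (h i j hij).2) (fun i j hij => by
    simp [pairData, rat, if_pos hij, if_neg hij.not_gt]; exact (h i j hij).1) v hn e

lemma Vanish.split {B} (hw : Words words) {L L₁ L₂} (h : ∀ l ∈ L, l.1 < l.2.1) (h₁ : ∀ l ∈ L₁, l.1 <
    l.2.1) (h₂ : ∀ l ∈ L₂, l.1 < l.2.1) {c} (hc : c ≠ 0) (hL : algebraMap ℂ _ c * prodList L =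
    prodList L₁ - prodList L₂) (v₁ : Vanish (mulList B L₁) words) (v₂ : Vanish (mulList B L₂) words)
    : Vanish (mulList B L) words := by
  intro n hn e; have hb : ∀ p ∈ words, Bd (posHeight p.2) n := by
    intro p hp; obtain ⟨b, hb⟩ := hn; exact Bd.posHeight ⟨b, fun e he l _ => hb e he l⟩
  have key : ∀ p ∈ words, ∀ K, (∀ l ∈ K, l.1 < l.2.1) → wop (pairData (mulList B K)) p.2 n = act
    (prodList K) (wop (pairData B) p.2 n) := fun p hp K hK => wop_mulList B hK (posHeight_pairwise
      (hw.nodup hp)) (hw.nodup hp) (fun i => hw.mem hp i) (hb p hp)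
  have h1 : ∀ p ∈ words, c * (p.1 * wop (pairData (mulList B L)) p.2 n e) =
      p.1 * wop (pairData (mulList B L₁)) p.2 n e -
        p.1 * wop (pairData (mulList B L₂)) p.2 n e := by
    intro p hp; have h2 := congrFun (congrArg (fun f => act f (wop (pairData B) p.2 n)) hL) e
    rw [map_mul, Module.End.mul_apply, act_algebraMap, map_sub, ← key p hp L h] at h2
    simp only [LinearMap.sub_apply, Pi.smul_apply, Pi.sub_apply, smul_eq_mul,
      ← key p hp L₁ h₁, ← key p hp L₂ h₂] at h2
    linear_combination p.1 * h2
  have h2 := List.sum_map_mul_left words (fun p => p.1 * wop (pairData (mulList B L)) p.2 n e) c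
  rw [map_congr_left h1] at h2
  have h3 : ∀ f g : ℂ × List (Fin k) → ℂ, (words.map fun p => f p - g p).sum =
      (words.map f).sum - (words.map g).sum := by
    intro f g; clear h2 h1 key hb v₁ v₂ hw; induction words with
    | nil => simp
    | cons a l ih => simp only [map_cons, sum_cons, ih]; ring
  rw [h3, v₁ n hn e, v₂ n hn e, sub_zero] at h2; exact (mul_eq_zero.1 h2.symm).resolve_left hc

def pol (B : Bond S) (i j : Fin k) : Laurent (Fin k) S :=
  algebraMap S _ B.fwd.c * linP B.fwd.num i j * linP B.bwd.den j i

/-- The polynomial of a pair in the other order. -/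
def pol' (B : Bond S) (i j : Fin k) : Laurent (Fin k) S :=
  algebraMap S _ B.bwd.c * linP B.bwd.num j i * linP B.fwd.den i j

def Small (B : Bond (Polynomial ℂ)) : Prop :=
  (∀ p ∈ B.fwd.den, p.1 = 1 ∧ Polynomial.X ∣ p.2) ∧ ∀ p ∈ B.bwd.den, p.1 = 1 ∧ Polynomial.X ∣ p.2

def LiftTo (B : Bond ℂ) (i j : Fin k) (f f' : Laurent (Fin k) (Polynomial ℂ)) : Prop :=
  ∃ (B' : Bond (Polynomial ℂ)) (c : Laurent (Fin k) (Polynomial ℂ)), B'.map ev = B ∧ B'.Small ∧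
    pol B' i j = c * f ∧ pol' B' i j = c * f'

lemma wordP_perm_of_symm {c : Fin k → Fin k → Laurent (Fin k) S} (hc : ∀ i j, c i j = c j i)
    {w w'} (h : w.Perm w') : wordP c w = wordP c w' := by
  induction h with
  | nil => rfl
  | cons i h ih => rw [wordP, wordP, ih, (h.map _).prod_eq]
  | swap i j w => grind [wordP]
  | trans _ _ h1 h2 => rw [h1, h2]

lemma wordP_mul {q c p : Fin k → Fin k → Laurent (Fin k) S} (h : ∀ i j, i ≠ j → q i j = c i j * p i
    j) {w} (hw : w.Nodup) : wordP q w = wordP c w * wordP p w := by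
  induction w with
  | nil => simp [wordP]
  | cons i w ih =>
    rw [nodup_cons] at hw; rw [wordP, wordP, wordP, ih hw.2,
      map_congr_left fun j hj => h i j fun e => hw.1 (e ▸ hj), List.prod_map_mul]
    ring

lemma vanish_of_liftTo {B} {p} {words : List (Polynomial ℂ × List (Fin k))} (hw : Words words) (hp
    : (words.map fun w => algebraMap _ _ w.1 * wordP p w.2).sum = 0) (h : ∀ i j, i < j → LiftTo (B i
    j) i j (p i j) (p j i)) : Vanish B (words.map fun p => (ev p.1, p.2)) := by
  choose B' c h1 h2 h3 h4 using h; intro n hn e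
  set F : Fin k → Fin k → Rat2 (Polynomial ℂ) := fun i j =>
    if h : i < j then (B' i j h).fwd else if h : j < i then (B' j i h).bwd else ⟨1, [], []⟩ with hF
  set c' : Fin k → Fin k → Laurent (Fin k) (Polynomial ℂ) := fun i j =>
    if h : i < j then c i j h else if h : j < i then c j i h else 1 with hc'
  have hd : ∀ i j, ∀ p ∈ (F i j).den, p.1 = 1 ∧ Polynomial.X ∣ p.2 := by
    intro i j p hp; simp only [hF] at hp; split_ifs at hp with h h
    exacts [(h2 i j h).1 p hp, (h2 j i h).2 p hp, by simp at hp]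
  have hsym : ∀ i j, c' i j = c' j i := by
    intro i j; rcases lt_trichotomy i j with h | rfl | h <;> simp [*, lt_asymm]
  have hmul : ∀ i j, i ≠ j → pairP F i j = c' i j * p i j := by
    intro i j hij; rcases lt_or_gt_of_ne hij with h | h
    · simp only [pairP, hF, hc', dif_pos h, dif_neg h.not_gt]; exact h3 i j h
    · simp only [pairP, hF, hc', dif_pos h, dif_neg h.not_gt]; exact h4 j i h
  have key := sum_wop_eq_zero (pd := pairData B) F hd ?_ (List.nodup_finRange k) words hw ?_
    (n := n) ?_ e
  · rw [map_map]; exact key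
  · intro i j hij; have e1 : rat B i j = (F i j).map ev := by
      rcases lt_or_gt_of_ne hij with h | h
      · simp only [rat, hF, h, dif_pos, if_pos, ← h1 i j h]; rfl
      · simp only [rat, hF, h, h.not_gt, dif_pos, dif_neg, if_neg, not_false_iff, ← h1 j i h]; rfl
    simp only [pairData, e1]; refine ⟨linS_mul_ratS _ fun p hp => ?_, by ring⟩
    obtain ⟨p', hp', rfl⟩ := mem_map.1 hp; simp [(hd i j p' hp').1]
  · have : ∀ w ∈ words, algebraMap _ (Laurent (Fin k) (Polynomial ℂ)) w.1 * wordP (pairP F) w.2 =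
        wordP c' (finRange k) * (algebraMap _ _ w.1 * wordP p w.2) := by
      intro w hw'; rw [wordP_mul hmul (hw.nodup hw'), wordP_perm_of_symm hsym (hw w hw')]; ring
    rw [map_congr_left this, List.sum_map_mul_left, hp, mul_zero]
  · obtain ⟨b, hb⟩ := hn; exact ⟨b, fun e he l _ => hb e he l⟩

lemma Equiv.refl_and {B : Bond S} (h : B.Monic) : B.Equiv B ∧ B.Monic :=
  ⟨⟨⟨linS_mul_ratS _ h.1, by ring⟩, ⟨linS_mul_ratS _ h.2, by ring⟩⟩, h⟩

end Bond

lemma cur_words_eq_zero {k} (b) (idx : Fin k → Idx P) {words} (hw : Bond.Words words) (h : ∀ ε :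
    Fin k → Bool, (∀ i, vcf Λ b (idx i) (ε i) ≠ 0) → ∃ B : Fin k → Fin k → Bond ℂ, (∀ i j, i < j →
    (B i j).Monic ∧ LRat (.V b (idx i) (ε i)) (.V b (idx j) (ε j)) (B i j).fwd ∧ LRat (.V b (idx j)
    (ε j)) (.V b (idx i) (ε i)) (B i j).bwd) ∧ Bond.Vanish B words) (e : Fin k → ℤ) : (words.map fun
    p => p.1 • (p.2.map fun i => cur Λ b (idx i) (e i)).prod).sum = 0 := by
  have key := sum_words_eq_zero (ι := Fin k) (fun i ε => llet Λ (.V b (idx i) ε)) (fun i => vcf Λ b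
    (idx i)) (List.nodup_finRange k) (mem_finRange) (words.map fun p => (p.1, 0, p.2)) ?_ ?_ e
  · rw [map_map] at key; rw [← key]; simp only [comp_def, Pi.zero_apply, sub_zero]
    rfl
  · intro p hp; obtain ⟨p', hp', rfl⟩ := mem_map.1 hp; exact hw p' hp'
  · intro ε hε; refine ⟨_, _, compat_llet Λ (fun i => .V b (idx i) (ε i)), fun n hn e => ?_⟩
    obtain ⟨B, h1, h2⟩ := h ε hε; rw [map_map]; simp only [comp_def, sub_zero]
    refine Bond.vanish_of_isRat hw (fun i j hij => (h1 i j hij).1) (fun i j hij => ⟨?_, ?_⟩) h2 ?_ e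
    · exact LRat.pairData (Λ := Λ) (f := fun i => Lab.V b (idx i) (ε i)) (h1 i j hij).2.1
    · exact LRat.pairData (Λ := Λ) (f := fun i => Lab.V b (idx i) (ε i)) (h1 i j hij).2.2
    · obtain ⟨b, hb⟩ := hn; exact ⟨b, fun e he l => hb e he l (mem_finRange l)⟩

section

open Polynomial (C X)

namespace Bond

/-! ### Bonds of neighbouring vertex operators -/

section Types

variable {S : Type*} [CommRing S]

def left (s c x δ y : S) : Bond S := ⟨⟨c * x, [], []⟩, ⟨s * c, [(1, x * δ)], [(1, y)]⟩⟩

def right (s c x δ y : S) : Bond S := ⟨⟨c, [(1, x * δ)], [(1, y)]⟩, ⟨s * c * x, [], []⟩⟩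

def leftC (s c x δ : S) : Bond S := ⟨⟨-c, [(δ, x)], []⟩, ⟨s * c, [(1, x * δ)], []⟩⟩

def rightC (s c x δ : S) : Bond S := ⟨⟨c, [(1, x * δ)], []⟩, ⟨-(s * c), [(δ, x)], []⟩⟩

def pole (s c x δ : ℂ) : Bond ℂ := ⟨⟨c, [], [(1, x * δ⁻¹)]⟩, ⟨-(s * c * δ), [], [(1, x * δ)]⟩⟩

/-- Contractions `κ`, `s κ`. -/
def const (s κ : S) : Bond S := ⟨⟨κ, [], []⟩, ⟨s * κ, [], []⟩⟩

def edge (t : Bool) (s c x δ : ℂ) : Bond ℂ :=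
  if t then right s c x δ (x⁻¹ * δ) else left s c x δ⁻¹ (x⁻¹ * δ⁻¹)

/-- The same without its pole. -/
def clear (t : Bool) (s c x δ : ℂ) : Bond ℂ := if t then rightC s c x δ else leftC s c x δ⁻¹

def selfPole (κ a b y : ℂ) : Bond ℂ := ⟨⟨κ, [(a, b)], [(1, y)]⟩, ⟨κ, [(b, a)], [(1, y)]⟩⟩

def selfPoleC (κ y : ℂ) : Bond ℂ := ⟨⟨κ, [], [(1, y)]⟩, ⟨-κ, [], [(1, y)]⟩⟩

def selfEven (κ y : ℂ) : Bond ℂ := ⟨⟨κ, [(1, 1), (1, y)], []⟩, ⟨κ, [(1, 1), (1, y)], []⟩⟩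

def selfOdd (κ a b : ℂ) : Bond ℂ := ⟨⟨κ, [(a, b)], []⟩, ⟨κ, [(b, a)], []⟩⟩

lemma monic_edge (t s c x δ) : (edge t s c x δ).Monic := by
  cases t <;> simp [edge, left, right, Monic]

lemma monic_clear (t s c x δ) : (clear t s c x δ).Monic := by
  cases t <;> simp [clear, leftC, rightC, Monic]

lemma monic_pole (s c x δ) : (pole s c x δ).Monic := by simp [pole, Monic]

lemma linP_single {ι : Type*} [DecidableEq ι] (a b : S) (i j : ι) : linP [(a, b)] i j = lf a b i j := by
  simp [linP]

end Types

section Lifts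

local notation "κ" => algebraMap (Polynomial ℂ) (Laurent _ (Polynomial ℂ))

def Lifts (B : Bond ℂ) (s g x α β : Polynomial ℂ) : Prop := ∀ (k : ℕ) (i j : Fin k), LiftTo B i j
  (κ g * (κ α * zv j) - κ x * (κ β * zv i)) (κ s * (κ x * (κ α * zv j) - κ g * (κ β * zv i)))

def SelfLifts (B : Bond ℂ) (g x : Polynomial ℂ) : Prop := ∀ (k : ℕ) (i j : Fin k), LiftTo B i j
  (κ x ^ 2 * zv j - κ g ^ 2 * zv i) (κ g ^ 2 * zv j - κ x ^ 2 * zv i)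

lemma LiftTo.neg {k} {B} {i j} {f f' : Laurent (Fin k) (Polynomial ℂ)}
    (h : LiftTo B i j f f') : LiftTo B i j (-f) (-f') := by
  obtain ⟨B', c, h1, h2, h3, h4⟩ := h
  exact ⟨B', -c, h1, h2, by rw [h3, neg_mul_neg], by rw [h4, neg_mul_neg]⟩

lemma C_mul_inv {ι : Type*} {x} (hx : x ≠ 0) :
    algebraMap _ (Laurent ι (Polynomial ℂ)) (C x) * κ (C x⁻¹) = 1 := by
  rw [← map_mul, ← map_mul, mul_inv_cancel₀ hx, map_one, map_one]

lemma lifts_selfPole (c a b x) : SelfLifts (selfPole c a b (x ^ 2)) (C x * X ^ 1) 1 := by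
  refine fun k i j => ⟨⟨⟨C c, [(C a, C b)], [(1, (C x * X ^ 1) ^ 2)]⟩,
    ⟨C c, [(C b, C a)], [(1, (C x * X ^ 1) ^ 2)]⟩⟩, κ (C c) * lf (C a) (C b) i j, ?_, ?_, ?_, ?_⟩
  · simp [selfPole, map, Rat2.map]
  · simp [Small, mul_pow, dvd_mul_of_dvd_right]
  all_goals simp only [pol, pol', linP_single, lf, map_one, map_pow]; ring

lemma lifts_selfPoleC (c x) : SelfLifts (selfPoleC c (x ^ 2)) (C x * X ^ 1) 1 := by
  refine fun k i j => ⟨⟨⟨C c, [], [(1, (C x * X ^ 1) ^ 2)]⟩, ⟨-C c, [], [(1, (C x * X ^ 1) ^ 2)]⟩⟩, κ (C c),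
    ?_, ?_, ?_, ?_⟩
  · simp [selfPoleC, map, Rat2.map]
  · simp [Small, mul_pow, dvd_mul_of_dvd_right]
  all_goals simp only [pol, pol', linP_single, linP_nil, lf, map_one, map_pow, map_neg]; ring

lemma lifts_selfEven (c x) : SelfLifts (selfEven c (x ^ 2)) 1 (C x * X ^ 1) := by
  refine fun k i j => ⟨⟨⟨C c, [(1, 1), (1, (C x * X ^ 1) ^ 2)], []⟩,
    ⟨C c, [(1, 1), (1, (C x * X ^ 1) ^ 2)], []⟩⟩, -κ (C c) * lf 1 1 i j, ?_, ?_, ?_, ?_⟩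
  · simp [selfEven, map, Rat2.map]
  · simp [Small]
  all_goals simp [pol, pol', linP, lf]; ring

lemma lifts_selfOdd (c a b) {k} (i j : Fin k) : LiftTo (selfOdd c a b) i j 1 (-1) := by
  refine ⟨⟨⟨C c, [(C a, C b)], []⟩, ⟨C c, [(C b, C a)], []⟩⟩, κ (C c) * lf (C a) (C b) i j,
    ?_, ?_, ?_, ?_⟩
  · simp [selfOdd, map, Rat2.map]
  · simp [Small]
  all_goals simp [pol, pol', linP_single, linP_nil, lf] <;> ring

lemma lifts_const (s : ℤ) (c) {k} (i j : Fin k) : LiftTo (const s c) i j 1 s :=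
  ⟨const s (C c), κ (C c), by simp [const, map, Rat2.map], by simp [const, Small],
    by simp [pol, const, linP_nil], by simp [pol', const, linP_nil, map_mul]; ring⟩

variable {x δ : ℂ} (hx : x ≠ 0) (hδ : δ ≠ 0)

include hδ

lemma lifts_clear (t) (s c x) (n e f) :
    Lifts (clear t s c x δ) (C s) (C x * X ^ n) 1 (X ^ f) (C δ⁻¹ * X ^ e) := by
  intro k i j; have h := C_mul_inv (ι := Fin k) hδ; cases t
  · refine ⟨⟨⟨-C c, [(C δ⁻¹ * X ^ e, C x * X ^ n * X ^ f)], []⟩,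
      ⟨C s * C c, [(X ^ f, C x * X ^ n * (C δ⁻¹ * X ^ e))], []⟩⟩, κ (C c), ?_, ?_, ?_, ?_⟩
    · simp [clear, leftC, map, Rat2.map]
    · simp [Small]
    all_goals simp only [pol, pol', linP_single, linP_nil, lf, map_mul, map_neg, map_one]; ring
  · refine ⟨⟨⟨C c, [(X ^ e, C x * X ^ n * (C δ * X ^ f))], []⟩,
      ⟨-(C s * C c), [(C δ * X ^ f, C x * X ^ n * X ^ e)], []⟩⟩, -κ (C c) * κ (C δ), ?_, ?_, ?_, ?_⟩
    · simp [clear, rightC, map, Rat2.map]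
    · simp [Small]
    all_goals simp only [pol, pol', linP_single, linP_nil, lf, map_mul, map_neg, map_one]
    · grind
    · grind

include hx

lemma lifts_edge (t : Bool) (s c) {n e f} (h : if t then f = e + n + 1 else e = f + n + 1) :
    Lifts (edge t s c x δ) (C s) (C x * X ^ n) 1 (X ^ f) (C δ⁻¹ * X ^ e) := by
  intro k i j; have h1 := C_mul_inv (ι := Fin k) hx; have h2 := C_mul_inv (ι := Fin k) hδ; cases t
  · obtain rfl : e = f + n + 1 := by simpa using h
    refine ⟨⟨⟨C (c * x) * X ^ (n + f), [], []⟩, ⟨C (s * c) * X ^ f,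
      [(1, C (x * δ⁻¹) * X ^ (2 * n + 1))], [(1, C (x⁻¹ * δ⁻¹) * X)]⟩⟩, κ (C c), ?_, ?_, ?_, ?_⟩
    · simp [edge, left, map, Rat2.map]
    · simp [Small]
    all_goals simp only [pol, pol', linP_single, linP_nil, lf, map_mul, map_one, map_pow]
    · grind
    · ring
  · obtain rfl : f = e + n + 1 := by simpa using h
    refine ⟨⟨⟨C c * X ^ e, [(1, C (x * δ) * X ^ (2 * n + 1))], [(1, C (x⁻¹ * δ) * X)]⟩,
      ⟨C (s * c * x) * X ^ (n + e), [], []⟩⟩, -κ (C c) * κ (C δ), ?_, ?_, ?_, ?_⟩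
    · simp [edge, right, map, Rat2.map]
    · simp [Small]
    all_goals simp only [pol, pol', linP_single, linP_nil, lf, map_mul, map_one, map_pow]
    · linear_combination (-(κ (C c) * κ X ^ e * zv i)) * h2
    · linear_combination (-(κ (C s) * κ (C c) * κ (C x) * κ X ^ (n + e) * zv i)) * h2 -
        (κ (C s) * κ (C c) * κ (C δ) * κ X ^ (n + e + 1) * zv j) * h1

/-- The weights of the two variables of a bond. -/
def wtz (n : ℕ) (t : Bool) : ℕ := if t then 0 else n + 1

def wtw (n : ℕ) (t : Bool) : ℕ := if t then n + 1 else 0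

lemma lifts_edge_wt (t) (s c) (n) : Lifts (edge t s c x δ) (C s) (C x * X ^ n) 1
    (X ^ wtw n t) (C δ⁻¹ * X ^ wtz n t) :=
  lifts_edge hx hδ t s c (by cases t <;> simp [wtz, wtw])

omit hx in
lemma lifts_pole (s c x) {n e f p r} (hk : n + f = e + (p + 1)) (hl : n + e = f + (r + 1)) :
    Lifts (pole s c x δ) (C s) 1 (C x * X ^ n) (X ^ f) (C δ * X ^ e) := by
  intro k i j; refine ⟨⟨⟨C c * X ^ f, [], [(1, C (x * δ⁻¹) * X ^ (p + 1))]⟩,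
    ⟨-(C (s * c * δ) * X ^ e), [], [(1, C (x * δ) * X ^ (r + 1))]⟩⟩, κ (C c), ?_, ?_, ?_, ?_⟩
  · simp [pole, map, Rat2.map]
  · simp [Small, pow_succ, ← mul_assoc]
  all_goals
    simp only [pol, pol', linP_single, linP_nil, lf, map_mul, map_one, map_neg, map_pow]
    have e1 := congrArg (fun n => (κ X : Laurent (Fin k) _) ^ n) hk
    have e2 := congrArg (fun n => (κ X : Laurent (Fin k) _) ^ n) hl
    simp only [pow_add _ n, pow_add _ e, pow_add _ f] at e1 e2
  · grind
  · linear_combination (κ (C s) * κ (C c) * κ (C x) * κ X ^ e * κ X ^ (p + 1) * zv j) * (C_mul_inv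
      (ι := Fin k) hδ) - (κ (C s) * κ (C c) * κ (C x) * zv j) * e1

end Lifts

section Cancel

lemma Equiv_of_isRat {r r' : Rat2 ℂ} (hm : ∀ p ∈ r.den, p.1 = 1)
    (h : ∀ g φ, IsRat g φ r → IsRat g φ r') : r.Equiv r' :=
  h _ _ ⟨linS_mul_ratS _ hm, by ring⟩

lemma IsRat.scale {g φ c c' a b a' b'} {num den : List (ℂ × ℂ)} (h : IsRat g φ ⟨c, (a, b) :: num,
    den⟩) (ha : c * a = c' * a') (hb : c * b = c' * b') : IsRat g φ ⟨c', (a', b') :: num, den⟩ := by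
  refine ⟨h.1.trans ?_, h.2⟩; simp only [linS_cons, ← mul_assoc]
  rw [mul_sub, mul_sub, ← mul_assoc, ← mul_assoc, ← map_mul, ← map_mul, ← map_mul, ← map_mul, ha,
    hb]

/-- The factor of the pole. -/
def xt (t : Bool) (x : ℂ) : ℂ := if t then x else x⁻¹

lemma equiv_lin {c c' a b a' b' : ℂ} (ha : c * a = c' * a') (hb : c * b = c' * b') :
    Rat2.Equiv ⟨c, [(a, b)], []⟩ ⟨c', [(a', b')], []⟩ :=
  Equiv_of_isRat (by simp) fun _ _ h => IsRat.scale h ha hb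

lemma equiv_cancel {c c' a b a' b' u v y : ℂ} (hv : v = u * y) (ha : c * u * a = c' * a') (hb : c *
    u * b = c' * b') : Rat2.Equiv ⟨c, [(u, v), (a, b)], [(1, y)]⟩ ⟨c', [(a', b')], []⟩ :=
  Equiv_of_isRat (by simp) fun _ _ h => IsRat.scale (IsRat.cancel (hv ▸ h)) ha hb

lemma selfPole_equiv (c y a b) : (selfPole c a b y).Equiv ((selfPoleC c y).mulLin a b) :=
  ⟨Equiv_of_isRat (by simp [selfPole]) fun _ _ h => h, Equiv_of_isRat (by simp [selfPole])
    fun _ _ h => IsRat.scale h (by simp only [selfPoleC]; ring) (by simp only [selfPoleC]; ring)⟩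

lemma selfOdd_equiv (c a b) : (selfOdd c a b).Equiv ((const (-1) c).mulLin a b) :=
  ⟨Equiv_of_isRat (by simp [selfOdd]) fun _ _ h => h, Equiv_of_isRat (by simp [selfOdd])
    fun _ _ h => IsRat.scale h (by simp only [const]; ring) (by simp only [const]; ring)⟩

/-- Replacement of the bond of `a` and `b`. -/
def put {k : ℕ} (B : Fin k → Fin k → Bond ℂ) (a b : Fin k) (K : Bond ℂ) (i j : Fin k) : Bond ℂ :=
  if i = a ∧ j = b then K else B i j

lemma monic_put {k B} (hm : ∀ i j, i < j → (B i j).Monic)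
    {K} (hK : K.Monic) (a b i j : Fin k) (h : i < j) : (put B a b K i j).Monic := by
  unfold put; split_ifs; exacts [hK, hm i j h]

variable {x δ : ℂ} (hx : x ≠ 0) (hδ : δ ≠ 0)

include hx hδ

lemma edge_mulLin (t t' s c b) :
    ∃ c', ((edge t s c x δ).mulLin (xt t x * b) (δ * b)).Equiv (clear t' s c' x δ) := by
  cases t <;> cases t'
  · refine ⟨-(δ * c * b), equiv_lin ?_ ?_, equiv_cancel ?_ ?_ ?_⟩ <;>
      (try simp only [edge, left, xt, false_eq_true, if_false]) <;> field_simp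
  · refine ⟨c * b, equiv_lin ?_ ?_, equiv_cancel ?_ ?_ ?_⟩ <;>
      (try simp only [edge, left, xt, false_eq_true, if_false]) <;> field_simp
  · refine ⟨-(δ * x * c * b), equiv_cancel ?_ ?_ ?_, equiv_lin ?_ ?_⟩ <;>
      (try simp only [edge, right, xt, if_true]) <;> field_simp
  · refine ⟨x * c * b, equiv_cancel ?_ ?_ ?_, equiv_lin ?_ ?_⟩ <;>
      (try simp only [edge, right, xt, if_true]) <;> field_simp

lemma Vanish.split_edge {k words} (hw : Words words) {B} (hm : ∀ i j, i < j → (B i j).Monic) {a b c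
    : Fin k} (hab : a < b) (hbc : b < c) {t t' s f f' u v K} (mK : K.Monic) (hS : (B a b).Equiv
    (K.mulLin u v)) (ha : B a c = edge t s f x δ) (hb : B b c = edge t' s f' x δ) (h : t = t' ∨ u =
    xt t x ∧ v = xt t' x) (v₀ : t = t' → Vanish B words) (v₁ : ∀ e, Vanish (put (put B a b K) a c
    (clear t' s e x δ)) words) (v₂ : ∀ e, Vanish (put (put B a b K) b c (clear t s e x δ)) words) :
    Vanish B words := by
  by_cases ht : t = t'
  · exact v₀ ht
  obtain ⟨rfl, rfl⟩ := h.resolve_left ht; obtain ⟨e, he⟩ := edge_mulLin hx hδ t t' s f 1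
  obtain ⟨e', he'⟩ := edge_mulLin hx hδ t' t s f' 1; rw [mul_one, mul_one] at he he'
  have r : ∀ a' α B', B'.Monic → ((put B a b K a' c).mulLin α δ).Equiv B' → ∀ i j, i < j →
      (mulList (put B a b K) [(a', c, α, δ)] i j).Equiv (put (put B a b K) a' c B' i j) ∧
        (put (put B a b K) a' c B' i j).Monic := by
    intro a' α B' hB' hE i j hij; by_cases h1 : i = a' ∧ j = c
    · obtain ⟨rfl, rfl⟩ := h1; simp [mulList, put, and_self, if_true]; exact ⟨hE, hB'⟩
    · simp [mulList, put, h1, if_false]; exact Equiv.refl_and ((monic_put hm mK a b) i j hij)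
  have v := Vanish.split (B := put B a b K) hw (L := [(a, b, xt t x, xt t' x)])
    (L₂ := [(b, c, xt t' x, δ)]) (by simpa) (by simpa using hab.trans hbc)
    (by simpa) one_ne_zero (by
      simp only [prodList, map_cons, map_nil, prod_cons, prod_nil, map_one, lf]
      ring)
    ((v₁ e).of_equiv hw (r a _ _ (monic_clear _ _ _ _ _) (by simpa [put, hbc.ne', ha] using he)))
    ((v₂ e').of_equiv hw (r b _ _ (monic_clear _ _ _ _ _) (by simpa [put, hbc.ne', hb] using he')))
  refine v.of_equiv hw fun i j hij => ?_; simp [mulList, put]; split_ifs with h1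
  · rw [h1.1, h1.2]; exact ⟨hS, mK⟩
  · exact Equiv.refl_and (hm i j hij)

end Cancel

lemma words_of_map {k} {T : Type*} {words : List (T × List (Fin k))}
    (h : ∀ w ∈ words.map Prod.snd, w.Perm (finRange k)) : Words words :=
  fun p hp => h p.2 (List.mem_map_of_mem hp)

end Bond

end

section

open Polynomial (C X)

namespace Bond

local notation "κ" => algebraMap (Polynomial ℂ) (Laurent _ (Polynomial ℂ))

/-! ### The cubic and the quartic relations -/

lemma forall_lt_three {p : Fin 3 → Fin 3 → Prop} (h₁ : p 0 1) (h₂ : p 0 2) (h₃ : p 1 2) (i j)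
    (h : i < j) : p i j := by grind

lemma forall_lt_four {p : Fin 4 → Fin 4 → Prop} (h₁ : p 0 1) (h₂ : p 0 2) (h₃ : p 0 3) (h₄ : p 1 2)
    (h₅ : p 1 3) (h₆ : p 2 3) (i j) (h : i < j) : p i j := by grind

/-- The words of the cubic relations. -/
def cubic {S : Type*} [CommRing S] (x : S) : List (S × List (Fin 3)) :=
  [(x, [0, 1, 2]), (x, [1, 0, 2]), (-(1 + x ^ 2), [0, 2, 1]), (-(1 + x ^ 2), [1, 2, 0]),
    (x, [2, 0, 1]), (x, [2, 1, 0])]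

lemma words_cubic {S : Type*} [CommRing S] (x : S) : Words (cubic x) := by
  refine words_of_map ?_
  change ∀ w ∈ ([[0, 1, 2], [1, 0, 2], [0, 2, 1], [1, 2, 0], [2, 0, 1], [2, 1, 0]] :
    List (List (Fin 3))), _
  decide

lemma vanish_cubic {B} {x} {g y α β} (h : g * y = C x *
    X ^ 1 ∧ g ^ 2 + y ^ 2 = 1 + (g * y) ^ 2) (h₁ : SelfLifts (B 0 1) g y) (h₂ : Lifts (B 0 2) (C 1)
    g y α β) (h₃ : Lifts (B 1 2) (C 1) g y α β) : Vanish B (cubic x) := by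
  have hx : ((cubic (C x * X ^ 1)).map fun p => (ev p.1, p.2)) = cubic x := by simp [cubic]
  rw [← hx]
  refine vanish_of_liftTo (words_cubic _) (p := ![ ![0, κ y ^ 2 * zv 1 - κ g ^ 2 * zv 0, κ g * (κ α
    * zv 2) - κ y * (κ β * zv 0)], ![κ g ^ 2 * zv 1 - κ y ^ 2 * zv 0, 0, κ g * (κ α * zv 2) - κ y *
      (κ β * zv 1)], ![κ (C 1) * (κ y * (κ α * zv 2) - κ g * (κ β * zv 0)), κ (C 1) * (κ y * (κ α *
        zv 2) - κ g * (κ β * zv 1)), 0]]) ?_ (forall_lt_three (h₁ 3 0 1) (h₂ 3 0 2) (h₃ 3 1 2))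
  simp only [cubic, ← h.1, ← h.2]
  simp only [map_cons, map_nil, sum_cons, sum_nil, wordP, prod_cons,
    prod_nil, map_neg, map_add, map_one, map_pow, map_mul, cons_val]
  ring

lemma vanish_cubic_edge {B x δ c a b f f' t t'} (hx : x ≠ 0)
    (hδ : δ ≠ 0) (h₁ : B 0 1 = selfPole c a b (x ^ 2)) (h₂ : B 0 2 = edge t 1 f x δ) (h₃ : B 1 2 =
    edge t' 1 f' x δ) (h : t = t' ∨ a = xt t x ∧ b = xt t' x) : Vanish B (cubic x) := by
  have l₂ := lifts_edge_wt hx hδ t 1 f 1; have l₃ := lifts_edge_wt hx hδ t' 1 f' 1; rw [← h₂] at l₂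
  rw [← h₃] at l₃
  have hg : C x * X ^ 1 * 1 = C x * X ^ 1 ∧ (C x * X ^ 1) ^ 2 + 1 ^ 2 = 1 + (C x * X ^ 1 * 1) ^ 2 := by
    constructor <;> ring
  refine Vanish.split_edge hx hδ (words_cubic x) (forall_lt_three ?_ ?_ ?_) (a := 0) (b := 1) (c := 2)
    (by decide) (by decide) (K := selfPoleC c (x ^ 2)) (by simp [selfPoleC, Monic])
    (h₁ ▸ selfPole_equiv _ _ _ _) h₂ h₃ h ?_
    (fun _ => vanish_cubic hg (lifts_selfPoleC _ _) (lifts_clear hδ _ _ _ _ _ _ _) l₃)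
    fun _ => vanish_cubic hg (lifts_selfPoleC _ _) l₂ (lifts_clear hδ _ _ _ _ _ _ _)
  · simp [h₁, selfPole, Monic]
  · exact h₂ ▸ monic_edge _ _ _ _ _
  · exact h₃ ▸ monic_edge _ _ _ _ _
  · rintro rfl; exact vanish_cubic hg (h₁ ▸ lifts_selfPole _ _ _ _) l₂ l₃

/-- The words of the quartic relations. -/
def quartic {S : Type*} [CommRing S] (s r x : S) : List (S × List (Fin 4)) :=
  [(x, [0, 2, 1, 3]), (x * s * r, [0, 3, 1, 2]), (x * s * r, [2, 1, 3, 0]), (x, [3, 1, 2, 0]),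
    (-(r * (1 + x ^ 2)), [0, 2, 3, 1]),
    (x, [1, 2, 0, 3]), (x * s * r, [1, 3, 0, 2]), (x * s * r, [2, 0, 3, 1]), (x, [3, 0, 2, 1]),
    (-(r * (1 + x ^ 2)), [1, 2, 3, 0])]

lemma words_quartic {S : Type*} [CommRing S] (s r x : S) : Words (quartic s r x) := by
  refine words_of_map ?_
  change ∀ w ∈ ([[0, 2, 1, 3], [0, 3, 1, 2], [2, 1, 3, 0], [3, 1, 2, 0], [0, 2, 3, 1], [1, 2, 0, 3],
    [1, 3, 0, 2], [2, 0, 3, 1], [3, 0, 2, 1], [1, 2, 3, 0]] : List (List (Fin 4))), _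
  decide

lemma vanish_quartic {B} {s r x τ} {α β γ η} (hs : s = 1 ∨ s = -1) (hr : r = 1 ∨ r = -1) (h₁ :
    LiftTo (B 0 1) (0 : Fin 4) 1 1 (-1)) (h₂ : Lifts (B 0 2) (C s) (C x * X ^ 1) 1 α β) (h₃ : Lifts
    (B 0 3) (C r) 1 (C x * X ^ 1) η γ) (h₄ : Lifts (B 1 2) (C s) (C x * X ^ 1) 1 α β) (h₅ : Lifts (B
    1 3) (C r) 1 (C x * X ^ 1) η γ) (h₆ : B 2 3 = const 1 τ) : Vanish B (quartic s r x) := by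
  have hx : ((quartic (C s) (C r) (C x * X ^ 1)).map fun p => (ev p.1, p.2)) = quartic s r x := by
    simp [quartic]
  rw [← hx]; have l := lifts_const 1 τ (2 : Fin 4) 3; rw [cast_one, cast_one, ← h₆] at l
  refine vanish_of_liftTo (words_quartic _ _ _) (p := ![
    ![0, 1, κ (C x * X ^ 1) * (κ α * zv 2) - κ 1 * (κ β * zv 0),
      κ 1 * (κ η * zv 3) - κ (C x * X ^ 1) * (κ γ * zv 0)],
    ![-1, 0, κ (C x * X ^ 1) * (κ α * zv 2) - κ 1 * (κ β * zv 1),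
      κ 1 * (κ η * zv 3) - κ (C x * X ^ 1) * (κ γ * zv 1)],
    ![κ (C s) * (κ 1 * (κ α * zv 2) - κ (C x * X ^ 1) * (κ β * zv 0)),
      κ (C s) * (κ 1 * (κ α * zv 2) - κ (C x * X ^ 1) * (κ β * zv 1)), 0, 1],
    ![κ (C r) * (κ (C x * X ^ 1) * (κ η * zv 3) - κ 1 * (κ γ * zv 0)),
      κ (C r) * (κ (C x * X ^ 1) * (κ η * zv 3) - κ 1 * (κ γ * zv 1)), 1, 0]]) ?_
    (forall_lt_four h₁ (h₂ 4 0 2) (h₃ 4 0 3) (h₄ 4 1 2) (h₅ 4 1 3) l)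
  simp only [quartic, List.map, sum_cons, sum_nil, wordP,
    prod_cons, prod_nil, map_neg, map_add, map_one, map_pow, map_mul, cons_val]
  grind

lemma vanish_quartic_edge {B x δ γ s r c a b d d' f f' τ} {t t' :
    Bool} (hx : x ≠ 0) (hδ : δ ≠ 0) (hγ : γ ≠ 0) (hs : s = 1 ∨ s = -1) (hr : r = 1 ∨ r = -1) (h₁ : B
    0 1 = selfOdd c a b) (h₂ : B 0 2 = edge t s f x δ) (h₃ : B 0 3 = pole r d x γ) (h₄ : B 1 2 =
    edge t' s f' x δ) (h₅ : B 1 3 = pole r d' x γ) (h₆ : B 2 3 = const 1 τ) (h : t = t' ∨ a = xt t x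
    ∧ b = xt t' x) : Vanish B (quartic s r x) := by
  have l₂ := lifts_edge_wt hx hδ t s f 1; have l₄ := lifts_edge_wt hx hδ t' s f' 1
  have lP := fun d => lifts_pole hγ r d x (n := 1) (e := 0) (f := 0) (p := 0) (r := 0) rfl rfl
  have l₃ := lP d; have l₅ := lP d'; rw [← h₂] at l₂; rw [← h₃] at l₃; rw [← h₄] at l₄
  rw [← h₅] at l₅
  have lK : LiftTo (const (-1) c) (0 : Fin 4) 1 1 (-1) := by simpa using lifts_const (-1) c 0 1
  refine Vanish.split_edge hx hδ (words_quartic s r x) (forall_lt_four ?_ ?_ ?_ ?_ ?_ ?_) (a := 0)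
    (b := 1) (c := 2) (by decide) (by decide) (K := const (-1) c) (by simp [const, Monic])
    (h₁ ▸ selfOdd_equiv _ _ _) h₂ h₄ h ?_
    (fun _ => vanish_quartic hs hr lK (lifts_clear hδ _ _ _ _ _ _ _) l₃ l₄ l₅ h₆)
    fun _ => vanish_quartic hs hr lK l₂ l₃ (lifts_clear hδ _ _ _ _ _ _ _) l₅ h₆
  · simp [h₁, selfOdd, Monic]
  · exact h₂ ▸ monic_edge _ _ _ _ _
  · exact h₃ ▸ monic_pole _ _ _ _
  · exact h₄ ▸ monic_edge _ _ _ _ _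
  · exact h₅ ▸ monic_pole _ _ _ _
  · simp [h₆, const, Monic]
  · rintro rfl; exact vanish_quartic hs hr (h₁ ▸ lifts_selfOdd _ _ _ _ _) l₂ l₃ l₄ l₅ h₆

end Bond

end

/-! ### Cubic and quartic relations of the currents -/

/-- The contractions of two vertex operators. -/
def IsBond (b : Bool) (i : Idx P) (ε : Bool) (j : Idx P) (ε' : Bool) (B : Bond ℂ) : Prop :=
  B.Monic ∧ LRat (.V b i ε) (.V b j ε') B.fwd ∧ LRat (.V b j ε') (.V b i ε) B.bwd

lemma bond_posEdge_next (b) {i} (h : P.m ≤ i.1) (ε ε') : ∃ c,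
    IsBond b i ε (next P i) ε' (.edge (if b then ε' else ε) (psgn i (next P i)) c (xb P b) P.d⁻¹) := by
  have hx := xb_ne_zero (P := P) b; obtain ⟨κ, h1, h2⟩ := rat_posEdge b h ε ε'
  refine ⟨κ * (xb P b)⁻¹, Bond.monic_edge _ _ _ _ _, ?_⟩
  have e1 : κ * (xb P b)⁻¹ * xb P b = κ := by field_simp
  rcases ht : (if b then ε' else ε) with _ | _
  · obtain ⟨r1, r2⟩ := h1 ht
    simp only [Bond.edge, false_eq_true, if_false, Bond.left, e1, inv_inv]; grind
  · obtain ⟨r1, r2⟩ := h2 ht; simp only [Bond.edge, if_true, Bond.right]; refine ⟨r1, ?_⟩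
    rwa [mul_assoc, e1, mul_comm]

lemma bond_posEdge_prev (b) {i} (h : P.m ≤ (prev P i).1) (ε ε') : ∃ c,
    IsBond b i ε (prev P i) ε' (.edge (!(if b then ε else ε')) (psgn i (prev P i)) c (xb P b) P.d) := by
  have hx := xb_ne_zero (P := P) b; obtain ⟨κ, h1, h2⟩ := rat_posEdge b h ε' ε
  rw [next_prev, psgn_comm] at h1 h2; set s := psgn i (prev P i) with hs
  have hs2 : s * s = 1 := psgn_mul_self _ _
  refine ⟨κ * s * (xb P b)⁻¹, Bond.monic_edge _ _ _ _ _, ?_⟩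
  rcases ht : (if b then ε else ε') with _ | _
  · obtain ⟨r1, r2⟩ := h1 ht; simp only [Bond.edge, Bool.not_false, if_true, Bond.right]
    refine ⟨r2, ?_⟩
    rwa [show s * (κ * s * (xb P b)⁻¹) * xb P b = κ by field_simp; linear_combination κ * hs2]
  · simp only [Bond.edge, Bool.not_true, false_eq_true, if_false, Bond.left]; grind

lemma bond_negEdge_next (b) {i} (h : i.1 < P.m) (ε ε') : ∃ c, IsBond b i ε (next P i) ε' (.pole
    (psgn i (next P i)) c (xb P b) P.d⁻¹) := by
  obtain ⟨κ, h1, h2⟩ := rat_negEdge b h ε ε'; refine ⟨κ, Bond.monic_pole _ _ _ _, ?_, ?_⟩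
  · simpa [Bond.pole] using h1
  · simp [Bond.pole]; grind

lemma bond_negEdge_prev (b) {i} (h : (prev P i).1 < P.m) (ε ε') : ∃ c, IsBond b i ε (prev P i) ε'
    (.pole (psgn i (prev P i)) c (xb P b) P.d) := by
  have hd := P.d_ne_zero; obtain ⟨κ, h1, h2⟩ := rat_negEdge b h ε' ε; rw [next_prev] at h1 h2
  rw [psgn_comm] at h2; set s := psgn i (prev P i) with hs
  have hs2 : s * s = 1 := psgn_mul_self _ _
  refine ⟨-κ * s * P.d⁻¹, Bond.monic_pole _ _ _ _, h2, ?_⟩; simp [Bond.pole]; grind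

lemma qe_eq_xt_false (ε) : qe P ε = Bond.xt ε (xb P false) := by simp [qe, Bond.xt, xb]

lemma qe_eq_xt_true (ε) : qe P ε = Bond.xt (!ε) (xb P true) := by
  cases ε <;> simp [qe, Bond.xt, xb]

lemma xb_add (b) : 1 + xb P b ^ 2 = xb P b * (P.q + P.q⁻¹) := by
  have := P.q_ne_zero; cases b <;> simp [xb] <;> field_simp; ring

lemma cur_cubic (b) {i j} (hi : ¬ IsOdd P i) (hj : j = next P i ∨ j = prev P i) (e e' f) : cur Λ b
    i e * (cur Λ b i e' * cur Λ b j f) + cur Λ b i e' * (cur Λ b i e * cur Λ b j f) - (P.q + P.q⁻¹)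
    • (cur Λ b i e * (cur Λ b j f * cur Λ b i e') + cur Λ b i e' * (cur Λ b j f * cur Λ b i e)) +
    (cur Λ b j f * (cur Λ b i e * cur Λ b i e') + cur Λ b j f * (cur Λ b i e' * cur Λ b i e)) = 0
    := by
  have hx := xb_ne_zero (P := P) b; have hd := P.d_ne_zero
  have key := cur_words_eq_zero Λ b ![i, i, j] (Bond.words_cubic (xb P b)) ?_ ![e, e', f]
  · simp only [Bond.cubic, map_cons, map_nil, prod_cons, prod_nil, mul_one,
      sum_cons, sum_nil, add_zero, cons_val_zero, cons_val_one,
      cons_val, xb_add] at key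
    have h2 := congrArg (fun y => (xb P b)⁻¹ • y) key
    simp only [smul_add, smul_smul, smul_zero, mul_neg, inv_mul_cancel₀ hx,
      inv_mul_cancel_left₀ hx] at h2
    rw [← h2]; module
  · intro ε hε; have hs : ∀ j, psgn i j = 1 := psgn_of_not_odd hi; unfold IsOdd at hi
    rcases lt_or_gt_of_ne (show i.1 ≠ P.m by tauto) with h | h
    · set S := Bond.selfEven (twist (root P i) (root P i)) (xb P b ^ 2)
      have hS : IsBond b i (ε 0) i (ε 1) S := ⟨by simp [S, Bond.selfEven, Bond.Monic], rat_self_pos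
        b (by tauto) h _ _, rat_self_pos b (by tauto) h _ _⟩
      obtain ⟨δ, hδ, hc⟩ : ∃ δ ≠ 0, ∀ k, ∃ c, IsBond b i (ε k) j (ε 2) (.pole 1 c (xb P b) δ) := by
        rcases hj with rfl | rfl
        · exact ⟨_, inv_ne_zero hd, fun k => hs (next P i) ▸ bond_negEdge_next b h (ε k) (ε 2)⟩
        · have hp : (prev P i).1 < P.m := by rw [prev_val]; split_ifs <;> omega
          exact ⟨_, hd, fun k => hs (prev P i) ▸ bond_negEdge_prev b hp (ε k) (ε 2)⟩
      choose c hc using hc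
      have lP := fun k => Bond.lifts_pole hδ 1 (c k) (xb P b) (n := 1) (e := 0) (f := 0) (p := 0)
        (r := 0) rfl rfl
      exact ⟨![![S, S, .pole 1 (c 0) (xb P b) δ], ![S, S, .pole 1 (c 1) (xb P b) δ], ![S, S, S]],
        Bond.forall_lt_three hS (hc 0) (hc 1), Bond.vanish_cubic (by constructor <;> ring)
          (Bond.lifts_selfEven _ _) (lP 0) (lP 1)⟩
    · set S := Bond.selfPole (twist (root P i) (root P i) * (P.d ^ dsc i) ^ 2) (qe P (ε 0))
        (qe P (ε 1)) (xb P b ^ 2)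
      obtain ⟨δ, hδ, T, hc, hT⟩ : ∃ δ ≠ 0, ∃ T : Fin 3 → Bool,
          (∀ k, ∃ c, IsBond b i (ε k) j (ε 2) (.edge (T k) 1 c (xb P b) δ)) ∧
          (T 0 = T 1 ∨ qe P (ε 0) = Bond.xt (T 0) (xb P b) ∧ qe P (ε 1) = Bond.xt (T 1) (xb P b))
            := by
        rcases hj with rfl | rfl
        · refine ⟨_, inv_ne_zero hd, _,
            fun k => hs (next P i) ▸ bond_posEdge_next b h.le (ε k) (ε 2), ?_⟩
          cases b; exacts [.inr ⟨qe_eq_xt_false _, qe_eq_xt_false _⟩, .inl rfl]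
        · have hp : P.m ≤ (prev P i).1 := by rw [prev_val]; split_ifs <;> omega
          refine ⟨_, hd, _, fun k => hs (prev P i) ▸ bond_posEdge_prev b hp (ε k) (ε 2), ?_⟩
          cases b; exacts [.inl rfl, .inr ⟨qe_eq_xt_true _, qe_eq_xt_true _⟩]
      choose c hc using hc
      exact ⟨![![S, S, .edge (T 0) 1 (c 0) (xb P b) δ], ![S, S, .edge (T 1) 1 (c 1) (xb P b) δ],
        ![S, S, S]], Bond.forall_lt_three (⟨by simp [S, Bond.selfPole, Bond.Monic], rat_self_neg b
          h _ _, rat_self_neg b h _ _⟩) (hc 0) (hc 1), Bond.vanish_cubic_edge hx hδ rfl rfl rfl hT⟩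

lemma psgn_eq_one_or (i j : Idx P) : psgn i j = 1 ∨ psgn i j = -1 :=
  neg_one_pow_eq_or ℂ _

lemma bond_far (b) {i j} (h1 : i ≠ j) (h2 : j ≠ next P i) (h3 : i ≠ next P j) (h : psgn i j = 1) (ε
    ε') : IsBond b i ε j ε' (.const 1 (twist (root P i) (root P j))) := by
  refine ⟨by simp [Bond.const, Bond.Monic], rat_far b b h1 h2 h3 ε ε', ?_⟩
  have := rat_far b b h1.symm h3 h2 ε' ε; rw [twist_far h1 h2 h3, h] at this; exact this

lemma cur_quartic (b) {i u v} (hi : IsOdd P i) (hmn : P.m * P.n ≠ 2) (huv : i.1 = P.m ∧ u = next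
    P i ∧ v = prev P i ∨ i.1 = 0 ∧ u = prev P i ∧ v = next P i) (e e' f g) : (cur Λ b i e * (cur Λ
    b u f * (cur Λ b i e' * cur Λ b v g)) + cur Λ b i e' * (cur Λ b u f * (cur Λ b i e * cur Λ b v
    g))) + (psgn i u * psgn i v) • (cur Λ b i e * (cur Λ b v g * (cur Λ b i e' * cur Λ b u f)) + cur
    Λ b i e' * (cur Λ b v g * (cur Λ b i e * cur Λ b u f))) + (psgn i u * psgn i v) • (cur Λ b u f *
    (cur Λ b i e' * (cur Λ b v g * cur Λ b i e)) + cur Λ b u f * (cur Λ b i e * (cur Λ b v g * cur Λ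
    b i e'))) + (cur Λ b v g * (cur Λ b i e' * (cur Λ b u f * cur Λ b i e)) + cur Λ b v g * (cur Λ b
    i e * (cur Λ b u f * cur Λ b i e'))) - (psgn i v * (P.q + P.q⁻¹)) • (cur Λ b i e * (cur Λ b u f
    * (cur Λ b v g * cur Λ b i e')) + cur Λ b i e' * (cur Λ b u f * (cur Λ b v g * cur Λ b i e))) =
    0 := by
  have hx := xb_ne_zero (P := P) b; have hd := P.d_ne_zero
  have key := cur_words_eq_zero Λ b ![i, i, u, v]
    (Bond.words_quartic (psgn i u) (psgn i v) (xb P b)) ?_ ![e, e', f, g]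
  · simp only [Bond.quartic, map_cons, map_nil, prod_cons, prod_nil, mul_one,
      sum_cons, sum_nil, add_zero, cons_val_zero, cons_val_one,
      cons_val, xb_add] at key
    have h2 := congrArg (fun y => (xb P b)⁻¹ • y) key
    have e1 : (xb P b)⁻¹ * (psgn i v * (xb P b * (P.q + P.q⁻¹))) = psgn i v * (P.q + P.q⁻¹) := by
      field_simp
    simp only [smul_add, smul_smul, smul_zero, mul_neg, inv_mul_cancel₀ hx, mul_assoc,
      inv_mul_cancel_left₀ hx, e1] at h2
    rw [← h2]; module
  · intro ε hε; have hm := P.one_le_m; have hn := P.one_le_n; have hne := P.m_ne_n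
    have h4 : 4 ≤ P.m + P.n := by
      by_contra h; have : P.m + P.n = 3 := by omega
      rcases (show P.m = 1 ∧ P.n = 2 ∨ P.m = 2 ∧ P.n = 1 by omega) with ⟨h1, h2⟩ | ⟨h1, h2⟩ <;>
        simp [h1, h2] at hmn
    set S := Bond.selfOdd (twist (root P i) (root P i) * P.d ^ dsc i) (lamb b i (ε 0))
      (lamb b i (ε 1))
    have e1 := next_val i; have e2 := prev_val i
    obtain ⟨f1, f2, f3, f4⟩ : next P i ≠ prev P i ∧ prev P i ≠ next P (next P i) ∧
        next P i ≠ next P (prev P i) ∧ psgn (next P i) (prev P i) = 1 := by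
      have e3 := next_val (next P i); rw [next_prev]
      refine ⟨fun h => ?_, fun h => ?_, fun h => ?_, ?_⟩
      · rw [h, e2] at e1; split_ifs at e1 <;> omega
      · rw [← h, e2] at e3; split_ifs at e1 e3 <;> omega
      · rw [h] at e1; split_ifs at e1 <;> omega
      · by_cases ho : IsOdd P (next P i)
        · rw [psgn_comm]; refine psgn_of_not_odd (fun ho' => ?_) _; unfold IsOdd at hi ho ho'
          split_ifs at e1 e2 <;> omega
        · exact psgn_of_not_odd ho _
    obtain ⟨δ, γ, hδ, hγ, T, τ, hc, hk, hτ, hT⟩ : ∃ δ γ, δ ≠ 0 ∧ γ ≠ 0 ∧ ∃ (T : Fin 4 → Bool)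
      (τ : ℂ), (∀ k, ∃ c, IsBond b i (ε k) u (ε 2) (.edge (T k) (psgn i u) c (xb P b) δ)) ∧
        (∀ k, ∃ c, IsBond b i (ε k) v (ε 3) (.pole (psgn i v) c (xb P b) γ)) ∧
        IsBond b u (ε 2) v (ε 3) (.const 1 τ) ∧ (T 0 = T 1 ∨
          lamb b i (ε 0) = Bond.xt (T 0) (xb P b) ∧ lamb b i (ε 1) = Bond.xt (T 1) (xb P b)) := by
      rcases huv with ⟨h1, rfl, rfl⟩ | ⟨h1, rfl, rfl⟩
      · have hp : (prev P i).1 < P.m := by rw [prev_val]; split_ifs <;> omega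
        refine ⟨_, _, inv_ne_zero hd, hd, _, _, fun k => bond_posEdge_next b h1.ge (ε k) (ε 2),
          fun k => bond_negEdge_prev b hp (ε k) (ε 3), bond_far b f1 f2 f3 f4 _ _, ?_⟩
        cases b
        · simp [lamb, dpart, h1, qe_eq_xt_false]
        · exact .inl rfl
      · have hp : P.m ≤ (prev P i).1 := by rw [prev_val, if_pos h1]; omega
        refine ⟨_, _, hd, inv_ne_zero hd, _, _, fun k => bond_posEdge_prev b hp (ε k) (ε 2),
          fun k => bond_negEdge_next b (by omega) (ε k) (ε 3),
          bond_far b f1.symm f3 f2 (psgn_comm _ _ ▸ f4) _ _, ?_⟩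
        cases b
        · exact .inl rfl
        · simp [lamb, dpart, hp, qe_eq_xt_true]
    choose c hc using hc; choose k hk using hk
    exact ⟨![![S, S, .edge (T 0) (psgn i u) (c 0) (xb P b) δ, .pole (psgn i v) (k 0) (xb P b) γ],
      ![S, S, .edge (T 1) (psgn i u) (c 1) (xb P b) δ, .pole (psgn i v) (k 1) (xb P b) γ],
      ![S, S, S, .const 1 τ], ![S, S, S, S]],
      Bond.forall_lt_four (⟨by simp [S, Bond.selfOdd, Bond.Monic], rat_self_odd b hi _ _,
        rat_self_odd b hi _ _⟩) (hc 0) (hk 0) (hc 1) (hk 1) hτ, Bond.vanish_quartic_edge hx hδ hγ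
        (psgn_eq_one_or _ _) (psgn_eq_one_or _ _) rfl rfl rfl rfl rfl rfl hT⟩

section

open Polynomial (C X)

namespace Bond

local notation "κ" => algebraMap (Polynomial ℂ) (Laurent _ (Polynomial ℂ))

/-! ### The quintic relations -/

lemma forall_lt_five {p : Fin 5 → Fin 5 → Prop} (h₁ : p 0 1) (h₂ : p 0 2) (h₃ : p 0 3) (h₄ : p 0 4)
    (h₅ : p 1 2) (h₆ : p 1 3) (h₇ : p 1 4) (h₈ : p 2 3) (h₉ : p 2 4) (h₀ : p 3 4) (i j)
    (h : i < j) : p i j := by grind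

def quinticPart {S : Type*} [CommRing S] (x : S) (a b u v : Fin 5) : List (S × List (Fin 5)) :=
  [(x, [a, u, b, v, 4]), (-x, [u, a, v, b, 4]), (-(1 + x ^ 2), [a, u, b, 4, v]),
    (1 + x ^ 2, [u, a, v, 4, b]), (-(1 + x ^ 2), [a, u, 4, v, b]), (1 + x ^ 2, [u, a, 4, b, v]),
    (1 + x ^ 2, [a, 4, u, b, v]), (-(1 + x ^ 2), [u, 4, a, v, b]), (x, [4, u, a, v, b]),
    (-x, [4, a, u, b, v])]

/-- The words of the quintic relations. -/
def quintic {S : Type*} [CommRing S] (x : S) : List (S × List (Fin 5)) :=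
  quinticPart x 0 1 2 3 ++ quinticPart x 1 0 2 3 ++ quinticPart x 0 1 3 2 ++ quinticPart x 1 0 3 2

lemma words_quintic {S : Type*} [CommRing S] (x : S) : Words (quintic x) := by
  have h : ∀ a b u v, [a, b, u, v].Perm [0, 1, 2, 3] → Words (quinticPart x a b u v) := by
    intro a b u v h; refine words_of_map ?_
    change ∀ w ∈ ([[a, u, b, v, 4], [u, a, v, b, 4], [a, u, b, 4, v], [u, a, v, 4, b],
      [a, u, 4, v, b], [u, a, 4, b, v], [a, 4, u, b, v], [u, 4, a, v, b], [4, u, a, v, b],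
      [4, a, u, b, v]] : List (List (Fin 5))), w.Perm [0, 1, 2, 3, 4]
    revert a b u v; decide
  intro p hp; simp only [quintic, List.mem_append] at hp; rcases hp with ((hp | hp) | hp) | hp
  exacts [h _ _ _ _ (by decide) p hp, h _ _ _ _ (by decide) p hp, h _ _ _ _ (by decide) p hp,
    h _ _ _ _ (by decide) p hp]

lemma quintic_map_ev (x n) : ((quintic (C x * X ^ n)).map fun p => (ev p.1, p.2)) =
    quintic x := by simp [quintic, quinticPart]

def quinticPoly {R : Type*} [CommRing R] (g x D E a b u v y : R) : Fin 5 → Fin 5 → R :=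
  ![![0, 1, g * (D * a) - x * (E * u), g * (D * a) - x * (E * v), g * y - x * a],
    ![-1, 0, g * (D * b) - x * (E * u), g * (D * b) - x * (E * v), g * y - x * b],
    ![g * (E * u) - x * (D * a), g * (E * u) - x * (D * b), 0, 1, x * u - g * y],
    ![g * (E * v) - x * (D * a), g * (E * v) - x * (D * b), -1, 0, x * v - g * y],
    ![x * y - g * a, x * y - g * b, g * u - x * y, g * v - x * y, 0]]

def quinticForm {R : Type*} [CommRing R] (x T : R) (p : Fin 5 → Fin 5 → R)
    (r2 r3 s0 s1 c1 c2 : R) : R :=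
    x * (p 0 4 * p 1 4 * p 2 4 * p 3 4) *
      (p 0 3 * p 1 3 * r2 - p 0 2 * p 1 2 * r3 - p 2 0 * p 2 1 * r3 + p 3 0 * p 3 1 * r2) +
    T * (p 0 4 * p 1 4 * p 2 4 * p 4 3 * (-p 0 3 * p 1 3 * r2) +
      p 0 4 * p 1 4 * p 4 2 * p 3 4 * (p 0 2 * p 1 2 * r3) +
      p 0 4 * p 4 1 * p 2 4 * p 3 4 * (-p 2 1 * p 3 1 * s0) +
      p 4 0 * p 1 4 * p 2 4 * p 3 4 * (p 2 0 * p 3 0 * s1) +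
      p 0 4 * p 4 1 * p 2 4 * p 4 3 * (p 0 3 * p 2 1 * c1) +
      p 0 4 * p 4 1 * p 4 2 * p 3 4 * (p 0 2 * p 3 1 * c2) +
      p 4 0 * p 1 4 * p 2 4 * p 4 3 * (-p 1 3 * p 2 0 * c2) +
      p 4 0 * p 1 4 * p 4 2 * p 3 4 * (-p 1 2 * p 3 0 * c1) +
      p 0 4 * p 4 1 * p 4 2 * p 4 3 * (-p 0 2 * p 0 3 * s1) +
      p 4 0 * p 1 4 * p 4 2 * p 4 3 * (p 1 2 * p 1 3 * s0) +
      p 4 0 * p 4 1 * p 2 4 * p 4 3 * (-p 2 0 * p 2 1 * r3) +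
      p 4 0 * p 4 1 * p 4 2 * p 3 4 * (p 3 0 * p 3 1 * r2)) -
    x * (p 4 0 * p 4 1 * p 4 2 * p 4 3) *
      (p 0 3 * p 1 3 * r2 - p 0 2 * p 1 2 * r3 - p 2 0 * p 2 1 * r3 + p 3 0 * p 3 1 * r2)

lemma quinticForm_mul {R : Type*} [CommRing R] (x T p) (K r2 r3 s0 s1 c1 c2 : R) : quinticForm x T p
    (K * r2) (K * r3) (K * s0) (K * s1) (K * c1) (K * c2) = K * quinticForm x T p r2 r3 s0 s1 c1 c2
    := by grind [quinticForm]

set_option maxHeartbeats 1000000 in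
lemma quintic_sum {S : Type*} [CommRing S] {p} {x T : Laurent
    (Fin 5) S} (h01 : p 0 1 = 1) (h10 : p 1 0 = -1) (h23 : p 2 3 = 1) (h32 : p 3 2 = -1) (x')
    (hx : algebraMap S _ x' = x) (hT : 1 + x ^ 2 = T) : ((quintic x').map fun w => algebraMap S _
    w.1 * wordP p w.2).sum = quinticForm x T p (p 0 2 * p 2 1 - p 1 2 * p 2 0) (p 0 3 * p 3 1 - p 1
    3 * p 3 0) (p 0 2 * p 3 0 - p 0 3 * p 2 0) (p 1 2 * p 3 1 - p 1 3 * p 2 1) (p 1 3 * p 2 0 - p 0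
    2 * p 3 1) (p 0 3 * p 2 1 - p 1 2 * p 3 0) := by
  simp only [quintic, quinticPart, List.map_append, List.map, List.sum_append,
    sum_cons, sum_nil, wordP, prod_cons, prod_nil, h01, h10, h23, h32, map_add,
    map_neg, map_pow, map_one, hx, hT, quinticForm]
  ring

set_option maxHeartbeats 1000000 in
lemma quintic_eq_zero {S : Type*} [CommRing S] {g x D E a b u v y : Laurent (Fin 5) S} (x') (hx
    : algebraMap S _ x' = g * x) (hT : 1 + (g * x) ^ 2 = g ^ 2 + x ^ 2) : ((quintic x').map fun w =>
    algebraMap S _ w.1 * wordP (quinticPoly g x D E a b u v y) w.2).sum = 0 := by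
  rw [quintic_sum rfl rfl rfl rfl x' hx hT]
  trans quinticForm (g * x) (g ^ 2 + x ^ 2) (quinticPoly g x D E a b u v y)
    ((g ^ 2 - x ^ 2) * ((D * a - D * b) * (E * u))) ((g ^ 2 - x ^ 2) * ((D * a - D * b) * (E * v)))
    ((g ^ 2 - x ^ 2) * (-(D * a) * (E * u - E * v))) ((g ^ 2 - x ^ 2) * (-(D * b) * (E * u - E * v)))
    ((g ^ 2 - x ^ 2) * (D * b * (E * u) - D * a * (E * v)))
    ((g ^ 2 - x ^ 2) * (D * a * (E * u) - D * b * (E * v)))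
  · congr 1 <;> simp only [quinticPoly, cons_val] <;> ring
  · rw [quinticForm_mul]; convert mul_zero _; simp only [quinticForm, quinticPoly, cons_val]
    ring

lemma vanish_quintic₁ {B x δ} (hδ : δ ≠ 0) {c c' : Fin 2 → ℂ} {s t :
    Fin 2 → Bool} (hz : LiftTo (B 0 1) (0 : Fin 5) 1 1 (-1)) (hw : LiftTo (B 2 3) (2 : Fin 5) 3 1
    (-1)) {E : Fin 2 → Fin 2 → Bond ℂ} (hB : B 0 2 = E 0 0 ∧ B 0 3 = E 0 1 ∧ B 1 2 = E 1 0 ∧ B 1 3 =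
    E 1 1) (hE : ∀ k l, Lifts (E k l) (C (-1)) (C x * X ^ 5) 1 (X ^ wtw 5 (t l)) (C δ⁻¹ * X ^ wtz 5
    (s k))) (hP : B 0 4 = pole 1 (c 0) x δ⁻¹ ∧ B 1 4 = pole 1 (c 1) x δ⁻¹ ∧ B 2 4 = pole 1 (c' 0) x
    δ ∧ B 3 4 = pole 1 (c' 1) x δ) : Vanish B (quintic x) := by
  obtain ⟨b1, b2, b3, b4⟩ := hB; obtain ⟨p1, p2, p3, p4⟩ := hP
  let a := fun k (i : Fin 5) => κ (C δ⁻¹ * X ^ wtz 5 (s k)) * zv i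
  let u := fun l (i : Fin 5) => κ (C δ * X ^ wtw 5 (t l)) * zv i
  rw [← quintic_map_ev x 5]; have hd := C_mul_inv (ι := Fin 5) hδ
  have lE : ∀ k l i j, LiftTo (E k l) i j (1 * (1 * a k i) - κ (C x * X ^ 5) * (κ (C δ⁻¹) * u l j))
      (1 * (κ (C δ⁻¹) * u l j) - κ (C x * X ^ 5) * (1 * a k i)) := by
    intro k l i j
    convert (hE k l 5 i j).neg using 1 <;> simp only [a, u, map_mul, map_one, map_neg]
    · grind
    · grind
  have l₁ : ∀ k i, LiftTo (pole 1 (c k) x δ⁻¹) i 4 (1 * (κ (X ^ 3) * zv 4) - κ (C x * X ^ 5) * a k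
    i) (κ (C x * X ^ 5) * (κ (X ^ 3) * zv 4) - 1 * a k i) := by
    intro k i; have h : wtz 5 (s k) ≤ 6 := by cases s k <;> simp [wtz]
    convert lifts_pole (inv_ne_zero hδ) 1 (c k) x (n := 5) (f := 3) (e := wtz 5 (s k))
      (p := 7 - wtz 5 (s k)) (r := wtz 5 (s k) + 1) (by omega) (by omega) 5 i 4 using 1 <;>
      simp only [a, map_mul, map_one, map_neg] <;> ring
  have l₂ : ∀ l i, LiftTo (pole 1 (c' l) x δ) i 4 (κ (C x * X ^ 5) * u l i - 1 * (κ (X ^ 3) * zv 4))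
      (1 * u l i - κ (C x * X ^ 5) * (κ (X ^ 3) * zv 4)) := by
    intro l i; have h : wtw 5 (t l) ≤ 6 := by cases t l <;> simp [wtw]
    convert (lifts_pole hδ 1 (c' l) x (n := 5) (f := 3) (e := wtw 5 (t l))
      (p := 7 - wtw 5 (t l)) (r := wtw 5 (t l) + 1) (by omega) (by omega) 5 i 4).neg using 1 <;>
      simp only [u, map_mul, map_one, map_neg] <;> ring
  exact vanish_of_liftTo (words_quintic _) (quintic_eq_zero (x := κ (C x * X ^ 5)) (D := 1) (E := κ
    (C δ⁻¹)) (a := a 0 0) (b := a 1 1) (u := u 0 2) (v := u 1 3) (y := κ (X ^ 3) * zv 4) (C x * X ^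
      5) (by ring) (by ring)) (forall_lt_five hz (b1 ▸ lE 0 0 0 2) (b2 ▸ lE 0 1 0 3) (p1 ▸ l₁ 0 0)
        (b3 ▸ lE 1 0 1 2) (b4 ▸ lE 1 1 1 3) (p2 ▸ l₁ 1 1) hw (p3 ▸ l₂ 0 2) (p4 ▸ l₂ 1 3))

lemma vanish_quintic_edge₁ {B} {x δ e e'} (hx : x ≠ 0) (hδ : δ ≠ 0) {a b c c' : Fin 2 → ℂ} {f : Fin
    2 → Fin 2 → ℂ} {t : Fin 2 → Fin 2 → Bool} (hz : B 0 1 = selfOdd e (a 0) (a 1)) (hw : B 2 3 =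
    selfOdd e' (b 0) (b 1)) (hB : B 0 2 = edge (t 0 0) (-1) (f 0 0) x δ ∧ B 0 3 = edge (t 0 1) (-1)
    (f 0 1) x δ ∧ B 1 2 = edge (t 1 0) (-1) (f 1 0) x δ ∧ B 1 3 = edge (t 1 1) (-1) (f 1 1) x δ) (hP
    : B 0 4 = pole 1 (c 0) x δ⁻¹ ∧ B 1 4 = pole 1 (c 1) x δ⁻¹ ∧ B 2 4 = pole 1 (c' 0) x δ ∧ B 3 4 =
    pole 1 (c' 1) x δ) (h : ∀ k l, a k = xt (t k l) x * b l) : Vanish B (quintic x) := by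
  have hW := words_quintic x
  choose g hg using (fun k l => h k l ▸ edge_mulLin hx hδ _ _ _ _ _ : ∀ k l, ∃ e, ((edge (t k l)
    (-1) (f k l) x δ).mulLin (a k) (δ * b l)).Equiv (clear true (-1) e x δ))
  have lE := fun t c => lifts_edge_wt hx hδ t (-1) c 5
  have lC := fun c n m => lifts_clear hδ true (-1) c x 5 n m
  have lK : ∀ c (i j : Fin 5), LiftTo (const (-1) c) i j 1 (-1) := fun c i j => by
    simpa using lifts_const (-1) c i j
  have mK : ∀ c : ℂ, (const (-1) c).Monic := by simp [const, Monic]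
  have mC := fun k l => monic_clear true (-1) (g k l) x δ; obtain ⟨b1, b2, b3, b4⟩ := hB
  obtain ⟨p1, p2, p3, p4⟩ := id hP; have hm : ∀ i j, i < j → (B i j).Monic := by
    refine forall_lt_five ?_ ?_ ?_ ?_ ?_ ?_ ?_ ?_ ?_ ?_ <;> simp only [*, monic_edge, monic_pole]
      <;> simp [selfOdd, Monic]
  set B₀ := put (put B 0 1 (const (-1) e)) 2 3 (const (-1) e')
  have r := fun i j hij => Equiv.refl_and ((monic_put (monic_put hm (mK e) 0 1) (mK e') 2 3) i j
    hij)
  have v₁ := vanish_quintic₁ (B := put (put B₀ 0 2 (clear true (-1) (g 0 0) x δ)) 1 3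
    (clear true (-1) (g 1 1) x δ)) hδ (s := ![t 0 1, t 1 0]) (t := ![t 1 0, t 0 1]) (lK e _ _)
    (lK e' _ _) (E := ![![clear true (-1) (g 0 0) x δ, edge (t 0 1) (-1) (f 0 1) x δ],
      ![edge (t 1 0) (-1) (f 1 0) x δ, clear true (-1) (g 1 1) x δ]]) ⟨rfl, b2, b3, rfl⟩
    (fun k l => by fin_cases k <;> fin_cases l <;> first | exact lC _ _ _ | exact lE _ _) hP
  have v₂ := vanish_quintic₁ (B := put (put B₀ 0 3 (clear true (-1) (g 0 1) x δ)) 1 2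
    (clear true (-1) (g 1 0) x δ)) hδ (s := ![t 0 0, t 1 1]) (t := ![t 0 0, t 1 1]) (lK e _ _)
    (lK e' _ _) (E := ![![edge (t 0 0) (-1) (f 0 0) x δ, clear true (-1) (g 0 1) x δ],
      ![clear true (-1) (g 1 0) x δ, edge (t 1 1) (-1) (f 1 1) x δ]]) ⟨b1, rfl, rfl, b4⟩
    (fun k l => by fin_cases k <;> fin_cases l <;> first | exact lC _ _ _ | exact lE _ _) hP
  have h1 := hg 0 0; have h2 := hg 0 1; have h3 := hg 1 0; have h4 := hg 1 1; rw [← b1] at h1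
  rw [← b2] at h2; rw [← b3] at h3; rw [← b4] at h4; have v := Vanish.split (B := B₀) hW
    (L := [(0, 1, a 0, a 1), (2, 3, b 0, b 1)]) (L₁ := [(0, 2, a 0, δ * b 0), (1, 3, a 1, δ * b 1)])
    (L₂ := [(0, 3, a 0, δ * b 1), (1, 2, a 1, δ * b 0)]) (by simp) (by simp) (by simp) hδ (by
      simp only [prodList, map_cons, map_nil, prod_cons, prod_nil, map_mul, lf]
      ring)
    (v₁.of_equiv hW (forall_lt_five (r 0 1 (by decide)) ⟨h1, mC 0 0⟩ (r 0 3 (by decide))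
      (r 0 4 (by decide)) (r 1 2 (by decide)) ⟨h4, mC 1 1⟩ (r 1 4 (by decide)) (r 2 3 (by decide))
      (r 2 4 (by decide)) (r 3 4 (by decide))))
    (v₂.of_equiv hW (forall_lt_five (r 0 1 (by decide)) (r 0 2 (by decide)) ⟨h2, mC 0 1⟩
      (r 0 4 (by decide)) ⟨h3, mC 1 0⟩ (r 1 3 (by decide)) (r 1 4 (by decide)) (r 2 3 (by decide))
      (r 2 4 (by decide)) (r 3 4 (by decide))))
  exact v.of_equiv hW (forall_lt_five ⟨hz ▸ selfOdd_equiv _ _ _, mK e⟩ (r 0 2 (by decide))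
    (r 0 3 (by decide)) (r 0 4 (by decide)) (r 1 2 (by decide)) (r 1 3 (by decide))
    (r 1 4 (by decide)) ⟨hw ▸ selfOdd_equiv _ _ _, mK e'⟩ (r 2 4 (by decide)) (r 3 4 (by decide)))

section

variable {B : Fin 5 → Fin 5 → Bond ℂ} {x δ : ℂ} (hδ : δ ≠ 0) {p r : ℕ}

include hδ

lemma vanish_quintic₂ (hp : p ≤ 4) (hr : r ≤ 4) (hz : LiftTo (B 0 1) (0 : Fin 5) 1 1 (-1)) (hw :
    LiftTo (B 2 3) (2 : Fin 5) 3 1 (-1)) (hP : ∃ c : Fin 2 → Fin 2 → ℂ, B 0 2 = pole (-1) (c 0 0) x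
    δ⁻¹ ∧ B 0 3 = pole (-1) (c 0 1) x δ⁻¹ ∧ B 1 2 = pole (-1) (c 1 0) x δ⁻¹ ∧ B 1 3 = pole (-1) (c 1
    1) x δ⁻¹) (h₀ : Lifts (B 0 4) (C 1) (C x * X ^ 1) 1 (X ^ 2) (C δ⁻¹ * X ^ p)) (h₁ : Lifts (B 1 4)
    (C 1) (C x * X ^ 1) 1 (X ^ 2) (C δ⁻¹ * X ^ p)) (k₀ : Lifts (B 2 4) (C 1) (C x * X ^ 1) 1 (X ^ 2)
    (C δ⁻¹⁻¹ * X ^ r)) (k₁ : Lifts (B 3 4) (C 1) (C x * X ^ 1) 1 (X ^ 2) (C δ⁻¹⁻¹ * X ^ r)) : Vanish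
    B (quintic x) := by
  obtain ⟨c, b1, b2, b3, b4⟩ := hP; let a := fun i : Fin 5 => κ (C δ⁻¹ * X ^ p) * zv i
  let u := fun i : Fin 5 => κ (C δ⁻¹⁻¹ * X ^ r) * zv i; rw [← quintic_map_ev x 1]
  have hd := C_mul_inv (ι := Fin 5) (inv_ne_zero hδ)
  have ep : ∀ {p}, p ≤ 4 → (κ (X ^ 4) : Laurent (Fin 5) _) = κ (X ^ (4 - p)) * κ (X ^ p) :=
    fun hp => by grind [map_mul, pow_add, Nat.sub_add_cancel]
  have lP : ∀ c i j, LiftTo (pole (-1) c x δ⁻¹) i j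
      (κ (C x * X ^ 1) * (κ (X ^ (4 - p)) * a i) - 1 * (κ (C δ⁻¹ * X ^ (4 - r)) * u j))
      (κ (C x * X ^ 1) * (κ (C δ⁻¹ * X ^ (4 - r)) * u j) - 1 * (κ (X ^ (4 - p)) * a i)) := by
    intro c i j
    convert (lifts_pole (inv_ne_zero hδ) (-1) c x (n := 1) (e := 4) (f := 4) (p := 0) (r := 0) rfl
      rfl 5 i j).neg using 1 <;> simp only [a, u, map_mul, map_one, map_neg]
    · grind
    · grind
  have l₁ : ∀ {i} {E : Bond ℂ}, Lifts E (C 1) (C x * X ^ 1) 1 (X ^ 2) (C δ⁻¹ * X ^ p) →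
      LiftTo E i 4 (κ (C x * X ^ 1) * (κ (X ^ 2) * zv 4) - 1 * a i)
        (1 * (κ (X ^ 2) * zv 4) - κ (C x * X ^ 1) * a i) := fun {i} E h => by
    convert h 5 i 4 using 1 <;> simp only [a, map_mul, map_one, map_neg] <;> ring
  have l₂ : ∀ {i} {E : Bond ℂ}, Lifts E (C 1) (C x * X ^ 1) 1 (X ^ 2) (C δ⁻¹⁻¹ * X ^ r) →
      LiftTo E i 4 (1 * u i - κ (C x * X ^ 1) * (κ (X ^ 2) * zv 4))
        (κ (C x * X ^ 1) * u i - 1 * (κ (X ^ 2) * zv 4)) := fun {i} E h => by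
    convert (h 5 i 4).neg using 1 <;> simp only [u, map_mul, map_one, map_neg] <;> ring
  exact vanish_of_liftTo (words_quintic _) (quintic_eq_zero (S := Polynomial ℂ) (g := κ (C x * X ^
    1)) (x := 1) (D := κ (X ^ (4 - p))) (E := κ (C δ⁻¹ * X ^ (4 - r))) (a := a 0) (b := a 1) (u :=
      u 2) (v := u 3) (y := κ (X ^ 2) * zv 4) (C x * X ^ 1) (by ring) (by ring)) (forall_lt_five hz
        (b1 ▸ lP _ 0 2) (b2 ▸ lP _ 0 3)
    (l₁ h₀) (b3 ▸ lP _ 1 2) (b4 ▸ lP _ 1 3) (l₁ h₁) hw (l₂ k₀) (l₂ k₁))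

def wt4 (t : Bool) : ℕ := if t then 0 else 4

omit hδ in
lemma wt4_le (t) : wt4 t ≤ 4 := by cases t <;> simp [wt4]

lemma lifts_edge_wt4 (hx : x ≠ 0) (t) (c) :
    Lifts (edge t 1 c x δ) (C 1) (C x * X ^ 1) 1 (X ^ 2) (C δ⁻¹ * X ^ wt4 t) :=
  lifts_edge hx hδ t 1 c (by cases t <;> simp [wt4])

variable {c a b f f' : ℂ} {t t' : Bool}

lemma vanish_quintic_right (hx : x ≠ 0) (hp : p ≤ 4) (hz : LiftTo (B 0 1) (0 : Fin 5) 1 1 (-1)) (hP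
    : ∃ c : Fin 2 → Fin 2 → ℂ, B 0 2 = pole (-1) (c 0 0) x δ⁻¹ ∧ B 0 3 = pole (-1) (c 0 1) x δ⁻¹ ∧ B
    1 2 = pole (-1) (c 1 0) x δ⁻¹ ∧ B 1 3 = pole (-1) (c 1 1) x δ⁻¹) (h₀ : Lifts (B 0 4) (C 1) (C x
    * X ^ 1) 1 (X ^ 2) (C δ⁻¹ * X ^ p)) (h₁ : Lifts (B 1 4) (C 1) (C x * X ^ 1) 1 (X ^ 2) (C δ⁻¹ * X
    ^ p)) (hm : ∀ i j, i < j → (B i j).Monic) (hw : B 2 3 = selfOdd c a b) (k₀ : B 2 4 = edge t 1 f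
    x δ⁻¹) (k₁ : B 3 4 = edge t' 1 f' x δ⁻¹) (h : t = t' ∨ a = xt t x ∧ b = xt t' x) : Vanish B
    (quintic x) := by
  have hδ' := inv_ne_zero hδ; have l₀ := lifts_edge_wt4 hδ' hx t f
  have l₁ := lifts_edge_wt4 hδ' hx t' f'; rw [← k₀] at l₀; rw [← k₁] at l₁
  have lK : LiftTo (const (-1) c) (2 : Fin 5) 3 1 (-1) := by simpa using lifts_const (-1) c 2 3
  refine Vanish.split_edge hx hδ' (words_quintic x) hm (a := 2) (b := 3) (c := 4) (by decide)
    (by decide) (K := const (-1) c) (by simp [const, Monic]) (hw ▸ selfOdd_equiv _ _ _) k₀ k₁ h ?_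
    (fun _ => vanish_quintic₂ hδ hp (wt4_le t') hz lK hP h₀ h₁ (lifts_clear hδ' _ _ _ _ _ _ _) l₁)
    fun _ => vanish_quintic₂ hδ hp (wt4_le t) hz lK hP h₀ h₁ l₀ (lifts_clear hδ' _ _ _ _ _ _ _)
  rintro rfl
  exact vanish_quintic₂ hδ hp (wt4_le t) hz (hw ▸ lifts_selfOdd _ _ _ _ _) hP h₀ h₁ l₀ l₁

lemma vanish_quintic_edge₂ {c' a' b' g g' s s'} (hx : x ≠ 0) (hP : ∃ c : Fin 2 → Fin 2 → ℂ, B 0 2 =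
    pole (-1) (c 0 0) x δ⁻¹ ∧ B 0 3 = pole (-1) (c 0 1) x δ⁻¹ ∧ B 1 2 = pole (-1) (c 1 0) x δ⁻¹ ∧ B
    1 3 = pole (-1) (c 1 1) x δ⁻¹) (hz : B 0 1 = selfOdd c a b) (h₀ : B 0 4 = edge t 1 f x δ) (h₁ :
    B 1 4 = edge t' 1 f' x δ) (hw : B 2 3 = selfOdd c' a' b') (k₀ : B 2 4 = edge s 1 g x δ⁻¹) (k₁ :
    B 3 4 = edge s' 1 g' x δ⁻¹) (h : t = t' ∨ a = xt t x ∧ b = xt t' x) (h' : s = s' ∨ a' = xt s x ∧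
    b' = xt s' x) : Vanish B (quintic x) := by
  have l₀ := lifts_edge_wt4 hδ hx t f; have l₁ := lifts_edge_wt4 hδ hx t' f'; rw [← h₀] at l₀
  rw [← h₁] at l₁
  have lK : LiftTo (const (-1) c) (0 : Fin 5) 1 1 (-1) := by simpa using lifts_const (-1) c 0 1
  have mK : (const (-1) c).Monic := by simp [const, Monic]
  have hm : ∀ i j, i < j → (B i j).Monic := by
    obtain ⟨_, b1, b2, b3, b4⟩ := hP
    refine forall_lt_five ?_ ?_ ?_ ?_ ?_ ?_ ?_ ?_ ?_ ?_ <;> simp [*, monic_edge, monic_pole] <;>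
      simp [selfOdd, Monic]
  have m := fun i B hB => monic_put (monic_put hm mK 0 1) (K := B) hB i 4
  refine Vanish.split_edge hx hδ (words_quintic x) hm (by decide)
    (by decide) mK (hz ▸ selfOdd_equiv _ _ _) h₀ h₁ h ?_
    (fun _ => vanish_quintic_right hδ hx (wt4_le t') lK hP (lifts_clear hδ _ _ _ _ _ _ _) l₁
      (m _ _ (monic_clear _ _ _ _ _)) hw k₀ k₁ h')
    fun _ => vanish_quintic_right hδ hx (wt4_le t) lK hP l₀ (lifts_clear hδ _ _ _ _ _ _ _)
      (m _ _ (monic_clear _ _ _ _ _)) hw k₀ k₁ h'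
  rintro rfl
  exact vanish_quintic_right hδ hx (wt4_le t) (hz ▸ lifts_selfOdd _ _ _ _ _) hP l₀ l₁ hm hw k₀ k₁ h'

end

end Bond

lemma cur_quintic (b) {z w y} (hmn : P.m * P.n = 2) (hz : z.1 = 0) (hw : w.1 = P.m) (hy : ¬
    IsOdd P y) (e : Fin 5 → ℤ) : ((Bond.quintic (xb P b)).map fun p => p.1 • (p.2.map fun k => cur Λ
    b (![z, z, w, w, y] k) (e k)).prod).sum = 0 := by
  have hx := xb_ne_zero (P := P) b; have hd := P.d_ne_zero; have zo : IsOdd P z := .inl hz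
  have wo : IsOdd P w := .inr hw
  refine cur_words_eq_zero Λ b _ (Bond.words_quintic (xb P b)) (fun ε _ => ?_) e
  set S := Bond.selfOdd (twist (root P z) (root P z) * P.d ^ dsc z) (lamb b z (ε 0)) (lamb b z (ε 1))
  set S' := Bond.selfOdd (twist (root P w) (root P w) * P.d ^ dsc w) (lamb b w (ε 2)) (lamb b w (ε 3))
  let M : Bond ℂ → Bond ℂ → (Fin 5 → Fin 5 → Bond ℂ) → (Fin 5 → Bond ℂ) → (Fin 5 → Bond ℂ) →
      Fin 5 → Fin 5 → Bond ℂ := fun z w F c c' => ![![z, z, F 0 2, F 0 3, c 0],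
    ![z, z, F 1 2, F 1 3, c 1], ![z, z, z, w, c' 2], ![z, z, z, z, c' 3], ![z, z, z, z, z]]
  have hS : ∀ {i : Idx P}, IsOdd P i → ∀ k l, IsBond b i (ε k) i (ε l)
      (.selfOdd (twist (root P i) (root P i) * P.d ^ dsc i) (lamb b i (ε k)) (lamb b i (ε l))) :=
    fun hi k l => ⟨by simp [Bond.selfOdd, Bond.Monic], rat_self_odd b hi _ _, rat_self_odd b hi _ _⟩
  have hs : psgn z w = -1 := by simp [psgn, par, zo, wo]
  have hs' : ∀ i, psgn i y = 1 := fun i => by rw [psgn_comm]; exact psgn_of_not_odd hy i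
  have hy' := hy; unfold IsOdd at hy'; have hyl := y.isLt; have hm := P.one_le_m
  have hn := P.one_le_n; obtain ⟨h1, h2⟩ | ⟨h1, h2⟩ : P.m = 2 ∧ P.n = 1 ∨ P.m = 1 ∧ P.n = 2 := by
    have : P.m ≤ 2 := Nat.le_of_dvd two_pos ⟨_, hmn.symm⟩
    obtain h | h : P.m = 1 ∨ P.m = 2 := by omega
    · rw [h] at hmn; omega
    · rw [h] at hmn; omega
  · obtain rfl : w = prev P z := Fin.ext (by rw [prev_val, if_pos hz]; omega)
    obtain rfl : y = next P z := Fin.ext (by rw [next_val, if_neg (by omega)]; omega)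
    have hwy : next P z = prev P (prev P z) := Fin.ext (by rw [prev_val, if_neg (by omega)]; omega)
    have c₁ := fun k l => bond_posEdge_prev b (i := z) (by omega) (ε k) (ε l)
    have c₂ := fun k l => bond_negEdge_next b (i := z) (by omega) (ε k) (ε l)
    have c₃ := fun k l => bond_negEdge_prev b (i := prev P z) (by rw [← hwy]; omega) (ε k) (ε l)
    rw [← hwy] at c₃; rw [hs] at c₁; rw [hs'] at c₂ c₃; choose f hf using c₁; choose c hc using c₂
    choose c' hc' using c₃
    refine ⟨M S S' (fun k l => .edge (!if b then ε k else ε l) (-1) (f k l) (xb P b) P.d)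
      (fun k => .pole 1 (c k 4) (xb P b) P.d⁻¹) fun k => .pole 1 (c' k 4) (xb P b) P.d,
      Bond.forall_lt_five (hS zo 0 1) (hf 0 2) (hf 0 3) (hc 0 4) (hf 1 2) (hf 1 3) (hc 1 4)
        (hS wo 2 3) (hc' 2 4) (hc' 3 4),
      Bond.vanish_quintic_edge₁ hx hd (a := fun k => lamb b z (ε (![0, 1] k)))
        (b := fun l => lamb b (prev P z) (ε (![2, 3] l)))
        (t := fun k l => !(if b then ε (![0, 1] k) else ε (![2, 3] l)))
        (f := fun k l => f (![0, 1] k) (![2, 3] l))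
        (c := fun k => c (![0, 1] k) 4) (c' := fun l => c' (![2, 3] l) 4) rfl rfl ⟨rfl, rfl, rfl, rfl⟩ ⟨rfl, rfl, rfl, rfl⟩
        fun k l => ?_⟩
    have e1 : dpart true z := by simp only [dpart, if_true]; omega
    have e2 : ¬ dpart true (prev P z) := by simp only [dpart, if_true, ← hwy]; omega
    have e3 : ¬ dpart false z := by simp only [dpart, false_eq_true, if_false]; omega
    have e4 : dpart false (prev P z) := by simp only [dpart, false_eq_true, if_false]; omega
    cases b
    · simp only [lamb, e3, e4, if_true, if_false, qe_eq_xt_false, false_eq_true]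
      cases ε (![2, 3] l) <;> simp [Bond.xt, hx]
    · simp only [lamb, e1, e2, if_true, if_false, qe_eq_xt_true, mul_one]
  · obtain rfl : w = next P z := Fin.ext (by rw [next_val, if_neg (by omega)]; omega)
    obtain rfl : y = prev P z := Fin.ext (by rw [prev_val, if_pos hz]; omega)
    have hwy : prev P z = next P (next P z) := Fin.ext (by rw [next_val, if_neg (by omega)]; omega)
    have c₁ := fun k l => bond_negEdge_next b (i := z) (by omega) (ε k) (ε l)
    have c₂ := fun k l => bond_posEdge_prev b (i := z) (by omega) (ε k) (ε l)
    have c₃ := fun k l => bond_posEdge_next b (i := next P z) (by omega) (ε k) (ε l)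
    rw [← hwy] at c₃; rw [hs] at c₁; rw [hs'] at c₂ c₃; choose f hf using c₁; choose c hc using c₂
    choose c' hc' using c₃; have e1 : dpart true z := by simp only [dpart, if_true]; omega
    have e4 : dpart false (next P z) := by simp only [dpart, false_eq_true, if_false]; omega
    refine ⟨M S S' (fun k l => .pole (-1) (f k l) (xb P b) P.d⁻¹)
      (fun k => .edge (!if b then ε k else ε 4) 1 (c k 4) (xb P b) P.d)
      (fun k => .edge (if b then ε 4 else ε k) 1 (c' k 4) (xb P b) P.d⁻¹),
      Bond.forall_lt_five (hS zo 0 1) (hf 0 2) (hf 0 3) (hc 0 4) (hf 1 2) (hf 1 3) (hc 1 4)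
        (hS wo 2 3) (hc' 2 4) (hc' 3 4), Bond.vanish_quintic_edge₂ hd hx
        ⟨fun k l => f (![0, 1] k) (![2, 3] l), rfl, rfl, rfl, rfl⟩ rfl rfl rfl rfl rfl rfl ?_ ?_⟩
    · cases b
      · exact .inl rfl
      · exact .inr ⟨by rw [lamb, if_pos e1]; exact qe_eq_xt_true _,
          by rw [lamb, if_pos e1]; exact qe_eq_xt_true _⟩
    · cases b
      · exact .inr ⟨by rw [lamb, if_pos e4]; exact qe_eq_xt_false _,
          by rw [lamb, if_pos e4]; exact qe_eq_xt_false _⟩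
      · exact .inl rfl

end

/-! ### The action of the generators -/

section Action

variable {P : Params}

variable (P) in
/-- Operators on the Fock space factor. -/
def onFock : Module.End ℂ (Fock P) →ₐ[ℂ] Module.End ℂ (Big P) :=
  AlgHom.ofLinearMap
    { toFun := fun T => Finsupp.mapRange.linearMap T
      map_add' := fun S T => lhom_ext fun α f => by simp
      map_smul' := fun c T => lhom_ext fun α f => by simp }
    (lhom_ext fun α f => by simp) fun S T => lhom_ext fun α f => by simp

lemma onFock_single (T α f) : onFock P T (Finsupp.single α f) = Finsupp.single α (T f) :=
  Finsupp.mapRange_single (hf := T.map_zero)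

lemma onFock_expCoeff (a s) : onFock P (expCoeff a s) = expCoeff (fun r => onFock P (a r)) s :=
  expCoeff_map (R' := Module.End ℂ (Big P)) (onFock P) a s

lemma onFock_apply (T w α) : onFock P T w α = T (w α) := rfl

variable (Λ : Weight P)

/-- The zero mode `q ^ (c ⟨α_i, ·⟩)`. -/
def kzero (c : ℤ) (i : Idx P) : Module.End ℂ (Big P) :=
  Finsupp.lsum ℂ fun α => exp (c * rootPair Λ i α * P.logq) • lsingle α

lemma kzero_single (c i α f) : kzero Λ c i (Finsupp.single α f) =
    Finsupp.single α (exp (c * rootPair Λ i α * P.logq) • f) := by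
  rw [kzero, lsum_single, LinearMap.smul_apply, lsingle_apply, smul_single]

lemma kzero_apply (c i w α) :
    kzero Λ c i w α = exp (c * rootPair Λ i α * P.logq) • w α := by
  induction w using Finsupp.induction_linear with
  | zero => simp
  | add f g hf hg => simp [hf, hg]
  | single β f => grind [kzero_single, smul_zero]

/-- The action of the generators. -/
def genAct : Gen P → Module.End ℂ (Big P)
  | .E i k => cur Λ true i (-k)
  | .F i k => cur Λ false i (-k)
  | .H i r => onFock P (mode P (.inl i) r)
  | .K i => kzero Λ 1 i
  | .Kinv i => kzero Λ (-1) i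
  | .C => P.q • 1
  | .Cinv => P.q⁻¹ • 1

/-- The action of the free algebra. -/
def frAct : Fr P →ₐ[ℂ] Module.End ℂ (Big P) := FreeAlgebra.lift ℂ (genAct Λ)

lemma frAct_ι (g) : frAct Λ (FreeAlgebra.ι ℂ g) = genAct Λ g := lift_ι_apply _ _

lemma frAct_sc (x) : frAct Λ (Fr.sc x) = algebraMap ℂ _ x := commutes _ _

lemma frAct_expCoeff (a s) : frAct Λ (expCoeff a s) = expCoeff (fun r => frAct Λ (a r)) s :=
  expCoeff_map (R' := Module.End ℂ (Big P)) (frAct Λ) a s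

lemma frAct_E (i k) : frAct Λ (Fr.E i k) = cur Λ true i (-k) := frAct_ι Λ _

lemma frAct_F (i k) : frAct Λ (Fr.F i k) = cur Λ false i (-k) := frAct_ι Λ _

lemma frAct_X (b i k) : frAct Λ (Fr.X b i k).1 = cur Λ b i (-k) := by
  cases b
  · exact frAct_F Λ i k
  · exact frAct_E Λ i k

lemma frAct_Cpow (k) : frAct Λ (Fr.Cpow k) = P.q ^ k • 1 := by
  have h1 : frAct Λ Fr.C = P.q • 1 := frAct_ι Λ _
  have h2 : frAct Λ Fr.Cinv = P.q⁻¹ • 1 := frAct_ι Λ _; unfold Fr.Cpow; split_ifs with h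
  · lift k to ℕ using h; simp [h1, smul_pow]
  · obtain ⟨n, rfl⟩ : ∃ n : ℕ, k = -n := ⟨(-k).toNat, by omega⟩; simp [h2, smul_pow]

lemma N1_kplus (i e) : (klet Λ true i).osc.N1 e = if e ≤ 0 then expCoeff (fun r =>
    (P.q - P.q⁻¹) • ann P (.inl i) r.toPNat') (-e).toNat else 0 := by
  have h0 : (klet Λ true i).osc.creLin = fun _ => 0 := by funext r; simp [Osc.creLin, klet]
  have hE : ∀ s, (klet Λ true i).osc.E s = if s = 0 then 1 else 0 := by
    intro s; rcases lt_or_ge s 0 with hs | hs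
    · grind [Osc.E_of_neg]
    · lift s to ℕ using hs; rw [Osc.E_natCast, h0]
      have := congrArg (coeff s) (expSeries_zero (S := Osc.Sp (Boson P)))
      rw [coeff_expSeries, coeff_one] at this; simpa using this
  refine LinearMap.ext fun f => ?_
  rw [Osc.N1_eq_sum _ _ _ (B := max ((klet Λ true i).osc.T f).natDegree (-e).toNat + 1) (by omega)]
  simp only [hE, ite_mul, one_mul, zero_mul]; split_ifs with he
  · rw [Finset.sum_eq_single_of_mem (-e).toNat (by simp) fun r _ hr => if_neg (by omega),
      if_pos (by omega), Osc.Tc_eq_expCoeff]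
    congr 2; funext r; simp [Osc.annLin, klet, ann, smul_sum, smul_smul]
  · exact sum_eq_zero fun r _ => if_neg (by omega)

lemma N1_kminus (i e) : (klet Λ false i).osc.N1 e = if 0 ≤ e then expCoeff (fun r : ℕ
    => (-(P.q - P.q⁻¹)) • cre P (.inl i) r.toPNat') e.toNat else 0 := by
  have hE : (klet Λ false i).osc.N1 e = mulLeft ℂ ((klet Λ false i).osc.E e) := by
    refine LinearMap.ext fun f => ?_
    induction f using induction_on generalizing e with
    | C c => rw [Osc.N1_C, mulLeft_apply, mul_comm, smul_eq_C_mul]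
    | add f g hf hg => rw [map_add, map_add, hf, hg]
    | mul_X f v hf =>
      rw [Osc.N1_mul_X, hf, mulLeft_apply, mulLeft_apply, mul_assoc]
      simp [klet]
  rw [hE]; split_ifs with he
  · lift e to ℕ using he; rw [Osc.E_natCast]
    have := expCoeff_map (lmul ℂ (Osc.Sp (Boson P))) (klet Λ false i).osc.creLin e
    rw [Int.toNat_natCast]
    refine this.trans (congrArg (fun a => expCoeff a e) (funext fun r => ?_))
    refine LinearMap.ext fun f => ?_; simp [Osc.creLin, klet, cre]
  · rw [Osc.E_of_neg _ (not_le.1 he), LinearMap.mulLeft_zero_eq_zero]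

lemma frAct_H_pos (i) (r : ℕ+) : frAct Λ (Fr.H i r) = onFock P (ann P (.inl i) r) := by
  rw [Fr.H, dif_pos (by exact_mod_cast r.ne_zero), frAct_ι, genAct, mode, if_neg (by simp)]; rfl

lemma frAct_H_neg (i) (r : ℕ+) : frAct Λ (Fr.H i (-r)) = onFock P (cre P (.inl i) r) := by
  rw [Fr.H, dif_pos (by simp), frAct_ι, genAct, mode, if_pos (by simp)]; congr 2
  exact eq (by simp)

lemma kcur_eq_kzero_mul (b i e) :
    kcur Λ b i e = kzero Λ (sg b) i * onFock P ((klet Λ b i).osc.N1 e) := by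
  refine lhom_ext fun α f => ?_
  simp [kcur, Letter.op_single, onFock_single, kzero_single, klet]

lemma frAct_Kplus (i s) : frAct Λ (Fr.Kplus i s) = kcur Λ true i (-s) := by
  rw [kcur_eq_kzero_mul, N1_kplus, Fr.Kplus]; by_cases hs : 0 ≤ s
  · rw [if_pos hs, if_pos (by omega), map_mul, frAct_expCoeff, onFock_expCoeff, neg_neg]
    refine congrArg₂ _ (frAct_ι Λ _) (expCoeff_congr (fun r hr => ?_) _)
    rw [map_smul, map_smul, ← frAct_H_pos, toPNat'_of_pos hr]
  · simp [if_neg hs]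

lemma frAct_Kminus (i s) : frAct Λ (Fr.Kminus i s) = kcur Λ false i (-s) := by
  rw [kcur_eq_kzero_mul, N1_kminus, Fr.Kminus]; by_cases hs : s ≤ 0
  · rw [if_pos hs, if_pos (by omega), map_mul, frAct_expCoeff, onFock_expCoeff]
    refine congrArg₂ _ (frAct_ι Λ _) (expCoeff_congr (fun r hr => ?_) _)
    rw [map_smul, map_smul, ← frAct_H_neg, toPNat'_of_pos hr]
  · simp [if_neg hs]

end Action

/-! ### The relations -/

section Expansion

variable {R : Type*} [Ring R] [Algebra ℂ R] {q : ℂ} (hq : q ≠ 0)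

include hq

lemma serre_cubic {a b y : R} (h : a * (b * y) + b * (a * y) - (q + q⁻¹) • (a * (y * b) + b * (y *
    a)) + (y * (a * b) + y * (b * a)) = 0) : (a * (b * y - q • (y * b)) - q⁻¹ • ((b * y - q • (y *
    b)) * a)) + (b * (a * y - q • (y * a)) - q⁻¹ • ((a * y - q • (y * a)) * b)) = 0 := by
  rw [← h]; simp [mul_sub, sub_mul, mul_assoc, smul_sub, smul_smul, inv_mul_cancel₀ hq]; module

lemma serre_quartic {a b u v} (hab : a * b = -(b * a)) (huv : u * v = v * u) {s r} (hs : s = 1 ∨ s =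
    -1) (hr : r = 1 ∨ r = -1) : let f := fun a b : R =>
      let m := u * (b * v - (r * q) • (v * b)) - (s * q⁻¹) • ((b * v - (r * q) • (v * b)) * u)
      a * m - (-(s * r)) • (m * a)
    f a b + f b a = (a * (u * (b * v)) + b * (u * (a * v))) + (s * r) • (a * (v * (b * u)) + b * (v
      * (a * u))) + (s * r) • (u * (b * (v * a)) + u * (a * (v * b))) + (v * (b * (u * a)) + v * (a
        * (u * b))) - (r * (q + q⁻¹)) • (a * (u * (v * b)) + b * (u * (v * a))) := by
  have h1 : a * (b * (v * u)) = -(b * (a * (v * u))) := by rw [← mul_assoc, hab]; noncomm_ring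
  have h2 : v * (u * (a * b)) = -(v * (u * (b * a))) := by rw [hab]; noncomm_ring
  have h3 : ∀ t, u * (v * t) = v * (u * t) := fun t => by rw [← mul_assoc, huv, mul_assoc]
  simp [mul_sub, sub_mul, mul_assoc, h1, h2, h3]
  rcases hs with rfl | rfl <;> rcases hr with rfl | rfl <;> match_scalars <;> field_simp <;> ring

def nested (q : ℂ) (a u b v y : R) : R :=
  let B := v * y - q • (y * v)
  let D := u * (b * B - (-1 : ℂ) • (B * b)) - (1 : ℂ) • ((b * B - (-1 : ℂ) • (B * b)) * u)
  a * D - (-q⁻¹) • (D * a)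

lemma serre_quintic {x} (hx : x ≠ 0) (hxq : 1 + x ^ 2 = x * (q + q⁻¹)) {z z' w w' y : R} (hz : z' *
    z = -(z * z')) (hw : w' * w = -(w * w')) (h : ((Bond.quintic x).map fun p => p.1 • (p.2.map ![z,
    z', w, w', y]).prod).sum = 0) : nested q z w z' w' y + nested q z' w z w' y + nested q z w' z' w
    y + nested q z' w' z w y = nested q w z w' z' y + nested q w z' w' z y + nested q w' z w z' y +
    nested q w' z' w z y := by
  have h1 : ∀ t, z' * (z * t) = -(z * (z' * t)) := fun t => by rw [← mul_assoc, hz]; noncomm_ring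
  have h2 : ∀ t, w' * (w * t) = -(w * (w' * t)) := fun t => by rw [← mul_assoc, hw]; noncomm_ring
  simp only [Bond.quintic, Bond.quinticPart, List.map_append, map_cons, map_nil,
    List.sum_append, sum_cons, sum_nil, prod_cons, prod_nil, mul_one,
    cons_val, hxq] at h
  simp only [nested, mul_sub, sub_mul, mul_smul_comm, smul_mul_assoc, mul_assoc, smul_sub, smul_smul,
    h1, h2, hz, hw, mul_neg, smul_neg, neg_mul]
  linear_combination (norm := skip) x⁻¹ • h; match_scalars <;> field_simp <;> ring

end Expansion

lemma kzero_mul (c c' i j α f) : (kzero Λ c i * kzero Λ c' j) (Finsupp.single α f) = Finsupp.single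
    α (exp (c * rootPair Λ i α * P.logq + c' * rootPair Λ j α * P.logq) • f) := by simp [kzero_single, smul_smul, exp_add]

lemma kzero_mul_inv (i c) : kzero Λ c i * kzero Λ (-c) i = 1 := by
  refine lhom_ext fun α f => ?_
  grind [kzero_mul, rootPair, exp_zero, one_smul, Module.End.one_apply]

lemma kzero_cur (b i j e) :
    kzero Λ 1 i * cur Λ b j e = P.q ^ (sg b * A P i j) • (cur Λ b j e * kzero Λ 1 i) := by
  rw [cur, lsum, mul_sum, sum_mul, smul_sum]
  refine sum_congr rfl fun ε _ => ?_; rw [mul_smul_comm, smul_mul_assoc, smul_comm]; congr 1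
  refine lhom_ext fun α f => ?_; have h := (compat_llet Λ id).σ (.K true i) (.V b j ε) α
  simp only [id, llet, klet, lt] at h
  rw [Module.End.mul_apply, LinearMap.smul_apply, Module.End.mul_apply, Letter.op_single,
    kzero_single, kzero_single, Letter.op_single, map_smul, smul_single, smul_smul,
    smul_smul, smul_smul]
  simp only [llet, sg, if_true, cast_one, one_mul] at h ⊢; rw [h]; ring

lemma frAct_lin {x y c c'} (hx : frAct Λ x = algebraMap ℂ _ c)
    (hy : frAct Λ y = algebraMap ℂ _ c') (f a b) :
    frAct Λ (Fr.lin x y f a b) = c • frAct Λ (f (a + 1) b) - c' • frAct Λ (f a (b + 1)) := by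
  simp [Fr.lin, hx, hy, ← smul_def]

lemma frAct_lin_sc (x y f a b) : frAct Λ (Fr.lin (Fr.sc x) (Fr.sc y) f a b) = x • frAct Λ (f (a + 1)
    b) - y • frAct Λ (f a (b + 1)) :=
  frAct_lin Λ (frAct_sc Λ x) (frAct_sc Λ y) f a b

lemma frAct_br (a X Y) : frAct Λ (Fr.br a X Y).1 =
    frAct Λ X.1 * frAct Λ Y.1 - ((-1) ^ (X.2 * Y.2) * a) • (frAct Λ Y.1 * frAct Λ X.1) := by simp [Fr.br]

lemma sc_one : (1 : Fr P) = Fr.sc 1 := (map_one _).symm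

lemma frAct_Cpow_mul (k x) : frAct Λ (Fr.Cpow k * x) = P.q ^ k • frAct Λ x := by
  rw [map_mul, frAct_Cpow, smul_mul_assoc, one_mul]

lemma xb_zpow (b k) : xb P b ^ (-k) = P.q ^ (sg b * k) := by simp [xb, sg]

lemma frAct_quadratic (b i j k l) (h : A P i j ≠ 0) : P.d ^ M P i j • (cur Λ b i (-(k + 1)) * cur Λ
    b j (-l)) - P.q ^ (sg b * A P i j) • (cur Λ b i (-k) * cur Λ b j (-(l + 1))) = (-1 : ℂ) ^ (par P
    i * par P j) • ((P.d ^ M P i j * P.q ^ (sg b * A P i j)) • (cur Λ b j (-l) * cur Λ b i (-(k +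
    1))) - (1 : ℂ) • (cur Λ b j (-(l + 1)) * cur Λ b i (-k))) := by
  have := cur_quadratic Λ b h (-k) (-l); rw [xb_zpow] at this; rw [neg_add', neg_add']; exact this

lemma par_of_not_odd {i} (h : ¬ IsOdd P i) : par P i = 0 := if_neg h

lemma par_of_odd {i} (h : IsOdd P i) : par P i = 1 := if_pos h

lemma br_snd (a) (X Y : Fr P × ℕ) : (Fr.br a X Y).2 = X.2 + Y.2 := rfl

lemma X_snd (e i k) : (Fr.X e i k).2 = par P i := rfl

lemma frAct_serre3 (e) {i j} (hi : ¬ IsOdd P i) (hj : j = next P i ∨ j = prev P i)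
    (k₁ k₂ l) : frAct Λ (Fr.serre3 e i j k₁ k₂ l + Fr.serre3 e i j k₂ k₁ l) = 0 := by
  simp only [map_add, Fr.serre3, frAct_br, frAct_X, X_snd, par_of_not_odd hi, zero_mul, pow_zero, one_mul]
  exact serre_cubic (R := Module.End ℂ (Big P)) P.q_ne_zero (cur_cubic Λ e hi hj _ _ _)

lemma cur_anti (e) {i} (hi : IsOdd P i) (k l) :
    cur Λ e i l * cur Λ e i k = -(cur Λ e i k * cur Λ e i l) :=
  (cur_comm Λ e (A_odd hi) l k).trans (by rw [psgn_odd_self hi]; exact neg_one_smul (M := Module.End ℂ (Big P)) ℂ _)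

lemma frAct_serre4 (e) {i} (hi : IsOdd P i) (hmn : P.m * P.n ≠ 2) (k₁ k₂ l₁ l₂) :
    frAct Λ (Fr.serre4 e i k₁ k₂ l₁ l₂ + Fr.serre4 e i k₂ k₁ l₁ l₂) = 0 := by
  have hm := P.one_le_m; have hn := P.one_le_n; have hne := P.m_ne_n; have h4 : 4 ≤ P.m + P.n := by
    by_contra h
    rcases (show P.m = 1 ∧ P.n = 2 ∨ P.m = 2 ∧ P.n = 1 by omega) with ⟨h1, h2⟩ | ⟨h1, h2⟩ <;> grind
  have n1 := next_cases i; have n2 := prev_cases i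
  have hp : ¬ IsOdd P (next P i) ∨ ¬ IsOdd P (prev P i) := by grind [IsOdd]
  have hA : A P (next P i) (prev P i) = 0 := by
    refine A_far (next_ne_prev i) (fun h => ?_) (by rw [next_prev]; exact next_ne i)
    grind [next_cases]
  have huv := cur_comm Λ e hA (-l₁) (-l₂); rw [show psgn (next P i) (prev P i) = 1 by
    rcases hp with hp | hp
    · grind [psgn_of_not_odd]
    · rw [psgn_comm]; exact psgn_of_not_odd hp _, one_smul] at huv
  have s1 : psgn i (next P i) = (-1) ^ par P (next P i) := by rw [psgn, par_of_odd hi, one_mul]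
  have s2 : psgn i (prev P i) = (-1) ^ par P (prev P i) := by rw [psgn, par_of_odd hi, one_mul]
  have e1 : (-1) ^ (par P (next P i) * (1 + par P (prev P i))) = psgn i (next P i) := by
    rw [s1]; rcases hp with hp | hp <;> simp [par_of_not_odd hp]
  have e2 : (-1) ^ (par P (next P i) + (1 + par P (prev P i))) = -(psgn i (next P i) * psgn i (prev
    P i)) := by rw [s1, s2]; ring
  simp only [map_add, Fr.serre4, frAct_br, frAct_X, X_snd, br_snd, par_of_odd hi, one_mul, e1, e2,
    ← s2, mul_one]
  refine Eq.trans (serre_quartic (R := Module.End ℂ (Big P)) P.q_ne_zero (cur_anti Λ e hi (-k₂)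
    (-k₁)) huv (psgn_eq_one_or i (next P i)) (psgn_eq_one_or i (prev P i))) ?_
  rcases hi with h | h
  · have c := cur_quartic Λ e (.inl h) hmn (.inr ⟨h, rfl, rfl⟩) (-k₁) (-k₂) (-l₂) (-l₁)
    have h3 : ∀ t, cur Λ e (next P i) (-l₁) * (cur Λ e (prev P i) (-l₂) * t) = cur Λ e (prev P i)
      (-l₂) * (cur Λ e (next P i) (-l₁) * t) := fun t => by rw [← mul_assoc, huv, mul_assoc]
    rw [h3, h3]
    refine Eq.trans ?_ ((congrArg ((psgn i (next P i) * psgn i (prev P i)) • ·) c).trans (smul_zero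
      _))
    rcases psgn_eq_one_or i (next P i) with h | h <;> rcases psgn_eq_one_or i (prev P i) with h' |
      h' <;> simp only [h, h'] <;> module
  · exact cur_quartic Λ e (.inr h) hmn (.inl ⟨h, rfl, rfl⟩) (-k₁) (-k₂) (-l₁) (-l₂)

lemma frAct_serre5_eq (e) {z o c} (hz : IsOdd P z) (ho : IsOdd P o) (hc : ¬ IsOdd P c) (k₁ k₂ l₁ l₂
    y) : frAct Λ (Fr.serre5 e z o c k₁ k₂ l₁ l₂ y) = nested (R := Module.End ℂ (Big P)) P.q (cur Λ e
    z (-k₁)) (cur Λ e o (-l₁)) (cur Λ e z (-k₂)) (cur Λ e o (-l₂)) (cur Λ e c (-y)) := by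
  simp only [Fr.serre5, frAct_br, frAct_X, X_snd, br_snd, par_of_odd hz, par_of_odd ho,
    par_of_not_odd hc, one_mul, mul_one, add_zero, mul_zero, pow_zero, pow_one, Nat.reduceAdd]
  rw [show (-1 : ℂ) ^ 2 = 1 by simp, show (-1 : ℂ) ^ 3 = -1 by norm_num, neg_one_mul]; rfl

lemma frAct_serre5 (e) {z o c} (hmn : P.m * P.n = 2) (hz : z.1 = 0) (ho : o.1 = P.m) (hc : ¬
    IsOdd P c) (k₁ k₂ l₁ l₂ y) : frAct Λ (Fr.serre5 e z o c k₁ k₂ l₁ l₂ y + Fr.serre5 e z o c k₂ k₁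
    l₁ l₂ y + Fr.serre5 e z o c k₁ k₂ l₂ l₁ y + Fr.serre5 e z o c k₂ k₁ l₂ l₁ y) = frAct Λ
    (Fr.serre5 e o z c l₁ l₂ k₁ k₂ y + Fr.serre5 e o z c l₁ l₂ k₂ k₁ y + Fr.serre5 e o z c l₂ l₁ k₁
    k₂ y + Fr.serre5 e o z c l₂ l₁ k₂ k₁ y) := by
  have zo : IsOdd P z := .inl hz; have oo : IsOdd P o := .inr ho
  have key := serre_quintic (R := Module.End ℂ (Big P)) P.q_ne_zero (xb_ne_zero (P := P) e) (xb_add e)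
    (cur_anti Λ e zo (-k₁) (-k₂)) (cur_anti Λ e oo (-l₁) (-l₂)) (y := cur Λ e c (-y)) (by
      rw [show ![cur Λ e z (-k₁), cur Λ e z (-k₂), cur Λ e o (-l₁), cur Λ e o (-l₂), cur Λ e c (-y)] =
        fun k => cur Λ e (![z, z, o, o, c] k) (![-k₁, -k₂, -l₁, -l₂, -y] k) by
          funext k; fin_cases k <;> rfl]
      exact cur_quintic Λ e hmn hz ho hc _)
  simpa only [map_add, frAct_serre5_eq Λ e zo oo hc, frAct_serre5_eq Λ e oo zo hc] using key

lemma frAct_rel {x y} (h : Rel P x y) : frAct Λ x = frAct Λ y := by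
  have hq := P.q_ne_zero; have hC : frAct Λ Fr.C = P.q • 1 := frAct_ι Λ _
  have hCi : frAct Λ Fr.Cinv = P.q⁻¹ • 1 := frAct_ι Λ _
  have hK : ∀ i, frAct Λ (Fr.K i) = kzero Λ 1 i := fun i => frAct_ι Λ _
  have hKi : ∀ i, frAct Λ (Fr.Kinv i) = kzero Λ (-1) i := fun i => frAct_ι Λ _
  have hs : ∀ {y : Fr P} {c : ℂ} x, frAct Λ y = c • 1 →
      frAct Λ (Fr.sc x * y) = algebraMap ℂ _ (x * c) := fun x hy => by
    rw [map_mul, frAct_sc, hy, mul_smul_comm, mul_one, mul_comm, ← smul_eq_mul, Algebra.algebraMap_eq_smul_one,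
      Algebra.algebraMap_eq_smul_one, smul_assoc]
  have h1 : frAct Λ 1 = algebraMap ℂ _ 1 := by rw [map_one, map_one]
  induction h with
  | C_Cinv => rw [map_mul, hC, hCi, smul_mul_smul_comm, mul_inv_cancel₀ hq, one_smul, one_mul, map_one]
  | Cinv_C => rw [map_mul, hC, hCi, smul_mul_smul_comm, inv_mul_cancel₀ hq, one_smul, one_mul, map_one]
  | K_Kinv i => rw [map_mul, hK, hKi, map_one]; exact kzero_mul_inv Λ i 1
  | Kinv_K i => rw [map_mul, hK, hKi, map_one]; exact kzero_mul_inv Λ i (-1)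
  | C_central g => rw [map_mul, map_mul, hC, smul_mul_assoc, one_mul, mul_smul_comm, mul_one]
  | K_comm i j =>
    rw [map_mul, map_mul, hK, hK]; refine lhom_ext fun α f => ?_
    rw [kzero_mul, kzero_mul, add_comm]
  | K_E i j k =>
    rw [map_mul, map_mul, hK, hKi, frAct_E, kzero_cur, smul_mul_assoc, mul_assoc, kzero_mul_inv Λ i 1,
      mul_one, map_smul, frAct_E, sg, if_pos rfl, one_mul]
  | K_F i j k =>
    rw [map_mul, map_mul, hK, hKi, frAct_F, kzero_cur, smul_mul_assoc, mul_assoc, kzero_mul_inv Λ i 1,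
      mul_one, map_smul, frAct_F, sg, if_neg (by simp), neg_one_mul]
  | KK_plus i j a b => simp only [map_mul, frAct_Kplus]; exact kcur_comm Λ true i j _ _
  | KK_minus i j a b => simp only [map_mul, frAct_Kminus]; exact kcur_comm Λ false i j _ _
  | KK_mixed i j a b =>
    have := kcur_mixed Λ i j (-a) (-b)
    rw [frAct_lin Λ (hs _ hCi) (frAct_sc Λ _), frAct_lin Λ (hs _ hCi) h1]
    simp only [frAct_lin Λ (hs _ hC) h1, frAct_lin Λ (hs _ hC) (frAct_sc Λ _), map_mul, frAct_Kplus,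
      frAct_Kminus, neg_add', one_smul]
    exact this
  | Kplus_E i j a b =>
    have := congrArg (fun x => P.q ^ a • x) (kplus_cur Λ true i j (-a) (-b))
    simp only [hk, if_true, sg, one_mul, inv_inv] at this; rw [sc_one, frAct_lin_sc, frAct_lin_sc]
    simp only [mul_assoc (Fr.Cpow _), map_mul, frAct_Cpow, frAct_Kplus, frAct_E,
      smul_mul_assoc, mul_smul_comm, one_mul, zpow_add_one₀ hq, neg_add']
    exact Eq.trans (by module) (this.trans (by module))
  | Kminus_E i j a b =>
    have := kminus_cur Λ true i j (-a) (-b)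
    simp only [hk, if_true, false_eq_true, if_false, sg, one_mul, mul_one] at this
    rw [sc_one, frAct_lin_sc, frAct_lin_sc]; simp only [map_mul, frAct_Kminus, frAct_E, neg_add']
    exact Eq.trans (by module) (this.trans (by module))
  | Kplus_F i j a b =>
    have := kplus_cur Λ false i j (-a) (-b)
    simp only [hk, if_true, false_eq_true, if_false, sg, neg_one_mul, inv_one, mul_one] at this
    rw [sc_one, frAct_lin_sc, frAct_lin_sc]; simp only [map_mul, frAct_Kplus, frAct_F, neg_add']
    exact Eq.trans (by module) (this.trans (by module))
  | Kminus_F i j a b =>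
    have := congrArg (fun x => P.q ^ a • x) (kminus_cur Λ false i j (-a) (-b))
    simp only [hk, if_false, sg, neg_one_mul, false_eq_true] at this
    rw [sc_one, frAct_lin_sc, frAct_lin_sc]
    simp only [mul_assoc (Fr.Cpow _), map_mul, frAct_Cpow, frAct_Kminus, frAct_F,
      smul_mul_assoc, mul_smul_comm, one_mul, zpow_add_one₀ hq, neg_add']
    exact Eq.trans (by module) (this.trans (by module))
  | EF i j k l =>
    rw [frAct_br, frAct_X, frAct_X, mul_one]; split_ifs with hij
    · subst hij; rw [map_smul, map_sub, frAct_Cpow_mul, frAct_Cpow_mul, frAct_Kplus, frAct_Kminus]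
      have := cur_EF_self Λ i (-k) (-l); rw [neg_neg, neg_neg, ← neg_add] at this; exact this
    · rw [map_zero]; exact sub_eq_zero_of_eq (cur_EF_ne Λ hij _ _)
  | XX_zero e i j k l h =>
    rw [frAct_br, frAct_X, frAct_X, mul_one, map_zero]; exact sub_eq_zero_of_eq (cur_comm Λ e h _ _)
  | EE i j a b h =>
    rw [map_smul, sc_one, frAct_lin_sc, frAct_lin_sc]; simp only [map_mul, frAct_E]
    have := frAct_quadratic Λ true i j a b h; rwa [sg, if_pos rfl, one_mul] at this
  | FF i j a b h =>
    rw [map_smul, sc_one, frAct_lin_sc, frAct_lin_sc]; simp only [map_mul, frAct_F]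
    have := frAct_quadratic Λ false i j a b h; rwa [sg, if_neg (by simp), neg_one_mul] at this
  | serre_next e i k₁ k₂ l h => exact (frAct_serre3 Λ e h (.inl rfl) k₁ k₂ l).trans (map_zero _).symm
  | serre_prev e i k₁ k₂ l h => exact (frAct_serre3 Λ e h (.inr rfl) k₁ k₂ l).trans (map_zero _).symm
  | serre_odd e i k₁ k₂ l₁ l₂ h hmn =>
    exact (frAct_serre4 Λ e h hmn k₁ k₂ l₁ l₂).trans (map_zero _).symm
  | serre_small e z o c k₁ k₂ l₁ l₂ y hmn hz ho hc =>
    exact frAct_serre5 Λ e hmn hz ho hc k₁ k₂ l₁ l₂ y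

/-! ### The energy of the lattice vectors -/

def rext (y : RootIdx P → ℤ) (k : ℕ) : ℤ :=
  if h : k ≠ 0 ∧ k < P.m + P.n then y ⟨⟨k, h.2⟩, h.1⟩ else 0

/-- The coordinates in the basis of the `ε_k`. -/
def yv (y : RootIdx P → ℤ) (k : Idx P) : ℤ := rext y (k.1 + 1) - rext y k.1

lemma rext_root (y) (l : RootIdx P) : rext y l.1.1 = y l := dif_pos ⟨l.2, l.1.isLt⟩

lemma rext_next (y : RootIdx P → ℤ) (i) : rext y (next P i).1 = rext y (i.1 + 1) := by
  rcases next_cases i with ⟨h, h'⟩ | ⟨h, h'⟩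
  · rw [h', h, rext, rext, dif_neg (by omega), dif_neg (by omega)]
  · rw [h']

lemma rext_add_zsmul (y z : RootIdx P → ℤ) (c k) :
    rext (y + c • z) k = rext y k + c * rext z k := by
  unfold rext; split_ifs <;> simp

lemma yv_add_zsmul (y z c) (k : Idx P) : yv (y + c • z) k = yv y k + c * yv z k := by
  simp only [yv, rext_add_zsmul]; ring

lemma rext_simple (i k) : rext (root P i) k.1 =
    (if k = i then 1 else 0) - if i.1 = 0 then 1 else 0 := by
  unfold rext root; grind

lemma yv_root (i k) : yv (root P i) k = -kvec i k := by
  rw [yv, ← rext_next, rext_simple, rext_simple, kvec]; ring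

lemma form_root_eq (i y) : form P (root P i) y =
    edge P (next P i) * yv y i - edge P i * yv y (prev P i) := by
  have h := sum_rootIdx (fun l => A P i l * rext y l.1); simp [rext_root] at h
  rw [form_root_left, h, sum_nbr i, A_next, A_prev, A_self, yv, yv, ← rext_next, ← rext_next,
    next_prev, show rext y (zeroIdx).1 = 0 from dif_neg (by simp [zeroIdx])]
  · ring
  · grind [A_far, eq_next_iff.1]

lemma simple_mem_Qtilde (i) : ((root P i, fun j => kvec i j.1) : QLat P) ∈ Qtilde P := by
  have h1 : ∀ l : RootIdx P, ((root P l.1, fun j => kvec l.1 j.1) : QLat P) ∈ Qtilde P := by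
    refine fun l => AddSubgroup.subset_closure ⟨l, Prod.ext rfl (funext fun j => ?_)⟩
    have := next_cases j.1; have := l.2; have := l.1.isLt; simp only [kvec, ext_iff]; grind
  by_cases hi : i.1 = 0
  · have h2 : ((root P i, fun j => kvec i j.1) : QLat P) =
        -∑ l : RootIdx P, (root P l.1, fun j => kvec l.1 j.1) := by
      refine Prod.ext (funext fun l => ?_) (funext fun j => ?_)
      · have h3 : ∀ k, (l.1 = k.1) ↔ l = k := fun k => Subtype.ext_iff.symm
        simp [root, hi, Prod.fst_sum, Finset.sum_apply, fun k : RootIdx P => k.2, h3]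
      · have h3 := sum_rootIdx (fun l => kvec l j.1)
        have h4 : ∑ l, kvec l j.1 = 0 := by simp [kvec]
        have h5 : i = zeroIdx := Fin.ext hi
        simp only [snd_neg, Prod.snd_sum, Pi.neg_apply, Finset.sum_apply]
        rw [h3, h4, h5]; ring
    rw [h2]; exact neg_mem (sum_mem fun l _ => h1 l)
  · exact h1 ⟨i, hi⟩

lemma Qtilde_snd {α} (h : α ∈ Qtilde P) (j) : α.2 j = -yv α.1 j.1 := by
  have h0 : yv 0 j.1 = 0 := by simp [yv, rext]
  induction h using AddSubgroup.closure_induction with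
  | mem x hx =>
    obtain ⟨i, rfl⟩ := hx; have := next_cases j.1; have := i.2; have := i.1.isLt
    simp only [yv_root, kvec, neg_neg, ext_iff]; grind
  | zero => simp [h0]
  | add x y _ _ hx hy =>
    have := yv_add_zsmul x.1 y.1 1 j.1; rw [one_smul] at this
    simp only [snd_add, Pi.add_apply, fst_add, hx, hy, this]; ring
  | neg x _ hx =>
    have := yv_add_zsmul 0 x.1 (-1) j.1; rw [neg_one_smul, zero_add, h0] at this
    simp only [snd_neg, Pi.neg_apply, Prod.fst_neg, hx, this]; ring

lemma pairing_eq {α} (h : α ∈ Qtilde P) (i) : form P (root P i) α.1 + ∑ j, kvec i j.1 * α.2 j = (if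
    (prev P i).1 < P.m then yv α.1 (prev P i) else 0) - if i.1 < P.m then yv α.1 i else 0 := by
  have h1 : ∀ k, edge P (next P k) = if k.1 < P.m then -1 else 1 := by
    intro k; have := next_cases k; have := P.one_le_n; unfold edge; grind
  have h2 := h1 (prev P i); rw [next_prev] at h2; rw [form_root_eq, h1, h2, sum_charged i]
  · simp [kvec_self, kvec_prev, Qtilde_snd h]; grind
  · grind [kvec_eq_zero, zero_mul]

def energy (Λ : Weight P) (y : RootIdx P → ℤ) : ℤ :=
  (∑ k : Idx P, if k.1 < P.m then yv y k * (yv y k + 1) / 2 else 0) +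
    ∑ l : RootIdx P, y l * lint Λ l.1

lemma sum_lint (Λ) : ∑ i : Idx P, lint Λ i = 0 := by
  cases Λ with
  | line a => simp [lint]
  | fund i₀ h =>
    have h1 : ∀ i : Idx P, i.1 = 0 ↔ i = zeroIdx := fun i => by rw [ext_iff]; rfl
    simp [lint, h1]

lemma tri_sub (y : ℤ) : (y - 1) * (y - 1 + 1) / 2 = y * (y + 1) / 2 - y := by grind

lemma tri_add (y : ℤ) : (y + 1) * (y + 1 + 1) / 2 = y * (y + 1) / 2 + (y + 1) := by grind

lemma vlet_ex_eq (Λ b i ε) {α} (h : α ∈ Qtilde P) :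
    (vlet Λ b i ε).ex α = energy Λ (α + (vlet Λ b i ε).β).1 - energy Λ α.1 := by
  have h1 : (α + (vlet Λ b i ε).β).1 = α.1 + sg b • root P i := rfl
  have h2 : ∑ l, (α.1 + sg b • root P i) l * lint Λ l.1 =
      ∑ l, α.1 l * lint Λ l.1 + sg b * lint Λ i := by
    have := sum_root_mul i (lint Λ) (sum_lint Λ); simp only [cast_id] at this
    rw [← this, mul_sum, ← sum_add_distrib]
    exact sum_congr rfl fun l _ => by simp; ring
  have h3 : ∀ k, yv (α.1 + sg b • root P i) k = yv α.1 k - sg b * kvec i k := by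
    intro k; rw [yv_add_zsmul, yv_root]; ring
  rw [h1, energy, energy, h2]; simp only [h3]
  have h4 : (∑ k, if k.1 < P.m then (yv α.1 k - sg b * kvec i k) *
        (yv α.1 k - sg b * kvec i k + 1) / 2 else 0) -
      (∑ k, if k.1 < P.m then yv α.1 k * (yv α.1 k + 1) / 2 else 0) =
      (if i.1 < P.m then (if b then -yv α.1 i else yv α.1 i + 1) else 0) +
      if (prev P i).1 < P.m then (if b then yv α.1 (prev P i) + 1 else -yv α.1 (prev P i)) else 0 := by
    rw [← sum_sub_distrib, Finset.sum_eq_add i (prev P i) (prev_ne i).symm]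
    · rw [kvec_self, kvec_prev]
      congr 1 <;> cases b <;> simp only [sg, false_eq_true, if_true, if_false, mul_one,
        mul_neg, neg_neg, sub_neg_eq_add, tri_sub, tri_add] <;> split_ifs <;> ring
    · intro k _ hk; rw [kvec_eq_zero hk.1 fun h => hk.2 (eq_next_iff.1 h.symm)]; simp
    · simp
    · simp
  have h5 := pairing_eq h i
  have h6 : (vlet Λ b i ε).ex α = 1 + sg b * (form P (root P i) α.1 + ∑ j : CIdx P,
    kvec i j.1 * α.2 j + lint Λ i) - if dpart b i then 1 else 0 := rfl
  rw [h6, h5, add_sub_add_comm, h4]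
  cases b <;> simp only [sg, dpart, false_eq_true, if_true, if_false] <;> split_ifs <;> omega

lemma energy_bound (Λ) (y : RootIdx P → ℤ) : -(P.m + P.n : ℕ) ≤ energy Λ y := by
  obtain ⟨t, ht, h⟩ : ∃ t < P.m, ∑ l, y l * lint Λ l.1 = rext y t := by
    have h0 : rext y 0 = 0 := dif_neg (by simp); cases Λ with
    | line a => exact ⟨0, P.one_le_m, by simp [lint, h0]⟩
    | fund i₀ h =>
      by_cases hi : i₀.1 < P.m
      · refine ⟨i₀.1, hi, ?_⟩; have hi0 : i₀.1 ≠ 0 := fun h' => h (.inl h')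
        have h3 : ∀ k : RootIdx P, k.1 = i₀ ↔ k = ⟨i₀, hi0⟩ := fun k => by rw [Subtype.ext_iff]
        rw [rext_root y ⟨i₀, hi0⟩]; simp [lint, hi, fun k : RootIdx P => k.2, h3]
      · exact ⟨0, P.one_le_m, by simp [lint, hi, h0]⟩
  have h1 : rext y t = ∑ k, if k.1 < t then yv y k else 0 := by
    rw [show (∑ k, if k.1 < t then yv y k else 0) = ∑ k ∈ range (P.m + P.n),
      if k < t then rext y (k + 1) - rext y k else 0 from
        Fin.sum_univ_eq_sum_range (fun k => if k < t then rext y (k + 1) - rext y k else 0) _,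
      ← Finset.sum_filter, show (range (P.m + P.n)).filter (· < t) = range t by
        ext k; simp; omega, Finset.sum_range_sub, show rext y 0 = 0 from dif_neg (by simp), sub_zero]
  rw [energy, h, h1, ← sum_add_distrib]
  refine le_trans (le_of_eq (by simp)) (sum_le_sum (f := fun _ => (-1)) fun k _ => ?_)
  have hk : 0 ≤ yv y k * (yv y k + 1) := by rcases lt_or_ge (yv y k) 0 with h | h <;> nlinarith
  have hk' : 0 ≤ (yv y k + 1) * (yv y k + 1 + 1) := by
    rcases lt_or_ge (yv y k) (-1) with h | h <;> nlinarith
  have := tri_add (yv y k); split_ifs <;> omega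

/-! ### The gradings -/

/-- The weight of the creation operators. -/
abbrev wt {Y : Type*} : Y × ℕ+ → ℤ := fun v => ((v.2 : ℕ) : ℤ)

lemma isWeightedHomogeneous_expCoeff {σ : Type*} {w : σ → ℤ} {a : ℕ → MvPolynomial σ ℂ} (ha : ∀ r, 0
    < r → (a r).IsWeightedHomogeneous w r) (s) : (expCoeff a s).IsWeightedHomogeneous w s := by
  induction s using Nat.strong_induction_on with
  | _ s ih => cases s with
    | zero => rw [expCoeff_zero]; exact MvPolynomial.isWeightedHomogeneous_one _ _
    | succ s =>
      rw [← inv_smul_smul₀ (cast_ne_zero.2 (succ_ne_zero s) : ((s + 1 : ℕ) : ℂ) ≠ 0)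
        (expCoeff a (s + 1)), expCoeff_succ_of_comm a s]
      refine smul_mem (weightedHomogeneousSubmodule ℂ w _) _
        (Submodule.sum_mem _ fun p hp => smul_mem _ _ ?_)
      have hp := mem_antidiagonal.1 hp
      have := (ha (p.1 + 1) (Nat.succ_pos _)).mul (ih p.2 (by omega))
      rw [show (p.1 + 1 : ℕ) + p.2 = ((s + 1 : ℕ) : ℤ) by omega] at this; exact this

lemma Osc.isWeightedHomogeneous_N1 {Y : Type*} [Fintype Y] (X : Osc Y) (n s) :
    (X.N1 n (MvPolynomial.monomial s 1)).IsWeightedHomogeneous wt (weight wt s + n) := by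
  have hE : ∀ n, (X.E n).IsWeightedHomogeneous wt n := by
    intro n; rcases lt_or_ge n 0 with hn | hn
    · rw [E_of_neg _ hn]; exact MvPolynomial.isWeightedHomogeneous_zero ..
    · lift n to ℕ using hn; rw [E_natCast]; refine isWeightedHomogeneous_expCoeff (fun r hr => ?_) n
      refine Submodule.sum_mem (weightedHomogeneousSubmodule ℂ wt _) fun y _ =>
        smul_mem _ _ ?_
      have := isWeightedHomogeneous_X ℂ wt (y, r.toPNat')
      rwa [wt, toPNat'_of_pos hr] at this
  have key : ∀ s c, ∃ k : ℤ, (MvPolynomial.monomial s c).IsWeightedHomogeneous wt k ∧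
      ∀ n, (X.N1 n (MvPolynomial.monomial s c)).IsWeightedHomogeneous wt (k + n) := by
    refine MvPolynomial.induction_on_monomial (fun c => ⟨0, ?_, fun n => ?_⟩)
      fun f v ⟨k, h, h'⟩ => ⟨k + wt v, h.mul (isWeightedHomogeneous_X _ _ _), fun n => ?_⟩
    · exact MvPolynomial.isWeightedHomogeneous_C ..
    · rw [N1_C, zero_add]
      exact smul_mem (weightedHomogeneousSubmodule ℂ wt _) _ (hE n)
    · rw [N1_mul_X]; have h1 := (h' n).mul (isWeightedHomogeneous_X ℂ wt v)
      have h2 := h' (n + v.2); rw [add_right_comm] at h1; rw [← add_assoc, add_right_comm] at h2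
      exact h1.add (smul_mem (weightedHomogeneousSubmodule ℂ wt _) _ h2)
  obtain ⟨k, h, h'⟩ := key s 1
  rw [(MvPolynomial.isWeightedHomogeneous_monomial wt s 1 rfl).inj_right (by simp) h]; exact h' n

def dspan {G : Type*} (D : QLat P → (Boson P × ℕ+ →₀ ℕ) → G) (S : Set G) : Submodule ℂ (Big P) :=
  span ℂ {w | ∃ α ∈ Qtilde P, ∃ s, D α s ∈ S ∧
    w = Finsupp.single α (MvPolynomial.monomial s (1 : ℂ))}

section Degree

variable {G : Type*} {D : QLat P → (Boson P × ℕ+ →₀ ℕ) → G} {S : Set G}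

lemma mem_dspan {w} : w ∈ dspan D S ↔
    w ∈ FSpace P ∧ ∀ α s, MvPolynomial.coeff s (w α) ≠ 0 → D α s ∈ S := by
  constructor
  · intro h; induction h using span_induction with
    | mem x hx => classical
      obtain ⟨α, hα, s, hs, rfl⟩ := hx
      refine ⟨single_mem_supported ℂ _ hα, fun β t h => ?_⟩; rw [single_apply] at h
      split_ifs at h with h1
      · rw [MvPolynomial.coeff_monomial] at h; split_ifs at h with h2
        · rwa [← h1, ← h2]
        · exact absurd rfl h
      · simp at h
    | zero => exact ⟨zero_mem _, fun α s h => absurd (by simp) h⟩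
    | add x y _ _ hx hy =>
      refine ⟨add_mem hx.1 hy.1, fun α s h => ?_⟩; by_cases h1 : MvPolynomial.coeff s (x α) = 0
      · refine hy.2 α s fun h2 => h ?_
        rw [Finsupp.add_apply, coeff_add, h1, h2, add_zero]
      · exact hx.2 α s h1
    | smul c x _ hx =>
      refine ⟨smul_mem _ c hx.1, fun α s h => hx.2 α s fun h2 => h ?_⟩
      rw [Finsupp.smul_apply, MvPolynomial.coeff_smul, h2, smul_zero]
  · rintro ⟨h1, h2⟩; rw [← Finsupp.sum_single w]; refine Submodule.sum_mem _ fun α hα => ?_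
    rw [(w α).as_sum, ← lsingle_apply (R := ℂ), map_sum]
    refine Submodule.sum_mem _ fun s hs => ?_
    rw [← mul_one (MvPolynomial.coeff s (w α)), ← smul_eq_mul, ← MvPolynomial.smul_monomial, map_smul]
    exact smul_mem _ _ (subset_span
      ⟨α, h1 hα, s, h2 α s (MvPolynomial.mem_support_iff.1 hs), rfl⟩)

lemma dspan_univ : dspan D Set.univ = FSpace P := by
  ext w; simp [mem_dspan]

lemma dspan_mono {S'} (h : S ⊆ S') : dspan D S ≤ dspan D S' :=
  fun _ hw => mem_dspan.2 ⟨(mem_dspan.1 hw).1, fun α s hs => h ((mem_dspan.1 hw).2 α s hs)⟩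

variable (D) in
/-- The homogeneous components of `ℱ_Λ`. -/
def dpiece (g : G) : Submodule ℂ (FSpace P) := (dspan D {g}).comap (FSpace P).subtype

lemma iSupIndep_dpiece : iSupIndep (dpiece D) := by
  refine fun g => Submodule.disjoint_def.2 fun x hx hx' => ?_
  have h1 : (⨆ g', ⨆ _, dpiece D g') ≤ (dspan D {g}ᶜ).comap (FSpace P).subtype :=
    iSup₂_le fun g' hg' => Submodule.comap_mono (dspan_mono (by simpa using Ne.symm hg'))
  refine Subtype.ext (Finsupp.ext fun α => MvPolynomial.ext _ _ fun s => ?_); by_contra h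
  exact ((mem_dspan.1 (h1 hx')).2) α s h ((mem_dspan.1 hx).2 α s h)

lemma iSup_dpiece : iSup (dpiece D) = ⊤ := by
  have h : FSpace P ≤ (iSup (dpiece D)).map (FSpace P).subtype := by
    refine (dspan_univ (D := D)).symm.le.trans (span_le.2 ?_); rintro _ ⟨α, hα, s, -, rfl⟩
    refine ⟨⟨_, single_mem_supported ℂ _ hα⟩, Submodule.mem_iSup_of_mem (D α s) ?_, rfl⟩
    exact subset_span ⟨α, hα, s, rfl, rfl⟩
  refine eq_top_iff.2 fun x _ => ?_; obtain ⟨y, hy, hxy⟩ := h x.2; simp_all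

variable [AddCommGroup G]

lemma dspan_map {T : Module.End ℂ (Big P)} {g}
    (h : ∀ α ∈ Qtilde P, ∀ s, T (Finsupp.single α (MvPolynomial.monomial s 1)) ∈ dspan D {g + D α s})
    {x k} (hx : x ∈ dspan D {k}) : T x ∈ dspan D {g + k} := by
  induction hx using span_induction with
  | mem x hx => obtain ⟨α, hα, s, rfl, rfl⟩ := hx; exact h α hα s
  | zero => simp
  | add x y _ _ hx hy => rw [map_add]; exact add_mem hx hy
  | smul c x _ hx => rw [map_smul]; exact smul_mem _ c hx

end Degree

section Generators

variable (Λ : Weight P)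

variable (P) in
abbrev Deg : Type := ZMod 2 × RootClass P × ℤ

/-- The degree of the generators. -/
def degGen (g : Gen P) : Deg P := (parityDeg P g, fullDeg P g)

def degVec (α : QLat P) (k : ℤ) : Deg P :=
  (((α.1 mRoot : ℤ) : ZMod 2), (QuotientAddGroup.mk fun i : Idx P => rext α.1 i.1),
    -k - energy Λ α.1)

/-- The degree of the monomials. -/
def degMon (α : QLat P) (s : Boson P × ℕ+ →₀ ℕ) : Deg P := degVec Λ α (weight wt s)

lemma single_mem_dspan {α} (hα : α ∈ Qtilde P) {f k} (hf : f.IsWeightedHomogeneous wt k) {g} (hg :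
    degVec Λ α k = g) : Finsupp.single α f ∈ dspan (degMon Λ) {g} := by
  refine mem_dspan.2 ⟨single_mem_supported ℂ _ hα, fun β s h => ?_⟩
  rw [single_apply] at h; split_ifs at h with h1
  · rw [degMon, hf h, ← h1]; exact hg
  · simp at h

lemma root_mRoot (b i) : ((sg b * root P i mRoot : ℤ) : ZMod 2) = par P i := by
  have h1 : (-1 : ZMod 2) = 1 := rfl; unfold root par IsOdd; by_cases h : i.1 = 0
  · simp [h, sg]
  · by_cases h' : mRoot.1 = i
    · have h2 : i.1 = P.m := by rw [← h']; rfl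
      simp [h', h2, sg]
    · have h2 : i.1 ≠ P.m := fun h2 => h' (Fin.ext h2.symm); simp_all

lemma degVec_vlet (b i ε) {α} (hα : α ∈ Qtilde P) (k e) : degVec Λ (α + (vlet Λ b i ε).β) (k + (-e -
    (vlet Λ b i ε).ex α)) = degGen (if b then .E i e else .F i e) + degVec Λ α k := by
  have h1 : (fun l => rext (α.1 + sg b • root P i) l.1) =
      sg b • Pi.single i 1 + (fun l => rext α.1 l.1) +
        (-sg b * if i.1 = 0 then 1 else 0) • fun _ => 1 := by
    funext l
    simp only [rext_add_zsmul, rext_simple, Pi.add_apply, Pi.smul_apply, Pi.single_apply, smul_eq_mul]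
    ring
  refine Prod.ext ?_ (Prod.ext ?_ ?_)
  · have := root_mRoot b i; rw [fst_add]
    change (((α.1 mRoot + sg b * root P i mRoot : ℤ)) : ZMod 2) = _
    rw [Int.cast_add, this, add_comm]; cases b <;> rfl
  · change (QuotientAddGroup.mk (fun l => rext (α.1 + sg b • root P i) l.1) : RootClass P) = _
    rw [h1, mk_add, mk_add, (eq_zero_iff _).2
      (AddSubgroup.zsmul_mem_zmultiples _ _), add_zero]
    cases b
    · rw [sg, if_neg (by simp), neg_one_smul]; rfl
    · rw [sg, if_pos rfl, one_smul]; rfl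
  · change -(k + (-e - (vlet Λ b i ε).ex α)) - energy Λ (α + (vlet Λ b i ε).β).1 =
      (degGen (if b then Gen.E i e else Gen.F i e)).2.2 + (-k - energy Λ α.1)
    rw [vlet_ex_eq Λ b i ε hα, show (degGen (if b then Gen.E i e else Gen.F i e)).2.2 = e by
      cases b <;> rfl]
    ring

lemma cur_mem_dspan (b : Bool) (i e) {α} (hα : α ∈ Qtilde P) (s : Boson P ×
    ℕ+ →₀ ℕ) : cur Λ b i (-e) (Finsupp.single α (MvPolynomial.monomial s 1)) ∈ dspan (degMon Λ)
    {degGen (if b then .E i e else .F i e) + degMon Λ α s} := by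
  rw [cur, lsum, LinearMap.sum_apply]; refine Submodule.sum_mem _ fun ε _ => ?_
  rw [LinearMap.smul_apply, Letter.op_single]; exact smul_mem _ _ (single_mem_dspan Λ
    (add_mem hα (zsmul_mem (simple_mem_Qtilde i) (sg b)))
    (smul_mem (weightedHomogeneousSubmodule ℂ wt _) _
      (Osc.isWeightedHomogeneous_N1 _ _ s)) (degVec_vlet Λ b i ε hα _ e))

lemma genAct_mem_dspan (g) {α} (hα : α ∈ Qtilde P) (s) : genAct Λ g (Finsupp.single α
    (MvPolynomial.monomial s 1)) ∈ dspan (degMon Λ) {degGen g + degMon Λ α s} := by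
  have hs := MvPolynomial.isWeightedHomogeneous_monomial (R := ℂ) (wt) s 1 rfl
  have hz := single_mem_dspan Λ hα hs (zero_add _).symm; cases g with
  | E i e => exact cur_mem_dspan Λ true i e hα s
  | F i e => exact cur_mem_dspan Λ false i e hα s
  | C => exact smul_mem _ P.q hz
  | Cinv => exact smul_mem _ P.q⁻¹ hz
  | K i => rw [genAct, kzero_single, ← smul_single]; exact smul_mem _ _ hz
  | Kinv i => rw [genAct, kzero_single, ← smul_single]; exact smul_mem _ _ hz
  | H i r =>
    rw [genAct, onFock_single]; have hd : ∀ k, k = weight wt s - r.1 →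
        degVec Λ α k = degGen (.H i r) + degMon Λ α s := by
      rintro k rfl; refine Prod.ext (zero_add _).symm (Prod.ext (zero_add _).symm ?_)
      change -(weight wt s - r.1) - energy Λ α.1 =
        r.1 + (-weight wt s - energy Λ α.1)
      ring
    unfold mode; have hr := r.2; split_ifs with h
    · refine single_mem_dspan Λ hα ((isWeightedHomogeneous_X ℂ wt _).mul hs) (hd _ ?_)
      change ((r.1.natAbs : ℕ) : ℤ) + _ = _; omega
    · refine single_mem_dspan Λ hα ?_ (hd _ rfl); simp only [ann, LinearMap.sum_apply]
      refine Submodule.sum_mem (weightedHomogeneousSubmodule ℂ wt _) fun y _ =>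
        smul_mem _ _ (MvPolynomial.IsWeightedHomogeneous.pderiv hs ?_)
      change _ - _ + ((r.1.natAbs : ℕ) : ℤ) = _; omega

lemma genAct_mem_FSpace (g) {x} (hx : x ∈ FSpace P) : genAct Λ g x ∈ FSpace P := by
  rw [← dspan_univ (D := fun _ _ => 0)] at hx; induction hx using span_induction with
  | mem x hx => obtain ⟨α, hα, s, -, rfl⟩ := hx; exact (mem_dspan.1 (genAct_mem_dspan Λ g hα s)).1
  | zero => simp
  | add x y _ _ hx hy => rw [map_add]; exact add_mem hx hy
  | smul c x _ hx => rw [map_smul]; exact smul_mem _ c hx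

/-- The action of the free algebra on `ℱ_Λ`. -/
def frRep : Fr P →ₐ[ℂ] Module.End ℂ (FSpace P) :=
  FreeAlgebra.lift ℂ fun g => (genAct Λ g).restrict fun _ => genAct_mem_FSpace Λ g

lemma coe_frRep (x w) : frRep Λ x w = frAct Λ x w := by
  induction x using FreeAlgebra.induction generalizing w with
  | grade0 r => rw [commutes, commutes]; rfl
  | grade1 g => rw [frAct_ι, frRep, lift_ι_apply]; rfl
  | mul a b ha hb => rw [map_mul, map_mul, Module.End.mul_apply, Module.End.mul_apply, ha, hb]
  | add a b ha hb => simp_all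

def rep : Alg P →ₐ[ℂ] Module.End ℂ (FSpace P) :=
  RingQuot.liftAlgHom ℂ ⟨frRep Λ, fun _ _ h => LinearMap.ext fun w => Subtype.ext (by
    rw [coe_frRep, coe_frRep, frAct_rel Λ h])⟩

lemma coe_rep_gen (g w) : (rep Λ (gen P g) w) = genAct Λ g w := by
  rw [rep, gen, RingQuot.liftAlgHom_mkAlgHom_apply, coe_frRep, frAct_ι]

variable {G : Type*} [AddCommGroup G]

lemma isGradedBy_rep (π : Deg P →+ G) :
    IsGradedBy (rep Λ) (fun g => π (degGen g)) (dpiece fun α s => π (degMon Λ α s)) := by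
  refine ⟨iSupIndep_dpiece, iSup_dpiece, fun g h x hx => ?_⟩
  induction hx using span_induction with
  | mem x hx => obtain ⟨l, rfl, rfl⟩ := hx; induction l generalizing h with
    | nil => intro v hv; simpa using hv
    | cons g l ih =>
      intro v hv; have := ih h v hv
      rw [map_cons, map_cons, sum_cons, prod_cons, map_mul, Module.End.mul_apply,
        add_assoc]
      change (rep Λ (gen P g) _ : Big P) ∈ dspan _ _; rw [coe_rep_gen]
      refine dspan_map (fun α hα s => ?_) this; have h1 := mem_dspan.1 (genAct_mem_dspan Λ g hα s)
      refine mem_dspan.2 ⟨h1.1, fun β t ht => ?_⟩; rw [Set.mem_singleton_iff, h1.2 β t ht, map_add]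
  | zero => intro v _; simp
  | add x y _ _ hx hy => intro v hv; rw [map_add]; exact add_mem (hx v hv) (hy v hv)
  | smul c x _ hx => intro v hv; rw [map_smul]; exact smul_mem _ c (hx v hv)

lemma isAdmissible_rep : IsAdmissible (rep Λ) := by
  set π : Deg P →+ ℤ := (snd _ _).comp (snd _ _)
  have hg := isGradedBy_rep Λ π; intro v
  have hv : v ∈ iSup (dpiece fun α s => π (degMon Λ α s)) := by simp [hg.2.1]
  induction hv using Submodule.iSup_induction' with
  | mem h v hv =>
    refine ⟨(P.m + P.n : ℕ) - h, fun k hk x hx => ?_⟩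
    refine Subtype.ext (Finsupp.ext fun α => MvPolynomial.ext _ _ fun s => ?_); by_contra h2
    have h3 : -weight wt s - energy Λ α.1 = k + h := (mem_dspan.1 (hg.2.2 k h x hx v hv)).2
      α s h2
    have h4 := energy_bound Λ α.1; have h5 : 0 ≤ weight (wt) s := by
      rw [Finsupp.weight_apply]; exact Finset.sum_nonneg fun v _ => by positivity
    omega
  | zero => exact ⟨0, fun k _ x _ => map_zero _⟩
  | add x y _ _ hx hy => obtain ⟨N, hN⟩ := hx; obtain ⟨N', hN'⟩ := hy; exact ⟨max N N', fun k hk z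
    hz => by rw [map_add, hN k (by omega) z hz, hN' k (by omega) z hz, add_zero]⟩

lemma parityPart_eq (p) :
    parityPart P p = dpiece (fun α s => fst _ _ (degMon Λ α s)) p := by
  ext w; refine Iff.trans ?_ (mem_dspan).symm
  refine (Finsupp.mem_supported ℂ _).trans ⟨fun h => ⟨w.2, fun α s hs => ?_⟩, fun h α hα => ?_⟩
  · aesop
  · obtain ⟨s, hs⟩ := ne_zero_iff.1 (Finsupp.mem_support_iff.1 hα); exact h.2 α s hs

lemma coe_rep_K (i w α) : (rep Λ (gen P (.K i)) w : Big P) α =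
    exp (rootPair Λ i α * P.logq) • (w : Big P) α := by
  rw [coe_rep_gen, genAct, kzero_apply, cast_one, one_mul]

lemma sum_rootPair (α : QLat P) : ∑ i, rootPair Λ i α = 0 := by
  have h1 : ∀ l, ∑ i, root P i l = 0 := by
    intro l
    have h : ∀ i, root P i l = (if l.1 = i then 1 else 0) - if i = zeroIdx then 1 else 0 := by
      intro i; have := l.2; simp only [root, ext_iff, zeroIdx]; split_ifs <;> omega
    simp [h]
  have h2 : ∑ i, form P (root P i) α.1 = 0 := by
    simp only [form]; rw [sum_comm]; refine sum_eq_zero fun k _ => ?_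
    rw [sum_comm]; refine sum_eq_zero fun l _ => ?_
    rw [← sum_mul, ← sum_mul, h1, zero_mul, zero_mul]
  simp only [rootPair]; rw [sum_add_distrib, sum_comm]
  simp only [← sum_mul, ← Int.cast_sum, h1, h2]; simp

lemma hasLevel_rep : HasLevel (rep Λ) 1 0 := by
  refine ⟨LinearMap.ext fun w => Subtype.ext ?_, LinearMap.ext fun w => Subtype.ext (Finsupp.ext
    fun α => ?_)⟩
  · rw [coe_rep_gen, zpow_one]; rfl
  · have h : ∀ l : List (Idx P), (rep Λ (l.map fun i => gen P (.K i)).prod w : Big P) α =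
        exp ((l.map fun i => rootPair Λ i α).sum * P.logq) • (w : Big P) α := by
      intro l; induction l with
      | nil => simp
      | cons i l ih => rw [map_cons, prod_cons, map_mul, Module.End.mul_apply, coe_rep_K,
        ih, smul_smul, ← exp_add, map_cons, sum_cons, add_mul]
    rw [KTot, List.ofFn_eq_map, h, ← List.ofFn_eq_map, List.sum_ofFn, sum_rootPair]; simp

end Generators

/-! ### The modes of the currents -/

section Modes

variable {P : Params}

open Current

def vop (β : QLat P) (c : QLat P → ℂ) (N : QLat P → ℤ → Module.End ℂ (Fock P)) (x : ℂ) :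
    Module.End ℂ (Big P) :=
  open Classical in Finsupp.lsum ℂ fun α => if ((⌊(x - c α).re⌋ : ℤ) : ℂ) = x - c α then
    lsingle (α + β) ∘ₗ N α ⌊(x - c α).re⌋ else 0

/-- The same as a series. -/
def vcur (β : QLat P) (c : QLat P → ℂ) (N : QLat P → ℤ → Module.End ℂ (Fock P)) : Current P :=
  fun x w => vop β c N x w

variable {β β' : QLat P} {c c' : QLat P → ℂ} {N N' N'' : QLat P → ℤ → Module.End ℂ (Fock P)}

lemma vop_single (α f) {x} {e : ℤ} (h : x = c α + e) :
    vop β c N x (Finsupp.single α f) = Finsupp.single (α + β) (N α e f) := by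
  have h1 : x - c α = e := by rw [h]; ring
  have h2 : ⌊(x - c α).re⌋ = e := by simp_all
  rw [vop, lsum_single, h2, if_pos h1.symm]; rfl

lemma vop_single_eq_zero (α f) {x} (h : ∀ e : ℤ, x ≠ c α + e) :
    vop β c N x (Finsupp.single α f) = 0 := by
  rw [vop, lsum_single, if_neg, LinearMap.zero_apply]; grind

lemma vop_ext {T : Module.End ℂ (Big P)} {x}
    (h : ∀ α f (e : ℤ), x = c α + e → T (Finsupp.single α f) = Finsupp.single (α + β) (N α e f))
    (h' : ∀ α f, (∀ e : ℤ, x ≠ c α + e) → T (Finsupp.single α f) = 0) : T = vop β c N x := by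
  refine lhom_ext fun α f => ?_; by_cases hx : ∃ e : ℤ, x = c α + e
  · obtain ⟨e, he⟩ := hx; rw [h α f e he, vop_single α f he]
  · push Not at hx; rw [h' α f hx, vop_single_eq_zero α f hx]

/-- Finitely supported sums. -/
def HasFinsum {κ W : Type*} [AddCommMonoid W] (u : κ → W) (s : W) : Prop :=
  u.support.Finite ∧ ∑ᶠ k, u k = s

lemma HasFinsum.zero {κ W : Type*} [AddCommMonoid W] : HasFinsum (fun _ : κ => (0 : W)) 0 :=
  ⟨by simp, finsum_zero⟩

lemma HasFinsum.single {κ W : Type*} [AddCommMonoid W] {u : κ → W} (k)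
    (h : ∀ k', k' ≠ k → u k' = 0) : HasFinsum u (u k) :=
  ⟨(Set.finite_singleton k).subset fun k' hk' => by_contra fun hne => hk' (h k' hne),
    finsum_eq_single _ _ h⟩

lemma HasFinsum.add {κ W : Type*} [AddCommMonoid W] {u v : κ → W} {s t} (hu : HasFinsum u s)
    (hv : HasFinsum v t) : HasFinsum (fun k => u k + v k) (s + t) :=
  ⟨(hu.1.union hv.1).subset (Function.support_add u v), by
    rw [finsum_add_distrib hu.1 hv.1, hu.2, hv.2]⟩

lemma HasFinsum.map {κ W W' F : Type*} [AddCommMonoid W] [AddCommMonoid W'] [FunLike F W W']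
    [AddMonoidHomClass F W W'] (L : F) {u : κ → W} {s} (hu : HasFinsum u s) :
    HasFinsum (fun k => L (u k)) (L s) :=
  ⟨hu.1.subset (Function.support_comp_subset (map_zero L) u), by
    rw [← hu.2]; exact ((L : W →+ W').map_finsum hu.1).symm⟩

lemma HasFinsum.of_injective {κ κ' W : Type*} [AddCommMonoid W] {i : κ → κ'}
    (hi : Function.Injective i) {u} {s : W} (hu : HasFinsum (fun k => u (i k)) s)
    (h : ∀ k', k' ∉ Set.range i → u k' = 0) : HasFinsum u s := by
  have h1 : u.support ⊆ Set.range i := fun k' hk' => by_contra fun hne => hk' (h k' hne)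
  have h2 : u.support = i '' (fun k => u (i k)).support := by
    ext k'; constructor
    · intro hk'; obtain ⟨k, rfl⟩ := h1 hk'; exact ⟨k, hk', rfl⟩
    · rintro ⟨k, hk, rfl⟩; exact hk
  refine ⟨h2 ▸ hu.1.image i, ?_⟩; rw [← hu.2, ← finsum_mem_range hi]
  exact (finsum_mem_univ u).symm.trans (finsum_mem_inter_support_eq u _ _
    (by rw [Set.univ_inter, Set.inter_eq_right.2 h1]))

lemma vcur_mul (h : ∀ α e f, HasFinsum (fun a => N (α + β') a (N' α (e - a) f)) (N'' α e f)) :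
    vcur β c N * vcur β' c' N' = vcur (β' + β) (fun α => c' α + c (α + β')) N'' := by
  funext x w; suffices HasFinsum (fun y => vop β c N y (vop β' c' N' (x - y) w))
    (vop (β' + β) (fun α => c' α + c (α + β')) N'' x w) from this.2
  induction w using Finsupp.induction_linear with
  | zero => simpa only [map_zero] using HasFinsum.zero
  | add w w' hw hw' => simpa only [map_add] using hw.add hw'
  | single α f =>
    have h0 : ∀ y, vop β c N y (vop β' c' N' (x - y) (Finsupp.single α f)) ≠ 0 →
        ∃ a b : ℤ, y = c (α + β') + a ∧ x - y = c' α + b := by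
      intro y hy; by_cases hb : ∃ b : ℤ, x - y = c' α + b
      · obtain ⟨b, hb⟩ := hb; rw [vop_single α f hb] at hy
        by_cases ha : ∃ a : ℤ, y = c (α + β') + a
        · obtain ⟨a, ha⟩ := ha; exact ⟨a, b, ha, hb⟩
        · push Not at ha; exact absurd (vop_single_eq_zero _ _ ha) hy
      · push Not at hb; rw [vop_single_eq_zero α f hb, map_zero] at hy; exact absurd rfl hy
    by_cases hx : ∃ e : ℤ, x = c' α + c (α + β') + e
    · obtain ⟨e, he⟩ := hx; rw [vop_single α f he]
      refine HasFinsum.of_injective (i := fun a : ℤ => c (α + β') + a)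
        (fun a b hab => by simpa using hab) ?_ fun y hy => ?_
      · have := (h α e f).map (lsingle (R := ℂ) (α + (β' + β)))
        refine cast (congrArg₂ HasFinsum (funext fun a => ?_) rfl) this
        rw [vop_single (e := e - a) α f (by rw [he]; push_cast; ring), vop_single _ _ rfl, add_assoc]
        rfl
      · by_contra hne; obtain ⟨a, b, ha, -⟩ := h0 y hne; exact hy ⟨a, ha.symm⟩
    · push Not at hx
      have h1 : (fun y => vop β c N y (vop β' c' N' (x - y) (Finsupp.single α f))) = fun _ => 0 := by
        funext y; by_contra hne; obtain ⟨a, b, ha, hb⟩ := h0 y hne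
        exact hx (a + b) (by push_cast; linear_combination ha + hb)
      rw [h1, vop_single_eq_zero α f hx]; exact HasFinsum.zero

def bosc (x : Boson P) (t u t' u' : ℂ) : Osc (Boson P) where
  cr y r := if y = x then t * u ^ (r : ℕ) / qInt P r else 0
  an y r := t' * u'⁻¹ ^ (r : ℕ) / qInt P r * heis P x y r

lemma ofFock_eq {e} (he : e = 1 ∨ e = -1) (T : ℕ → Module.End ℂ (Fock P)) :
    ofFock e T = vcur 0 (fun _ => 0) fun _ a => if 0 ≤ e * a then T (e * a).toNat else 0 := by
  have hee : (e : ℂ) * e = 1 := by rcases he with rfl | rfl <;> norm_num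
  have hee' : e * e = 1 := by grind
  have h0 : ∀ (r : ℕ) x, (e : ℂ) * r = x ↔ x = (e * r : ℤ) := fun r x => by push_cast; exact eq_comm
  funext x w; by_cases hx : ∃ r : ℕ, e * r = x
  · obtain ⟨r, hr⟩ := hx; have h1 : ofFock e T x w = onFock P (T r) w := by
      rw [ofFock, finsum_eq_single _ r, finsum_eq_if, if_pos hr]
      · rfl
      · intro r' hr'; rw [finsum_eq_if, if_neg]; intro h; apply hr'
        have : (e : ℂ) * (e * r') = e * (e * r) := by rw [h, hr]
        rw [← mul_assoc, ← mul_assoc, hee] at this; simpa using this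
    rw [h1]; refine LinearMap.congr_fun (vop_ext (fun α f a ha => ?_) fun α f ha => ?_) w
    · have h2 : a = e * r := by rw [(h0 r x).1 hr, zero_add] at ha; exact_mod_cast ha.symm
      rw [onFock_single, h2, ← mul_assoc, hee', one_mul, if_pos (by positivity), add_zero,
        Int.toNat_natCast]
    · exact absurd (by rw [(h0 r x).1 hr, zero_add]) (ha (e * r))
  · have h1 : ofFock e T x w = 0 := by
      rw [ofFock]; refine finsum_eq_zero_of_forall_eq_zero fun r => ?_
      rw [finsum_eq_if, if_neg fun h => hx ⟨r, h⟩]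
    rw [h1]
    refine (LinearMap.congr_fun (vop_ext (T := 0) (fun α f a ha => ?_) fun α f ha => rfl) w :)
    rw [if_neg, LinearMap.zero_apply, LinearMap.zero_apply, single_zero]; intro h
    refine hx ⟨(e * a).toNat, ?_⟩
    have h2 : (((e * a).toNat : ℤ) : ℂ) = (e * a : ℤ) := by rw [Int.toNat_of_nonneg h]
    rw [Int.cast_natCast] at h2; rw [h2, ha]; push_cast; rw [← mul_assoc, hee, one_mul, zero_add]

lemma expCre_eq (x : Boson P) (t u t' u') : expCre x t u =
    vcur 0 (fun _ => 0) fun _ a => mulLeft ℂ ((bosc x t u t' u').E a) := by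
  rw [expCre, ofFock_eq (.inl rfl)]; congr 1; funext _ a; rw [one_mul]; split_ifs with h
  · lift a to ℕ using h
    refine Eq.trans ?_ (expCoeff_map (lmul ℂ (Fock P)) (bosc x t u t' u').creLin a).symm
    refine expCoeff_congr (fun r hr => LinearMap.ext fun f => ?_) a
    have hr' : r.toPNat' = ⟨r, hr⟩ := eq (toPNat'_of_pos hr)
    simp [Osc.creLin, bosc, hr, cre, hr']
  · grind [Osc.E_of_neg, not_le.1, LinearMap.mulLeft_zero_eq_zero]

lemma expAnn_eq (x : Boson P) (t u t' u') : expAnn x t' u' =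
    vcur 0 (fun _ => 0) fun _ a => if a ≤ 0 then (bosc x t u t' u').Tc (-a).toNat else 0 := by
  rw [expAnn, ofFock_eq (.inr rfl)]; congr 1; funext _ a; rw [neg_one_mul]
  refine if_congr (by omega) ?_ rfl; rw [Osc.Tc_eq_expCoeff]
  refine expCoeff_congr (fun r hr => ?_) _
  have hr' : r.toPNat' = ⟨r, hr⟩ := eq (toPNat'_of_pos hr)
  simp [Osc.annLin, bosc, hr, ann, hr', smul_sum, smul_smul]

lemma const_mul (T Z x) (w : Big P) : (const T * Z) x w = T (Z x w) := by
  refine (finsum_eq_single (fun y => if y = 0 then T (Z (x - y) w) else 0) 0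
    fun y hy => if_neg hy).trans ?_
  simp

lemma const_mul_eq {T : Big P → Big P} {Z : Current P} {t s : QLat P → ℂ} (hT : ∀ w, T w =
    Finsupp.lsum ℂ (fun α => t α • (lsingle (α + β) : Fock P →ₗ[ℂ] Big P)) w) (hZ : ∀ x α f,
    c α = x → Z x (Finsupp.single α f) = Finsupp.single α (s α • f)) (hZ' : ∀ x α f, c α ≠ x → Z x
    (Finsupp.single α f) = 0) (hadd : ∀ x, ∃ L : Module.End ℂ (Big P), Z x = L) : const T * Z = vcur
    β c fun α a => if a = 0 then (s α * t α) • 1 else 0 := by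
  funext x w; rw [const_mul, hT]; obtain ⟨L, hL⟩ := hadd x; rw [hL, ← comp_apply]
  refine LinearMap.congr_fun (vop_ext (fun α f a ha => ?_) fun α f ha => ?_) w
  · rw [comp_apply, ← hL]; by_cases h : a = 0
    · rw [hZ _ _ _ (by rw [ha, h]; simp), lsum_single, if_pos h]; simp [smul_smul, mul_comm]
    · rw [hZ' _ _ _ (by rw [ha]; simpa using h), if_neg h]; simp
  · rw [comp_apply, ← hL, hZ' _ _ _ fun h => ha 0 (by simp [h]), map_zero]

lemma boson_mul_eq (x t u t' u') (s : QLat P → ℂ) : expCre x t u * (expAnn x t' u' * vcur β c fun α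
    a => if a = 0 then s α • 1 else 0) = vcur β c fun α a => s α • (bosc x t u t' u').N1 a := by
  rw [expCre_eq x t u t' u', expAnn_eq x t u t' u', vcur_mul (N'' := fun α a =>
    s α • if a ≤ 0 then (bosc x t u t' u').Tc (-a).toNat else 0), vcur_mul (N'' := fun α a =>
    s α • (bosc x t u t' u').N1 a)]
  · simp
  · intro α e f; set X := bosc x t u t' u'
    refine HasFinsum.of_injective (i := fun r : ℕ => e + r) (fun r r' h => by simpa using h)
      ?_ fun a ha => ?_
    · have h1 : (fun r : ℕ => mulLeft ℂ (X.E (e + r)) ((s α • if e - (e + r) ≤ 0 then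
        X.Tc (-(e - (e + r))).toNat else 0) f)) = fun r : ℕ => s α • (X.E (e + r) * X.Tc r f) := by
          funext r; rw [if_pos (by omega), show (-(e - (e + r))).toNat = r by omega]; simp
      have h2 : (fun r : ℕ => s α • (X.E (e + r) * X.Tc r f)).support ⊆
          range ((X.T f).natDegree + 1) := by
        intro r hr; by_contra h; refine hr ?_; simp [coe_range, Set.mem_Iio, not_lt] at h
        simp [X.Tc_eq_zero (f := f) (r := r) (by omega)]
      rw [h1, LinearMap.smul_apply, Osc.N1_eq_sum _ _ _ (lt_succ_self _), smul_sum]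
      exact ⟨(Finset.finite_toSet _).subset h2, finsum_eq_sum_of_support_subset _ h2⟩
    · rw [if_neg fun h => ha ⟨(a - e).toNat, by simp; omega⟩]; simp
  · intro α e f; convert HasFinsum.single e fun a ha => ?_ using 1
    · rw [sub_self, if_pos rfl, LinearMap.smul_apply, LinearMap.smul_apply, map_smul]; rfl
    · rw [if_neg (sub_ne_zero.2 (Ne.symm ha)), LinearMap.zero_apply, map_zero]

end Modes

section Modes

variable {P : Params}

open Current

lemma Osc.N1_mul_N1_hasFinsum {Y : Type*} [Fintype Y] (X Z)
    (h : ∀ r, 0 < r → Osc.contr X Z r = 0) (e) (f : Osc.Sp Y) :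
    HasFinsum (fun a => X.N1 a (Z.N1 (e - a) f)) ((Osc.fuse 1 X Z).N1 e f) := by
  have hphi : Osc.phi X Z = 1 := by
    rw [Osc.phi, ← expSeries_zero]; ext n; grind [coeff_expSeries, expCoeff_congr]
  have h1 : ∀ a, X.N1 a (Z.N1 (e - a) f) = Osc.nprod ![X, Z] [0, 1] ![a, e - a] f := by
    intro a; have h2 := Osc.N1_nprod ![X, Z] (fun _ _ => 0) 0 [1] (by simp) ![a, e - a] f
    rw [Osc.nprod_singleton, rops, rops, rop] at h2
    simp only [Osc.pairData, cons_val_zero, cons_val_one, hphi] at h2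
    rw [kop_one] at h2; simpa using h2
  simp only [h1]; obtain ⟨B, hB⟩ := Osc.nprod_bounded ![X, Z] [0, 1] f
  refine ⟨(Set.finite_Icc B (e - B)).subset fun a ha => ?_, ?_⟩
  · have h2 := hB _ ha 0 (by simp); have h3 := hB _ ha 1 (by simp)
    simp only [cons_val_zero, cons_val_one] at h2 h3; exact ⟨h2, by omega⟩
  · have := dsum_nprod one_ne_zero ![X, Z] f e; simp only [dsum, one_zpow, one_smul] at this
    exact this

/-- Vertex operators with complex exponents. -/
def vx (β : QLat P) (c s : QLat P → ℂ) (X : Osc (Boson P)) : Current P :=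
  vcur β c fun α e => s α • X.N1 e

/-- Sums of two vertex operators. -/
def vsum (β : QLat P) (c : QLat P → ℂ) (s : Bool → QLat P → ℂ) (X : Bool → Osc (Boson P)) :
    Current P :=
  vcur β c fun α e => ∑ ε, s ε α • (X ε).N1 e

variable {β β' : QLat P} {c c' s : QLat P → ℂ} {s' : Bool → QLat P → ℂ} {X : Osc (Boson P)}
  {X' : Bool → Osc (Boson P)}

lemma vx_eq_vsum : vx β c s X = vsum β c (fun ε α => if ε then s α else 0) fun _ => X := by
  simp [vx, vsum]

lemma vx_mul_vsum (h : ∀ ε r, 0 < r → Osc.contr X (X' ε) r = 0) : vx β c s X * vsum β' c' s' X' =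
    vsum (β' + β) (fun α => c' α + c (α + β')) (fun ε α => s (α + β') * s' ε α) fun ε => Osc.fuse 1
    X (X' ε) := by
  refine vcur_mul fun α e f => ?_
  have key := fun ε => (Osc.N1_mul_N1_hasFinsum X (X' ε) (h ε) e f).map
    (lsmul ℂ (Fock P) (s (α + β') * s' ε α))
  have := (key true).add (key false); simpa [mul_smul] using this

/-- Rescaling of the variable. -/
def Osc.scl {Y : Type*} (a : ℂ) (X : Osc Y) : Osc Y where
  cr y r := a ^ (r : ℕ) * X.cr y r
  an y r := a⁻¹ ^ (r : ℕ) * X.an y r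

lemma scale_vx (ℓ) : scale ℓ (vx β c s X) =
    vx β c (fun α => exp (c α * ℓ) * s α) (X.scl (exp ℓ)) := by
  funext x w; refine LinearMap.congr_fun (vop_ext (T := exp (x * ℓ) • vop β c _ x)
    (fun α f e he => ?_) fun α f he => ?_) w
  · rw [LinearMap.smul_apply, vop_single α f he, smul_single, LinearMap.smul_apply,
      LinearMap.smul_apply, Osc.N1_scale (Z := X.scl _) (Complex.exp_ne_zero ℓ) (fun _ _ => rfl)
      fun _ _ => rfl, smul_smul, smul_smul, he, add_mul, exp_add, exp_int_mul]
    congr 2; ring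
  · rw [LinearMap.smul_apply, vop_single_eq_zero α f he, smul_zero]

lemma zMul_vx : zMul (vx β c s X) = vx β (fun α => c α + 1) s X := by
  funext x w; refine LinearMap.congr_fun (vop_ext (fun α f e he => ?_) fun α f he => ?_) w
  · rw [vop_single α f (by rw [he]; ring)]
  · grind [vop_single_eq_zero]

lemma qDeriv_vx : qDeriv (vx β c s X) = vsum β (fun α => c α - 1) (fun ε α => (P.q - P.q⁻¹)⁻¹ * (sg
    ε * exp (c α * (sg ε * P.logq)) * s α)) fun ε => X.scl (qe P ε) := by
  funext x w; have h1 : scale P.logq (vx β c s X) = _ := scale_vx _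
  have h2 : scale (-P.logq) (vx β c s X) = _ := scale_vx _; rw [Complex.exp_neg, P.exp_logq] at h2
  rw [P.exp_logq] at h1; rw [qDeriv, h1, h2]
  refine LinearMap.congr_fun (vop_ext (T := (P.q - P.q⁻¹)⁻¹ •
    (vop β c _ (x + 1) - vop β c _ (x + 1))) (fun α f e he => ?_) fun α f he => ?_) w
  · have he' : x + 1 = c α + e := by rw [he]; ring
    rw [LinearMap.smul_apply, LinearMap.sub_apply, vop_single α f he', vop_single α f he',
      ← single_sub, smul_single]
    simp only [sum_bool, LinearMap.add_apply, LinearMap.smul_apply, sg, qe, if_true,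
      false_eq_true, if_false, cast_one, cast_neg, one_mul, mul_neg, neg_mul]
    congr 1; module
  · have he' : ∀ e : ℤ, x + 1 ≠ c α + e := fun e h => he e (by linear_combination h)
    rw [LinearMap.smul_apply, LinearMap.sub_apply, vop_single_eq_zero α f he',
      vop_single_eq_zero α f he', sub_zero, smul_zero]

variable (Λ : Weight P)

/-- The vertex operators `Γ⁺_i`, `Γ⁻_i`. -/
def gam (b : Bool) (i : Idx P) : Current P := if b then GammaPlus Λ i else GammaMinus Λ i

/-- The oscillators of `Γ⁺_i`, `Γ⁻_i`. -/
def gosc (b : Bool) (i : Idx P) : Osc (Boson P) :=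
  bosc (.inl i) (sg b) (if b then P.q⁻¹ else 1) (-sg b) (if b then 1 else P.q⁻¹)

lemma zH_single (k i x α f) : zH Λ k i x (Finsupp.single α f) = if k * rootPair Λ i α = x then
    Finsupp.single α (P.dHalf ^ (k * amForm i α.1) • f) else 0 :=
  Finsupp.sum_single_index (by simp)

lemma zH_linear (k i x) : ∃ L : Module.End ℂ (Big P), zH Λ k i x = L := by
  classical
  refine ⟨Finsupp.lsum ℂ fun α => if k * rootPair Λ i α = x then
      P.dHalf ^ (k * amForm i α.1) • lsingle α else 0, funext fun w => ?_⟩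
  rw [coe_lsum]; refine Finsupp.sum_congr fun α _ => ?_; split_ifs
  · rw [LinearMap.smul_apply, lsingle_apply, smul_single]; rfl
  · rfl

lemma gam_eq (b i) : gam Λ b i = vx (sg b • root P i, 0) (fun α => sg b * rootPair Λ i α + 1) (fun α
    => P.dHalf ^ (sg b * amForm i α.1) * if b then twist (root P i) α.1 else twist (root P i) (α.1 -
    root P i)) (gosc b i) := by
  cases b
  · have h := const_mul_eq (T := expRootInv i) (Z := zH Λ (-1) i) (β := (-root P i, 0))
      (c := fun α => (-1 : ℤ) * rootPair Λ i α)
      (t := fun α => twist (root P i) (α.1 - root P i)) (fun w => ?_)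
      (fun x α f h => by rw [zH_single, if_pos h]) (fun x α f h => by rw [zH_single, if_neg h])
      (zH_linear Λ _ i)
    · rw [gam, if_neg (by simp), GammaMinus, h, boson_mul_eq]; refine zMul_vx.trans ?_
      simp [gosc, sg]
    · rw [coe_lsum]; refine Finsupp.sum_congr fun α _ => ?_
      rw [LinearMap.smul_apply, lsingle_apply, smul_single, sub_eq_add_neg]; simp
  · have h := const_mul_eq (T := expRoot i) (Z := zH Λ 1 i) (β := (root P i, 0)) (c := fun α => (1
      : ℤ) * rootPair Λ i α) (t := fun α => twist (root P i) α.1) (fun w => ?_) (fun x α f h => by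
        rw [zH_single, if_pos h]) (fun x α f h => by rw [zH_single, if_neg h]) (zH_linear Λ _ i)
    · rw [gam, if_pos rfl, GammaPlus, h, boson_mul_eq]; refine zMul_vx.trans ?_; simp [gosc, sg]
    · rw [coe_lsum]; refine Finsupp.sum_congr fun α _ => ?_
      rw [LinearMap.smul_apply, lsingle_apply, smul_single]

lemma CCur_eq (k j) : CCur Λ k j = vx (0, Pi.single j k)
    (fun α => k * cPair Λ j α) (fun _ => 1) (bosc (.inr j) k 1 (-k) 1) := by
  have h0 : ∀ x α f, zC Λ k j x (Finsupp.single α f) = if k * cPair Λ j α = x then Finsupp.single α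
    f else 0 := fun x α f => Finsupp.sum_single_index (by simp)
  have h := const_mul_eq (T := expC k j) (Z := zC Λ k j) (β := (0, Pi.single j k)) (c := fun α => k
    * cPair Λ j α) (t := fun _ => 1) (s := fun _ => 1) (fun w => ?_) (fun x α f h => by rw [h0,
      if_pos h, one_smul]) (fun x α f h => by rw [h0, if_neg h]) (fun x => ?_)
  · rw [CCur, h, boson_mul_eq]; simp [vx]
  · rw [coe_lsum]; refine Finsupp.sum_congr fun α _ => ?_; rw [one_smul]; rfl
  · classical
    refine ⟨Finsupp.lsum ℂ fun α => if k * cPair Λ j α = x then lsingle α else 0,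
      funext fun w => ?_⟩
    rw [coe_lsum]; refine Finsupp.sum_congr fun α _ => ?_; split_ifs <;> rfl

end Modes

section Modes

variable {P : Params}

open Current

/-- The charges of `C⁺_p ∂ C⁻_d`. -/
def ch (p d : Idx P) (j : CIdx P) : ℤ := (if j.1 = p then 1 else 0) - if j.1 = d then 1 else 0

/-- The oscillators of `C⁺_p ∂ C⁻_d`. -/
def cosc (D : ℤ) (p d : Idx P) (ε : Bool) : Osc (Boson P) where
  cr
    | .inl _, _ => 0
    | .inr j, r => ch p d j * (P.d ^ D * if j.1 = d then qe P ε else 1) ^ (r : ℕ) / qInt P r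
  an
    | .inl _, _ => 0
    | .inr j, r => -(ch p d j * (P.d ^ D * if j.1 = d then qe P ε else 1)⁻¹ ^ (r : ℕ) / qInt P r) *
        heis P (.inr j) (.inr j) r

variable (Λ : Weight P)

/-- The pairing of `c_p - c_d` with the weights. -/
def chPair (p d : Idx P) (α : QLat P) : ℂ := ∑ j, ch p d j * cPair Λ j α

/-- The scalars arising from the `q`-derivative. -/
def dfac (d : Idx P) (ε : Bool) (α : QLat P) : ℂ :=
  if h : P.m ≤ d.1 then
    (P.q - P.q⁻¹)⁻¹ * (sg ε * exp (-cPair Λ ⟨d, h⟩ α * (sg ε * P.logq)))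
  else if ε then 1 else 0

def csc (D : ℤ) (p d : Idx P) (ε : Bool) (α : QLat P) : ℂ :=
  exp (chPair Λ p d α * (D * P.logd)) * dfac Λ d ε α

def IsCPart (D : ℤ) (p d : Idx P) (J : Current P) : Prop :=
  J = vsum (0, ch p d) (fun α => chPair Λ p d α - if P.m ≤ d.1 then 1 else 0) (csc Λ D p d)
    (cosc D p d)

variable {p d : Idx P}

lemma eq_idx_iff (j : CIdx P) (hp : P.m ≤ p.1) : j.1 = p ↔ j = ⟨p, hp⟩ := by grind

lemma ne_idx (j : CIdx P) (hp : ¬ P.m ≤ p.1) : j.1 ≠ p := fun h => hp (h ▸ j.2)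

lemma exp_int_mul_logd (D : ℤ) : exp (D * P.logd) = P.d ^ D := by
  rw [exp_int_mul, P.exp_logd]

lemma vsum_congr {β β' c c' s s'} {X X' : Bool → Osc (Boson P)} (hβ : β = β') (hc : ∀ α, c α = c' α)
    (hs : ∀ ε α, s ε α = s' ε α) (hX : ∀ ε, X ε = X' ε) : vsum β c s X = vsum β' c' s' X' := by
  rw [hβ, funext hc, funext fun ε => funext (hs ε), funext hX]

lemma isCPart_plus (D) (hp : P.m ≤ p.1) (hd : ¬ P.m ≤ d.1) :
    IsCPart Λ D p d (dScale D (CCur Λ 1 ⟨p, hp⟩)) := by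
  have h0 : ∀ j, ch p d j = if j = ⟨p, hp⟩ then 1 else 0 := fun j => by
    simp [ch, ne_idx j hd, eq_idx_iff j hp]
  have h1 : ∀ α, chPair Λ p d α = cPair Λ ⟨p, hp⟩ α := fun α => by simp [chPair, h0]
  have hX : ∀ ε, cosc D p d ε = (bosc (.inr ⟨p, hp⟩) (1 : ℤ) 1 (-(1 : ℤ)) 1).scl (P.d ^ D) := by
    intro ε
    refine Osc.ext ?_ ?_ <;> (funext y r; rcases y with l | j; · simp [cosc, Osc.scl, bosc, heis])
    all_goals
      by_cases hj : j = ⟨p, hp⟩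
      · simp [cosc, Osc.scl, bosc, h0, hj, ne_idx _ hd]; ring
      · simp [cosc, Osc.scl, bosc, h0, hj, heis, Ne.symm hj]
  rw [IsCPart, dScale, CCur_eq, scale_vx, vx_eq_vsum, exp_int_mul_logd]
  refine vsum_congr ?_ (fun α => ?_) (fun ε α => ?_) fun ε => (hX ε).symm
  · exact Prod.ext rfl (funext fun j => by simp [h0, Pi.single_apply])
  · simp [h1, hd]
  · simp [csc, dfac, h1, hd]

lemma isCPart_deriv (D) (hp : ¬ P.m ≤ p.1) (hd : P.m ≤ d.1) :
    IsCPart Λ D p d (qDeriv (dScale D (CCur Λ (-1) ⟨d, hd⟩))) := by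
  have h0 : ∀ j, ch p d j = if j = ⟨d, hd⟩ then -1 else 0 := fun j => by
    simp only [ch, if_neg (ne_idx j hp), eq_idx_iff j hd]; split_ifs <;> rfl
  have h1 : ∀ α, chPair Λ p d α = -cPair Λ ⟨d, hd⟩ α := fun α => by simp [chPair, h0]
  have hX : ∀ ε, cosc D p d ε =
      ((bosc (.inr ⟨d, hd⟩) (-1 : ℤ) 1 (-(-1 : ℤ)) 1).scl (P.d ^ D)).scl (qe P ε) := by
    intro ε
    refine Osc.ext ?_ ?_ <;> (funext y r; rcases y with l | j; · simp [cosc, Osc.scl, bosc, heis])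
    all_goals
      by_cases hj : j = ⟨d, hd⟩
      · simp [cosc, Osc.scl, bosc, h0, hj]; ring
      · simp [cosc, Osc.scl, bosc, h0, hj, heis, Ne.symm hj]
  rw [IsCPart, dScale, CCur_eq, scale_vx, qDeriv_vx, exp_int_mul_logd]
  refine vsum_congr ?_ (fun α => ?_) (fun ε α => ?_) fun ε => (hX ε).symm
  · exact Prod.ext rfl (funext fun j => by simp [h0, Pi.single_apply])
  · simp [h1, hd]
  · simp [csc, dfac, h1, hd]; ring

lemma isCPart_both (D) (hp : P.m ≤ p.1) (hd : P.m ≤ d.1) (hpd : p ≠ d) :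
    IsCPart Λ D p d (dScale D (CCur Λ 1 ⟨p, hp⟩) * qDeriv (dScale D (CCur Λ (-1) ⟨d, hd⟩))) := by
  have hz : ¬ P.m ≤ (zeroIdx : Idx P).1 := by grind [P.one_le_m, zeroIdx]
  have h2 := isCPart_deriv Λ D hz hd
  have hch : ∀ j, ch p d j = (if j = ⟨p, hp⟩ then 1 else 0) + ch zeroIdx d j := fun j => by
    simp only [ch, if_neg (ne_idx j hz), eq_idx_iff j hp]; ring
  rw [IsCPart] at h2 ⊢; rw [h2, dScale, CCur_eq, scale_vx, exp_int_mul_logd, vx_mul_vsum]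
  · have hc : ∀ α, cPair Λ ⟨p, hp⟩ (α + (0, ch zeroIdx d)) = cPair Λ ⟨p, hp⟩ α := fun α => by
      simp [cPair, ch, hpd, ne_idx ⟨p, hp⟩ hz]
    have hpair : ∀ α, chPair Λ p d α = cPair Λ ⟨p, hp⟩ α + chPair Λ zeroIdx d α := fun α => by
      simp [chPair, hch, add_mul, sum_add_distrib]
    refine vsum_congr ?_ (fun α => ?_) (fun ε α => ?_) fun ε => ?_
    · refine Prod.ext (add_zero _) (funext fun j => ?_); simp [hch, Pi.single_apply, add_comm]
    · grind
    · simp only [csc]; rw [hc, hpair, add_mul, exp_add]; push_cast; ring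
    · refine Osc.ext ?_ ?_ <;>
        (funext y r; rcases y with l | j; · simp [cosc, Osc.scl, bosc, Osc.fuse, heis])
      all_goals
        by_cases hj : j = ⟨p, hp⟩
        · simp [cosc, Osc.scl, bosc, Osc.fuse, hj, hpd, ch, ne_idx ⟨p, hp⟩ hz]; ring
        · simp [cosc, Osc.scl, bosc, Osc.fuse, hch, hj, heis, Ne.symm hj]
  · intro ε r hr; refine sum_eq_zero fun y _ => ?_; rcases y with l | j
    · simp [cosc]
    · by_cases hj : j = ⟨p, hp⟩
      · simp [cosc, ch, hj, hpd, ne_idx ⟨p, hp⟩ hz]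
      · simp [Osc.scl, bosc, heis, Ne.symm hj]

def gprod (b : Bool) (i : Idx P) (D : ℤ) (p d : Idx P) : Current P :=
  vsum (sg b • root P i, ch p d) (fun α => chPair Λ p d α - (if P.m ≤ d.1 then 1 else 0) +
    (sg b * rootPair Λ i α + 1)) (fun ε α => (P.dHalf ^ (sg b * amForm i α.1) *
      if b then twist (root P i) α.1 else twist (root P i) (α.1 - root P i)) * csc Λ D p d ε α)
    fun ε => Osc.fuse 1 (gosc b i) (cosc D p d ε)

lemma gam_mul {D J} (h : IsCPart Λ D p d J) (b i) : gam Λ b i * J = gprod Λ b i D p d := by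
  rw [h, gam_eq, vx_mul_vsum, gprod]
  · simp [rootPair]
  · intro ε r hr; refine sum_eq_zero fun y _ => ?_; rcases y with l | j
    · simp [cosc]
    · simp [gosc, bosc, heis]

lemma gam_eq_gprod (D) (hp : ¬ P.m ≤ p.1) (hd : ¬ P.m ≤ d.1) (b i) :
    gam Λ b i = gprod Λ b i D p d := by
  have h0 : ∀ j, ch p d j = 0 := fun j => by simp [ch, ne_idx j hp, ne_idx j hd]
  have h1 : ∀ α, chPair Λ p d α = 0 := fun α => by simp [chPair, h0]
  rw [gam_eq, gprod, vx_eq_vsum]; refine vsum_congr ?_ (fun α => ?_) (fun ε α => ?_) fun ε => ?_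
  · exact Prod.ext rfl (funext fun j => (h0 j).symm)
  · simp [h1, hd]
  · simp [csc, dfac, h1, hd]
  · refine Osc.ext (funext fun y => funext fun r => ?_) (funext fun y => funext fun r => ?_) <;>
      rcases y with l | j <;> simp [Osc.fuse, cosc, h0]

end Modes

section Modes

variable {P : Params} (Λ : Weight P)

open Current

def pidx (b : Bool) (i : Idx P) : Idx P := if b then i else prev P i

def didx (b : Bool) (i : Idx P) : Idx P := if b then prev P i else i

/-- The prefactors of `E_i` and `F_i`. -/
def pref (b : Bool) (i : Idx P) : ℂ :=
  if b then (if P.m ≤ i.1 then P.d ^ dsc i else 1)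
    else if P.m ≤ (prev P i).1 then -P.d ^ dsc i else 1

lemma ch_idx (b) (i) (j : CIdx P) : ch (pidx b i) (didx b i) j = sg b * kvec i j.1 := by
  have : next P j.1 = i ↔ j.1 = prev P i := by rw [eq_comm, eq_next_iff]
  cases b <;> simp [ch, pidx, didx, sg, kvec, this]

lemma dpart_iff (b) (i : Idx P) : dpart b i ↔ P.m ≤ (didx b i).1 := by
  cases b <;> simp [dpart, didx]

lemma fuse_gosc_cosc (b) (i : Idx P) (ε) :
    Osc.fuse 1 (gosc b i) (cosc (dsc i) (pidx b i) (didx b i) ε) = vosc b i ε := by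
  have hu : ∀ j : CIdx P, (P.d ^ dsc i * if j.1 = didx b i then qe P ε else 1) = usc b i ε j.1 := by
    intro j; have : next P j.1 = i ↔ j.1 = prev P i := by rw [eq_comm, eq_next_iff]
    cases b <;> simp [usc, didx, this]
  refine Osc.ext (funext fun y => funext fun r => ?_) (funext fun y => funext fun r => ?_) <;>
    rcases y with l | j
  · cases b <;> simp [Osc.fuse, cosc, gosc, bosc, vosc, sg]
  · simp [Osc.fuse, cosc, gosc, bosc, vosc, ch_idx, hu]
  · cases b <;> simp [Osc.fuse, cosc, gosc, bosc, vosc, sg]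
  · simp [Osc.fuse, cosc, gosc, bosc, vosc, ch_idx, hu, heis]

lemma chPair_eq (b) (i) (α) : chPair Λ (pidx b i) (didx b i) α =
    sg b * (∑ j, (kvec i j.1 : ℂ) * α.2 j + ∑ j, (kvec i j.1) * Λ.tilde.2 j) := by
  rw [chPair, ← sum_add_distrib, mul_sum]; refine sum_congr rfl fun j _ => ?_
  rw [ch_idx, cPair]; push_cast; ring

lemma exponent_eq (b) (i) (ε) (α) : chPair Λ (pidx b i) (didx b i) α - (if P.m ≤ (didx b i).1 then
    1 else 0) + (sg b * rootPair Λ i α + 1) = ((vlet Λ b i ε).ex α : ℂ) := by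
  have h : (vlet Λ b i ε).ex α = 1 + sg b * (form P (root P i) α.1 + ∑ j : CIdx P,
    kvec i j.1 * α.2 j + lint Λ i) - if dpart b i then 1 else 0 := rfl
  rw [h, chPair_eq, rootPair]; push_cast; grind [sum_root_tilde, dpart_iff]

lemma scalar_eq (b) (i) (ε) (α) : pref b i * ((P.dHalf ^ (sg b *
    amForm i α.1) * if b then twist (root P i) α.1 else twist (root P i) (α.1 - root P i)) * csc Λ
    (dsc i) (pidx b i) (didx b i) ε α) = vcf Λ b i ε * (vlet Λ b i ε).σ α := by
  have h1 : exp (chPair Λ (pidx b i) (didx b i) α * (dsc i * P.logd)) =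
      (P.d ^ dsc i) ^ (sg b * ∑ j, kvec i j.1 * α.2 j) *
      ∏ j, exp (sg b * kvec i j.1 * Λ.tilde.2 j * (dsc i * P.logd)) := by
    rw [← Complex.exp_sum, ← exp_int_mul_logd, ← exp_int_mul, ← exp_add, chPair_eq,
      ← sum_mul]
    push_cast; simp only [mul_assoc (sg b : ℂ), ← mul_sum]; congr 1; ring
  have h2 : dfac Λ (didx b i) ε α = (if h : dpart b i then (P.q - P.q⁻¹)⁻¹ * (sg ε *
      exp (-Λ.tilde.2 (dj b i h) * (sg ε * P.logq))) else if ε then 1 else 0) *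
      if h : dpart b i then qe P ε ^ (-α.2 (dj b i h)) else 1 := by
    by_cases h : dpart b i
    · have h3 : (⟨didx b i, (dpart_iff b i).1 h⟩ : CIdx P) = dj b i h := rfl
      rw [dfac, dif_pos ((dpart_iff b i).1 h), dif_pos h, dif_pos h, h3, cPair, qe_eq_exp,
        mul_assoc, mul_assoc, ← exp_add]
      push_cast; congr 3; ring
    · rw [dfac, dif_neg fun h' => h ((dpart_iff b i).2 h'), dif_neg h, dif_neg h, mul_one]
  rw [vcf_eq, vlet_sigma_eq, csc, h1, h2, pref]; ring

lemma hasModes_gprod (b) (i) {X : ℤ → Module.End ℂ (FSpace P)} (hX : ∀ k w, X k w = cur Λ b i (-k)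
    w) : HasModes (pref b i • gprod Λ b i (dsc i) (pidx b i) (didx b i)) X := by
  have hex := fun α => exponent_eq Λ b i true α; refine fun w => ⟨fun k => ?_, fun x hx => ?_⟩
  · rw [hX]
    refine LinearMap.congr_fun (f := pref b i • vop _ _ _ _) (lhom_ext fun α f => ?_) _
    have hβ : ∀ ε, α + (vlet Λ b i ε).β = α + (sg b • root P i, ch (pidx b i) (didx b i)) := fun ε =>
      congrArg (α + ·) (Prod.ext rfl (funext fun j => (ch_idx b i j).symm))
    rw [LinearMap.smul_apply, vop_single (e := -k - (vlet Λ b i true).ex α) α f (by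
      rw [hex]; push_cast; ring), cur, lsum]
    simp only [sum_bool, LinearMap.add_apply, LinearMap.smul_apply, llet, Letter.op_single, hβ,
      smul_single, ← single_add, smul_add, smul_smul, scalar_eq, fuse_gosc_cosc]
    rfl
  · refine LinearMap.congr_fun (f := pref b i • vop _ _ _ _) (g := 0)
      (lhom_ext fun α f => ?_) _
    rw [LinearMap.smul_apply, vop_single_eq_zero, smul_zero, LinearMap.zero_apply]; intro e he
    rw [hex] at he; exact hx ⟨(vlet Λ b i true).ex α + e, by rw [he]; push_cast; rfl⟩

lemma one_smul_current (J : Current P) : (1 : ℂ) • J = J :=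
  funext fun x => funext fun w => one_smul ℂ (J x w)

variable {i : Idx P}

lemma dsc_of_ne (h : i.1 ≠ 0) : dsc i = 2 * P.m - i.1 := by rw [dsc, if_neg h]

lemma dsc_of_eq (h : i.1 = 0) : dsc i = P.m - P.n := by
  rw [dsc, if_pos h]; push_cast; ring

lemma lastC_eq (h) : lastC = ⟨prev P i, (prev_ge_iff i).2 (.inl h)⟩ :=
  Subtype.ext (Fin.ext (by have := prev_cases i; change P.m + P.n - 1 = (prev P i).1; omega))

lemma predC_eq (h) : predC i h = ⟨prev P i, (prev_ge_iff i).2 (.inr h)⟩ :=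
  Subtype.ext (Fin.ext (by have := prev_cases i; change i.1 - 1 = (prev P i).1; omega))

lemma mRoot_eq (h : i.1 = P.m) : (⟨mRoot.1, le_refl P.m⟩ : CIdx P) = ⟨i, h.ge⟩ :=
  Subtype.ext (Fin.ext h.symm)

variable (i)

lemma ECur_eq : ECur Λ i = pref true i • gprod Λ true i (dsc i) (pidx true i) (didx true i) := by
  have hp := prev_ge_iff i; have hm := P.one_le_m
  rw [ECur, show GammaPlus Λ i = gam Λ true i from rfl]; simp only [pidx, didx, pref, if_true]
  by_cases h0 : i.1 = 0
  · rw [if_pos h0, if_neg (by omega), one_smul_current, ← gam_mul Λ (isCPart_deriv Λ (dsc i)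
      (by omega) (hp.2 (.inl h0))), dsc_of_eq h0, lastC_eq h0]
  rw [if_neg h0]; by_cases h1 : i.1 < P.m
  · grind [one_smul_current, gam_eq_gprod]
  rw [if_neg h1, if_pos (by omega), dsc_of_ne h0]; by_cases h3 : P.m < i.1
  · rw [dif_pos h3, ← gam_mul Λ (isCPart_both Λ _ h3.le (hp.2 (.inr h3)) (prev_ne i).symm),
      predC_eq h3]
  · have h4 : i.1 = P.m := by omega
    rw [dif_neg h3, ← gam_mul Λ (isCPart_plus Λ _ h4.ge (by rw [hp]; omega)), mRoot_eq h4,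
      show 2 * (P.m : ℤ) - i.1 = P.m by omega]

lemma FCur_eq : FCur Λ i = pref false i • gprod Λ false i (dsc i) (pidx false i) (didx false i) := by
  have hp := prev_ge_iff i; have hm := P.one_le_m
  rw [FCur, show GammaMinus Λ i = gam Λ false i from rfl]
  simp only [pidx, didx, pref, if_false, false_eq_true]; by_cases h0 : i.1 = 0
  · rw [if_pos h0, if_pos (hp.2 (.inl h0)), ← gam_mul Λ (isCPart_plus Λ (dsc i) (hp.2 (.inl h0))
      (by omega)), dsc_of_eq h0, lastC_eq h0]
  rw [if_neg h0]; by_cases h1 : i.1 < P.m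
  · grind [one_smul_current, gam_eq_gprod]
  rw [if_neg h1, dsc_of_ne h0]; by_cases h3 : P.m < i.1
  · rw [dif_pos h3, if_pos (hp.2 (.inr h3)),
      ← gam_mul Λ (isCPart_both Λ _ (hp.2 (.inr h3)) h3.le (prev_ne i)), predC_eq h3]
  · have h4 : i.1 = P.m := by omega
    rw [dif_neg h3, if_neg (by rw [hp]; omega), one_smul_current, ← gam_mul Λ (isCPart_deriv Λ _
      (by rw [hp]; omega) h4.ge), mRoot_eq h4, show 2 * (P.m : ℤ) - i.1 = P.m by omega]

end Modes

end QToroidal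

end

open QToroidal
/-- For every level one partially integrable weight `Λ`, the vertex operators define a graded
admissible module of level `(1, 0)` over the quantum toroidal algebra on the Fock space. -/
theorem theorem3p3 (P : Params) (Λ : Weight P) :
    ∃ ρ : Alg P →ₐ[ℂ] Module.End ℂ (FSpace P),
      -- the action of the generators
      ρ (gen P Gen.C) = P.q • (1 : Module.End ℂ (FSpace P)) ∧
      (∀ (i : Idx P) (w : FSpace P) (α : QLat P),
        (ρ (gen P (Gen.K i)) w : Big P) α =
          Complex.exp (rootPair Λ i α * P.logq) • (w : Big P) α) ∧
      (∀ (i : Idx P) (w : FSpace P) (α : QLat P),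
        (ρ (gen P (Gen.Kinv i)) w : Big P) α =
          Complex.exp (-rootPair Λ i α * P.logq) • (w : Big P) α) ∧
      (∀ (i : Idx P) (r : {r : ℤ // r ≠ 0}) (w : FSpace P) (α : QLat P),
        (ρ (gen P (Gen.H i r)) w : Big P) α = mode P (Sum.inl i) r ((w : Big P) α)) ∧
      (∀ i : Idx P, (Current.ECur Λ i).HasModes fun k => ρ (gen P (Gen.E i k))) ∧
      (∀ i : Idx P, (Current.FCur Λ i).HasModes fun k => ρ (gen P (Gen.F i k))) ∧
      -- it is a graded module over the superalgebra, admissible, of level `(1, 0)`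
      IsGradedBy ρ (parityDeg P) (parityPart P) ∧
      (∃ 𝒱 : RootClass P × ℤ → Submodule ℂ (FSpace P), IsGradedBy ρ (fullDeg P) 𝒱) ∧
      IsAdmissible ρ ∧
      HasLevel ρ 1 0 := by
  refine ⟨rep Λ, ?_, coe_rep_K Λ, fun i w α => ?_, fun i r w α => ?_, fun i => ?_, fun i => ?_, ?_,
    ⟨_, isGradedBy_rep Λ (AddMonoidHom.snd _ _)⟩, isAdmissible_rep Λ, hasLevel_rep Λ⟩
  · rw [(hasLevel_rep Λ).1, zpow_one]
  · rw [coe_rep_gen, genAct, kzero_apply, Int.cast_neg, Int.cast_one, neg_one_mul]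
  · rw [coe_rep_gen, genAct, onFock_apply]
  · rw [ECur_eq]
    exact hasModes_gprod Λ true i fun k w => coe_rep_gen Λ (.E i k) w
  · rw [FCur_eq]
    exact hasModes_gprod Λ false i fun k w => coe_rep_gen Λ (.F i k) w
  · rw [show parityPart P = _ from funext (parityPart_eq Λ)]
    exact isGradedBy_rep Λ (AddMonoidHom.fst _ _)
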